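/- Work over $\mathbb{C}$. Let $C\subset\mathbb{P}^2$ be a cuspidal cubic curve, let $x$ be a smooth inflection point of $C$, and let $L$ be the tangent line of $C$ at $x$. Put $X_1=\mathbb{P}^2$, let $X_2\to X_1$ be the blow-up of $x$, and for $2\le i\le 8$ let $X_{i+1}\to X_i$ be the blow-up of the intersection point of the strict transform of $C$ with the exceptional curve of $X_i\to X_{i-1}$. Let $q\colon X_9\to X$ be the contraction to a normal projective surface $X$ of exactly the following eight $(-2)$-curves: the strict transform of $L$ and the strict transforms of the exceptional curves of $X_8\to X_1$. (The surface $X$ is unique up to isomorphism and is denoted $S^c(E_8)$.) Let $|-K_X|$ be the linear system of all effective Weil divisors of the form $-\operatorname{div}\omega$, where $\omega$ is a nonzero rational $2$-form on $X$. Then all smooth integral curves in $|-K_X|$ (they are elliptic curves) are isomorphic over $\mathbb{C}$. Moreover, there are homogeneous coordinates $[a_1:a_2:a_3]$ on $\mathbb{P}^2$ in which $C$ is given by $a_3a_2^2=a_1^3$ and $x=[0:1:0]$, and such that for every smooth integral curve $E\in|-K_X|$ there is $\lambda\in\mathbb{C}$, $\lambda\neq 0$, for which the strict transform of $E$ in $\mathbb{P}^2$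 is the curve $a_3a_2^2=a_1^3+\lambda a_3^3$, and $E$ is isomorphic over $\mathbb{C}$ to this plane cubic. In particular $E$ is an elliptic curve with $j$-invariant $0$. -/

import Mathlib

open CategoryTheory AlgebraicGeometry
open scoped KaehlerDifferential

namespace ScE8

noncomputable section

/-- The spectrum of the field of complex numbers. -/
abbrev SpecC : Scheme.{0} := Spec (CommRingCat.of ℂ)

/-! ### The projective plane and its curves -/

/-- The grading of `ℂ[a₁, a₂, a₃]` by degree. -/
abbrev planeGrading : ℕ → Submodule ℂ (MvPolynomial (Fin 3) ℂ) :=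
  MvPolynomial.homogeneousSubmodule (Fin 3) ℂ

instance planeGradedAlgebra : GradedAlgebra planeGrading := MvPolynomial.gradedAlgebra

/-- The complex projective plane `Proj ℂ[a₁, a₂, a₃]`. -/
abbrev Plane : Scheme.{0} := Proj planeGrading

/-- The structure morphism of the projective plane. -/
def planeStr : Plane ⟶ SpecC :=
  Proj.toSpecZero planeGrading ≫
    Spec.map (CommRingCat.ofHom (algebraMap ℂ (planeGrading 0)))

/-- `p` is the closed point of the plane with homogeneous coordinates `v`. -/
def IsPointWithCoords (p : Plane) (v : Fin 3 → ℂ) : Prop :=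
  ∀ (d : ℕ) (G : MvPolynomial (Fin 3) ℂ), G.IsHomogeneous d →
    (G ∈ (show ProjectiveSpectrum planeGrading from p).asHomogeneousIdeal.toIdeal ↔
      MvPolynomial.eval v G = 0)

/-- `c` is the generic point of the integral plane curve with equation `G = 0`. -/
def IsGenericPointOfCurve (c : Plane) (G : MvPolynomial (Fin 3) ℂ) : Prop :=
  (show ProjectiveSpectrum planeGrading from c).asHomogeneousIdeal.toIdeal = Ideal.span {G}

/-- The reduced `ℂ`-scheme `t : E ⟶ Spec ℂ` is isomorphic to the (reduced) plane curve `F = 0`. -/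
def IsPlaneCurve {E : Scheme.{0}} (t : E ⟶ SpecC) (F : MvPolynomial (Fin 3) ℂ) : Prop :=
  IsReduced E ∧ ∃ j : E ⟶ Plane, IsClosedImmersion j ∧ j ≫ planeStr = t ∧
    Set.range j = ProjectiveSpectrum.zeroLocus planeGrading {F}

/-- The cubic form `a₃a₂² - a₁³ - λa₃³` in the linear forms `a = (a₁, a₂, a₃)`. -/
def cubicForm (a : Fin 3 → MvPolynomial (Fin 3) ℂ) (l : ℂ) : MvPolynomial (Fin 3) ℂ :=
  a 2 * a 1 ^ 2 - a 0 ^ 3 - MvPolynomial.C l * a 2 ^ 3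

/-- `a` is a system of homogeneous coordinates on the plane: three linearly independent linear
forms. -/
def IsCoordinateSystem (a : Fin 3 → MvPolynomial (Fin 3) ℂ) : Prop :=
  (∀ i, (a i).IsHomogeneous 1) ∧ LinearIndependent ℂ a

/-- `F = 0` is a cuspidal plane cubic: `F` is an irreducible cubic form, and the curve has a
singular point at which the tangent cone is a double line (the Hessian has rank one). -/
def IsCuspidalCubic (F : MvPolynomial (Fin 3) ℂ) : Prop :=
  F.IsHomogeneous 3 ∧ Irreducible F ∧
    ∃ z : Fin 3 → ℂ, z ≠ 0 ∧ (∀ i, MvPolynomial.eval z (MvPolynomial.pderiv i F) = 0) ∧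
      (Matrix.of fun i j =>
        MvPolynomial.eval z (MvPolynomial.pderiv i (MvPolynomial.pderiv j F))).rank = 1

/-- The equation of the projective tangent line of `F = 0` at the smooth point `v`. -/
def tangentLine (F : MvPolynomial (Fin 3) ℂ) (v : Fin 3 → ℂ) : MvPolynomial (Fin 3) ℂ :=
  ∑ i, MvPolynomial.C (MvPolynomial.eval v (MvPolynomial.pderiv i F)) * MvPolynomial.X i

/-- `v` is a smooth inflection point of the curve `F = 0`: a smooth point at which the tangent
line meets the curve with order at least three. -/
def IsSmoothInflectionPoint (F : MvPolynomial (Fin 3) ℂ) (v : Fin 3 → ℂ) : Prop :=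
  MvPolynomial.eval v F = 0 ∧ (∃ i, MvPolynomial.eval v (MvPolynomial.pderiv i F) ≠ 0) ∧
    ∀ w : Fin 3 → ℂ, MvPolynomial.eval w (tangentLine F v) = 0 →
      (Polynomial.X : Polynomial ℂ) ^ 3 ∣
        MvPolynomial.aeval
          (fun i => Polynomial.C (v i) + Polynomial.X * Polynomial.C (w i)) F

/-- The `ℂ`-scheme `t : E ⟶ Spec ℂ` is an elliptic curve with `j`-invariant `j`: it is isomorphic
to the plane cubic of a nonsingular Weierstrass equation with this `j`-invariant. -/
def HasJInvariant {E : Scheme.{0}} (t : E ⟶ SpecC) (j : ℂ) : Prop :=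
  ∃ (W : WeierstrassCurve ℂ) (_ : W.IsElliptic),
    W.j = j ∧ IsPlaneCurve t (WeierstrassCurve.Projective.polynomial W)

/-! ### Blow-ups -/

/-- An ideal sheaf is invertible if it is locally generated by one nonzerodivisor. -/
def IsInvertibleIdeal {X : Scheme.{0}} (I : X.IdealSheafData) : Prop :=
  ∀ x : X, ∃ U : X.affineOpens, x ∈ U.1 ∧
    ∃ t ∈ nonZeroDivisors Γ(X, U.1), I.ideal U = Ideal.span {t}

/-- The ideal sheaf of the closed point `p` (with its reduced structure). -/
def pointIdeal {X : Scheme.{0}} (p : X) : X.IdealSheafData :=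
  Scheme.IdealSheafData.vanishingIdeal (TopologicalSpace.Closeds.closure {p})

/-- `π : Y ⟶ X` is the blow-up of `X` at the closed point `p`, by the universal property: the
inverse image ideal sheaf of `p` on `Y` is invertible, and `π` is universal for this. -/
def IsBlowUpAt {Y X : Scheme.{0}} (π : Y ⟶ X) (p : X) : Prop :=
  IsClosed ({p} : Set X) ∧ IsInvertibleIdeal ((pointIdeal p).comap π) ∧
    ∀ (T : Scheme.{0}) (f : T ⟶ X), IsInvertibleIdeal ((pointIdeal p).comap f) →
      ∃! g : T ⟶ Y, g ≫ π = f

/-- `IsTower c₀ p₀ n Y ρ c p`: the surface `ρ : Y ⟶ ℙ²` is obtained by `n` successive blow-ups.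
The first centre is `p₀`, a point of the curve `C` with generic point `c₀`; each further centre is
the intersection point of the strict transform of `C` and the exceptional curve of the last
blow-up. On `Y`, the generic point of the strict transform of `C` is `c`, and `p` is the centre of
the next blow-up. -/
inductive IsTower (c₀ p₀ : Plane) :
    (n : ℕ) → (Y : Scheme.{0}) → (Y ⟶ Plane) → Y → Y → Prop
  | base : IsTower c₀ p₀ 0 Plane (𝟙 Plane) c₀ p₀
  | step {n : ℕ} {Y Y' : Scheme.{0}} {ρ : Y ⟶ Plane} {c p : Y}
      (h : IsTower c₀ p₀ n Y ρ c p) (π : Y' ⟶ Y) (hπ : IsBlowUpAt π p) (c' p' : Y')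
      (hc : π c' = c) (hp : π p' = p) (hpc : p' ∈ closure ({c'} : Set Y')) :
      IsTower c₀ p₀ (n + 1) Y' (π ≫ ρ) c' p'

/-! ### The surface -/

/-- A presentation of the `ℂ`-surface `s : X ⟶ Spec ℂ` as the surface `S^c(E₈)`. -/
structure Construction {X : Scheme.{0}} (s : X ⟶ SpecC) where
  /-- The equation of the cuspidal cubic `C`. -/
  F : MvPolynomial (Fin 3) ℂ
  cuspidal : IsCuspidalCubic F
  /-- Coordinates of a smooth inflection point `x` of `C`. -/
  v : Fin 3 → ℂ
  inflection : IsSmoothInflectionPoint F v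
  /-- The generic point of `C`. -/
  c₀ : Plane
  isGeneric_c₀ : IsGenericPointOfCurve c₀ F
  /-- The point `x`. -/
  p₀ : Plane
  isPoint_p₀ : IsPointWithCoords p₀ v
  /-- The generic point of the tangent line `L` of `C` at `x`. -/
  l₀ : Plane
  isGeneric_l₀ : IsGenericPointOfCurve l₀ (tangentLine F v)
  /-- The surface `X₈`, obtained from the plane by seven blow-ups. -/
  X₈ : Scheme.{0}
  ρ : X₈ ⟶ Plane
  c : X₈
  /-- The centre of the eighth blow-up. -/
  p : X₈
  tower : IsTower c₀ p₀ 7 X₈ ρ c p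
  /-- The surface `X₉`. -/
  X₉ : Scheme.{0}
  π : X₉ ⟶ X₈
  blowUp : IsBlowUpAt π p
  /-- The blow-down of all `(-2)`-curves: a proper birational morphism onto a normal surface. -/
  q : X₉ ⟶ X
  q_over : q ≫ s = π ≫ ρ ≫ planeStr
  proper : IsProper s
  q_proper : IsProper q
  q_birational : ∃ U : X.Opens, (U : Set X).Nonempty ∧ IsIso (q ∣_ U)
  normal : ∀ x : X, IsIntegrallyClosed (X.presheaf.stalk x)
  /-- The curve with generic point `ξ` is contracted to a point exactly if it is the strict
  transform of `L` or of an exceptional curve of `X₈ ⟶ ℙ²`. -/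
  contracts : ∀ ξ : X₉, ¬ IsClosed ({ξ} : Set X₉) →
    (IsClosed ({q ξ} : Set X) ↔
      (ρ (π ξ) = l₀ ∨ (¬ IsClosed ({π ξ} : Set X₈) ∧ ρ (π ξ) = p₀)))

/-! ### The anticanonical linear system -/

/-- The `ℂ`-algebra structure on the local rings (and on the function field) of a `ℂ`-scheme. -/
@[reducible] def stalkAlgebra {X : Scheme.{0}} (s : X ⟶ SpecC) (x : X) :
    Algebra ℂ (X.presheaf.stalk x) :=
  ((Scheme.ΓSpecIso (CommRingCat.of ℂ)).inv ≫ s.appTop ≫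
    X.presheaf.germ ⊤ x trivial).hom.toAlgebra

/-- Let `O` be a `k`-algebra and `K` its fraction field. `ω = f • (da ∧ db)` for local coordinates
`a`, `b` at `O`, i.e. elements whose differentials generate `Ω[O⁄k]`. -/
def IsLocalExpression (k O K : Type) [CommRing k] [CommRing O] [Field K] [Algebra k O]
    [Algebra k K] [Algebra O K] (ω : ⋀[K]^2 (Ω[K⁄k])) (f : K) : Prop :=
  ∃ a b : O,
    Submodule.span O {KaehlerDifferential.D k O a, KaehlerDifferential.D k O b} = ⊤ ∧
    ω = f • exteriorPower.ιMulti K 2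
      ![KaehlerDifferential.D k K (algebraMap O K a), KaehlerDifferential.D k K (algebraMap O K b)]

/-- The linear system `|-K_X|` of a normal surface: the effective Weil divisors of the form
`-div ω`, for a nonzero rational `2`-form `ω` on `X`. A Weil divisor is a cycle supported at points
of codimension one, and the order of `ω` at such a point is the order of `f` for any expression
`ω = f • (da ∧ db)` in local coordinates at this point. -/
def anticanonicalSystem {X : Scheme.{0}} [IsIntegral X] [IsLocallyNoetherian X]
    (s : X ⟶ SpecC) : Set (AlgebraicCycle X ℤ) :=
  letI := stalkAlgebra s (genericPoint X)
  {D | (∀ z : X, 0 ≤ D z) ∧ (∀ z : X, Order.coheight z ≠ 1 → D z = 0) ∧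
    ∃ ω : ⋀[X.functionField]^2 (Ω[X.functionField⁄ℂ]), ω ≠ 0 ∧
      ∀ z : X, Order.coheight z = 1 →
        letI := stalkAlgebra s z
        ∃ f : X.functionField,
          IsLocalExpression ℂ (X.presheaf.stalk z) X.functionField ω f ∧
          D z = - Scheme.ord f z}

open Classical in
/-- `i : E ⟶ X` is the inclusion of a smooth integral curve `E` that is a member of the linear
system `|-K_X|` (as the prime divisor `E`, with multiplicity one). -/
def IsSmoothAnticanonicalCurve {X : Scheme.{0}} [IsIntegral X] [IsLocallyNoetherian X]
    (s : X ⟶ SpecC) {E : Scheme.{0}} [IsIntegral E] (i : E ⟶ X) : Prop :=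
  IsClosedImmersion i ∧ Smooth (i ≫ s) ∧
    ∃ D ∈ anticanonicalSystem s, ∀ z : X, D z = if z = i (genericPoint E) then 1 else 0

end

end ScE8

/-!
All surfaces in the construction have the same function field `K = ℂ(x, y)`, where `x = a₀ / a₂` and
`y = a₁ / a₂` in coordinates in which the cuspidal cubic is `a₂a₁² = a₀³` and the inflection point is
`[0 : 1 : 0]` (`exists_isNormalForm`). A point of one of these surfaces is recorded by its local ring,
as a subring of `K` (`HasLocalRing`). With `u = x / y` and `rₙ = (1 / y - u³) / uⁿ`, the curve is
`rₙ = 0` and the last exceptional curve is `u = 0` near the centre of the next blow-up, whose local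
ring is the localization of `ℂ[u, rₙ]` at the origin (`IsTower.exists_model`). The universal property
of the blow-up gives the local rings above a centre: they are localizations of the two charts
(`IsBlowUpAt.hasLocalRing_over`). The last exceptional curve has the local ring of the prime `(u)` of
`ℂ[u, r₈]`, called `excRing`.

By the valuative criterion and a form of Zariski's main theorem, the normal surface `X` has the points
of the affine plane, and its curves are the curves of the affine plane and the image of the last
exceptional curve (`IsContractionModel.classification`). A two-form on `X` is `H dx ∧ dy`. If its
divisor is `-E`, with `E` the closure of a plane curve `g = 0`, then `H g` has neither zeros nor poles
in the plane, hence is constant. As `dx ∧ dy` has a simple pole along the last exceptional curve, `g`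
has at most a simple pole there, and expanding in powers of `y² - x³` shows that `g` is a linear
combination of `y² - x³` and `1` (`exists_of_anticanonical`). So `E` is the curve `y² = x³ + l` or the
image of the last exceptional curve.

Two cases remain to be excluded. The strict transform of the cuspidal cubic, `l = 0`, is not normal at
the cusp (`IsContractionModel.not_isCurveField_zero`). The functions `p = 1 / f`, `q = x / f²` and
`r = y / f³` with `f = y² - x³` are regular at the singular point of `X` and satisfy
`r² = q³ + p⁵`; on the image of the last exceptional curve, `p` vanishes and `q = τ²`, `r = τ³` for the
parameter `τ` at infinity of the exceptional curve. If the image were smooth, `τ` would lift to a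
function `b` on `X`, and improving `b` by successive approximation leads to a contradiction
(`IsContractionModel.false_of_smooth_excRing`).

Hence a smooth member `E` has the function field of `y² = x³ + l` with `l ≠ 0`. Smooth curves are
normal, and normal proper curves are determined by their function fields
(`IsNormalCurve.exists_iso_of_isCurveField`), so `E` is isomorphic to the plane cubic
`a₂a₁² = a₀³ + l a₂³`, which has `j`-invariant zero. Over `ℂ` these cubics are isomorphic to each other
by `(x, y) ↦ (c² x, c³ y)`.
-/

namespace ScE8

noncomputable section

section

/-! ### Pulling back ideal sheaves to affine test schemes -/

/-- The ideal of `S` cut out by the inverse image of the ideal sheaf `J` under `g : Spec S ⟶ Y`. -/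
def pullIdeal {Y : Scheme.{0}} (J : Y.IdealSheafData) {S : CommRingCat.{0}} (g : Spec S ⟶ Y) :
    Ideal S :=
  ((J.comap g).ideal ⟨⊤, isAffineOpen_top _⟩).comap (Scheme.ΓSpecIso S).inv.hom

lemma comap_iso_eq_map {R S : CommRingCat.{0}} (e : R ≅ S) (I : Ideal S) :
    I.comap e.hom.hom = I.map e.inv.hom := by
  exact (Ideal.map_symm (I := I) e.commRingCatIsoToRingEquiv).symm

lemma comap_iso_inv_eq_map {R S : CommRingCat.{0}} (e : R ≅ S) (I : Ideal R) :
    I.comap e.inv.hom = I.map e.hom.hom :=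
  comap_iso_eq_map e.symm I

lemma ideal_comap_of_isAffine {X Y : Scheme.{0}} [IsAffine X] [IsAffine Y] (f : X ⟶ Y)
    (J : Y.IdealSheafData) :
    (J.comap f).ideal ⟨⊤, isAffineOpen_top _⟩ =
      (J.ideal ⟨⊤, isAffineOpen_top _⟩).map f.appTop.hom := by
  apply le_antisymm
  · have : J.comap f ≤ Scheme.IdealSheafData.ofIdealTop
        ((J.ideal ⟨⊤, isAffineOpen_top _⟩).map f.appTop.hom) := by
      rw [← Scheme.IdealSheafData.le_map_iff_comap_le]
      refine Scheme.IdealSheafData.le_of_isAffine ?_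
      rw [Scheme.IdealSheafData.ideal_map_of_isAffineHom]
      refine Ideal.map_le_iff_le_comap.mp ?_
      change Ideal.map f.appTop.hom _ ≤ _
      simp
    refine (this _).trans ?_
    simp
  · have := (Scheme.IdealSheafData.le_map_comap J f) ⟨⊤, isAffineOpen_top _⟩
    rw [Scheme.IdealSheafData.ideal_map_of_isAffineHom] at this
    exact Ideal.map_le_iff_le_comap.mpr this

lemma pullIdeal_comp {Y : Scheme.{0}} (J : Y.IdealSheafData) {R S : CommRingCat.{0}}
    (g : Spec R ⟶ Y) (φ : R ⟶ S) :
    pullIdeal J (Spec.map φ ≫ g) = (pullIdeal J g).map φ.hom := by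
  simp only [pullIdeal, Scheme.IdealSheafData.comap_comp]
  rw [ideal_comap_of_isAffine, comap_iso_inv_eq_map, comap_iso_inv_eq_map, Ideal.map_map,
    Ideal.map_map, ← CommRingCat.hom_comp, ← CommRingCat.hom_comp]
  simp

lemma ideal_comap_eqToHom {Y : Scheme.{0}} (J : Y.IdealSheafData) {U V : Y.affineOpens}
    (h : V = U) (i : V.1 ≤ U.1) :
    (J.ideal V).comap (Y.presheaf.map (homOfLE i).op).hom = J.ideal U := by
  subst h
  have : Y.presheaf.map (homOfLE i).op = 𝟙 _ := Y.presheaf.map_id _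
  rw [this]
  exact Ideal.comap_id _

lemma pullIdeal_fromSpec {Y : Scheme.{0}} (J : Y.IdealSheafData) {U : Y.Opens}
    (hU : IsAffineOpen U) : pullIdeal J hU.fromSpec = J.ideal ⟨U, hU⟩ := by
  have hV : hU.fromSpec ''ᵁ ⊤ = U := by
    rw [Scheme.Hom.image_top_eq_opensRange, IsAffineOpen.opensRange_fromSpec]
  have h1 := Scheme.IdealSheafData.ideal_comap_of_isOpenImmersion J hU.fromSpec
    ⟨⊤, isAffineOpen_top _⟩
  rw [pullIdeal, h1, Ideal.comap_comap, ← CommRingCat.hom_comp]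
  have h2 : (Scheme.ΓSpecIso Γ(Y, U)).inv ≫ (hU.fromSpec.appIso ⊤).inv =
      Y.presheaf.map (homOfLE hV.le).op := by
    have h3 := Scheme.Hom.appLE_appIso_inv hU.fromSpec (U := U) (V := ⊤)
      (by rw [hU.fromSpec_preimage_self])
    rw [← h3, Scheme.Hom.appLE, hU.fromSpec_app_self, Category.assoc, Category.assoc,
      ← Functor.map_comp_assoc]
    congr 1
  rw [h2]
  exact ideal_comap_eqToHom J (U := ⟨U, hU⟩) (V := ⟨hU.fromSpec ''ᵁ ⊤, _⟩) (Subtype.ext hV) hV.le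

lemma isInvertibleIdeal_comap {Y : Scheme.{0}} (J : Y.IdealSheafData) {S : CommRingCat.{0}}
    (g : Spec S ⟶ Y) (t : S) (ht : t ∈ nonZeroDivisors S) (h : pullIdeal J g = Ideal.span {t}) :
    IsInvertibleIdeal (J.comap g) := by
  intro x
  refine ⟨⟨⊤, isAffineOpen_top _⟩, trivial, (Scheme.ΓSpecIso S).inv t, ?_, ?_⟩
  · exact mem_nonZeroDivisors_of_injective
      (f := (Scheme.ΓSpecIso S).hom.hom) ((Scheme.ΓSpecIso S).commRingCatIsoToRingEquiv.injective)
      (by simpa using ht)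
  · rw [pullIdeal, comap_iso_inv_eq_map] at h
    have := congrArg (Ideal.map (Scheme.ΓSpecIso S).inv.hom) h
    rw [Ideal.map_map, ← CommRingCat.hom_comp, Iso.hom_inv_id, CommRingCat.hom_id, Ideal.map_id,
      Ideal.map_span, Set.image_singleton] at this
    exact this

lemma pullIdeal_fromSpecStalk_of_isInvertibleIdeal {Y : Scheme.{0}} (J : Y.IdealSheafData)
    (hJ : IsInvertibleIdeal J) (y : Y) :
    ∃ t ∈ nonZeroDivisors (Y.presheaf.stalk y),
      pullIdeal J (Y.fromSpecStalk y) = Ideal.span {t} := by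
  obtain ⟨⟨U, hU⟩, hyU, t, ht, h⟩ := hJ y
  replace hU : IsAffineOpen U := hU
  refine ⟨Y.presheaf.germ U y hyU t, ?_, ?_⟩
  · have := hU.isLocalization_stalk ⟨y, hyU⟩
    let := Y.presheaf.algebra_section_stalk ⟨y, hyU⟩
    exact IsLocalization.map_nonZeroDivisors_le (hU.primeIdealOf ⟨y, hyU⟩).asIdeal.primeCompl _
      ⟨t, ht, rfl⟩
  · rw [← hU.fromSpecStalk_eq_fromSpecStalk hyU]
    change pullIdeal J (Spec.map _ ≫ hU.fromSpec) = _
    rw [pullIdeal_comp,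
      pullIdeal_fromSpec _ hU, h, Ideal.map_span, Set.image_singleton]

/-- The pullback of the ideal of a closed point to its local ring is the maximal ideal. -/
lemma pullIdeal_pointIdeal {Y : Scheme.{0}} (p : Y) (hp : IsClosed ({p} : Set Y)) :
    pullIdeal (pointIdeal p) (Y.fromSpecStalk p) =
      IsLocalRing.maximalIdeal (Y.presheaf.stalk p) := by
  obtain ⟨_, ⟨U, hU, rfl⟩, hpU, -⟩ :=
    Y.isBasis_affineOpens.exists_subset_of_mem_open (Set.mem_univ p) isOpen_univ
  replace hU : IsAffineOpen U := hU
  have := hU.isLocalization_stalk ⟨p, hpU⟩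
  let := Y.presheaf.algebra_section_stalk ⟨p, hpU⟩
  rw [← hU.fromSpecStalk_eq_fromSpecStalk hpU]
  change pullIdeal _ (Spec.map _ ≫ hU.fromSpec) = _
  have h : hU.fromSpec ⁻¹' (TopologicalSpace.Closeds.closure {p} : Set Y) =
      {hU.primeIdealOf ⟨p, hpU⟩} := by
    ext q
    simp only [TopologicalSpace.Closeds.coe_closure, hp.closure_eq, Set.mem_preimage,
      Set.mem_singleton_iff]
    refine Iff.trans ?_ hU.fromSpec.isOpenEmbedding.injective.eq_iff
    rw [hU.fromSpec_primeIdealOf]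
  have h' : (pointIdeal p).ideal ⟨U, hU⟩ = (hU.primeIdealOf ⟨p, hpU⟩).asIdeal :=
    (congrArg PrimeSpectrum.vanishingIdeal h).trans (PrimeSpectrum.vanishingIdeal_singleton _)
  rw [pullIdeal_comp, pullIdeal_fromSpec _ hU, h']
  exact IsLocalization.AtPrime.map_eq_maximalIdeal (hU.primeIdealOf ⟨p, hpU⟩).asIdeal _

lemma isInvertibleIdeal_top {Y : Scheme.{0}} : IsInvertibleIdeal (⊤ : Y.IdealSheafData) := by
  intro x
  obtain ⟨_, ⟨U, hU, rfl⟩, hpU, -⟩ :=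
    Y.isBasis_affineOpens.exists_subset_of_mem_open (Set.mem_univ x) isOpen_univ
  exact ⟨⟨U, hU⟩, hpU, 1, one_mem _, by simp⟩

lemma isInvertibleIdeal_comap_of_notMem_range {T Y : Scheme.{0}} (p : Y)
    (hp : IsClosed ({p} : Set Y)) (f : T ⟶ Y) (hf : ∀ t : T, f t ≠ p) :
    IsInvertibleIdeal ((pointIdeal p).comap f) := by
  have : (pointIdeal p).comap f = ⊤ := by
    rw [← Scheme.IdealSheafData.support_eq_bot_iff, Scheme.IdealSheafData.support_comap]
    ext t
    simp [pointIdeal, hf t]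
  rw [this]
  exact isInvertibleIdeal_top

end

section

/-! ### Local rings as subrings of a field -/

/-- The closed point of the spectrum of a local ring, as a point of the scheme. -/
def closedPt (S : CommRingCat.{0}) [IsLocalRing S] : Spec S := IsLocalRing.closedPoint S

lemma fromSpecStalk_closedPt {Z : Scheme.{0}} (z : Z) :
    Z.fromSpecStalk z (closedPt (Z.presheaf.stalk z)) = z :=
  Scheme.fromSpecStalk_closedPoint

lemma specMap_closedPt {R S : CommRingCat.{0}} [IsLocalRing R] [IsLocalRing S] (φ : R ⟶ S)
    [IsLocalHom φ.hom] : Spec.map φ (closedPt S) = closedPt R :=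
  IsLocalRing.comap_closedPoint φ.hom

/-- The ring map from the local ring at the image of the closed point induced by a morphism from
the spectrum of a local ring. -/
def stalkTo {S : CommRingCat.{0}} [IsLocalRing S] {Z : Scheme.{0}} (h : Spec S ⟶ Z) :
    Z.presheaf.stalk (h (closedPt S)) ⟶ S := Scheme.stalkClosedPointTo h

instance isLocalHom_stalkTo {S : CommRingCat.{0}} [IsLocalRing S] {Z : Scheme.{0}}
    (h : Spec S ⟶ Z) : IsLocalHom (stalkTo h).hom :=
  inferInstanceAs (IsLocalHom (Scheme.stalkClosedPointTo h).hom)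

lemma spec_stalkTo {S : CommRingCat.{0}} [IsLocalRing S] {Z : Scheme.{0}} (h : Spec S ⟶ Z) :
    Spec.map (stalkTo h) ≫ Z.fromSpecStalk (h (closedPt S)) = h :=
  Scheme.Spec_stalkClosedPointTo_fromSpecStalk h

/-- `R ⊆ S` are subrings of a field and `S` dominates `R`: an element of `R` is invertible in `R`
as soon as it is invertible in `S`. -/
def Dom {K : Type} [Field K] (R S : Subring K) : Prop :=
  R ≤ S ∧ ∀ x ∈ R, x⁻¹ ∈ S → x⁻¹ ∈ R

/-- `R` is essentially generated by the set `s`: it is the smallest subring containing `s` and the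
inverses of those elements that are invertible in `R`. -/
def EssGen {K : Type} [Field K] (s : Set K) (R : Subring K) : Prop :=
  s ⊆ R ∧ ∀ T : Subring K, s ⊆ T → (∀ x ∈ T, x⁻¹ ∈ R → x⁻¹ ∈ T) → R ≤ T

/-- The local ring of the scheme `Z` at `z`, embedded in `K` by means of the point
`ψ : Spec K ⟶ Z`, is the subring `R` of `K`. -/
def HasLocalRing {K : Type} [Field K] {Z : Scheme.{0}} (ψ : Spec (.of K) ⟶ Z) (z : Z)
    (R : Subring K) : Prop :=
  ∃ φ : Z.presheaf.stalk z ⟶ .of K, Function.Injective φ.hom ∧ φ.hom.range = R ∧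
    Spec.map φ ≫ Z.fromSpecStalk z = ψ

variable {K : Type} [Field K]

lemma Dom.refl (R : Subring K) : Dom R R := ⟨le_rfl, fun _ _ h ↦ h⟩

lemma EssGen.le_of_dom {s : Set K} {R S T : Subring K} (h : EssGen s R) (hs : s ⊆ T) (hT : Dom T S)
    (hRS : R ≤ S) : R ≤ T :=
  h.2 T hs fun x hx hxR ↦ hT.2 x hx (hRS hxR)

namespace HasLocalRing

variable {Z Z' : Scheme.{0}} {ψ : Spec (.of K) ⟶ Z}

lemma unique {z : Z} {R R' : Subring K} (h : HasLocalRing ψ z R) (h' : HasLocalRing ψ z R') :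
    R = R' := by
  obtain ⟨φ, -, rfl, h⟩ := h
  obtain ⟨φ', -, rfl, h'⟩ := h'
  have := Spec.map_injective ((cancel_mono _).mp (h.trans h'.symm))
  rw [this]

/-- The isomorphism between the stalk and the subring representing it. -/
lemma exists_equiv {z : Z} {R : Subring K} (h : HasLocalRing ψ z R) :
    ∃ e : Z.presheaf.stalk z ≃+* R,
      Spec.map (CommRingCat.ofHom (R.subtype.comp e.toRingHom)) ≫ Z.fromSpecStalk z = ψ := by
  obtain ⟨φ, hφ, rfl, h⟩ := h
  refine ⟨RingEquiv.ofBijective φ.hom.rangeRestrict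
    ⟨fun x y hxy ↦ hφ (congrArg Subtype.val hxy), φ.hom.rangeRestrict_surjective⟩, ?_⟩
  exact h

lemma isLocalRing {z : Z} {R : Subring K} (h : HasLocalRing ψ z R) : IsLocalRing R := by
  obtain ⟨e, -⟩ := h.exists_equiv
  exact e.isLocalRing

/-- A local ring `S ⊆ K` with a morphism `Spec S ⟶ Z` extending `ψ` dominates the local ring of `Z`
at the image of the closed point. -/
lemma dom_of_comp {S : Subring K} [IsLocalRing S] {R : Subring K}
    (h : Spec (.of S) ⟶ Z) (hψ : Spec.map (CommRingCat.ofHom S.subtype) ≫ h = ψ)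
    (hz : HasLocalRing ψ (h (closedPt (.of S))) R) : Dom R S := by
  obtain ⟨φ, hφ, rfl, hφψ⟩ := hz
  have h1 := spec_stalkTo h
  have h2 : φ = stalkTo h ≫ CommRingCat.ofHom S.subtype := by
    apply Spec.map_injective
    rw [← cancel_mono (Z.fromSpecStalk _), hφψ, Spec.map_comp, Category.assoc, h1, hψ]
  have h3 : ∀ o, φ.hom o = ((stalkTo h).hom o : S) := fun o ↦ by
    rw [h2]; rfl
  refine ⟨?_, ?_⟩
  · rintro _ ⟨o, rfl⟩
    rw [h3]
    exact Subtype.property _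
  · rintro _ ⟨o, rfl⟩ hS
    by_cases h0 : φ.hom o = 0
    · rw [h0, inv_zero]
      exact zero_mem _
    have hu : IsUnit ((stalkTo h).hom o) := by
      refine IsUnit.of_mul_eq_one (⟨_, hS⟩ : S) (Subtype.ext ?_)
      change (((stalkTo h).hom o : S) : K) * _ = 1
      rw [← h3, mul_inv_cancel₀ h0]
    obtain ⟨o', ho'⟩ := ((isLocalHom_stalkTo h).map_nonunit o hu).exists_right_inv
    refine ⟨o', ?_⟩
    exact eq_inv_of_mul_eq_one_right (by rw [← map_mul, ho', map_one])

/-- The morphism `Spec R ⟶ Z` for a local ring `R` of `Z`. -/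
lemma exists_spec {z : Z} {R : Subring K} (h : HasLocalRing ψ z R) [IsLocalRing R] :
    ∃ g : Spec (.of R) ⟶ Z, Spec.map (CommRingCat.ofHom R.subtype) ≫ g = ψ ∧
      g (closedPt (.of R)) = z := by
  obtain ⟨e, he⟩ := h.exists_equiv
  refine ⟨Spec.map (CommRingCat.ofHom e.toRingHom) ≫ Z.fromSpecStalk z, ?_, ?_⟩
  · rw [← he, ← Spec.map_comp_assoc]; rfl
  · rw [Scheme.Hom.comp_apply]
    have : IsLocalHom (CommRingCat.ofHom e.toRingHom).hom :=
      ⟨fun a ha ↦ (MulEquiv.isUnit_map e).mp ha⟩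
    rw [specMap_closedPt]
    exact fromSpecStalk_closedPt z

lemma exists_spec_of_dom {z : Z} {R : Subring K} (h : HasLocalRing ψ z R) {S : Subring K}
    [IsLocalRing S] (hRS : Dom R S) :
    ∃ g : Spec (.of S) ⟶ Z, Spec.map (CommRingCat.ofHom S.subtype) ≫ g = ψ ∧
      g (closedPt (.of S)) = z := by
  have := h.isLocalRing
  obtain ⟨g, hg, hgz⟩ := h.exists_spec
  refine ⟨Spec.map (CommRingCat.ofHom (Subring.inclusion hRS.1)) ≫ g, ?_, ?_⟩
  · rw [← hg, ← Spec.map_comp_assoc]; rfl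
  · have : IsLocalHom (CommRingCat.ofHom (Subring.inclusion hRS.1)).hom := by
      refine ⟨fun a ha ↦ ?_⟩
      obtain ⟨b, hb⟩ := ha.exists_right_inv
      have hb' : (a : K) * b = 1 := congrArg Subtype.val hb
      have ha0 : (a : K) ≠ 0 := left_ne_zero_of_mul_eq_one hb'
      have hbi : (b : K) = (a : K)⁻¹ := (inv_eq_of_mul_eq_one_right hb').symm
      refine IsUnit.of_mul_eq_one (⟨(a : K)⁻¹, hRS.2 _ a.2 (hbi ▸ b.2)⟩ : R)
        (Subtype.ext (mul_inv_cancel₀ ha0))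
    rw [Scheme.Hom.comp_apply, ← hgz, specMap_closedPt]

lemma map {π : Z' ⟶ Z} {ψ' : Spec (.of K) ⟶ Z'} (hψ : ψ' ≫ π = ψ) {z' : Z'} {R' R : Subring K}
    (h' : HasLocalRing ψ' z' R') (h : HasLocalRing ψ (π z') R) : Dom R R' := by
  have := h'.isLocalRing
  obtain ⟨g, hg, rfl⟩ := h'.exists_spec
  refine dom_of_comp (g ≫ π) (by rw [reassoc_of% hg, hψ]) ?_
  rwa [Scheme.Hom.comp_apply]

lemma le_of_specializes {z₁ z₂ : Z} {R₁ R₂ : Subring K} (h₁ : HasLocalRing ψ z₁ R₁)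
    (h₂ : HasLocalRing ψ z₂ R₂) (h : z₁ ⤳ z₂) : R₂ ≤ R₁ := by
  obtain ⟨φ, -, rfl, h₁⟩ := h₁
  obtain ⟨φ', -, rfl, h₂⟩ := h₂
  have : φ' = Z.presheaf.stalkSpecializes h ≫ φ := by
    apply Spec.map_injective
    rw [← cancel_mono (Z.fromSpecStalk _), h₂, Spec.map_comp, Category.assoc,
      Scheme.SpecMap_stalkSpecializes_fromSpecStalk, h₁]
  rintro _ ⟨o, rfl⟩
  exact ⟨_, (congrArg (fun f ↦ f.hom o) this).symm⟩

/-- A generization whose local ring dominates the one of its specialization is not proper. -/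
lemma eq_of_specializes_of_dom {z₁ z₂ : Z} {R₁ R₂ : Subring K} (h₁ : HasLocalRing ψ z₁ R₁)
    (h₂ : HasLocalRing ψ z₂ R₂) (h : z₁ ⤳ z₂) (hD : Dom R₂ R₁) : z₁ = z₂ := by
  obtain ⟨φ, hφi, rfl, h₁⟩ := h₁
  obtain ⟨φ', hφi', rfl, h₂⟩ := h₂
  have : φ' = Z.presheaf.stalkSpecializes h ≫ φ := by
    apply Spec.map_injective
    rw [← cancel_mono (Z.fromSpecStalk _), h₂, Spec.map_comp, Category.assoc,
      Scheme.SpecMap_stalkSpecializes_fromSpecStalk, h₁]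
  have hc : ∀ o, φ'.hom o = φ.hom ((Z.presheaf.stalkSpecializes h).hom o) := fun o ↦ by
    rw [this]; rfl
  have hl : IsLocalHom (Z.presheaf.stalkSpecializes h).hom := by
    refine ⟨fun a ha ↦ ?_⟩
    obtain ⟨b, hb⟩ := ha.exists_right_inv
    have hb' : φ'.hom a * φ.hom b = 1 := by rw [hc, ← map_mul, hb, map_one]
    have := hD.2 (φ'.hom a) ⟨a, rfl⟩ ⟨b, eq_inv_of_mul_eq_one_right hb'⟩
    obtain ⟨c, hc⟩ := this
    refine IsUnit.of_mul_eq_one c (hφi' ?_)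
    rw [map_mul, hc, map_one, mul_inv_cancel₀ (left_ne_zero_of_mul_eq_one hb')]
  rw [← fromSpecStalk_closedPt z₁, ← fromSpecStalk_closedPt z₂,
    ← Scheme.SpecMap_stalkSpecializes_fromSpecStalk h, Scheme.Hom.comp_apply, specMap_closedPt]

/-- On a separated scheme a local subring of `K` dominates at most one local ring. -/
lemma eq_of_dom [Z.IsSeparated] {z₁ z₂ : Z} {R₁ R₂ S : Subring K} [IsLocalRing S]
    (h₁ : HasLocalRing ψ z₁ R₁)
    (h₂ : HasLocalRing ψ z₂ R₂) (hD₁ : Dom R₁ S) (hD₂ : Dom R₂ S) : z₁ = z₂ := by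
  obtain ⟨g₁, hg₁, rfl⟩ := h₁.exists_spec_of_dom hD₁
  obtain ⟨g₂, hg₂, rfl⟩ := h₂.exists_spec_of_dom hD₂
  have : IsDominant (Spec.map (CommRingCat.ofHom S.subtype)) := by
    rw [isDominant_iff]
    exact PrimeSpectrum.denseRange_comap_iff_ker_le_nilRadical _ |>.mpr (by
      rw [(RingHom.injective_iff_ker_eq_bot _).mp Subtype.val_injective]; exact bot_le)
  rw [ext_of_isDominant (Spec.map (CommRingCat.ofHom S.subtype)) (hg₁.trans hg₂.symm)]

/-- The point `ψ : Spec K ⟶ Z` specializes to every point which has a local ring. -/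
lemma specializes {z : Z} {R : Subring K} (h : HasLocalRing ψ z R) :
    ψ (closedPt (.of K)) ⤳ z := by
  obtain ⟨φ, -, -, rfl⟩ := h
  rw [Scheme.Hom.comp_apply]
  have h1 : Spec.map φ (closedPt (.of K)) ⤳ closedPt (Z.presheaf.stalk z) :=
    IsLocalRing.specializes_closedPoint (R := Z.presheaf.stalk z) _
  have := h1.map (Z.fromSpecStalk z).continuous
  rwa [fromSpecStalk_closedPt] at this

end HasLocalRing

end

section

/-! ### Local rings of a blow-up -/

variable {K : Type} [Field K]

lemma isInvertibleIdeal_comap_spec_field {Y : Scheme.{0}} {p : Y} (hp : IsClosed ({p} : Set Y))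
    {ψ : Spec (.of K) ⟶ Y} (h : ψ (closedPt (.of K)) ≠ p) :
    IsInvertibleIdeal ((pointIdeal p).comap ψ) := by
  refine isInvertibleIdeal_comap_of_notMem_range p hp ψ fun t ↦ ?_
  rwa [show t = closedPt (.of K) from
    Subsingleton.elim (α := PrimeSpectrum K) _ _]

namespace IsBlowUpAt

variable {Y Y' : Scheme.{0}} {π : Y' ⟶ Y} {p : Y}

lemma hom_ext (hπ : IsBlowUpAt π p) {T : Scheme.{0}} {f g : T ⟶ Y'}
    (hf : IsInvertibleIdeal ((pointIdeal p).comap (f ≫ π))) (h : f ≫ π = g ≫ π) : f = g :=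
  (hπ.2.2 T (f ≫ π) hf).unique rfl h.symm

lemma isInvertibleIdeal_stalk (hπ : IsBlowUpAt π p) (y : Y') :
    IsInvertibleIdeal ((pointIdeal p).comap (Y'.fromSpecStalk y ≫ π)) := by
  obtain ⟨t, ht, h⟩ := pullIdeal_fromSpecStalk_of_isInvertibleIdeal _ hπ.2.1 y
  rw [Scheme.IdealSheafData.comap_comp]
  exact isInvertibleIdeal_comap _ _ t ht h

/-- If the local ring of the blow-up at `y` is a local algebra over a local ring `S` such that
`Spec S ⟶ Y` lifts to the blow-up, then it is a retract of `S`. -/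
lemma exists_retract (hπ : IsBlowUpAt π p) {S : CommRingCat.{0}} [IsLocalRing S] (h : Spec S ⟶ Y')
    (y : Y') (g : S ⟶ Y'.presheaf.stalk y) [IsLocalHom g.hom]
    (hg : Spec.map g ≫ h ≫ π = Y'.fromSpecStalk y ≫ π) :
    h (closedPt S) = y ∧ ∃ ε : Y'.presheaf.stalk y ⟶ S,
      Spec.map ε ≫ Y'.fromSpecStalk y = h ∧ ε ≫ g = 𝟙 _ := by
  have h1 : Y'.fromSpecStalk y = Spec.map g ≫ h :=
    hπ.hom_ext (hπ.isInvertibleIdeal_stalk y) (by rw [Category.assoc, hg])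
  have h2 : h (closedPt S) = y := by
    conv_rhs => rw [← fromSpecStalk_closedPt y, h1, Scheme.Hom.comp_apply, specMap_closedPt]
  subst h2
  refine ⟨rfl, stalkTo h, spec_stalkTo h, ?_⟩
  apply Spec.map_injective
  rw [← cancel_mono (Y'.fromSpecStalk _), Spec.map_comp, Category.assoc, spec_stalkTo, ← h1,
    Spec.map_id, Category.id_comp]

/-- A blow-up does not change the local rings away from the centre. -/
lemma hasLocalRing_away (hπ : IsBlowUpAt π p) {ψ : Spec (.of K) ⟶ Y} {ψ' : Spec (.of K) ⟶ Y'}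
    (hψ : ψ' ≫ π = ψ) (hψp : ψ (closedPt (.of K)) ≠ p) {y : Y} (hy : y ≠ p) {R : Subring K}
    (hR : HasLocalRing ψ y R) :
    ∃ y' : Y', π y' = y ∧ HasLocalRing ψ' y' R ∧ ∀ y'' : Y', π y'' = y → y'' = y' := by
  obtain ⟨h, hh, -⟩ := hπ.2.2 _ (Y.fromSpecStalk y)
    (isInvertibleIdeal_comap_of_notMem_range p hπ.1 _ fun t ht ↦ by
      have : Y.fromSpecStalk y t ∈ Set.range (Y.fromSpecStalk y) := ⟨t, rfl⟩
      rw [Scheme.range_fromSpecStalk, ht] at this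
      exact hy (by simpa [hπ.1.closure_eq] using Specializes.mem_closure this))
  have key : ∀ y'' : Y', π y'' = y → h (closedPt _) = y'' := by
    rintro y'' rfl
    exact (hπ.exists_retract h y'' (π.stalkMap y'') (by
      rw [hh, Scheme.SpecMap_stalkMap_fromSpecStalk])).1
  have hy' : π (h (closedPt _)) = y := by
    rw [← Scheme.Hom.comp_apply, hh]
    exact fromSpecStalk_closedPt y
  refine ⟨h (closedPt _), hy', ?_, fun y'' hy'' ↦ (key y'' hy'').symm⟩
  obtain ⟨y', rfl⟩ : ∃ y', y' = h (closedPt _) := ⟨_, rfl⟩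
  rw [← key _ hy'] at hy' ⊢
  generalize h (closedPt _) = y' at hy'
  subst hy'
  obtain ⟨hy', ε, hε, hεg⟩ := hπ.exists_retract h y' (π.stalkMap y') (by
      rw [hh, Scheme.SpecMap_stalkMap_fromSpecStalk])
  have hgε : π.stalkMap y' ≫ ε = 𝟙 _ := by
    apply Spec.map_injective
    rw [← cancel_mono (Y.fromSpecStalk _), Spec.map_comp, Category.assoc,
      Scheme.SpecMap_stalkMap_fromSpecStalk, reassoc_of% hε, hh, Spec.map_id, Category.id_comp]
  have hεi : Function.Bijective ε.hom := by
    have : IsIso ε := ⟨_, hεg, hgε⟩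
    exact ConcreteCategory.bijective_of_isIso ε
  obtain ⟨φ, hφ, rfl, hφψ⟩ := hR
  refine ⟨ε ≫ φ, hφ.comp hεi.1, ?_, ?_⟩
  · rw [CommRingCat.hom_comp]
    ext x
    simp only [RingHom.mem_range, RingHom.comp_apply]
    exact (hεi.2.exists (p := fun y ↦ φ.hom y = x)).symm
  · have hc : (Spec.map (ε ≫ φ) ≫ Y'.fromSpecStalk y') ≫ π = ψ := by
      rw [Spec.map_comp, Category.assoc, Category.assoc, reassoc_of% hε, hh, hφψ]
    refine hπ.hom_ext ?_ (hc.trans hψ.symm)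
    rw [hc]
    exact isInvertibleIdeal_comap_spec_field hπ.1 hψp

/-- The local ring of the blow-up at a point over the centre `p` where the element `a` of the
maximal ideal `(a, b)` of the local ring `R` of `p` generates the exceptional ideal. -/
lemma hasLocalRing_chart (hπ : IsBlowUpAt π p) {ψ : Spec (.of K) ⟶ Y} {ψ' : Spec (.of K) ⟶ Y'}
    (hψ : ψ' ≫ π = ψ) (hψp : ψ (closedPt (.of K)) ≠ p) {R : Subring K}
    (e : Y.presheaf.stalk p ≃+* R)
    (he : Spec.map (CommRingCat.ofHom (R.subtype.comp e.toRingHom)) ≫ Y.fromSpecStalk p = ψ)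
    (a b : R) (ha : a ≠ 0)
    (hm : (IsLocalRing.maximalIdeal (Y.presheaf.stalk p)).map e.toRingHom = Ideal.span {a, b})
    (y' : Y') (κ : R →+* Y'.presheaf.stalk y')
    (hκ : Spec.map (CommRingCat.ofHom (κ.comp e.toRingHom)) ≫ Y.fromSpecStalk p =
      Y'.fromSpecStalk y' ≫ π) (c : Y'.presheaf.stalk y') (hc : κ b = κ a * c)
    (hnz : κ a ∈ nonZeroDivisors (Y'.presheaf.stalk y')) :
    ∃ R' : Subring K, HasLocalRing ψ' y' R' ∧ R ≤ R' ∧ (b / a : K) ∈ R' ∧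
      EssGen (R ∪ {(b / a : K)}) R' := by
  have haK : (a : K) ≠ 0 := fun h ↦ ha (Subtype.ext h)
  -- A relation between `R` and `b / a` also holds for `κ` and `c`: homogenize it by `scaleRoots`,
  -- then cancel a power of the nonzerodivisor `κ a`.
  let α := Polynomial.eval₂RingHom R.subtype (b / a : K)
  let γ₁ := Polynomial.eval₂RingHom κ c
  have hker : RingHom.ker α.rangeRestrict ≤ RingHom.ker γ₁ := by
    intro P hP
    have hP' : Polynomial.eval₂ R.subtype (b / a : K) P = 0 := congrArg Subtype.val hP
    have h1 := Polynomial.scaleRoots_eval₂_mul (p := P) R.subtype (b / a : K) a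
    rw [hP', mul_zero] at h1
    have h2 : (R.subtype a : K) * (b / a : K) = R.subtype b := mul_div_cancel₀ _ haK
    rw [h2, Polynomial.eval₂_at_apply] at h1
    have h3 : Polynomial.eval b (P.scaleRoots a) = 0 := Subtype.ext h1
    have h4 := Polynomial.scaleRoots_eval₂_mul (p := P) κ c a
    rw [← hc, Polynomial.eval₂_at_apply, h3, map_zero] at h4
    exact (mul_left_mem_nonZeroDivisors_eq_zero_iff (pow_mem hnz P.natDegree)).mp h4.symm
  let B := α.range
  let γ : B →+* Y'.presheaf.stalk y' :=
    RingHom.liftOfSurjective α.rangeRestrict α.rangeRestrict_surjective ⟨γ₁, hker⟩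
  have hγ : ∀ P, γ (α.rangeRestrict P) = γ₁ P := fun P ↦
    RingHom.liftOfRightInverse_comp_apply _ _ _ ⟨γ₁, hker⟩ P
  -- `S` is the localization of `R[b / a]` at the preimage of the maximal ideal of the stalk, with
  -- the induced local homomorphism `g` to the stalk.
  let 𝔮 := (IsLocalRing.maximalIdeal (Y'.presheaf.stalk y')).comap γ
  have h𝔮 : 𝔮.IsPrime := Ideal.comap_isPrime _ _
  let S := (LocalSubring.ofPrime B 𝔮).toSubring
  have hBS : B ≤ S := LocalSubring.le_ofPrime B 𝔮
  let g : S →+* Y'.presheaf.stalk y' := IsLocalization.lift (M := 𝔮.primeCompl) (g := γ)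
    fun x ↦ by
      by_contra hx
      exact x.2 hx
  have hg : ∀ x : B, g (Subring.inclusion hBS x) = γ x := fun x ↦ IsLocalization.lift_eq _ x
  have hgl : IsLocalHom g := by
    refine ⟨fun x hx ↦ ?_⟩
    obtain ⟨n, d, rfl⟩ := IsLocalization.exists_mk'_eq 𝔮.primeCompl x
    have h1 : g (IsLocalization.mk' S n d) * γ d = γ n := by
      rw [← hg, ← map_mul]
      exact (congrArg g (IsLocalization.mk'_spec S n d)).trans (hg n)
    have h2 : IsUnit (γ d) := by
      by_contra hd
      exact d.2 hd
    have h3 : n ∈ 𝔮.primeCompl := fun hn ↦ hn (h1 ▸ hx.mul h2)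
    exact (IsLocalization.AtPrime.isUnit_mk'_iff S 𝔮 n d).mpr h3
  let C : R →+* B := α.rangeRestrict.comp Polynomial.C
  let ι : R →+* S := (Subring.inclusion hBS).comp C
  have hι : ∀ r, (ι r : K) = r := fun r ↦ by
    change Polynomial.eval₂ R.subtype (b / a : K) (Polynomial.C r) = r
    rw [Polynomial.eval₂_C]; rfl
  have hgι : g.comp ι = κ := by
    ext r
    change g (Subring.inclusion hBS (α.rangeRestrict (Polynomial.C r))) = κ r
    rw [hg, hγ]
    exact Polynomial.eval₂_C _ _
  have hbaB : (b / a : K) ∈ B := ⟨Polynomial.X, Polynomial.eval₂_X _ _⟩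
  have hba : (b / a : K) ∈ S := hBS hbaB
  have hRS : R ≤ S := fun r hr ↦ by
    have := (ι ⟨r, hr⟩).2
    rwa [hι] at this
  let f : Spec (.of S) ⟶ Y :=
    Spec.map (CommRingCat.ofHom (ι.comp e.toRingHom)) ≫ Y.fromSpecStalk p
  -- The centre pulls back to the principal ideal `(a)` of `S`, so `Spec S` maps to the blow-up;
  -- this gives a homomorphism `ε` from the stalk to `S` with `g ∘ ε = id`.
  obtain ⟨h, hh, -⟩ := hπ.2.2 _ f <| isInvertibleIdeal_comap _ _ (ι a)
    (mem_nonZeroDivisors_of_ne_zero fun h ↦ haK (by rw [← hι, h]; rfl)) (by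
      rw [pullIdeal_comp, pullIdeal_pointIdeal p hπ.1, CommRingCat.hom_ofHom, ← Ideal.map_map, hm,
        Ideal.map_span, Set.image_pair]
      apply le_antisymm
      · rw [Ideal.span_le, Set.pair_subset_iff]
        refine ⟨Ideal.mem_span_singleton_self _, ?_⟩
        refine Ideal.mem_span_singleton.mpr ⟨⟨_, hba⟩, Subtype.ext ?_⟩
        change (ι b : K) = (ι a : K) * (b / a : K)
        rw [hι, hι, mul_div_cancel₀ _ haK]
      · rw [Ideal.span_le, Set.singleton_subset_iff]
        exact Ideal.subset_span (Set.mem_insert _ _))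
  have hgl' : IsLocalHom (CommRingCat.ofHom g).hom := hgl
  have : IsLocalRing (CommRingCat.of S) := inferInstanceAs (IsLocalRing S)
  obtain ⟨-, ε, hε, hεg⟩ := hπ.exists_retract h y' (CommRingCat.ofHom g) (by
    rw [hh, ← hκ]
    have hq : CommRingCat.ofHom (ι.comp e.toRingHom) ≫ CommRingCat.ofHom g =
        CommRingCat.ofHom (κ.comp e.toRingHom) := by rw [← hgι]; rfl
    exact (Category.assoc _ _ _).symm.trans (congrArg (· ≫ Y.fromSpecStalk p)
      ((Spec.map_comp _ _).symm.trans (congrArg Spec.map hq))))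
  have hεκ : ∀ r, ε.hom (κ r) = ι r := by
    have : CommRingCat.ofHom (κ.comp e.toRingHom) ≫ ε =
        CommRingCat.ofHom (ι.comp e.toRingHom) := by
      apply Spec.map_injective
      rw [← cancel_mono (Y.fromSpecStalk _), Spec.map_comp, Category.assoc, hκ, reassoc_of% hε, hh]
    intro r
    obtain ⟨o, rfl⟩ := e.surjective r
    exact congrArg (fun f ↦ f.hom o) this
  -- Conversely `ε ∘ g = id`, since `ε ∘ g` fixes `R` and `b / a`.
  have hge : ∀ s, ε.hom (g s) = s := by
    have hB : ∀ P, ε.hom (g (Subring.inclusion hBS (α.rangeRestrict P))) =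
        Subring.inclusion hBS (α.rangeRestrict P) := by
      have : (ε.hom.comp (g.comp ((Subring.inclusion hBS).comp α.rangeRestrict))) =
          (Subring.inclusion hBS).comp α.rangeRestrict := by
        refine Polynomial.ringHom_ext (fun r ↦ ?_) ?_
        · change ε.hom (g (ι r)) = ι r
          rw [show g (ι r) = κ r from congrArg (fun f ↦ f r) hgι, hεκ]
        · have hX : g (Subring.inclusion hBS (α.rangeRestrict Polynomial.X)) = c := by
            rw [hg, hγ]; exact Polynomial.eval₂_X _ _
          change ε.hom (g (Subring.inclusion hBS (α.rangeRestrict Polynomial.X))) = _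
          rw [hX]
          have h5 := congrArg ε.hom hc
          rw [map_mul, hεκ, hεκ] at h5
          have h6 : (b : K) = a * (ε.hom c : S) := by
            rw [← hι b, h5, Subring.coe_mul, hι]
          refine Subtype.ext ?_
          change (ε.hom c : S).1 = Polynomial.eval₂ R.subtype (b / a : K) Polynomial.X
          rw [Polynomial.eval₂_X, h6, mul_div_cancel_left₀ _ haK]
      intro P
      exact congrArg (fun f ↦ f P) this
    have : ε.hom.comp g = RingHom.id S := by
      refine IsLocalization.ringHom_ext 𝔮.primeCompl ?_
      ext x
      obtain ⟨P, rfl⟩ := α.rangeRestrict_surjective x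
      exact congrArg Subtype.val (hB P)
    intro s
    exact congrArg (fun f ↦ f s) this
  refine ⟨S, ⟨ε ≫ CommRingCat.ofHom S.subtype, ?_, ?_, ?_⟩, hRS, hba, ?_, ?_⟩
  · refine Subtype.val_injective.comp ?_
    refine Function.LeftInverse.injective (g := g) fun o ↦ ?_
    exact congrArg (fun f ↦ f.hom o) hεg
  · ext x
    refine ⟨?_, fun hx ↦ ⟨g ⟨x, hx⟩, congrArg Subtype.val (hge ⟨x, hx⟩)⟩⟩
    rintro ⟨o, rfl⟩
    exact Subtype.property _
  · have hcomp : (Spec.map (ε ≫ CommRingCat.ofHom S.subtype) ≫ Y'.fromSpecStalk y') ≫ π = ψ := by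
      rw [Spec.map_comp, Category.assoc, Category.assoc, reassoc_of% hε, hh, ← he,
        ← Spec.map_comp_assoc, ← CommRingCat.ofHom_comp]
      congr 3
      ext o
      exact hι (e o)
    refine hπ.hom_ext ?_ (hcomp.trans hψ.symm)
    rw [hcomp]
    exact isInvertibleIdeal_comap_spec_field hπ.1 hψp
  · exact Set.union_subset hRS (Set.singleton_subset_iff.mpr hba)
  · intro T hT hTi x hx
    have hBT : B ≤ T := by
      rintro _ ⟨P, rfl⟩
      change Polynomial.eval₂ R.subtype (b / a : K) P ∈ T
      rw [Polynomial.eval₂_eq_sum]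
      refine sum_mem fun n _ ↦ mul_mem (hT (Or.inl (Subtype.property _))) (pow_mem (hT (Or.inr rfl)) _)
    obtain ⟨n, d, hnd⟩ := IsLocalization.exists_mk'_eq 𝔮.primeCompl (⟨x, hx⟩ : S)
    have h1 := IsLocalization.mk'_spec S n d
    rw [hnd] at h1
    have h2 : x * (d.1 : K) = n := congrArg Subtype.val h1
    have hu := IsLocalization.map_units S d
    obtain ⟨v, hv⟩ := hu.exists_right_inv
    have hv' : (d.1 : K) * v = 1 := congrArg Subtype.val hv
    have hd0 : (d.1 : K) ≠ 0 := left_ne_zero_of_mul_eq_one hv'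
    have hdi : (d.1 : K)⁻¹ ∈ S := by
      rw [inv_eq_of_mul_eq_one_right hv']; exact v.2
    rw [← eq_mul_inv_iff_mul_eq₀ hd0] at h2
    rw [h2]
    exact mul_mem (hBT n.2) (hTi _ (hBT d.1.2) hdi)

/-- The local rings of a blow-up at the points over the centre, when the maximal ideal of the local
ring `R` of the centre is generated by two elements `a`, `b`. -/
lemma hasLocalRing_over (hπ : IsBlowUpAt π p) {ψ : Spec (.of K) ⟶ Y} {ψ' : Spec (.of K) ⟶ Y'}
    (hψ : ψ' ≫ π = ψ) (hψp : ψ (closedPt (.of K)) ≠ p) {R : Subring K} (hR : HasLocalRing ψ p R)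
    {a b : K} (ha : a ∈ R) (hb : b ∈ R) (ha' : a⁻¹ ∉ R) (hb' : b⁻¹ ∉ R)
    (hm : ∀ x ∈ R, x⁻¹ ∉ R → ∃ c ∈ R, ∃ d ∈ R, x = a * c + b * d) (y' : Y') (hy' : π y' = p) :
    ∃ R' : Subring K, HasLocalRing ψ' y' R' ∧ Dom R R' ∧
      ((b / a ∈ R' ∧ EssGen (R ∪ {b / a}) R') ∨ (a / b ∈ R' ∧ EssGen (R ∪ {a / b}) R')) := by
  obtain ⟨e, he⟩ := hR.exists_equiv
  have hRl := hR.isLocalRing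
  have ha0 : a ≠ 0 := fun h ↦ ha' (by rw [h, inv_zero]; exact zero_mem _)
  have hb0 : b ≠ 0 := fun h ↦ hb' (by rw [h, inv_zero]; exact zero_mem _)
  have hmem : ∀ x : R, (x : K)⁻¹ ∉ R → x ∈ IsLocalRing.maximalIdeal R := by
    intro x hx hu
    obtain ⟨v, hv⟩ := hu.exists_right_inv
    have hv' : (x : K) * v = 1 := congrArg Subtype.val hv
    exact hx (inv_eq_of_mul_eq_one_right hv' ▸ v.2)
  have hspan : IsLocalRing.maximalIdeal R = Ideal.span {⟨a, ha⟩, ⟨b, hb⟩} := by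
    apply le_antisymm
    · intro x hx
      by_cases hx0 : x = 0
      · rw [hx0]; exact zero_mem _
      have hx1 : (x : K)⁻¹ ∉ R := fun h ↦ hx (IsUnit.of_mul_eq_one (⟨_, h⟩ : R)
        (Subtype.ext (mul_inv_cancel₀ fun h ↦ hx0 (Subtype.ext h))))
      obtain ⟨c, hc, d, hd, h⟩ := hm x x.2 hx1
      rw [Ideal.mem_span_pair]
      refine ⟨⟨c, hc⟩, ⟨d, hd⟩, Subtype.ext ?_⟩
      change c * a + d * b = x
      rw [h]; ring
    · rw [Ideal.span_le, Set.pair_subset_iff]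
      exact ⟨hmem _ ha', hmem _ hb'⟩
  have hmap : (IsLocalRing.maximalIdeal (Y.presheaf.stalk p)).map e.toRingHom =
      IsLocalRing.maximalIdeal R := by
    have h1 : (IsLocalRing.maximalIdeal (Y.presheaf.stalk p)).map (e : _ →+* R) =
        (IsLocalRing.maximalIdeal (Y.presheaf.stalk p)).comap (e.symm : R →+* _) :=
      Ideal.map_comap_of_equiv e
    refine h1.trans ?_
    ext x
    simp only [Ideal.mem_comap, IsLocalRing.mem_maximalIdeal, mem_nonunits_iff]
    exact not_congr (MulEquiv.isUnit_map e.symm)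
  subst hy'
  let κ : R →+* Y'.presheaf.stalk y' := (π.stalkMap y').hom.comp e.symm.toRingHom
  have hκe : κ.comp e.toRingHom = (π.stalkMap y').hom := by
    ext x
    exact congrArg (π.stalkMap y').hom (e.symm_apply_apply x)
  have hκ : Spec.map (CommRingCat.ofHom (κ.comp e.toRingHom)) ≫ Y.fromSpecStalk (π y') =
      Y'.fromSpecStalk y' ≫ π := by
    rw [hκe]
    exact Scheme.SpecMap_stalkMap_fromSpecStalk π
  -- The ideal `(a, b)` becomes principal in the local ring upstairs, with generator `t`. Then
  -- `a / t` and `b / t` generate the unit ideal, so one of them is a unit.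
  obtain ⟨t, ht, h⟩ := pullIdeal_fromSpecStalk_of_isInvertibleIdeal _ hπ.2.1 y'
  have hpull : pullIdeal ((pointIdeal (π y')).comap π) (Y'.fromSpecStalk y') =
      Ideal.span {κ ⟨a, ha⟩, κ ⟨b, hb⟩} := by
    have : pullIdeal ((pointIdeal (π y')).comap π) (Y'.fromSpecStalk y') =
        pullIdeal (pointIdeal (π y')) (Y'.fromSpecStalk y' ≫ π) := by
      simp only [pullIdeal, Scheme.IdealSheafData.comap_comp]
    rw [this, ← hκ, pullIdeal_comp, pullIdeal_pointIdeal _ hπ.1, CommRingCat.hom_ofHom,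
      ← Ideal.map_map, hmap, hspan, Ideal.map_span, Set.image_pair]
  rw [hpull] at h
  obtain ⟨a₁, ha₁⟩ : t ∣ κ ⟨a, ha⟩ := Ideal.mem_span_singleton.mp
    (h ▸ Ideal.subset_span (Set.mem_insert _ _))
  obtain ⟨b₁, hb₁⟩ : t ∣ κ ⟨b, hb⟩ := Ideal.mem_span_singleton.mp
    (h ▸ Ideal.subset_span (Set.mem_insert_of_mem _ rfl))
  obtain ⟨c, d, hcd⟩ := Ideal.mem_span_pair.mp (h ▸ Ideal.mem_span_singleton_self t)
  have hone : c * a₁ + d * b₁ = 1 := by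
    have h1 : (c * a₁ + d * b₁ - 1) * t = 0 := by
      rw [ha₁, hb₁] at hcd
      linear_combination hcd
    exact sub_eq_zero.mp ((mul_right_mem_nonZeroDivisors_eq_zero_iff ht).mp h1)
  have hunit : IsUnit a₁ ∨ IsUnit b₁ := by
    rcases IsLocalRing.isUnit_or_isUnit_of_add_one hone with h | h
    · exact Or.inl (isUnit_of_mul_isUnit_right h)
    · exact Or.inr (isUnit_of_mul_isUnit_right h)
  have hnz : ∀ x : R, ∀ v : Y'.presheaf.stalk y', κ x = t * v → IsUnit v →
      κ x ∈ nonZeroDivisors (Y'.presheaf.stalk y') := fun x v hx hv ↦ by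
    rw [hx]
    exact mul_mem ht hv.mem_nonZeroDivisors
  rcases hunit with hu | hu
  · obtain ⟨v, hv⟩ := hu.exists_right_inv
    obtain ⟨R', h1, h2, h3, h4⟩ := hπ.hasLocalRing_chart hψ hψp e he ⟨a, ha⟩ ⟨b, hb⟩
      (fun h ↦ ha0 (congrArg Subtype.val h)) (hmap.trans hspan) y' κ hκ (v * b₁)
      (by rw [ha₁, hb₁]; linear_combination (- t * b₁) * hv) (hnz _ _ ha₁ hu)
    exact ⟨R', h1, HasLocalRing.map hψ h1 hR, Or.inl ⟨h3, h4⟩⟩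
  · obtain ⟨v, hv⟩ := hu.exists_right_inv
    obtain ⟨R', h1, h2, h3, h4⟩ := hπ.hasLocalRing_chart hψ hψp e he ⟨b, hb⟩ ⟨a, ha⟩
      (fun h ↦ hb0 (congrArg Subtype.val h))
      (hmap.trans (hspan.trans (by rw [Set.pair_comm]))) y' κ hκ (v * a₁)
      (by rw [ha₁, hb₁]; linear_combination (- t * a₁) * hv) (hnz _ _ hb₁ hu)
    exact ⟨R', h1, HasLocalRing.map hψ h1 hR, Or.inr ⟨h3, h4⟩⟩

/-- A local ring dominating the local ring `R` of the centre, with maximal ideal `(a, b)`, and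
containing `b / a` dominates the local ring of a point of the blow-up. -/
lemma exists_center (hπ : IsBlowUpAt π p) {ψ : Spec (.of K) ⟶ Y} {ψ' : Spec (.of K) ⟶ Y'}
    (hψ : ψ' ≫ π = ψ) (hψp : ψ (closedPt (.of K)) ≠ p) {R : Subring K} (hR : HasLocalRing ψ p R)
    {a b : K} (ha : a ∈ R) (hb : b ∈ R) (ha' : a⁻¹ ∉ R) (hb' : b⁻¹ ∉ R)
    (hm : ∀ x ∈ R, x⁻¹ ∉ R → ∃ c ∈ R, ∃ d ∈ R, x = a * c + b * d)
    {S : Subring K} [IsLocalRing S] (hS : Dom R S) (hba : b / a ∈ S) :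
    ∃ y' : Y', π y' = p ∧ ∃ R' : Subring K, HasLocalRing ψ' y' R' ∧ Dom R' S ∧ Dom R R' ∧
      b / a ∈ R' ∧ EssGen (R ∪ {b / a}) R' := by
  obtain ⟨f, hf, hfp⟩ := hR.exists_spec_of_dom hS
  subst hfp
  have ha0 : a ≠ 0 := fun h ↦ ha' (by rw [h, inv_zero]; exact zero_mem _)
  obtain ⟨φ, hφ, hφR, hφψ⟩ := id hR
  have hl : IsLocalRing (CommRingCat.of S) := inferInstanceAs (IsLocalRing S)
  have hfs := spec_stalkTo f
  have hc : ∀ o, φ.hom o = ((stalkTo f).hom o : S) := by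
    have : φ = stalkTo f ≫ CommRingCat.ofHom S.subtype := by
      apply Spec.map_injective
      rw [← cancel_mono (Y.fromSpecStalk _), hφψ, Spec.map_comp, Category.assoc, hfs, hf]
    intro o
    rw [this]; rfl
  have hnu : ∀ o, o ∈ IsLocalRing.maximalIdeal (Y.presheaf.stalk (f (closedPt (.of S)))) →
      (φ.hom o)⁻¹ ∈ R → o = 0 := by
    intro o ho hu
    by_contra ho0
    rw [← hφR] at hu
    obtain ⟨v, hv⟩ := hu
    refine ho (IsUnit.of_mul_eq_one v (hφ ?_))
    rw [map_mul, hv, map_one, mul_inv_cancel₀]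
    exact fun h ↦ ho0 (hφ (h.trans (map_zero _).symm))
  -- Since `b / a ∈ S`, the centre pulls back to the ideal `(a)` of `S`.
  have hinv : IsInvertibleIdeal ((pointIdeal (f (closedPt (.of S)))).comap f) := by
    refine isInvertibleIdeal_comap _ _ (⟨a, hS.1 ha⟩ : S)
      (mem_nonZeroDivisors_of_ne_zero fun h ↦ ha0 (congrArg Subtype.val h)) ?_
    have hp := hπ.1
    rw [← congrArg (pullIdeal (pointIdeal (f (closedPt (.of S))))) hfs, pullIdeal_comp,
      pullIdeal_pointIdeal _ hp]
    apply le_antisymm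
    · rw [Ideal.map_le_iff_le_comap]
      intro o ho
      refine Ideal.mem_span_singleton.mpr ?_
      by_cases ho0 : o = 0
      · rw [ho0, map_zero]; exact dvd_zero _
      obtain ⟨c, hc', d, hd, h⟩ := hm (φ.hom o) (hφR ▸ ⟨o, rfl⟩) fun h ↦ ho0 (hnu o ho h)
      refine ⟨⟨c + b / a * d, add_mem (hS.1 hc') (mul_mem hba (hS.1 hd))⟩, Subtype.ext ?_⟩
      change (((stalkTo f).hom o : S) : K) = a * (c + b / a * d)
      rw [← hc, h]
      field_simp
    · rw [Ideal.span_le, Set.singleton_subset_iff]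
      rw [← hφR] at ha
      obtain ⟨o, rfl⟩ := ha
      have : o ∈ IsLocalRing.maximalIdeal (Y.presheaf.stalk (f (closedPt (.of S)))) := by
        intro hu
        obtain ⟨v, hv⟩ := hu.exists_right_inv
        refine ha' ?_
        rw [inv_eq_of_mul_eq_one_right (b := φ.hom v) (by rw [← map_mul, hv, map_one]), ← hφR]
        exact ⟨v, rfl⟩
      have h2 := Ideal.mem_map_of_mem (stalkTo f).hom this
      have h3 : (⟨φ.hom o, hc o ▸ Subtype.property _⟩ : S) = (stalkTo f).hom o :=
        Subtype.ext (hc o)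
      exact h3 ▸ h2
  obtain ⟨h, hh, -⟩ := hπ.2.2 _ f hinv
  have hhψ : Spec.map (CommRingCat.ofHom S.subtype) ≫ h = ψ' := by
    have : (Spec.map (CommRingCat.ofHom S.subtype) ≫ h) ≫ π = ψ := by
      rw [Category.assoc, hh, hf]
    refine hπ.hom_ext ?_ (this.trans hψ.symm)
    rw [this]
    exact isInvertibleIdeal_comap_spec_field hπ.1 hψp
  have hy' : π (h (closedPt (.of S))) = f (closedPt (.of S)) := by
    rw [← Scheme.Hom.comp_apply, hh]
  obtain ⟨R', hR', hD, hor⟩ := hπ.hasLocalRing_over hψ hψp hR ha hb ha' hb' hm _ hy'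
  have hD' : Dom R' S := HasLocalRing.dom_of_comp h hhψ hR'
  refine ⟨_, hy', R', hR', hD', hD, ?_⟩
  rcases hor with hor | ⟨h1, h2⟩
  · exact hor
  · -- both quotients are units of `S`, hence of the dominated ring `R'`
    have h3 : b / a ∈ R' := by
      rw [← inv_div]
      exact hD'.2 _ h1 (by rwa [inv_div])
    refine ⟨h3, Set.union_subset hD.1 (Set.singleton_subset_iff.mpr h3), fun T hT hTi ↦ ?_⟩
    refine h2.2 T (Set.union_subset (fun x hx ↦ hT (Or.inl hx)) ?_) hTi
    rw [Set.singleton_subset_iff, ← inv_div]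
    exact hTi _ (hT (Or.inr rfl)) (by rwa [inv_div])

end IsBlowUpAt

end

section

/-! ### Localizations inside a field -/

variable {K : Type} [Field K]

/-- The localization of `A` at the prime ideal `P`, as a subring of a field `K` containing `A` by
means of `α`. -/
def locAt {A : Type} [CommRing A] (α : A →+* K) (P : Ideal A) [P.IsPrime] : Subring K where
  carrier := {z | ∃ n d, d ∉ P ∧ z * α d = α n}
  mul_mem' := by
    rintro a b ⟨n, d, hd, h⟩ ⟨n', d', hd', h'⟩
    refine ⟨n * n', d * d', fun h0 ↦ ?_, by rw [map_mul, map_mul, ← h, ← h']; ring⟩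
    exact (Ideal.IsPrime.mem_or_mem inferInstance h0).elim hd hd'
  one_mem' := ⟨1, 1, (Ideal.ne_top_iff_one P).mp Ideal.IsPrime.ne_top', by simp⟩
  add_mem' := by
    rintro a b ⟨n, d, hd, h⟩ ⟨n', d', hd', h'⟩
    refine ⟨n * d' + n' * d, d * d', fun h0 ↦ ?_,
      by rw [map_add, map_mul, map_mul, map_mul, ← h, ← h']; ring⟩
    exact (Ideal.IsPrime.mem_or_mem inferInstance h0).elim hd hd'
  zero_mem' := ⟨0, 1, (Ideal.ne_top_iff_one P).mp Ideal.IsPrime.ne_top', by simp⟩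
  neg_mem' := by
    rintro a ⟨n, d, hd, h⟩
    exact ⟨-n, d, hd, by rw [map_neg, ← h]; ring⟩

section locAt

variable {A : Type} [CommRing A] {α : A →+* K} {P : Ideal A} [hP : P.IsPrime]

lemma mem_locAt {z : K} : z ∈ locAt α P ↔ ∃ n d, d ∉ P ∧ z * α d = α n := Iff.rfl

lemma apply_mem_locAt (a : A) : α a ∈ locAt α P :=
  ⟨a, 1, (Ideal.ne_top_iff_one P).mp hP.ne_top', by simp⟩

lemma inv_mem_locAt_iff (hα : Function.Injective α) {a : A} (ha : a ≠ 0) :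
    (α a)⁻¹ ∈ locAt α P ↔ a ∉ P := by
  have ha' : α a ≠ 0 := fun h ↦ ha (hα (by rw [h, map_zero]))
  refine ⟨?_, fun h ↦ ⟨1, a, h, by simp [inv_mul_cancel₀ ha']⟩⟩
  rintro ⟨n, d, hd, h⟩ haP
  rw [inv_mul_eq_iff_eq_mul₀ ha', ← map_mul] at h
  exact hd (hα h ▸ P.mul_mem_right _ haP)

lemma EssGen.mono_closure {s s' : Set K} {R : Subring K} (h : EssGen s R)
    (hs : s ⊆ Subring.closure s') (hs' : s' ⊆ R) : EssGen s' R :=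
  ⟨hs', fun T hT hTR ↦ h.2 T (hs.trans ((Subring.closure_le).mpr hT)) hTR⟩

lemma essGen_locAt (hα : Function.Injective α) : EssGen (Set.range α) (locAt α P) := by
  refine ⟨?_, fun T hT hTR ↦ ?_⟩
  · rintro _ ⟨a, rfl⟩
    exact apply_mem_locAt a
  · rintro z ⟨n, d, hd, h⟩
    have hd0 : d ≠ 0 := fun h ↦ hd (h ▸ P.zero_mem)
    have hd' : α d ≠ 0 := fun h ↦ hd0 (hα (by rw [h, map_zero]))
    rw [(eq_mul_inv_iff_mul_eq₀ hd').mpr h]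
    exact T.mul_mem (hT ⟨n, rfl⟩)
      (hTR _ (hT ⟨d, rfl⟩) ((inv_mem_locAt_iff hα hd0).mpr hd))

/-- A ring essentially generated by the image of `A` is a localization of `A`. -/
lemma EssGen.eq_locAt {R : Subring K} (h : EssGen (Set.range α) R)
    (hPR : ∀ a, a ∈ P ↔ α a = 0 ∨ (α a)⁻¹ ∉ R) : R = locAt α P := by
  apply le_antisymm
  · refine h.2 _ ?_ ?_
    · rintro _ ⟨a, rfl⟩
      exact apply_mem_locAt a
    · rintro z ⟨n, d, hd, hz⟩ hzR
      by_cases hz0 : z = 0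
      · simp [hz0]
      have hd' := (hPR d).not.mp hd
      push Not at hd'
      refine ⟨d, n, ?_, by rw [← hz]; field_simp⟩
      rw [hPR]
      push Not
      refine ⟨by rw [← hz]; exact mul_ne_zero hz0 hd'.1, ?_⟩
      rw [← hz, mul_inv]
      exact R.mul_mem hzR hd'.2
  · rintro z ⟨n, d, hd, hz⟩
    have hd' := (hPR d).not.mp hd
    push Not at hd'
    rw [(eq_mul_inv_iff_mul_eq₀ hd'.1).mpr hz]
    exact R.mul_mem (h.1 ⟨n, rfl⟩) hd'.2

/-- The prime ideal of the elements that become nonunits in a local subring. -/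
def centre (α : A →+* K) (R : Subring K) [IsLocalRing R] (hR : Set.range α ⊆ R) : Ideal A :=
  (IsLocalRing.maximalIdeal R).comap (α.codRestrict R fun a ↦ hR ⟨a, rfl⟩)

instance (R : Subring K) [IsLocalRing R] (hR : Set.range α ⊆ R) : (centre α R hR).IsPrime := by
  unfold centre; infer_instance

lemma isUnit_subring_iff {R : Subring K} (z : R) :
    IsUnit z ↔ (z : K) ≠ 0 ∧ (z : K)⁻¹ ∈ R := by
  refine ⟨fun h ↦ ?_, fun h ↦ .of_mul_eq_one ⟨_, h.2⟩ (Subtype.ext (mul_inv_cancel₀ h.1))⟩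
  obtain ⟨b, hb⟩ := h.exists_right_inv
  have hb' : (z : K) * b = 1 := congrArg Subtype.val hb
  exact ⟨left_ne_zero_of_mul_eq_one hb', (inv_eq_of_mul_eq_one_right hb') ▸ b.2⟩

lemma mem_centre_iff (R : Subring K) [IsLocalRing R] (hR : Set.range α ⊆ R) (a : A) :
    a ∈ centre α R hR ↔ α a = 0 ∨ (α a)⁻¹ ∉ R := by
  rw [centre, Ideal.mem_comap, IsLocalRing.mem_maximalIdeal, mem_nonunits_iff, isUnit_subring_iff]
  change ¬ (α a ≠ 0 ∧ (α a)⁻¹ ∈ R) ↔ _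
  tauto

/-- The sum of two nonunits of a local subring is a nonunit. -/
lemma nonunit_add {R : Subring K} [IsLocalRing R] {a b : K} (ha : a ∈ R) (hb : b ∈ R)
    (ha' : a = 0 ∨ a⁻¹ ∉ R) (hb' : b = 0 ∨ b⁻¹ ∉ R) : a + b = 0 ∨ (a + b)⁻¹ ∉ R := by
  have h := IsLocalRing.nonunits_add (R := R) (a := ⟨a, ha⟩) (b := ⟨b, hb⟩)
  simp only [mem_nonunits_iff, isUnit_subring_iff] at h
  have := h (by tauto) (by tauto)
  change ¬ (a + b ≠ 0 ∧ (a + b)⁻¹ ∈ R) at this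
  tauto

lemma nonunit_mul {R : Subring K} {a b : K} (hb : b ∈ R)
    (ha' : a = 0 ∨ a⁻¹ ∉ R) : a * b = 0 ∨ (a * b)⁻¹ ∉ R := by
  by_contra! h
  obtain ⟨h0, h⟩ := h
  have h1 := R.mul_mem h hb
  rw [mul_inv, mul_assoc, inv_mul_cancel₀ (right_ne_zero_of_mul h0), mul_one] at h1
  exact ha'.elim (left_ne_zero_of_mul h0) (· h1)

/-- Nonunits of the localization at a principal prime ideal are multiples of the generator. -/
lemma exists_eq_mul_of_nonunit {p z : K} {a : A} (ha : α a = p) (hP : P = Ideal.span {a})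
    (hz : z ∈ locAt α P) (hz' : z = 0 ∨ z⁻¹ ∉ locAt α P) : ∃ c ∈ locAt α P, z = p * c := by
  obtain ⟨n, d, hd, h⟩ := hz
  by_cases hn : n ∈ P
  · rw [hP, Ideal.mem_span_singleton] at hn
    obtain ⟨m, rfl⟩ := hn
    by_cases hd' : α d = 0
    · refine (hz'.elim (fun hz0 ↦ ⟨0, zero_mem _, by simp [hz0]⟩) fun hz0 ↦ ?_)
      exact absurd ⟨0, d, hd, by simp [hd']⟩ hz0
    · refine ⟨α m * (α d)⁻¹, ⟨m, d, hd, by field_simp⟩, ?_⟩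
      rw [(eq_mul_inv_iff_mul_eq₀ hd').mpr h, map_mul, ha, mul_assoc]
  · rcases hz' with rfl | hz'
    · exact ⟨0, zero_mem _, by simp⟩
    by_cases hz0 : z = 0
    · exact ⟨0, zero_mem _, by simp [hz0]⟩
    exact absurd ⟨d, n, hn, by rw [← h]; field_simp⟩ hz'

/-- A localization at a prime element of a factorial domain is a valuation ring. -/
lemma mem_or_inv_mem_locAt [IsDomain A] [UniqueFactorizationMonoid A] (hα : Function.Injective α)
    (hK : ∀ z : K, ∃ n d, d ≠ 0 ∧ z * α d = α n) {a : A} (hP' : P = Ideal.span {a}) (ha0 : a ≠ 0)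
    (z : K) : z ∈ locAt α P ∨ z⁻¹ ∈ locAt α P := by
  obtain ⟨n, d, hd, h⟩ := hK z
  have hpr : Prime a := (Ideal.span_singleton_prime ha0).mp (hP' ▸ hP)
  by_cases hn : n = 0
  · left
    refine ⟨0, 1, (Ideal.ne_top_iff_one P).mp hP.ne_top', ?_⟩
    rw [hn, map_zero, mul_eq_zero] at h
    have := h.resolve_right fun h ↦ hd (hα (by rw [h, map_zero]))
    simp [this]
  obtain ⟨n', m, hn', hm'⟩ := (FiniteMultiplicity.of_prime_left hpr hn).exists_eq_pow_mul_and_not_dvd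
    |> fun ⟨c, h1, h2⟩ ↦ (⟨_, c, h1, h2⟩ : ∃ k c, n = a ^ k * c ∧ ¬ a ∣ c)
  obtain ⟨d', e, hd', he'⟩ := (FiniteMultiplicity.of_prime_left hpr hd).exists_eq_pow_mul_and_not_dvd
    |> fun ⟨c, h1, h2⟩ ↦ (⟨_, c, h1, h2⟩ : ∃ k c, d = a ^ k * c ∧ ¬ a ∣ c)
  have hαa : α a ≠ 0 := fun h ↦ ha0 (hα (by rw [h, map_zero]))
  have hm : m ∉ P := by rwa [hP', Ideal.mem_span_singleton]
  have he : e ∉ P := by rwa [hP', Ideal.mem_span_singleton]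
  have hz0 : z ≠ 0 := by
    rintro rfl
    rw [zero_mul] at h
    exact hn (hα (by rw [← h, map_zero]))
  rw [hn', hd', map_mul, map_mul, map_pow, map_pow] at h
  rcases le_total d' n' with hle | hle
  · left
    refine ⟨a ^ (n' - d') * m, e, he, ?_⟩
    rw [map_mul, map_pow]
    apply mul_left_cancel₀ (pow_ne_zero d' hαa)
    rw [← mul_assoc, ← mul_assoc, ← pow_add, Nat.add_sub_of_le hle, ← h]
    ring
  · right
    refine ⟨a ^ (d' - n') * e, m, hm, ?_⟩
    rw [map_mul, map_pow]
    apply mul_left_cancel₀ (pow_ne_zero n' hαa)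
    rw [← mul_assoc (α a ^ n') (α a ^ _), ← pow_add, Nat.add_sub_of_le hle, inv_mul_eq_div,
      ← mul_div_assoc, ← h, div_eq_iff hz0]
    ring

end locAt

end

section

/-! ### Coordinates on rational surfaces -/

open Polynomial in
/-- The ring of polynomials in two variables; the outer variable is the second coordinate. -/
abbrev A2 : Type := ℂ[X][X]

/-- Evaluation of polynomials in two variables at elements of a field. -/
def ev {K : Type} [Field K] [Algebra ℂ K] (x y : K) : A2 →+* K :=
  (Polynomial.aevalAeval x y : A2 →ₐ[ℂ] K)

variable {K : Type} [Field K] [Algebra ℂ K] {x y : K}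

@[simp] lemma ev_X : ev x y Polynomial.X = y := Polynomial.aevalAeval_Y x y

@[simp] lemma ev_C (p : Polynomial ℂ) : ev x y (Polynomial.C p) = Polynomial.aeval x p :=
  Polynomial.aevalAeval_C x y p

lemma ev_eq_eval₂ : ev x y = Polynomial.eval₂RingHom (Polynomial.aeval x).toRingHom y := by
  ext
  · simp
  · simp [ev_C]
  · simp

lemma ev_apply (g : A2) : ev x y g = g.eval₂ (Polynomial.aeval x).toRingHom y := by
  rw [ev_eq_eval₂]; rfl

/-- The set of the elements from which polynomials in `x` and `y` are built. -/
def gens (x y : K) : Set K := Set.range (algebraMap ℂ K) ∪ {x, y}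

lemma gens_subset_iff {x y : K} {R : Subring K} :
    gens x y ⊆ R ↔ (∀ c : ℂ, algebraMap ℂ K c ∈ R) ∧ x ∈ R ∧ y ∈ R := by
  simp [gens, Set.insert_subset_iff, Set.range_subset_iff]
  tauto

lemma aeval_mem {R : Subring K} (hc : ∀ c : ℂ, algebraMap ℂ K c ∈ R) (hx : x ∈ R)
    (p : Polynomial ℂ) : Polynomial.aeval x p ∈ R := by
  induction p using Polynomial.induction_on' with
  | add p q hp hq => rw [map_add]; exact R.add_mem hp hq
  | monomial n a =>
    rw [Polynomial.aeval_monomial]; exact R.mul_mem (hc a) (R.pow_mem hx n)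

lemma ev_mem {R : Subring K} (h : gens x y ⊆ R) (g : A2) : ev x y g ∈ R := by
  obtain ⟨hc, hx, hy⟩ := gens_subset_iff.mp h
  induction g using Polynomial.induction_on' with
  | add p q hp hq => rw [map_add]; exact R.add_mem hp hq
  | monomial n a =>
    rw [← Polynomial.C_mul_X_pow_eq_monomial, map_mul, map_pow, ev_X, ev_C]
    exact R.mul_mem (aeval_mem hc hx a) (R.pow_mem hy n)

lemma gens_subset_range : gens x y ⊆ Set.range (ev x y) := by
  rintro z (⟨c, rfl⟩ | rfl | rfl)
  · exact ⟨Polynomial.C (Polynomial.C c), by simp⟩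
  · exact ⟨Polynomial.C Polynomial.X, by simp⟩
  · exact ⟨Polynomial.X, by simp⟩

lemma range_ev_subset_closure : Set.range (ev x y) ⊆ Subring.closure (gens x y) := by
  rintro _ ⟨g, rfl⟩
  exact ev_mem Subring.subset_closure g

lemma essGen_gens_iff {R : Subring K} : EssGen (gens x y) R ↔ EssGen (Set.range (ev x y)) R :=
  ⟨fun h ↦ h.mono_closure (gens_subset_range.trans Subring.subset_closure)
    (by rintro _ ⟨g, rfl⟩; exact ev_mem h.1 g),
   fun h ↦ h.mono_closure range_ev_subset_closure (gens_subset_range.trans h.1)⟩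

/-- The field `K` is the field of rational functions in `x` and `y` over the complex numbers. -/
structure IsPlaneField (x y : K) : Prop where
  injective : Function.Injective (ev x y)
  eq_top : ∀ F : Subfield K, (∀ c : ℂ, algebraMap ℂ K c ∈ F) → x ∈ F → y ∈ F → F = ⊤

namespace IsPlaneField

lemma exists_fraction (h : IsPlaneField x y) (z : K) :
    ∃ n d, d ≠ 0 ∧ z * ev x y d = ev x y n := by
  let F : Subfield K :=
    { locAt (ev x y) ⊥ with
      inv_mem' := by
        rintro z ⟨n, d, hd, hz⟩
        by_cases hz0 : z = 0
        · exact ⟨0, 1, by simp, by simp [hz0]⟩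
        refine ⟨d, n, fun hn ↦ ?_, by rw [← hz]; field_simp⟩
        rw [Ideal.mem_bot] at hn hd
        rw [hn, map_zero, mul_eq_zero] at hz
        exact hz.elim hz0 fun h' ↦ hd (h.injective (by rw [h', map_zero])) }
  have hF : F = ⊤ := by
    have h1 := gens_subset_iff.mp
      (gens_subset_range.trans (essGen_locAt h.injective (P := ⊥)).1)
    exact h.eq_top F h1.1 h1.2.1 h1.2.2
  have hz : z ∈ F := hF ▸ Subfield.mem_top z
  obtain ⟨n, d, hd, hz⟩ := hz
  exact ⟨n, d, by simpa using hd, hz⟩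

lemma ne_zero_left (h : IsPlaneField x y) : x ≠ 0 := fun h0 ↦
  Polynomial.X_ne_zero (R := ℂ) (Polynomial.C_injective
    (h.injective (a₁ := Polynomial.C Polynomial.X) (a₂ := Polynomial.C 0) (by simp [h0])))

lemma swap (h : IsPlaneField x y) : IsPlaneField y x := by
  refine ⟨fun a b hab ↦ ?_, fun F hc hy hx ↦ h.eq_top F hc hx hy⟩
  apply (Polynomial.Bivariate.swap (R := ℂ)).injective
  apply h.injective
  change Polynomial.aevalAeval x y _ = Polynomial.aevalAeval x y _
  rw [Polynomial.Bivariate.aevalAeval_swap, Polynomial.Bivariate.aevalAeval_swap]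
  exact hab

lemma ne_zero_right (h : IsPlaneField x y) : y ≠ 0 := h.swap.ne_zero_left

lemma div (h : IsPlaneField x y) : IsPlaneField x (y / x) := by
  refine ⟨(injective_iff_map_eq_zero _).mpr fun g hg ↦ ?_, fun F hc hx hy ↦ h.eq_top F hc hx ?_⟩
  · by_contra hg0
    apply Polynomial.scaleRoots_ne_zero hg0 Polynomial.X
    apply h.injective
    rw [map_zero, ev_apply]
    have := Polynomial.scaleRoots_eval₂_mul (p := g) (Polynomial.aeval x).toRingHom (y / x)
      Polynomial.X
    rw [← ev_apply (g := g), hg, mul_zero] at this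
    have h2 : (Polynomial.aeval x : Polynomial ℂ →ₐ[ℂ] K).toRingHom Polynomial.X * (y / x) = y := by
      have : (Polynomial.aeval x : Polynomial ℂ →ₐ[ℂ] K).toRingHom Polynomial.X = x :=
        Polynomial.aeval_X x
      rw [this, mul_div_cancel₀ _ h.ne_zero_left]
    rwa [h2] at this
  · rw [← mul_div_cancel₀ y h.ne_zero_left]
    exact F.mul_mem hx hy

lemma inv (h : IsPlaneField x y) : IsPlaneField x y⁻¹ := by
  refine ⟨(injective_iff_map_eq_zero _).mpr fun g hg ↦ ?_,
    fun F hc hx hy ↦ h.eq_top F hc hx (inv_inv y ▸ F.inv_mem hy)⟩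
  have hy := h.ne_zero_right
  let _ : Invertible y⁻¹ := invertibleOfNonzero (inv_ne_zero hy)
  have h1 : (⅟(y⁻¹) : K) = y := by rw [invOf_eq_inv, inv_inv]
  rw [ev_apply, ← Polynomial.eval₂_reverse_eq_zero_iff, h1, ← ev_apply] at hg
  exact Polynomial.reverse_eq_zero.mp (h.injective (by rw [hg, map_zero]))

lemma sub (h : IsPlaneField x y) (p : Polynomial ℂ) :
    IsPlaneField x (y - Polynomial.aeval x p) := by
  refine ⟨(injective_iff_map_eq_zero _).mpr fun g hg ↦ ?_, fun F hc hx hy ↦ h.eq_top F hc hx ?_⟩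
  · have : ev x y (Polynomial.taylor (-p) g) = 0 := by
      rw [Polynomial.taylor_apply, ev_apply, Polynomial.eval₂_comp, ← ev_apply, ← hg, ev_apply]
      have : Polynomial.eval₂ (Polynomial.aeval x).toRingHom y (Polynomial.X + Polynomial.C (-p)) =
          y - Polynomial.aeval x p := by
        rw [Polynomial.eval₂_add, Polynomial.eval₂_X, Polynomial.eval₂_C, map_neg, ← sub_eq_add_neg]
        rfl
      rw [this, ev_apply]
    exact Polynomial.taylor_injective (-p) (h.injective (by rw [this, map_zero, map_zero]))
  · have := F.add_mem hy (aeval_mem (R := F.toSubring) hc hx p)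
    simpa using this

lemma div_pow (h : IsPlaneField x y) (n : ℕ) : IsPlaneField x (y / x ^ n) := by
  induction n with
  | zero => simpa
  | succ n ih => rw [pow_succ, ← div_div]; exact ih.div

end IsPlaneField

/-- The quotient field of the coordinates at infinity `u = x / y`, `w = 1 / y`. -/
lemma IsPlaneField.infinity (h : IsPlaneField x y) : IsPlaneField (x / y) y⁻¹ := by
  have := h.swap.div.swap.inv
  exact this

/-- The coordinate `t = w - u ^ 3`, which vanishes on the cuspidal cubic, divided by `u ^ n`. -/
def rr (x y : K) (n : ℕ) : K := (y⁻¹ - (x / y) ^ 3) / (x / y) ^ n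

lemma IsPlaneField.rr (h : IsPlaneField x y) (n : ℕ) : IsPlaneField (x / y) (rr x y n) := by
  have := (h.infinity.sub (Polynomial.X ^ 3)).div_pow n
  simpa [ScE8.rr] using this

omit [Algebra ℂ K] in
lemma rr_succ (x y : K) (n : ℕ) : rr x y (n + 1) = rr x y n / (x / y) := by
  rw [ScE8.rr, ScE8.rr, div_div, ← pow_succ]

/-- The maximal ideal of the origin. -/
def originIdeal : Ideal A2 := RingHom.ker (Polynomial.evalEvalRingHom (0 : ℂ) 0)

instance : originIdeal.IsPrime := RingHom.ker_isPrime _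

lemma mem_originIdeal_iff (g : A2) :
    g ∈ originIdeal ↔ ∃ a b, g = Polynomial.C Polynomial.X * a + Polynomial.X * b := by
  constructor
  · intro h
    have h0 : (g.coeff 0).coeff 0 = 0 := by
      have : (g.eval (Polynomial.C 0)).eval 0 = 0 := h
      rwa [map_zero, ← Polynomial.coeff_zero_eq_eval_zero,
        ← Polynomial.coeff_zero_eq_eval_zero] at this
    refine ⟨Polynomial.C (g.coeff 0).divX, g.divX, ?_⟩
    conv_lhs => rw [← Polynomial.divX_mul_X_add g, ← Polynomial.divX_mul_X_add (g.coeff 0), h0]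
    simp only [map_add, map_mul, map_zero]
    ring
  · rintro ⟨a, b, rfl⟩
    have h1 : Polynomial.evalEval (0 : ℂ) 0 (Polynomial.C Polynomial.X) = 0 := by
      rw [Polynomial.evalEval_C, Polynomial.eval_X]
    have h2 : Polynomial.evalEval (0 : ℂ) 0 Polynomial.X = 0 := Polynomial.evalEval_X 0 0
    exact Ideal.add_mem _ (Ideal.mul_mem_right _ _ h1) (Ideal.mul_mem_right _ _ h2)

lemma evalEval_of_notMem_originIdeal {g : A2} (h : g ∉ originIdeal) :
    ∃ c : ℂ, c ≠ 0 ∧ ∃ g' ∈ originIdeal, g = Polynomial.C (Polynomial.C c) + g' := by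
  refine ⟨Polynomial.evalEval 0 0 g, h, g - Polynomial.C (Polynomial.C (Polynomial.evalEval 0 0 g)),
    ?_, by ring⟩
  change Polynomial.evalEval 0 0 _ = 0
  simp

lemma nonunit_ev {R : Subring K} [IsLocalRing R] (h : gens x y ⊆ R) (hx : x = 0 ∨ x⁻¹ ∉ R)
    (hy : y = 0 ∨ y⁻¹ ∉ R) (g : A2) :
    g ∈ originIdeal ↔ ev x y g = 0 ∨ (ev x y g)⁻¹ ∉ R := by
  obtain ⟨hc, hxR, hyR⟩ := gens_subset_iff.mp h
  have h1 : ∀ g ∈ originIdeal, ev x y g = 0 ∨ (ev x y g)⁻¹ ∉ R := by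
    intro g hg
    obtain ⟨a, b, rfl⟩ := (mem_originIdeal_iff g).mp hg
    rw [map_add]
    refine nonunit_add (ev_mem h _) (ev_mem h _) ?_ ?_
    · rw [map_mul]
      exact nonunit_mul (ev_mem h _) (by simpa using hx)
    · rw [map_mul]
      exact nonunit_mul (ev_mem h _) (by simpa using hy)
  refine ⟨h1 g, fun hg ↦ ?_⟩
  by_contra hg'
  obtain ⟨c, hc0, g', hg'', rfl⟩ := evalEval_of_notMem_originIdeal hg'
  have h2 := nonunit_add (R := R) (ev_mem h _) (ev_mem h (-g')) hg
    (h1 _ (neg_mem hg''))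
  rw [← map_add] at h2
  have h3 : ev x y (Polynomial.C (Polynomial.C c) + g' + -g') = algebraMap ℂ K c := by simp
  rw [h3, ← map_inv₀] at h2
  exact h2.elim (by simpa using hc0) (· (hc _))

/-- A local ring essentially generated by two nonunits `x`, `y` is the local ring of the affine
plane at the origin. -/
lemma eq_locAt_origin {R : Subring K} [IsLocalRing R] (h : EssGen (gens x y) R)
    (hx : x = 0 ∨ x⁻¹ ∉ R) (hy : y = 0 ∨ y⁻¹ ∉ R) : R = locAt (ev x y) originIdeal :=
  (essGen_gens_iff.mp h).eq_locAt (nonunit_ev h.1 hx hy)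

lemma exists_eq_of_nonunit {z : K} (hz : z ∈ locAt (ev x y) originIdeal)
    (hz' : z⁻¹ ∉ locAt (ev x y) originIdeal) (hxy : Function.Injective (ev x y)) :
    ∃ c ∈ locAt (ev x y) originIdeal, ∃ d ∈ locAt (ev x y) originIdeal, z = x * c + y * d := by
  obtain ⟨n, d, hd, h⟩ := hz
  have hd0 : ev x y d ≠ 0 := fun h ↦ hd (hxy (a₁ := d) (a₂ := 0) (by rw [h, map_zero]) ▸ zero_mem _)
  have hn : n ∈ originIdeal := by
    by_contra hn
    apply hz'
    by_cases hz0 : z = 0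
    · simp [hz0]
    exact ⟨d, n, hn, by rw [← h]; field_simp⟩
  obtain ⟨a, b, rfl⟩ := (mem_originIdeal_iff n).mp hn
  refine ⟨ev x y a / ev x y d, ⟨a, d, hd, by field_simp⟩, ev x y b / ev x y d,
    ⟨b, d, hd, by field_simp⟩, ?_⟩
  rw [(eq_mul_inv_iff_mul_eq₀ hd0).mpr h]
  simp
  field_simp

end

section

/-! ### The pencil spanned by the cuspidal cubic -/

variable {K : Type} [Field K] [Algebra ℂ K] {x y : K}

instance : (Ideal.span {(Polynomial.C Polynomial.X : A2)}).IsPrime := by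
  rw [Ideal.span_singleton_prime (by simp)]
  exact Polynomial.prime_C_iff.mpr Polynomial.prime_X

/-- The local ring of the last exceptional curve: the local ring of the plane with coordinates
`x / y` and `rr x y 8` at the generic point of the line where the first coordinate vanishes. -/
abbrev excRing (x y : K) : Subring K :=
  locAt (ev (x / y) (rr x y 8)) (Ideal.span {(Polynomial.C Polynomial.X : A2)})

lemma mem_excIdeal_iff (g : A2) : g ∈ Ideal.span {(Polynomial.C Polynomial.X : A2)} ↔
    g.map (Polynomial.evalRingHom (0 : ℂ)) = 0 := by
  rw [Ideal.mem_span_singleton, Polynomial.C_dvd_iff_dvd_coeff, Polynomial.ext_iff]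
  refine forall_congr' fun n ↦ ?_
  rw [Polynomial.X_dvd_iff, Polynomial.coeff_map, Polynomial.coeff_zero,
    Polynomial.coe_evalRingHom, Polynomial.coeff_zero_eq_eval_zero]

lemma left_mem_excRing : x / y ∈ excRing x y := by
  have := apply_mem_locAt (α := ev (x / y) (rr x y 8))
    (P := Ideal.span {(Polynomial.C Polynomial.X : A2)}) (Polynomial.C Polynomial.X)
  simpa using this

lemma algebraMap_mem_excRing (c : ℂ) : algebraMap ℂ K c ∈ excRing x y := by
  have := apply_mem_locAt (α := ev (x / y) (rr x y 8))
    (P := Ideal.span {(Polynomial.C Polynomial.X : A2)}) (Polynomial.C (Polynomial.C c))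
  simpa using this

lemma rr_mem_excRing : rr x y 8 ∈ excRing x y := by
  have := apply_mem_locAt (α := ev (x / y) (rr x y 8))
    (P := Ideal.span {(Polynomial.C Polynomial.X : A2)}) Polynomial.X
  simpa using this

lemma aeval_rr_mem_excRing (p : Polynomial ℂ) : Polynomial.aeval (rr x y 8) p ∈ excRing x y :=
  aeval_mem algebraMap_mem_excRing rr_mem_excRing p

section

variable (h : IsPlaneField x y)

include h

lemma inv_left_notMem_excRing : (x / y)⁻¹ ∉ excRing x y := by
  have := (inv_mem_locAt_iff (P := Ideal.span {(Polynomial.C Polynomial.X : A2)}) (h.rr 8).injective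
    (a := Polynomial.C Polynomial.X) (by simp)).not.mpr
    (not_not.mpr (Ideal.mem_span_singleton_self _))
  simpa using this

lemma inv_aeval_rr_mem_excRing {p : Polynomial ℂ} (hp : p ≠ 0) :
    (Polynomial.aeval (rr x y 8) p)⁻¹ ∈ excRing x y := by
  have hp' : p.map Polynomial.C ≠ 0 :=
    (Polynomial.map_ne_zero_iff Polynomial.C_injective).mpr hp
  have := (inv_mem_locAt_iff (P := Ideal.span {(Polynomial.C Polynomial.X : A2)}) (h.rr 8).injective
    hp').mpr (by
      rw [mem_excIdeal_iff, Polynomial.map_map]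
      have : (Polynomial.evalRingHom (0 : ℂ)).comp Polynomial.C = RingHom.id ℂ := by ext; simp
      rwa [this, Polynomial.map_id])
  have h2 : ev (x / y) (rr x y 8) (p.map Polynomial.C) = Polynomial.aeval (rr x y 8) p := by
    rw [ev_apply, Polynomial.eval₂_map, Polynomial.aeval_def]
    congr 1
    ext c
    simp
  rwa [h2] at this

lemma aeval_rr_ne_zero {p : Polynomial ℂ} (hp : p ≠ 0) : Polynomial.aeval (rr x y 8) p ≠ 0 := by
  have hp' : p.map Polynomial.C ≠ 0 :=
    (Polynomial.map_ne_zero_iff Polynomial.C_injective).mpr hp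
  have h2 : ev (x / y) (rr x y 8) (p.map Polynomial.C) = Polynomial.aeval (rr x y 8) p := by
    rw [ev_apply, Polynomial.eval₂_map, Polynomial.aeval_def]
    congr 1
    ext c
    simp
  rw [← h2]
  exact fun h0 ↦ hp' ((h.rr 8).injective (by rw [h0, map_zero]))

lemma inv_right_eq : y⁻¹ = (x / y) ^ 3 * (1 + (x / y) ^ 5 * rr x y 8) := by
  have := h.ne_zero_left
  have := h.ne_zero_right
  rw [rr]
  field_simp
  ring

/-- The unit `ε = 1 / (1 + u ^ 5 * r₈)` of the local ring of the last exceptional curve, congruent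
to one modulo `u`. -/
lemma exists_unit_excRing : ∃ e ∈ excRing x y, e⁻¹ ∈ excRing x y ∧ e ≠ 0 ∧
    (∃ c ∈ excRing x y, e = 1 + x / y * c) ∧ y * (x / y) ^ 3 = e ∧ x * (x / y) ^ 2 = e ∧
    (y ^ 2 - x ^ 3) * (x / y) = rr x y 8 * e ^ 3 := by
  have hu := h.infinity.ne_zero_left
  have hy := h.ne_zero_right
  have hx := h.ne_zero_left
  have hw := inv_right_eq h
  have hd : 1 + (x / y) ^ 5 * rr x y 8 ≠ 0 := fun h0 ↦ by
    rw [h0, mul_zero] at hw; exact inv_ne_zero hy hw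
  have hmem : (1 + (x / y) ^ 5 * rr x y 8)⁻¹ ∈ excRing x y := by
    have h0 : ((1 : A2) + Polynomial.C Polynomial.X ^ 5 * Polynomial.X) ∉
        Ideal.span {(Polynomial.C Polynomial.X : A2)} := by
      rw [mem_excIdeal_iff]
      simp
    have := (inv_mem_locAt_iff (P := Ideal.span {(Polynomial.C Polynomial.X : A2)})
      (h.rr 8).injective (a := 1 + Polynomial.C Polynomial.X ^ 5 * Polynomial.X)
      (fun h1 ↦ h0 (by rw [h1]; exact zero_mem _))).mpr h0
    simpa using this
  have hd' : 1 + (x / y) ^ 5 * rr x y 8 ∈ excRing x y :=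
    add_mem (one_mem _) (mul_mem (pow_mem left_mem_excRing 5) rr_mem_excRing)
  have he : y * (x / y) ^ 3 = (1 + (x / y) ^ 5 * rr x y 8)⁻¹ := by
    exact eq_inv_of_mul_eq_one_left (by rw [mul_assoc, ← hw, mul_inv_cancel₀ hy])
  refine ⟨(1 + (x / y) ^ 5 * rr x y 8)⁻¹, hmem, by rwa [inv_inv], inv_ne_zero hd,
    ⟨-((x / y) ^ 4 * rr x y 8 * (1 + (x / y) ^ 5 * rr x y 8)⁻¹), ?_, ?_⟩, he, ?_, ?_⟩
  · exact neg_mem (mul_mem (mul_mem (pow_mem left_mem_excRing 4) rr_mem_excRing) hmem)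
  · clear he hw hmem hd'
    generalize rr x y 8 = r at *
    generalize x / y = u at *
    field_simp
    ring
  · rw [← he]; field_simp
  · rw [← he, rr]; field_simp

/-- The element `g` has a pole of order exactly `M` along the last exceptional curve, with leading
coefficient the polynomial `P` in the coordinate of this curve (if `P ≠ 0`). -/
def Lead (x y g : K) (M : ℕ) (P : Polynomial ℂ) : Prop :=
  ∃ c ∈ excRing x y, g * (x / y) ^ M = Polynomial.aeval (rr x y 8) P + x / y * c

omit h in
lemma Lead.add_eq {g g' : K} {M : ℕ} {P P' : Polynomial ℂ} (h : Lead x y g M P)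
    (h' : Lead x y g' M P') : Lead x y (g + g') M (P + P') := by
  obtain ⟨c, hc, e⟩ := h
  obtain ⟨c', hc', e'⟩ := h'
  exact ⟨c + c', add_mem hc hc', by rw [add_mul, e, e', map_add]; ring⟩

omit h in
lemma Lead.zero_of_lt {g : K} {M M' : ℕ} {P : Polynomial ℂ} (h : Lead x y g M P) (hM : M < M') :
    Lead x y g M' 0 := by
  obtain ⟨c, hc, e⟩ := h
  obtain ⟨k, rfl⟩ := Nat.exists_eq_add_of_lt hM
  refine ⟨(x / y) ^ k * (Polynomial.aeval (rr x y 8) P + x / y * c),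
    mul_mem (pow_mem left_mem_excRing k)
      (add_mem (aeval_rr_mem_excRing P) (mul_mem left_mem_excRing hc)), ?_⟩
  rw [map_zero, ← e]
  ring

omit h in
lemma Lead.mul {g g' : K} {M M' : ℕ} {P P' : Polynomial ℂ} (h : Lead x y g M P)
    (h' : Lead x y g' M' P') : Lead x y (g * g') (M + M') (P * P') := by
  obtain ⟨c, hc, e⟩ := h
  obtain ⟨c', hc', e'⟩ := h'
  refine ⟨Polynomial.aeval (rr x y 8) P * c' + c * Polynomial.aeval (rr x y 8) P' + x / y * c * c',
    add_mem (add_mem (mul_mem (aeval_rr_mem_excRing P) hc') (mul_mem hc (aeval_rr_mem_excRing P')))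
      (mul_mem (mul_mem left_mem_excRing hc) hc'), ?_⟩
  rw [pow_add, mul_mul_mul_comm, e, e', map_mul]
  ring

omit h in
lemma lead_const (c : ℂ) : Lead x y (algebraMap ℂ K c) 0 (Polynomial.C c) :=
  ⟨0, zero_mem _, by simp⟩

lemma lead_left : Lead x y x 2 1 := by
  obtain ⟨e, -, -, -, ⟨c, hc, he⟩, -, h2, -⟩ := exists_unit_excRing h
  exact ⟨c, hc, by rw [h2, he, map_one]⟩

lemma lead_right : Lead x y y 3 1 := by
  obtain ⟨e, -, -, -, ⟨c, hc, he⟩, h2, -, -⟩ := exists_unit_excRing h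
  exact ⟨c, hc, by rw [h2, he, map_one]⟩

lemma lead_cuspidal : Lead x y (y ^ 2 - x ^ 3) 1 Polynomial.X := by
  obtain ⟨e, -, -, -, ⟨c, hc, he⟩, -, -, h2⟩ := exists_unit_excRing h
  refine ⟨rr x y 8 * (3 * c + 3 * (x / y) * c ^ 2 + (x / y) ^ 2 * c ^ 3), ?_, ?_⟩
  · have h3 : (3 : K) ∈ excRing x y := ofNat_mem _ 3
    exact mul_mem rr_mem_excRing (add_mem (add_mem (mul_mem h3 hc)
      (mul_mem (mul_mem h3 left_mem_excRing) (pow_mem hc 2)))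
      (mul_mem (pow_mem left_mem_excRing 2) (pow_mem hc 3)))
  · rw [pow_one, h2, he, Polynomial.aeval_X]; ring

lemma lead_aeval {a : Polynomial ℂ} (ha : a ≠ 0) : ∃ k, ∃ c : ℂ, c ≠ 0 ∧
    Lead x y (Polynomial.aeval x a) (2 * k) (Polynomial.C c) ∧ (k = 0 → a = Polynomial.C c) := by
  induction a using Polynomial.recOnHorner with
  | M0 => exact absurd rfl ha
  | MC p a hp ha' ih =>
    by_cases hp0 : p = 0
    · subst hp0
      refine ⟨0, a, ha', ?_, fun _ ↦ by simp⟩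
      simpa using lead_const a
    obtain ⟨k, c, hc, hl, hk⟩ := ih hp0
    have hk0 : k ≠ 0 := by
      intro hk0
      rw [hk hk0, Polynomial.coeff_C_zero] at hp
      exact hc hp
    refine ⟨k, c, hc, ?_, fun h ↦ absurd h hk0⟩
    have := hl.add_eq ((lead_const a).zero_of_lt (show 0 < 2 * k by omega))
    simpa using this
  | MX p hp ih =>
    obtain ⟨k, c, hc, hl, -⟩ := ih hp
    refine ⟨k + 1, c, hc, ?_, fun h ↦ absurd h (by omega)⟩
    have := hl.mul (lead_left h)
    simpa [mul_add] using this

/-- A polynomial of degree at most one in `y` has an odd or an even pole order; two different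
monomials `x ^ i`, `y * x ^ i` have different pole orders, so that nothing cancels. -/
lemma lead_linear {a b : Polynomial ℂ} (hab : a ≠ 0 ∨ b ≠ 0) : ∃ M, ∃ c : ℂ, c ≠ 0 ∧ M ≠ 1 ∧
    Lead x y (Polynomial.aeval x a + Polynomial.aeval x b * y) M (Polynomial.C c) ∧
    (M = 0 → b = 0 ∧ a = Polynomial.C c) := by
  by_cases hb : b = 0
  · subst hb
    obtain ⟨k, c, hc, hl, hk⟩ := lead_aeval h (hab.resolve_right (by simp))
    exact ⟨2 * k, c, hc, by omega, by simpa using hl, fun h ↦ ⟨rfl, hk (by omega)⟩⟩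
  obtain ⟨k, c, hc, hl, hk⟩ := lead_aeval h hb
  have hl := hl.mul (lead_right h)
  rw [mul_one] at hl
  by_cases ha : a = 0
  · subst ha
    exact ⟨2 * k + 3, c, hc, by omega, by simpa using hl, fun h ↦ absurd h (by omega)⟩
  obtain ⟨k', c', hc', hl', hk'⟩ := lead_aeval h ha
  rcases lt_or_gt_of_ne (show 2 * k + 3 ≠ 2 * k' by omega) with hlt | hlt
  · have := hl'.add_eq (hl.zero_of_lt hlt)
    rw [add_zero] at this
    exact ⟨_, c', hc', by omega, this, fun h ↦ absurd h (by omega)⟩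
  · have := (hl'.zero_of_lt hlt).add_eq hl
    rw [zero_add] at this
    exact ⟨_, c, hc, by omega, this, fun h ↦ absurd h (by omega)⟩

/-- The polynomial `Y ^ 2 - X ^ 3` of the cuspidal cubic. -/
def cuspPoly : A2 := Polynomial.X ^ 2 - Polynomial.C (Polynomial.X ^ 3)

omit h in
@[simp] lemma ev_cuspPoly : ev x y cuspPoly = y ^ 2 - x ^ 3 := by simp [cuspPoly]

omit [Field K] [Algebra ℂ K] h in
lemma monic_cuspPoly : cuspPoly.Monic := Polynomial.monic_X_pow_sub_C _ (by norm_num)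

omit [Field K] [Algebra ℂ K] h in
lemma natDegree_cuspPoly : cuspPoly.natDegree = 2 := Polynomial.natDegree_X_pow_sub_C

/-- The pole order along the last exceptional curve of a polynomial, computed by expanding it in
powers of the equation of the cuspidal cubic. -/
lemma exists_lead (n : ℕ) {g : A2} (hg : g ≠ 0) (hn : g.natDegree ≤ n) :
    ∃ M P, P ≠ 0 ∧ Lead x y (ev x y g) M P ∧
      (M = 0 → ∃ c : ℂ, g = Polynomial.C (Polynomial.C c)) ∧
      (M = 1 → ∃ a b : ℂ, a ≠ 0 ∧ g = Polynomial.C (Polynomial.C a) * cuspPoly +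
        Polynomial.C (Polynomial.C b)) := by
  induction n using Nat.strong_induction_on generalizing g with
  | _ n ih =>
  -- Write `g = a(X) + b(X) Y + g₁ (Y² - X³)` and compare the pole order `M₂` of the linear part
  -- with the pole order `1 + M₁` of the last term. If they agree, the two leading terms do not
  -- cancel: the first is a constant, the second a multiple of `X`.
  have hdiv := Polynomial.modByMonic_add_div g cuspPoly
  have hdeg : (g %ₘ cuspPoly).natDegree < 2 := by
    rw [← natDegree_cuspPoly]
    exact Polynomial.natDegree_modByMonic_lt g monic_cuspPoly fun h ↦ by
      have := natDegree_cuspPoly; rw [h] at this; simp at this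
  obtain ⟨a, b, hab⟩ : ∃ a b, g %ₘ cuspPoly = Polynomial.C a + Polynomial.C b * Polynomial.X :=
    ⟨_, _, by rw [add_comm]; exact Polynomial.eq_X_add_C_of_natDegree_le_one (by omega)⟩
  have hev : ev x y (g %ₘ cuspPoly) = Polynomial.aeval x a + Polynomial.aeval x b * y := by
    rw [hab]; simp
  set g1 := g /ₘ cuspPoly with hg1
  have hevg : ev x y g = ev x y (g %ₘ cuspPoly) + (y ^ 2 - x ^ 3) * ev x y g1 := by
    conv_lhs => rw [← hdiv]
    rw [map_add, map_mul, ev_cuspPoly]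
  have hlin : (a ≠ 0 ∨ b ≠ 0) ∨ g %ₘ cuspPoly = 0 := by
    by_contra! h0
    obtain ⟨⟨rfl, rfl⟩, h1⟩ := h0
    exact h1 (by rw [hab]; simp)
  by_cases hg10 : g1 = 0
  · rw [hg10, mul_zero, add_zero] at hdiv
    obtain ⟨M, c, hc, hM, hl, h0⟩ := lead_linear h (hlin.resolve_right (by rw [hdiv]; exact hg))
    refine ⟨M, Polynomial.C c, by simpa using hc, by rwa [← hdiv, hev], fun hM0 ↦ ⟨c, ?_⟩,
      fun h ↦ absurd h hM⟩
    obtain ⟨rfl, rfl⟩ := h0 hM0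
    rw [← hdiv, hab]; simp
  have hd1 : g1.natDegree < n := by
    rw [hg1, Polynomial.natDegree_divByMonic _ monic_cuspPoly, natDegree_cuspPoly]
    have : 2 ≤ g.natDegree := by
      by_contra! hlt
      exact hg10 ((Polynomial.divByMonic_eq_zero_iff monic_cuspPoly).mpr
        (Polynomial.degree_lt_degree (by rwa [natDegree_cuspPoly])))
    omega
  obtain ⟨M1, P1, hP1, hl1, h01, h11⟩ := ih _ hd1 hg10 le_rfl
  have hl1' := (lead_cuspidal h).mul hl1
  rcases hlin.symm with h0 | hlin
  · rw [h0, zero_add] at hdiv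
    refine ⟨1 + M1, _, mul_ne_zero Polynomial.X_ne_zero hP1, ?_, fun h ↦ absurd h (by omega),
      fun hM ↦ ?_⟩
    · rwa [hevg, h0, map_zero, zero_add]
    · obtain ⟨c, hc⟩ := h01 (by omega)
      refine ⟨c, 0, ?_, ?_⟩
      · rintro rfl; exact hg10 (by rw [hc]; simp)
      · rw [← hdiv, hc]; simp [mul_comm]
  obtain ⟨M2, c, hc, hM2, hl2, h02⟩ := lead_linear h hlin
  rw [← hev] at hl2
  rcases lt_trichotomy (1 + M1) M2 with hlt | rfl | hlt
  · have := hl2.add_eq (hl1'.zero_of_lt hlt)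
    rw [add_zero, ← hevg] at this
    exact ⟨_, _, by simpa using hc, this, fun h ↦ absurd h (by omega), fun h ↦ absurd h (by omega)⟩
  · have := hl2.add_eq hl1'
    rw [← hevg] at this
    refine ⟨_, _, fun h0 ↦ ?_, this, fun h ↦ absurd h (by omega), fun h ↦ absurd h (by omega)⟩
    have := congrArg (Polynomial.coeff · 0) h0
    simp at this
    exact hc this
  · have := (hl2.zero_of_lt hlt).add_eq hl1'
    rw [zero_add, ← hevg] at this
    refine ⟨_, _, mul_ne_zero Polynomial.X_ne_zero hP1, this, fun h ↦ absurd h (by omega),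
      fun h ↦ ?_⟩
    obtain ⟨d, hd⟩ := h01 (by omega)
    obtain ⟨rfl, rfl⟩ := h02 (by omega)
    refine ⟨d, c, ?_, ?_⟩
    · rintro rfl; exact hg10 (by rw [hd]; simp)
    · rw [← hdiv, hd, hab]; simp [mul_comm, add_comm]

/-- The polynomials with at most a simple pole along the last exceptional curve span the pencil of
the cuspidal cubic. -/
lemma eq_pencil {g : A2} (hg : g ≠ 0) (hu : x / y * ev x y g ∈ excRing x y) :
    (∃ c : ℂ, g = Polynomial.C (Polynomial.C c)) ∨
    ∃ a b : ℂ, a ≠ 0 ∧ g = Polynomial.C (Polynomial.C a) * cuspPoly +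
      Polynomial.C (Polynomial.C b) := by
  obtain ⟨M, P, hP, ⟨c, hc, e⟩, h0, h1⟩ := exists_lead h _ hg le_rfl
  rcases M with _ | _ | M
  · exact .inl (h0 rfl)
  · exact .inr (h1 rfl)
  exfalso
  have hu0 := h.infinity.ne_zero_left
  have hPu : Polynomial.aeval (rr x y 8) P =
      x / y * ((x / y) ^ M * (x / y * ev x y g) - c) := by
    linear_combination -e
  apply inv_left_notMem_excRing h
  have hP0 := aeval_rr_ne_zero h hP
  have : (x / y)⁻¹ = ((x / y) ^ M * (x / y * ev x y g) - c) *
      (Polynomial.aeval (rr x y 8) P)⁻¹ := by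
    rw [eq_mul_inv_iff_mul_eq₀ hP0, hPu, ← mul_assoc, inv_mul_cancel₀ hu0, one_mul]
  rw [this]
  exact mul_mem (sub_mem (mul_mem (pow_mem left_mem_excRing M) hu) hc)
    (inv_aeval_rr_mem_excRing h hP)

/-- A rational function that is a unit along every curve of the affine plane is constant. -/
lemma eq_const_of_forall_unit {z : K} (hz0 : z ≠ 0) (hz : ∀ g : A2, Prime g →
    ∀ P : Ideal A2, [P.IsPrime] → P = Ideal.span {g} →
      z ∈ locAt (ev x y) P ∧ z⁻¹ ∈ locAt (ev x y) P) :
    ∃ c : ℂ, c ≠ 0 ∧ z = algebraMap ℂ K c := by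
  obtain ⟨n, d, hd, e⟩ := h.exists_fraction z
  have hn : n ≠ 0 := by
    rintro rfl
    rw [map_zero, mul_eq_zero] at e
    exact e.elim hz0 fun h' ↦ hd (h.injective (by rw [h', map_zero]))
  obtain ⟨n', d', c, hrel, rfl, rfl⟩ := UniqueFactorizationMonoid.exists_reduced_factors' n d hd
  have hc0 := left_ne_zero_of_mul hn
  have hn0 := right_ne_zero_of_mul hn
  have hd0 := right_ne_zero_of_mul hd
  have hne : ∀ {g : A2}, g ≠ 0 → ev x y g ≠ 0 := fun hg h' ↦ hg (h.injective (by rw [h', map_zero]))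
  have e' : z * ev x y d' = ev x y n' := by
    apply mul_left_cancel₀ (hne hc0)
    rw [← map_mul, ← e, map_mul]; ring
  have key : ∀ g, Prime g → ∀ n d : A2, n ≠ 0 → d ≠ 0 → IsRelPrime n d → ∀ z : K,
      (∀ P : Ideal A2, [P.IsPrime] → P = Ideal.span {g} → z ∈ locAt (ev x y) P) →
      z * ev x y d = ev x y n → ¬ g ∣ d := by
    intro g hg n d hn hd hrel z hz e hgd
    have hP : (Ideal.span {g}).IsPrime := (Ideal.span_singleton_prime hg.ne_zero).mpr hg
    obtain ⟨a, b, hb, e2⟩ := hz _ rfl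
    rw [Ideal.mem_span_singleton] at hb
    have : n * b = a * d := h.injective (by rw [map_mul, map_mul, ← e, ← e2]; ring)
    have h1 : g ∣ n * b := this ▸ hgd.mul_left a
    exact hg.not_isUnit (hrel ((hg.dvd_or_dvd h1).resolve_right hb) hgd)
  have hud : IsUnit d' := by
    by_contra hu
    obtain ⟨g, hg, hgd⟩ := WfDvdMonoid.exists_irreducible_factor hu hd0
    exact key g hg.prime n' d' hn0 hd0 hrel z (fun P hP hPg ↦ (hz g hg.prime P hPg).1) e' hgd
  have hun : IsUnit n' := by
    by_contra hu
    obtain ⟨g, hg, hgd⟩ := WfDvdMonoid.exists_irreducible_factor hu hn0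
    exact key g hg.prime d' n' hd0 hn0 hrel.symm z⁻¹ (fun P hP hPg ↦ (hz g hg.prime P hPg).2)
      (by rw [← e']; field_simp) hgd
  have hconst : ∀ g : A2, IsUnit g → ∃ c : ℂ, c ≠ 0 ∧ ev x y g = algebraMap ℂ K c := by
    intro g hg
    obtain ⟨p, hp, rfl⟩ := Polynomial.isUnit_iff.mp hg
    obtain ⟨c, hc, rfl⟩ := Polynomial.isUnit_iff.mp hp
    exact ⟨c, hc.ne_zero, by simp⟩
  obtain ⟨a, ha, ea⟩ := hconst _ hun
  obtain ⟨b, hb, eb⟩ := hconst _ hud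
  refine ⟨a / b, div_ne_zero ha hb, ?_⟩
  rw [map_div₀, ← ea, ← eb, eq_div_iff (hne hd0), e']

end

end

section

/-! ### Local rings of the projective plane -/

/-- The homogeneous prime ideal of a point of the plane. -/
abbrev homIdeal (y : Plane) : Ideal (MvPolynomial (Fin 3) ℂ) :=
  (show ProjectiveSpectrum planeGrading from y).asHomogeneousIdeal.toIdeal

/-- The homogeneous localization at a point of the plane. -/
abbrev HLoc (y : Plane) : Type := HomogeneousLocalization.AtPrime planeGrading (homIdeal y)

/-- The local ring of the plane is the homogeneous localization. -/
def stalkEquiv (y : Plane) : Plane.presheaf.stalk y ≃+* HLoc y :=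
  (Proj.stalkIso planeGrading y).commRingCatIsoToRingEquiv

lemma stalkSpecializes_stalkEquiv {y z : Plane} (h : y ⤳ z)
    (f : HomogeneousLocalization.NumDenSameDeg planeGrading (homIdeal z).primeCompl)
    (hf : (f.den : MvPolynomial (Fin 3) ℂ) ∈ (homIdeal y).primeCompl) :
    (Plane.presheaf.stalkSpecializes h) ((stalkEquiv z).symm (.mk f)) =
      (stalkEquiv y).symm (.mk ⟨f.deg, f.num, f.den, hf⟩) := by
  exact TopCat.Presheaf.germ_stalkSpecializes_apply _ _ _ _

lemma fromSpecStalk_toSpecZero (y : Plane) : Plane.fromSpecStalk y ≫ Proj.toSpecZero planeGrading =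
    Spec.map (CommRingCat.ofHom ((stalkEquiv y).symm.toRingHom.comp
      (HomogeneousLocalization.fromZeroRingHom planeGrading (homIdeal y).primeCompl))) := by
  have hy : y ∈ Proj.basicOpen planeGrading 1 := by rw [Proj.basicOpen_one]; trivial
  have h1 : Plane.fromSpecStalk y ≫ (Scheme.topIso _).inv ≫
      (Scheme.isoOfEq _ (Proj.basicOpen_one planeGrading)).inv =
      (Proj.basicOpen planeGrading 1).fromSpecStalkOfMem y hy := by
    rw [← cancel_mono (Proj.basicOpen planeGrading 1).ι]
    simp
  rw [Proj.toSpecZero, Proj.basicOpenToSpec]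
  have h2 := (Proj.basicOpen planeGrading 1).fromSpecStalkOfMem_toSpecΓ y hy
  simp only [Category.assoc]
  rw [reassoc_of% h1, reassoc_of% h2, ← Spec.map_comp, ← Spec.map_comp]
  rfl

/-- The subring of a field `K` of the fractions `Φ G / Φ H` of homogeneous polynomials of the same
degree, with `H` not vanishing at `y`. -/
def homRing {K : Type} [Field K] [Algebra ℂ K] (Φ : MvPolynomial (Fin 3) ℂ →ₐ[ℂ] K) (y : Plane) :
    Set K :=
  {z | ∃ d G H, G.IsHomogeneous d ∧ H.IsHomogeneous d ∧ H ∉ homIdeal y ∧ z * Φ H = Φ G}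

/-- The point `ψ : Spec K ⟶ ℙ²` is the generic point, given by the evaluation `Φ` of forms. -/
structure IsGenericEval {K : Type} [Field K] [Algebra ℂ K] (ψ : Spec (.of K) ⟶ Plane)
    (Φ : MvPolynomial (Fin 3) ℂ →ₐ[ℂ] K) : Prop where
  eq_zero : ∀ d (G : MvPolynomial (Fin 3) ℂ), G.IsHomogeneous d → Φ G = 0 → G = 0
  exists_ring : ∀ y, ∃ R : Subring K, (R : Set K) = homRing Φ y ∧ HasLocalRing ψ y R
  exists_fraction : ∀ z, ∃ d G H, G.IsHomogeneous d ∧ H.IsHomogeneous d ∧ Φ H ≠ 0 ∧ z * Φ H = Φ G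

variable {K : Type} [Field K] [Algebra ℂ K]

/-- The fraction of two forms of the same degree, as an element of the local ring. -/
def frac (y : Plane) {d : ℕ} {G H : MvPolynomial (Fin 3) ℂ} (hG : G.IsHomogeneous d)
    (hH : H.IsHomogeneous d) (hHy : H ∉ homIdeal y) : HLoc y :=
  .mk ⟨d, ⟨G, hG⟩, ⟨H, hH⟩, hHy⟩

lemma val_frac (y : Plane) {d : ℕ} {G H : MvPolynomial (Fin 3) ℂ} (hG : G.IsHomogeneous d)
    (hH : H.IsHomogeneous d) (hHy : H ∉ homIdeal y) :
    (frac y hG hH hHy).val = Localization.mk G ⟨H, hHy⟩ := rfl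

lemma exists_frac (y : Plane) (z : HLoc y) : ∃ (d : ℕ) (G H : MvPolynomial (Fin 3) ℂ)
    (hG : G.IsHomogeneous d) (hH : H.IsHomogeneous d) (hHy : H ∉ homIdeal y),
    z = frac y hG hH hHy := by
  obtain ⟨f, rfl⟩ := HomogeneousLocalization.mk_surjective z
  exact ⟨f.deg, f.num, f.den, f.num.2, f.den.2, f.den_mem, rfl⟩

lemma frac_eq_zero_iff (y : Plane) {d : ℕ} {G H : MvPolynomial (Fin 3) ℂ} (hG : G.IsHomogeneous d)
    (hH : H.IsHomogeneous d) (hHy : H ∉ homIdeal y) : frac y hG hH hHy = 0 ↔ G = 0 := by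
  rw [← (HomogeneousLocalization.val_injective _).eq_iff, val_frac, HomogeneousLocalization.val_zero]
  refine ⟨fun h ↦ ?_, fun h ↦ by rw [h, Localization.mk_zero]⟩
  rw [Localization.mk_eq_mk', IsLocalization.mk'_eq_zero_iff] at h
  obtain ⟨m, hm⟩ := h
  exact (mul_eq_zero.mp hm).resolve_left fun h0 ↦ m.2 (by rw [h0]; exact zero_mem _)

/-- A form of degree `d` is the value of the corresponding polynomial at the fractions `Xᵢ / l`. -/
lemma frac_eq_eval₂ (y : Plane) {l : MvPolynomial (Fin 3) ℂ} (hl : l.IsHomogeneous 1)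
    (hly : l ∉ homIdeal y) {d : ℕ} {G : MvPolynomial (Fin 3) ℂ} (hG : G.IsHomogeneous d)
    (hly' : l ^ d ∉ homIdeal y) (hl' : (l ^ d).IsHomogeneous d) :
    frac y hG hl' hly' = MvPolynomial.eval₂Hom
      ((HomogeneousLocalization.fromZeroRingHom planeGrading (homIdeal y).primeCompl).comp
        (algebraMap ℂ (planeGrading 0)))
      (fun i ↦ frac y (MvPolynomial.isHomogeneous_X ℂ i) hl hly) G := by
  set V : HLoc y →+* Localization (homIdeal y).primeCompl := algebraMap _ _ with hV
  have hVv : ∀ z, V z = z.val := fun z ↦ rfl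
  have hVi : Function.Injective V := HomogeneousLocalization.val_injective _
  apply hVi
  rw [← RingHom.comp_apply, MvPolynomial.comp_eval₂Hom, hVv, val_frac]
  set A := algebraMap (MvPolynomial (Fin 3) ℂ) (Localization (homIdeal y).primeCompl) with hA
  have h1 : (V.comp ((HomogeneousLocalization.fromZeroRingHom planeGrading
      (homIdeal y).primeCompl).comp (algebraMap ℂ (planeGrading 0)))) = A.comp MvPolynomial.C := by
    ext c
    change Localization.mk (MvPolynomial.C c) 1 = A _
    rw [Localization.mk_one_eq_algebraMap]
    rfl
  have hu : IsUnit (A l) := IsLocalization.map_units _ (⟨l, hly⟩ : (homIdeal y).primeCompl)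
  obtain ⟨b, hb⟩ := hu.exists_right_inv
  have h2 : (fun i ↦ V (frac y (MvPolynomial.isHomogeneous_X ℂ i) hl hly)) =
      fun i ↦ b * A (MvPolynomial.X i) := by
    ext i
    rw [hVv, val_frac, Localization.mk_eq_mk', IsLocalization.mk'_eq_iff_eq_mul]
    linear_combination (-A (MvPolynomial.X i)) * hb
  rw [h1]
  change _ = MvPolynomial.eval₂Hom (A.comp MvPolynomial.C)
    (fun i ↦ V (frac y (MvPolynomial.isHomogeneous_X ℂ i) hl hly)) G
  rw [h2]
  have h3 : MvPolynomial.eval₂Hom (A.comp MvPolynomial.C) (fun i ↦ b * A (MvPolynomial.X i)) G =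
      b ^ d * A G := by
    conv_rhs => rw [G.as_sum]
    rw [MvPolynomial.coe_eval₂Hom, MvPolynomial.eval₂_eq, map_sum, Finset.mul_sum]
    refine Finset.sum_congr rfl fun m hm ↦ ?_
    have hdeg : m.degree = d := by
      have := hG (MvPolynomial.mem_support_iff.mp hm)
      exact (DFunLike.congr_fun (Finsupp.degree_eq_weight_one (R := ℕ)) m).trans this
    rw [MvPolynomial.monomial_eq, map_mul, Finsupp.prod, map_prod]
    simp only [mul_pow, Finset.prod_mul_distrib, map_pow]
    rw [Finset.prod_pow_eq_pow_sum]
    have : ∑ i ∈ m.support, m i = d := hdeg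
    rw [this, RingHom.comp_apply]
    ring
  rw [h3, Localization.mk_eq_mk', IsLocalization.mk'_eq_iff_eq_mul]
  change A G = b ^ d * A G * A (l ^ d)
  rw [map_pow, mul_right_comm, ← mul_pow, mul_comm b, hb, one_pow, one_mul]

/-- The generic point of the plane over a field isomorphic to its function field. -/
lemma exists_isGenericEval {ψ : Spec (.of K) ⟶ Plane} {η : Plane} (hη : homIdeal η = ⊥)
    (h : HasLocalRing ψ η ⊤) (hs : ψ ≫ planeStr = Spec.map (CommRingCat.ofHom (algebraMap ℂ K)))
    {l : MvPolynomial (Fin 3) ℂ} (hl : l.IsHomogeneous 1) (hl0 : l ≠ 0) :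
    ∃ Φ : MvPolynomial (Fin 3) ℂ →ₐ[ℂ] K, IsGenericEval ψ Φ ∧ Φ l = 1 := by
  obtain ⟨φ, hφ, hφr, hφψ⟩ := h
  have hη' : ∀ {G : MvPolynomial (Fin 3) ℂ}, G ≠ 0 → G ∉ homIdeal η := fun hG h ↦ hG (by
    rwa [hη, Ideal.mem_bot] at h)
  let θ : HLoc η →+* K := φ.hom.comp (stalkEquiv η).symm.toRingHom
  have hθ : Function.Injective θ := hφ.comp (stalkEquiv η).symm.injective
  have hθC : θ.comp ((HomogeneousLocalization.fromZeroRingHom planeGrading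
      (homIdeal η).primeCompl).comp (algebraMap ℂ (planeGrading 0))) = algebraMap ℂ K := by
    have h1 := fromSpecStalk_toSpecZero η
    have h2 : CommRingCat.ofHom (θ.comp ((HomogeneousLocalization.fromZeroRingHom planeGrading
      (homIdeal η).primeCompl).comp (algebraMap ℂ (planeGrading 0)))) =
        CommRingCat.ofHom (algebraMap ℂ K) := by
      apply Spec.map_injective
      rw [← hs, ← hφψ, planeStr, Category.assoc, reassoc_of% h1, ← Spec.map_comp, ← Spec.map_comp]
      rfl
    exact congrArg CommRingCat.Hom.hom h2
  -- `Φ` is dehomogenization by `l`: it sends a form `G` of degree `d` to the function `G / l ^ d`.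
  let Φ : MvPolynomial (Fin 3) ℂ →ₐ[ℂ] K :=
    MvPolynomial.aeval fun i ↦ θ (frac η (MvPolynomial.isHomogeneous_X ℂ i) hl (hη' hl0))
  have hlpow : ∀ d, (l ^ d).IsHomogeneous d := fun d ↦ by simpa using hl.pow d
  have hΦ : ∀ d G (hG : G.IsHomogeneous d),
      θ (frac η hG (hlpow d) (hη' (pow_ne_zero d hl0))) = Φ G := by
    intro d G hG
    rw [frac_eq_eval₂ η hl (hη' hl0), ← RingHom.comp_apply, MvPolynomial.comp_eval₂Hom, hθC]
    rfl
  have hz : ∀ d (G : MvPolynomial (Fin 3) ℂ), G.IsHomogeneous d → Φ G = 0 → G = 0 := by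
    intro d G hG h0
    rw [← hΦ d G hG] at h0
    exact (frac_eq_zero_iff _ _ _ _).mp (hθ (h0.trans (map_zero θ).symm))
  have hfr : ∀ d G H (hG : G.IsHomogeneous d) (hH : H.IsHomogeneous d) (hHy : H ∉ homIdeal η),
      θ (frac η hG hH hHy) * Φ H = Φ G := by
    intro d G H hG hH hHy
    rw [← hΦ d G hG, ← hΦ d H hH, ← map_mul]
    congr 1
    apply HomogeneousLocalization.val_injective
    rw [HomogeneousLocalization.val_mul, val_frac, val_frac, val_frac, Localization.mk_mul,
      Localization.mk_eq_mk_iff, Localization.r_iff_exists]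
    exact ⟨1, by simp; ring⟩
  refine ⟨Φ, ⟨hz, fun y ↦ ?_, fun z ↦ ?_⟩, ?_⟩
  · have hηy : η ⤳ y := by
      rw [specializes_iff_mem_closure]
      refine (ProjectiveSpectrum.le_iff_mem_closure _ _ _).mp ?_
      change homIdeal η ≤ homIdeal y
      rw [hη]; exact bot_le
    have hval : ∀ d G H (hG : G.IsHomogeneous d) (hH : H.IsHomogeneous d) (hHy : H ∉ homIdeal y),
        (Plane.presheaf.stalkSpecializes hηy ≫ φ).hom ((stalkEquiv y).symm (frac y hG hH hHy)) *
          Φ H = Φ G := by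
      intro d G H hG hH hHy
      have hH0 : H ≠ 0 := fun h ↦ hHy (by rw [h]; exact zero_mem _)
      rw [← hfr d G H hG hH (hη' hH0)]
      exact congrArg (fun o ↦ φ.hom o * Φ H)
        (stalkSpecializes_stalkEquiv hηy ⟨d, ⟨G, hG⟩, ⟨H, hH⟩, hHy⟩ (hη' hH0))
    refine ⟨(Plane.presheaf.stalkSpecializes hηy ≫ φ).hom.range, ?_,
      Plane.presheaf.stalkSpecializes hηy ≫ φ, ?_, rfl, ?_⟩
    · ext z
      constructor
      · rintro ⟨o, rfl⟩
        obtain ⟨f, rfl⟩ := (stalkEquiv y).symm.surjective o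
        obtain ⟨d, G, H, hG, hH, hHy, rfl⟩ := exists_frac y f
        exact ⟨d, G, H, hG, hH, hHy, hval d G H hG hH hHy⟩
      · rintro ⟨d, G, H, hG, hH, hHy, hzH⟩
        refine ⟨(stalkEquiv y).symm (frac y hG hH hHy), ?_⟩
        have hH0 : Φ H ≠ 0 := fun h ↦ hHy (by rw [hz d H hH h]; exact zero_mem _)
        exact mul_right_cancel₀ hH0 ((hval d G H hG hH hHy).trans hzH.symm)
    · rw [injective_iff_map_eq_zero]
      intro o ho
      obtain ⟨f, rfl⟩ := (stalkEquiv y).symm.surjective o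
      obtain ⟨d, G, H, hG, hH, hHy, rfl⟩ := exists_frac y f
      have := hval d G H hG hH hHy
      rw [ho, zero_mul] at this
      rw [(frac_eq_zero_iff y hG hH hHy).mpr (hz d G hG this.symm), map_zero]
    · rw [Spec.map_comp, Category.assoc, Scheme.SpecMap_stalkSpecializes_fromSpecStalk, hφψ]
  · have hz' : z ∈ φ.hom.range := hφr ▸ Subring.mem_top z
    obtain ⟨o, rfl⟩ := hz'
    obtain ⟨f, rfl⟩ := (stalkEquiv η).symm.surjective o
    obtain ⟨d, G, H, hG, hH, hHy, rfl⟩ := exists_frac η f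
    exact ⟨d, G, H, hG, hH, fun h0 ↦ hHy (by rw [hz d H hH h0]; exact zero_mem _),
      hfr d G H hG hH hHy⟩
  · have h1 := hfr 1 l l hl hl (hη' hl0)
    have h2 := hΦ 1 l hl
    rw [← h2]
    have : frac η hl (hlpow 1) (hη' (pow_ne_zero 1 hl0)) = 1 := by
      apply HomogeneousLocalization.val_injective
      rw [val_frac, HomogeneousLocalization.val_one]
      simp only [pow_one]
      exact Localization.mk_self_mk l _
    rw [this, map_one]

end

section

/-! ### Homogeneous coordinates -/

instance (y : Plane) : (homIdeal y).IsPrime := ProjectiveSpectrum.isPrime _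

namespace IsCoordinateSystem

variable {a : Fin 3 → MvPolynomial (Fin 3) ℂ}

lemma span_eq (ha : IsCoordinateSystem a) :
    Submodule.span ℂ (Set.range a) = MvPolynomial.homogeneousSubmodule (Fin 3) ℂ 1 := by
  rw [MvPolynomial.homogeneousSubmodule_one_eq_span_X]
  have hfin : FiniteDimensional ℂ (Submodule.span ℂ (Set.range
    (MvPolynomial.X : Fin 3 → MvPolynomial (Fin 3) ℂ))) :=
    FiniteDimensional.span_of_finite ℂ (Set.finite_range _)
  apply Submodule.eq_of_le_of_finrank_eq
  · rw [← MvPolynomial.homogeneousSubmodule_one_eq_span_X, Submodule.span_le]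
    rintro _ ⟨i, rfl⟩
    exact ha.1 i
  · rw [finrank_span_eq_card ha.2, finrank_span_eq_card]
    exact MvPolynomial.linearIndependent_X (Fin 3) ℂ

lemma exists_algHom (ha : IsCoordinateSystem a) {S : Type} [CommRing S] [Algebra ℂ S]
    (b : Fin 3 → S) : ∃ f : MvPolynomial (Fin 3) ℂ →ₐ[ℂ] S, ∀ i, f (a i) = b i := by
  obtain ⟨g, hg⟩ := LinearMap.exists_extend ((Module.Basis.span ha.2).constr ℂ b)
  refine ⟨MvPolynomial.aeval fun i ↦ g (MvPolynomial.X i), fun i ↦ ?_⟩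
  have h1 : g (a i) = b i := by
    have h := LinearMap.congr_fun hg (Module.Basis.span ha.2 i)
    rw [Module.Basis.constr_basis, LinearMap.comp_apply, Submodule.subtype_apply,
      Module.Basis.span_apply] at h
    exact h
  rw [← h1]
  have h2 : a i ∈ Submodule.span ℂ (Set.range MvPolynomial.X) := by
    rw [← MvPolynomial.homogeneousSubmodule_one_eq_span_X]
    exact ha.1 i
  refine Submodule.span_induction ?_ ?_ ?_ ?_ h2
  · rintro _ ⟨j, rfl⟩
    rw [MvPolynomial.aeval_X]
  · simp
  · intro p q _ _ hp hq
    rw [map_add, map_add, hp, hq]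
  · intro c p _ hp
    rw [map_smul, map_smul, hp]

lemma eq_smul (ha : IsCoordinateSystem a) {S : Type} [CommRing S] [Algebra ℂ S]
    {f g : MvPolynomial (Fin 3) ℂ →ₐ[ℂ] S} {b : S} (hfg : ∀ i, f (a i) = b * g (a i))
    {G : MvPolynomial (Fin 3) ℂ} (hG : G.IsHomogeneous 1) : f G = b * g G := by
  have : G ∈ Submodule.span ℂ (Set.range a) := ha.span_eq ▸ hG
  refine Submodule.span_induction ?_ ?_ ?_ ?_ this
  · rintro _ ⟨j, rfl⟩
    exact hfg j
  · simp
  · intro p q _ _ hp hq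
    rw [map_add, map_add, hp, hq, mul_add]
  · intro c p _ hp
    rw [map_smul, map_smul, hp, mul_smul_comm]

lemma algHom_ext (ha : IsCoordinateSystem a) {S : Type} [CommRing S] [Algebra ℂ S]
    {f g : MvPolynomial (Fin 3) ℂ →ₐ[ℂ] S} (hfg : ∀ i, f (a i) = g (a i)) : f = g := by
  ext i
  have := ha.eq_smul (f := f) (g := g) (b := 1) (by simpa using hfg)
    (MvPolynomial.isHomogeneous_X ℂ i)
  simpa using this

/-- Homogeneity: scaling the values of the coordinates by `b` scales a form of degree `d` by
`b ^ d`. -/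
lemma eq_pow_mul (ha : IsCoordinateSystem a) {S : Type} [CommRing S] [Algebra ℂ S]
    {f g : MvPolynomial (Fin 3) ℂ →ₐ[ℂ] S} {b : S} (hfg : ∀ i, f (a i) = b * g (a i)) {d : ℕ}
    {G : MvPolynomial (Fin 3) ℂ} (hG : G.IsHomogeneous d) : f G = b ^ d * g G := by
  have h1 : ∀ i, f (MvPolynomial.X i) = b * g (MvPolynomial.X i) :=
    fun i ↦ ha.eq_smul hfg (MvPolynomial.isHomogeneous_X ℂ i)
  conv_lhs => rw [G.as_sum]
  conv_rhs => rw [G.as_sum]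
  rw [map_sum, map_sum, Finset.mul_sum]
  refine Finset.sum_congr rfl fun m hm ↦ ?_
  have hdeg : ∑ i ∈ m.support, m i = d :=
    (DFunLike.congr_fun (Finsupp.degree_eq_weight_one (R := ℕ)) m).trans
      (hG (MvPolynomial.mem_support_iff.mp hm))
  rw [MvPolynomial.monomial_eq, map_mul, map_mul, Finsupp.prod, map_prod, map_prod]
  simp only [map_pow, h1, mul_pow, Finset.prod_mul_distrib]
  rw [Finset.prod_pow_eq_pow_sum, hdeg]
  have : ∀ c : ℂ, f (MvPolynomial.C c) = g (MvPolynomial.C c) := fun c ↦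
    (f.commutes c).trans (g.commutes c).symm
  rw [this]
  ring

lemma perm (ha : IsCoordinateSystem a) (σ : Equiv.Perm (Fin 3)) : IsCoordinateSystem (a ∘ σ) :=
  ⟨fun _ ↦ ha.1 _, ha.2.comp _ σ.injective⟩

lemma ne_zero (ha : IsCoordinateSystem a) (i : Fin 3) : a i ≠ 0 := ha.2.ne_zero i

/-- Passing to the affine coordinates `a₀ / a₂` and `a₁ / a₂`. -/
def dehom (ha : IsCoordinateSystem a) : MvPolynomial (Fin 3) ℂ →ₐ[ℂ] A2 :=
  (ha.exists_algHom (S := A2) ![Polynomial.C Polynomial.X, Polynomial.X, 1]).choose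

@[simp] lemma dehom_zero (ha : IsCoordinateSystem a) :
    ha.dehom (a 0) = Polynomial.C Polynomial.X :=
  (ha.exists_algHom (S := A2) ![Polynomial.C Polynomial.X, Polynomial.X, 1]).choose_spec 0

@[simp] lemma dehom_one (ha : IsCoordinateSystem a) : ha.dehom (a 1) = Polynomial.X :=
  (ha.exists_algHom (S := A2) ![Polynomial.C Polynomial.X, Polynomial.X, 1]).choose_spec 1

@[simp] lemma dehom_two (ha : IsCoordinateSystem a) : ha.dehom (a 2) = 1 :=
  (ha.exists_algHom (S := A2) ![Polynomial.C Polynomial.X, Polynomial.X, 1]).choose_spec 2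

lemma ev_dehom (ha : IsCoordinateSystem a) {K : Type} [Field K] [Algebra ℂ K] {x y : K}
    {Ψ : MvPolynomial (Fin 3) ℂ →ₐ[ℂ] K} (h0 : Ψ (a 0) = x) (h1 : Ψ (a 1) = y) (h2 : Ψ (a 2) = 1)
    (G : MvPolynomial (Fin 3) ℂ) : ev x y (ha.dehom G) = Ψ G := by
  have : (Polynomial.aevalAeval x y : A2 →ₐ[ℂ] K).comp ha.dehom = Ψ := by
    apply ha.algHom_ext
    intro i
    fin_cases i
    · change ev x y (ha.dehom (a 0)) = Ψ (a 0)
      simp [h0]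
    · change ev x y (ha.dehom (a 1)) = Ψ (a 1)
      simp [h1]
    · change ev x y (ha.dehom (a 2)) = Ψ (a 2)
      simp [h2]
  exact DFunLike.congr_fun this G

/-- Every polynomial in two variables is the dehomogenization of forms of all large degrees. -/
lemma exists_hom (ha : IsCoordinateSystem a) (g : A2) : ∃ N : ℕ, ∀ d ≥ N,
    ∃ G : MvPolynomial (Fin 3) ℂ, G.IsHomogeneous d ∧ ha.dehom G = g := by
  induction g using Polynomial.induction_on' with
  | add p q hp hq =>
    obtain ⟨N, hN⟩ := hp
    obtain ⟨N', hN'⟩ := hq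
    refine ⟨max N N', fun d hd ↦ ?_⟩
    obtain ⟨G, hG, rfl⟩ := hN d (le_trans (le_max_left _ _) hd)
    obtain ⟨G', hG', rfl⟩ := hN' d (le_trans (le_max_right _ _) hd)
    exact ⟨G + G', hG.add hG', map_add _ _ _⟩
  | monomial n p =>
    induction p using Polynomial.induction_on' with
    | add p q hp hq =>
      obtain ⟨N, hN⟩ := hp
      obtain ⟨N', hN'⟩ := hq
      refine ⟨max N N', fun d hd ↦ ?_⟩
      obtain ⟨G, hG, h⟩ := hN d (le_trans (le_max_left _ _) hd)
      obtain ⟨G', hG', h'⟩ := hN' d (le_trans (le_max_right _ _) hd)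
      exact ⟨G + G', hG.add hG', by rw [map_add, h, h', map_add]⟩
    | monomial m c =>
      refine ⟨m + n, fun d hd ↦ ?_⟩
      obtain ⟨k, rfl⟩ := Nat.exists_eq_add_of_le hd
      refine ⟨MvPolynomial.C c * (a 0 ^ m * a 1 ^ n * a 2 ^ k), ?_, ?_⟩
      · have := (MvPolynomial.isHomogeneous_C (Fin 3) c).mul
          ((((ha.1 0).pow m).mul ((ha.1 1).pow n)).mul ((ha.1 2).pow k))
        simpa using this
      · have : ha.dehom (MvPolynomial.C c) = Polynomial.C (Polynomial.C c) := ha.dehom.commutes c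
        rw [map_mul, this]
        simp only [map_mul, map_pow, dehom_zero, dehom_one, dehom_two, one_pow, mul_one]
        rw [← Polynomial.C_mul_X_pow_eq_monomial, ← Polynomial.C_mul_X_pow_eq_monomial]
        simp only [map_mul, map_pow]
        ring

lemma dehom_injective (ha : IsCoordinateSystem a) {d : ℕ} {G : MvPolynomial (Fin 3) ℂ}
    (hG : G.IsHomogeneous d) (h : ha.dehom G = 0) : G = 0 := by
  -- `G (t * a) = t ^ d * G (a)` in the field of fractions of the polynomial ring, for `t = 1 / a₂`
  let F := FractionRing (MvPolynomial (Fin 3) ℂ)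
  have h20 : algebraMap (MvPolynomial (Fin 3) ℂ) F (a 2) ≠ 0 := by
    rw [Ne, map_eq_zero_iff _ (IsFractionRing.injective _ F)]
    exact ha.ne_zero 2
  obtain ⟨Ψ, hΨ⟩ := ha.exists_algHom fun i ↦
    (algebraMap (MvPolynomial (Fin 3) ℂ) F (a 2))⁻¹ * algebraMap (MvPolynomial (Fin 3) ℂ) F (a i)
  have h1 := ha.eq_pow_mul (f := Ψ) (g := IsScalarTower.toAlgHom ℂ (MvPolynomial (Fin 3) ℂ) F) hΨ hG
  have h2 := ha.ev_dehom (Ψ := Ψ) rfl rfl (by rw [hΨ, inv_mul_cancel₀ h20]) G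
  rw [h, map_zero, h1] at h2
  have h3 := (mul_eq_zero.mp h2.symm).resolve_left (pow_ne_zero _ (inv_ne_zero h20))
  exact (map_eq_zero_iff _ (IsFractionRing.injective _ F)).mp h3

end IsCoordinateSystem

variable {K : Type} [Field K] [Algebra ℂ K] {ψ : Spec (.of K) ⟶ Plane}
  {Φ : MvPolynomial (Fin 3) ℂ →ₐ[ℂ] K} {a : Fin 3 → MvPolynomial (Fin 3) ℂ}

namespace IsGenericEval

lemma isPlaneField (h : IsGenericEval ψ Φ) (ha : IsCoordinateSystem a) (h2 : Φ (a 2) = 1) :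
    IsPlaneField (Φ (a 0)) (Φ (a 1)) := by
  refine ⟨(injective_iff_map_eq_zero _).mpr fun g hg ↦ ?_, fun F hc h0 h1 ↦ ?_⟩
  · obtain ⟨N, hN⟩ := ha.exists_hom g
    obtain ⟨G, hG, rfl⟩ := hN N le_rfl
    rw [ha.ev_dehom rfl rfl h2] at hg
    rw [h.eq_zero _ G hG hg, map_zero]
  · rw [eq_top_iff]
    rintro z -
    obtain ⟨d, G, H, hG, hH, hH0, hz⟩ := h.exists_fraction z
    have hmem : ∀ G, Φ G ∈ F := fun G ↦ by
      rw [← ha.ev_dehom rfl rfl h2]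
      exact ev_mem (R := F.toSubring) (gens_subset_iff.mpr ⟨hc, h0, h1⟩) _
    rw [eq_div_of_mul_eq hH0 hz]
    exact F.div_mem (hmem _) (hmem _)

lemma ne_zero (h : IsGenericEval ψ Φ) {d : ℕ} {G : MvPolynomial (Fin 3) ℂ} (hG : G.IsHomogeneous d)
    (h0 : G ≠ 0) : Φ G ≠ 0 := fun h' ↦ h0 (h.eq_zero d G hG h')

variable {y : Plane} {R : Subring K}

lemma mem_iff (h : IsGenericEval ψ Φ) (hR : HasLocalRing ψ y R) {z : K} : z ∈ R ↔
    ∃ d G H, G.IsHomogeneous d ∧ H.IsHomogeneous d ∧ H ∉ homIdeal y ∧ z * Φ H = Φ G := by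
  obtain ⟨R', hR', hR''⟩ := h.exists_ring y
  obtain rfl := hR.unique hR''
  change z ∈ (R : Set K) ↔ _
  rw [hR']
  rfl

lemma div_mem (h : IsGenericEval ψ Φ) (hR : HasLocalRing ψ y R) {d : ℕ}
    {G H : MvPolynomial (Fin 3) ℂ} (hG : G.IsHomogeneous d) (hH : H.IsHomogeneous d)
    (hHy : H ∉ homIdeal y) : Φ G / Φ H ∈ R := by
  refine (h.mem_iff hR).mpr ⟨d, G, H, hG, hH, hHy, div_mul_cancel₀ _ (h.ne_zero hH ?_)⟩
  rintro rfl
  exact hHy (zero_mem _)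

lemma nonunit_iff (h : IsGenericEval ψ Φ) (hR : HasLocalRing ψ y R) {d : ℕ}
    {G H : MvPolynomial (Fin 3) ℂ} (hG : G.IsHomogeneous d) (hH : H.IsHomogeneous d)
    (hHy : H ∉ homIdeal y) : (Φ G / Φ H = 0 ∨ (Φ G / Φ H)⁻¹ ∉ R) ↔ G ∈ homIdeal y := by
  have hH0 : H ≠ 0 := by rintro rfl; exact hHy (zero_mem _)
  have hΦH := h.ne_zero hH hH0
  constructor
  · intro h'
    by_contra hGy
    have hG0 : G ≠ 0 := by rintro rfl; exact hGy (zero_mem _)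
    rcases h' with h' | h'
    · exact div_ne_zero (h.ne_zero hG hG0) hΦH h'
    · rw [inv_div] at h'
      exact h' (h.div_mem hR hH hG hGy)
  · intro hGy
    by_cases hG0 : G = 0
    · left; rw [hG0, map_zero, zero_div]
    right
    rw [inv_div, h.mem_iff hR]
    rintro ⟨e, G', H', hG', hH', hH'y, e1⟩
    have hΦG := h.ne_zero hG hG0
    have h1 : Φ (H * H' - G' * G) = 0 := by
      rw [map_sub, map_mul, map_mul, ← e1]
      field_simp
      ring
    have h2 := h.eq_zero (d + e) _ ((hH.mul hH').sub (by rw [add_comm]; exact hG'.mul hG)) h1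
    rw [sub_eq_zero] at h2
    have : H * H' ∈ homIdeal y := h2 ▸ Ideal.mul_mem_left _ _ hGy
    exact (Ideal.IsPrime.mem_or_mem inferInstance this).elim hHy hH'y

/-- The local ring at a point where the coordinate `a₂` does not vanish is a localization of the
ring of polynomials in `a₀ / a₂` and `a₁ / a₂`. -/
lemma essGen (h : IsGenericEval ψ Φ) (ha : IsCoordinateSystem a) (hy : a 2 ∉ homIdeal y)
    (hR : HasLocalRing ψ y R) :
    EssGen (gens (Φ (a 0) / Φ (a 2)) (Φ (a 1) / Φ (a 2))) R := by
  have h20 := h.ne_zero (ha.1 2) (ha.ne_zero 2)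
  obtain ⟨Ψ, hΨ⟩ := ha.exists_algHom fun i ↦ Φ (a i) / Φ (a 2)
  have h1 : ∀ {d G}, G.IsHomogeneous d → Φ G = Φ (a 2) ^ d * Ψ G := fun hG ↦
    ha.eq_pow_mul (fun i ↦ by rw [hΨ, mul_div_cancel₀ _ h20]) hG
  have h2 := ha.ev_dehom (hΨ 0) (hΨ 1) (by rw [hΨ, div_self h20])
  refine ⟨gens_subset_iff.mpr ⟨fun c ↦ ?_, h.div_mem hR (ha.1 0) (ha.1 2) hy,
    h.div_mem hR (ha.1 1) (ha.1 2) hy⟩, fun T hT hTR ↦ ?_⟩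
  · refine (h.mem_iff hR).mpr ⟨0, MvPolynomial.C c, 1, MvPolynomial.isHomogeneous_C _ c,
      MvPolynomial.isHomogeneous_one _ _, (Ideal.ne_top_iff_one _).mp Ideal.IsPrime.ne_top', ?_⟩
    rw [map_one, mul_one]
    exact (Φ.commutes c).symm
  · intro z hz
    obtain ⟨d, G, H, hG, hH, hHy, e⟩ := (h.mem_iff hR).mp hz
    have hH0 : H ≠ 0 := by rintro rfl; exact hHy (zero_mem _)
    have hΦH := h.ne_zero hH hH0
    have hΨH : Ψ H ≠ 0 := right_ne_zero_of_mul (h1 hH ▸ hΦH)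
    have hinv : (Ψ H)⁻¹ ∈ R := by
      have := h.div_mem hR (by simpa using (ha.1 2).pow d) hH hHy
      rwa [map_pow, h1 hH, div_mul_cancel_left₀ (pow_ne_zero d h20)] at this
    have hmem : ∀ G, Ψ G ∈ T := fun G ↦ h2 G ▸ ev_mem hT _
    have e' : z = Ψ G * (Ψ H)⁻¹ := by
      rw [h1 hG, h1 hH] at e
      rw [eq_mul_inv_iff_mul_eq₀ hΨH]
      apply mul_left_cancel₀ (pow_ne_zero d h20)
      rw [← e]; ring
    rw [e']
    exact T.mul_mem (hmem G) (hTR _ (hmem H) hinv)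

/-- The local ring at a point of the affine chart `a₂ ≠ 0`. -/
lemma eq_locAt (h : IsGenericEval ψ Φ) (ha : IsCoordinateSystem a) (h2 : Φ (a 2) = 1)
    (hy : a 2 ∉ homIdeal y) (hR : HasLocalRing ψ y R) (P : Ideal A2) [P.IsPrime]
    (hP : ∀ d G, G.IsHomogeneous d → (G ∈ homIdeal y ↔ ha.dehom G ∈ P)) :
    R = locAt (ev (Φ (a 0)) (Φ (a 1))) P := by
  have h1 := h.essGen ha hy hR
  rw [h2, div_one, div_one, essGen_gens_iff] at h1
  refine h1.eq_locAt fun g ↦ ?_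
  obtain ⟨N, hN⟩ := ha.exists_hom g
  obtain ⟨G, hG, rfl⟩ := hN N le_rfl
  rw [← hP N G hG, ha.ev_dehom rfl rfl h2]
  have := h.nonunit_iff hR hG (H := a 2 ^ N) (by simpa using (ha.1 2).pow N)
    (fun h ↦ hy (Ideal.IsPrime.mem_of_pow_mem inferInstance _ h))
  rw [map_pow, h2, one_pow, div_one] at this
  exact this.symm

end IsGenericEval

/-- The point of the plane given by a prime ideal of the coordinate ring of the affine chart
`a₂ ≠ 0`. -/
lemma exists_point (ha : IsCoordinateSystem a) (P : Ideal A2) [hP : P.IsPrime] :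
    ∃ y : Plane, a 2 ∉ homIdeal y ∧
      ∀ d G, G.IsHomogeneous d → (G ∈ homIdeal y ↔ ha.dehom G ∈ P) := by
  let J : HomogeneousIdeal planeGrading := (P.comap ha.dehom).homogeneousCore planeGrading
  have hmem : ∀ d G, G.IsHomogeneous d → (G ∈ J.toIdeal ↔ ha.dehom G ∈ P) := fun d G hG ↦
    ⟨fun h ↦ Ideal.toIdeal_homogeneousCore_le planeGrading (P.comap ha.dehom) h,
      fun h ↦ Ideal.mem_homogeneousCore_of_homogeneous_of_mem ⟨d, hG⟩ h⟩
  have h2 : a 2 ∉ J.toIdeal := by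
    rw [hmem 1 _ (ha.1 2), ha.dehom_two]
    exact (Ideal.ne_top_iff_one P).mp hP.ne_top'
  refine ⟨(⟨J, (Ideal.IsPrime.comap ha.dehom).homogeneousCore, fun hle ↦ h2 ?_⟩ :
    ProjectiveSpectrum planeGrading), h2, hmem⟩
  refine hle ?_
  rw [HomogeneousIdeal.mem_irrelevant_iff, GradedRing.proj_apply]
  exact (DirectSum.decompose_of_mem_ne planeGrading (ha.1 2) one_ne_zero)

end

section

/-! ### The tower of blow-ups -/

variable {K : Type} [Field K]

lemma EssGen.trans {s : Set K} {b : K} {A R : Subring K} (hA : EssGen s A) (hAR : A ≤ R)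
    (hR : EssGen (A ∪ {b}) R) : EssGen (s ∪ {b}) R := by
  refine ⟨Set.union_subset (hA.1.trans hAR) (Set.subset_union_right.trans hR.1),
    fun T hT hTR ↦ hR.2 T (Set.union_subset ?_ (Set.subset_union_right.trans hT)) hTR⟩
  exact hA.2 T (Set.subset_union_left.trans hT) fun x hx hxA ↦ hTR x hx (hAR hxA)

/-- The generic point is not the centre of a blow-up. -/
lemma apply_closedPt_ne {Z : Scheme.{0}} {ψ : Spec (.of K) ⟶ Z} {c p : Z} (hp : IsClosed {p})
    {Rc A : Subring K} (hc : HasLocalRing ψ c Rc) (hA : HasLocalRing ψ p A) (hne : Rc ≠ A) :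
    ψ (closedPt (.of K)) ≠ p := by
  intro h
  have h1 : p ⤳ c := h ▸ hc.specializes
  have h2 : c = p := by simpa using h1.mem_closed hp (Set.mem_singleton p)
  subst h2
  exact hne (hc.unique hA)

variable [Algebra ℂ K] {x y : K}

/-- The local ring of the centre of the `n`-th blow-up, with local coordinates `u` and `rₙ`. -/
abbrev towRing (x y : K) (n : ℕ) : Subring K := locAt (ev (x / y) (rr x y n)) originIdeal

lemma C_X_mem_originIdeal : (Polynomial.C Polynomial.X : A2) ∈ originIdeal :=
  (mem_originIdeal_iff _).mpr ⟨1, 0, by ring⟩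

lemma X_mem_originIdeal : (Polynomial.X : A2) ∈ originIdeal :=
  (mem_originIdeal_iff _).mpr ⟨0, 1, by ring⟩

section

variable {s t : K} (h : IsPlaneField s t)

lemma left_mem_locAt {P : Ideal A2} [P.IsPrime] : s ∈ locAt (ev s t) P := by
  simpa using apply_mem_locAt (α := ev s t) (P := P) (Polynomial.C Polynomial.X)

lemma right_mem_locAt {P : Ideal A2} [P.IsPrime] : t ∈ locAt (ev s t) P := by
  simpa using apply_mem_locAt (α := ev s t) (P := P) Polynomial.X

lemma algebraMap_mem_locAt {P : Ideal A2} [P.IsPrime] (c : ℂ) :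
    algebraMap ℂ K c ∈ locAt (ev s t) P := by
  simpa using apply_mem_locAt (α := ev s t) (P := P) (Polynomial.C (Polynomial.C c))

include h

lemma inv_left_mem_locAt_iff {P : Ideal A2} [P.IsPrime] :
    s⁻¹ ∈ locAt (ev s t) P ↔ (Polynomial.C Polynomial.X : A2) ∉ P := by
  simpa using inv_mem_locAt_iff (P := P) h.injective (a := Polynomial.C Polynomial.X) (by simp)

lemma inv_right_mem_locAt_iff {P : Ideal A2} [P.IsPrime] :
    t⁻¹ ∈ locAt (ev s t) P ↔ (Polynomial.X : A2) ∉ P := by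
  simpa using inv_mem_locAt_iff (P := P) h.injective (a := Polynomial.X) (by simp)

lemma inv_left_notMem_origin : s⁻¹ ∉ locAt (ev s t) originIdeal :=
  (inv_left_mem_locAt_iff h).not.mpr (not_not.mpr C_X_mem_originIdeal)

lemma inv_right_notMem_origin : t⁻¹ ∉ locAt (ev s t) originIdeal :=
  (inv_right_mem_locAt_iff h).not.mpr (not_not.mpr X_mem_originIdeal)

end

/-- The configuration in the projective plane: the local ring `Rc` of the curve `C`, and the centre
`p₀` of the first blow-up, with its local coordinates `u` and `r₀`. -/
structure IsPlaneSetup (ψ : Spec (.of K) ⟶ Plane) (c₀ p₀ : Plane) (x y : K) (Rc : Subring K) :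
    Prop where
  isPlaneField : IsPlaneField x y
  hasLocalRing : ∀ z : Plane, ∃ R, HasLocalRing ψ z R
  curve : HasLocalRing ψ c₀ Rc
  inv_left_mem : (x / y)⁻¹ ∈ Rc
  inv_right_notMem : (rr x y 0)⁻¹ ∉ Rc
  centre : HasLocalRing ψ p₀ (towRing x y 0)

/-- What is needed about the surfaces in the tower: the local rings of the strict transform of `C`
and of the next centre, and the comparison with the plane away from the first centre. -/
structure IsTowerModel (ψ : Spec (.of K) ⟶ Plane) {Y : Scheme.{0}} (ρ : Y ⟶ Plane)
    (ψ' : Spec (.of K) ⟶ Y) (p₀ : Plane) : Prop where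
  comp : ψ' ≫ ρ = ψ
  unique : ∀ ψ₁, ψ₁ ≫ ρ = ψ → ψ₁ = ψ'
  hasLocalRing : ∀ z : Y, ∃ R, HasLocalRing ψ' z R
  away : ∀ y ≠ p₀, ∀ R, HasLocalRing ψ y R →
    ∃ z : Y, ρ z = y ∧ HasLocalRing ψ' z R ∧ ∀ z', ρ z' = y → z' = z

variable {ψ : Spec (.of K) ⟶ Plane} {c₀ p₀ : Plane} {Rc : Subring K}

lemma IsPlaneSetup.ne_towRing (hs : IsPlaneSetup ψ c₀ p₀ x y Rc) (n : ℕ) : Rc ≠ towRing x y n :=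
  fun h ↦ inv_left_notMem_origin (hs.isPlaneField.rr n) (by
    have := hs.inv_left_mem
    rwa [h] at this)

/-- The local rings of the blow-up of a centre with local coordinates `u`, `rₙ`. -/
lemma IsTowerModel.blowUp {n : ℕ} {Y Y' : Scheme.{0}} {ρ : Y ⟶ Plane} {ψ' : Spec (.of K) ⟶ Y}
    (hs : IsPlaneField x y) (h : IsTowerModel ψ ρ ψ' p₀) {π : Y' ⟶ Y} {p : Y}
    (hπ : IsBlowUpAt π p) (hp : HasLocalRing ψ' p (towRing x y n)) (hpp : ρ p = p₀)
    (hne : ψ' (closedPt (.of K)) ≠ p) :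
    ∃ ψ'' : Spec (.of K) ⟶ Y', ψ'' ≫ π = ψ' ∧ IsTowerModel ψ (π ≫ ρ) ψ'' p₀ := by
  obtain ⟨ψ'', hψ'', -⟩ := hπ.2.2 _ ψ' (isInvertibleIdeal_comap_spec_field hπ.1 hne)
  refine ⟨ψ'', hψ'', by rw [reassoc_of% hψ'', h.comp], fun ψ₁ h₁ ↦ ?_, fun z ↦ ?_, fun y hy R hR ↦ ?_⟩
  · have h₂ : ψ₁ ≫ π = ψ' := h.unique _ (by rwa [Category.assoc])
    exact (hπ.hom_ext (by rw [hψ'']; exact isInvertibleIdeal_comap_spec_field hπ.1 hne)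
      (hψ''.trans h₂.symm)).symm
  · by_cases hz : π z = p
    · have hf := hs.rr n
      obtain ⟨R', hR', -⟩ := hπ.hasLocalRing_over hψ'' hne hp left_mem_locAt right_mem_locAt
        (inv_left_notMem_origin hf) (inv_right_notMem_origin hf)
        (fun z hz hz' ↦ exists_eq_of_nonunit hz hz' hf.injective) z hz
      exact ⟨R', hR'⟩
    · obtain ⟨R, hR⟩ := h.hasLocalRing (π z)
      obtain ⟨z', -, hz', hu⟩ := hπ.hasLocalRing_away hψ'' hne hz hR
      obtain rfl := hu z rfl
      exact ⟨R, hz'⟩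
  · obtain ⟨z, hz, hzR, hzu⟩ := h.away y hy R hR
    have hzp : z ≠ p := by
      rintro rfl
      exact hy (hz.symm.trans hpp)
    obtain ⟨z', hz', hzR', hzu'⟩ := hπ.hasLocalRing_away hψ'' hne hzp hzR
    refine ⟨z', by rw [Scheme.Hom.comp_apply, hz', hz], hzR', fun z'' hz'' ↦ hzu' z'' ?_⟩
    rw [Scheme.Hom.comp_apply] at hz''
    exact hzu _ hz''

/-- The local rings over a centre with local coordinates `u`, `rₙ`. -/
lemma hasLocalRing_over_centre {n : ℕ} {Y Y' : Scheme.{0}} {ψ' : Spec (.of K) ⟶ Y}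
    {ψ'' : Spec (.of K) ⟶ Y'} (hs : IsPlaneField x y) {π : Y' ⟶ Y} {p : Y}
    (hπ : IsBlowUpAt π p) (hψ : ψ'' ≫ π = ψ') (hp : HasLocalRing ψ' p (towRing x y n))
    (hne : ψ' (closedPt (.of K)) ≠ p) {z : Y'} (hz : π z = p) :
    ∃ R', HasLocalRing ψ'' z R' ∧ Dom (towRing x y n) R' ∧
      (EssGen (gens (x / y) (rr x y (n + 1))) R' ∨
        ((rr x y (n + 1))⁻¹ ∈ R' ∧ EssGen (gens (rr x y (n + 1))⁻¹ (rr x y n)) R')) := by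
  have hf := hs.rr n
  have hu := hs.infinity.ne_zero_left
  obtain ⟨R', hR', hdom, hR''⟩ := hπ.hasLocalRing_over hψ hne hp left_mem_locAt right_mem_locAt
    (inv_left_notMem_origin hf) (inv_right_notMem_origin hf)
    (fun z hz hz' ↦ exists_eq_of_nonunit hz hz' hf.injective) z hz
  refine ⟨R', hR', hdom, ?_⟩
  have hE := essGen_gens_iff.mpr (essGen_locAt hf.injective (P := originIdeal))
  have key : ∀ {a b : K}, a ∈ R' → b ∈ R' → gens a b ⊆ R' := fun ha hb ↦
    gens_subset_iff.mpr ⟨fun c ↦ hdom.1 (algebraMap_mem_locAt c), ha, hb⟩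
  rw [← rr_succ] at hR''
  rcases hR'' with ⟨hm, hE'⟩ | ⟨hm, hE'⟩
  · left
    refine (hE.trans hdom.1 hE').mono_closure ?_ (key (hdom.1 left_mem_locAt) hm)
    have h1 := Subring.subset_closure (s := gens (x / y) (rr x y (n + 1)))
    obtain ⟨hc, ha, hb⟩ := gens_subset_iff.mp h1
    refine Set.union_subset (gens_subset_iff.mpr ⟨hc, ha, ?_⟩) (Set.singleton_subset_iff.mpr hb)
    have : rr x y n = x / y * rr x y (n + 1) := by rw [rr_succ, mul_div_cancel₀ _ hu]
    rw [this]
    exact mul_mem ha hb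
  · have hinv : x / y / rr x y n = (rr x y (n + 1))⁻¹ := by rw [rr_succ, inv_div]
    rw [hinv] at hm hE'
    right
    refine ⟨hm, (hE.trans hdom.1 hE').mono_closure ?_ (key hm (hdom.1 right_mem_locAt))⟩
    have h1 := Subring.subset_closure (s := gens (rr x y (n + 1))⁻¹ (rr x y n))
    obtain ⟨hc, ha, hb⟩ := gens_subset_iff.mp h1
    refine Set.union_subset (gens_subset_iff.mpr ⟨hc, ?_, hb⟩) (Set.singleton_subset_iff.mpr ha)
    have : x / y = (rr x y (n + 1))⁻¹ * rr x y n := by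
      rw [← hinv, div_mul_cancel₀ _ hf.ne_zero_right]
    rw [this]
    exact mul_mem ha hb

/-- The strict transform of `C` keeps its local ring, and the centre of the `n`-th blow-up has the
local coordinates `u`, `rₙ`. -/
lemma IsTower.exists_model (hs : IsPlaneSetup ψ c₀ p₀ x y Rc) {n : ℕ} {Y : Scheme.{0}}
    {ρ : Y ⟶ Plane} {c p : Y} (h : IsTower c₀ p₀ n Y ρ c p) :
    ∃ ψ' : Spec (.of K) ⟶ Y, IsTowerModel ψ ρ ψ' p₀ ∧ HasLocalRing ψ' c Rc ∧
      HasLocalRing ψ' p (towRing x y n) ∧ ρ p = p₀ := by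
  induction h with
  | base =>
    refine ⟨ψ, ⟨Category.comp_id _, fun ψ₁ h₁ ↦ (Category.comp_id ψ₁).symm.trans h₁,
      hs.hasLocalRing, fun y _ R hR ↦ ⟨y, rfl, hR, fun _ h ↦ h⟩⟩,
      hs.curve, hs.centre, rfl⟩
  | @step n Y Y' ρ c p h π hπ c' p' hc hp hpc ih =>
    obtain ⟨ψ', hmodel, hcR, hpR, hpp⟩ := ih
    have hne := apply_closedPt_ne hπ.1 hcR hpR (hs.ne_towRing n)
    obtain ⟨ψ'', hψ, hmodel'⟩ := hmodel.blowUp hs.isPlaneField hπ hpR hpp hne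
    have hcp : c ≠ p := by
      rintro rfl
      exact hs.ne_towRing n (hcR.unique hpR)
    have hc' : HasLocalRing ψ'' c' Rc := by
      obtain ⟨z', -, hz', hu⟩ := hπ.hasLocalRing_away hψ hne hcp hcR
      rwa [hu c' hc]
    refine ⟨ψ'', hmodel', hc', ?_, by rw [Scheme.Hom.comp_apply, hp, hpp]⟩
    obtain ⟨R', hR', hdom, hE⟩ := hasLocalRing_over_centre hs.isPlaneField hπ hψ hpR hne hp
    have hle : R' ≤ Rc := hc'.le_of_specializes hR' (specializes_iff_mem_closure.mpr hpc)
    have hu := hs.isPlaneField.infinity.ne_zero_left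
    have hf := hs.isPlaneField.rr (n + 1)
    -- the function `rₙ₊₁` vanishes on the strict transform of `C`
    have hr : (rr x y (n + 1))⁻¹ ∉ Rc := by
      intro hm
      apply hs.inv_right_notMem
      have : (rr x y 0)⁻¹ = (rr x y (n + 1))⁻¹ * ((x / y)⁻¹) ^ (n + 1) := by
        have h1 : rr x y (n + 1) = rr x y 0 / (x / y) ^ (n + 1) := by
          rw [rr, rr, pow_zero, div_one]
        rw [h1, inv_div, inv_pow, div_mul_eq_mul_div, mul_inv_cancel₀ (pow_ne_zero _ hu), one_div]
      rw [this]
      exact mul_mem hm (pow_mem hs.inv_left_mem _)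
    rcases hE with hE | ⟨hm, -⟩
    swap
    · exact absurd (hle hm) hr
    have := hR'.isLocalRing
    have h1 : R' = towRing x y (n + 1) := by
      refine eq_locAt_origin hE (.inr fun hm ↦ ?_) (.inr fun hm ↦ hr (hle hm))
      exact inv_left_notMem_origin (hs.isPlaneField.rr n) (hdom.2 _ left_mem_locAt hm)
    exact h1 ▸ hR'

end

section

/-! ### Contractions that are isomorphisms at a point -/

lemma exists_affine_chart {F : Scheme.{0}} (p : F) : ∃ (S : CommRingCat.{0}) (j : Spec S ⟶ F)
    (_ : IsOpenImmersion j) (p' : Spec S), j p' = p := by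
  obtain ⟨R, f, hf, ⟨p', hp⟩, -⟩ :=
    Scheme.exists_affine_mem_range_and_range_subset (X := F) (x := p) (U := ⊤) trivial
  exact ⟨R, f, hf, p', hp⟩

lemma locallyOfFiniteType_fiberToSpecResidueField {Z Z' : Scheme.{0}} (f : Z' ⟶ Z)
    [LocallyOfFiniteType f] (y : Z) : LocallyOfFiniteType (f.fiberToSpecResidueField y) :=
  inferInstanceAs (LocallyOfFiniteType (Limits.pullback.snd f (Z.fromSpecResidueField y)))

/-- A closed point without proper generalizations in its fibre is isolated in its fibre. -/
lemma quasiFiniteAt_of_isClosed {Z Z' : Scheme.{0}} (f : Z' ⟶ Z) [LocallyOfFiniteType f] {ξ : Z'}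
    (hξ : IsClosed {ξ}) (h : ∀ ξ', ξ' ⤳ ξ → f ξ' = f ξ → ξ' = ξ) : f.QuasiFiniteAt ξ := by
  rw [Scheme.Hom.quasiFiniteAt_iff_isOpen_singleton_asFiber]
  obtain ⟨S, j, hj, p, hp⟩ := exists_affine_chart (f.asFiber ξ)
  have hft : LocallyOfFiniteType (f.fiberToSpecResidueField (f ξ)) :=
    locallyOfFiniteType_fiberToSpecResidueField f (f ξ)
  obtain ⟨φ, hφ⟩ := Spec.map_surjective (j ≫ f.fiberToSpecResidueField (f ξ))
  have hg : LocallyOfFiniteType (Spec.map φ) := by rw [hφ]; infer_instance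
  rw [HasRingHomProperty.Spec_iff (P := @LocallyOfFiniteType)] at hg
  algebraize [φ.hom]
  have : IsNoetherianRing S := Algebra.FiniteType.isNoetherianRing (Z.residueField (f ξ)) _
  have : IsJacobsonRing S := isJacobsonRing_of_finiteType (A := Z.residueField (f ξ))
  have hjp : f.fiberι _ (j p) = ξ := by rw [hp, Scheme.Hom.fiberι_asFiber]
  have hjι : ∀ p', f.fiberι _ (j p') = ξ → p' = p := fun p' hp' ↦
    j.injective ((f.fiberι _).isEmbedding.injective (hp'.trans hjp.symm))
  have hclosed : IsClosed ({p} : Set (Spec S)) := by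
    have : ({p} : Set (Spec S)) = (fun p' ↦ f.fiberι _ (j p')) ⁻¹' {ξ} :=
      Set.ext fun p' ↦ ⟨fun h ↦ (congrArg (fun p' ↦ f.fiberι _ (j p')) h).trans hjp, hjι p'⟩
    exact this ▸ hξ.preimage ((f.fiberι _).continuous.comp j.continuous)
  have hopen : IsOpen ({p} : Set (Spec S)) := by
    refine ((PrimeSpectrum.isOpen_singleton_tfae_of_isNoetherian_of_isJacobsonRing
      (R := S) p).out 0 2 rfl rfl).mpr ⟨hclosed, ?_⟩
    · rintro p' p₂ h₁₂ hp'
      obtain rfl : p' = p := hp'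
      refine hjι p₂ (h _ ?_ ?_)
      · have h3 : f.fiberι _ (j p₂) ⤳ f.fiberι _ (j p') :=
          (Specializes.map h₁₂ j.continuous).map (f.fiberι _).continuous
        exact h3.trans (specializes_of_eq hjp)
      · have : f.fiberι _ (j p₂) ∈ Set.range (f.fiberι (f ξ)) := ⟨_, rfl⟩
        rw [Scheme.Hom.range_fiberι] at this
        exact this
  have := j.isOpenEmbedding.isOpenMap _ hopen
  rwa [Set.image_singleton, hp] at this

variable {K : Type} [Field K]

lemma HasLocalRing.of_isIso_stalkMap {Z Z' : Scheme.{0}} (g : Z' ⟶ Z) {ψ' : Spec (.of K) ⟶ Z'}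
    {ξ : Z'} {R : Subring K} (h : HasLocalRing ψ' ξ R) (hg : IsIso (g.stalkMap ξ)) :
    HasLocalRing (ψ' ≫ g) (g ξ) R := by
  obtain ⟨φ, hφ, hφR, hφψ⟩ := h
  have hb : Function.Bijective (g.stalkMap ξ).hom := ConcreteCategory.bijective_of_isIso _
  refine ⟨g.stalkMap ξ ≫ φ, hφ.comp hb.1, ?_, ?_⟩
  · rw [← hφR]
    ext z
    constructor
    · rintro ⟨o, rfl⟩
      exact ⟨(g.stalkMap ξ).hom o, rfl⟩
    · rintro ⟨o, rfl⟩
      obtain ⟨o', rfl⟩ := hb.2 o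
      exact ⟨o', rfl⟩
  · rw [Spec.map_comp, Category.assoc, Scheme.SpecMap_stalkMap_fromSpecStalk, reassoc_of% hφψ]

lemma isIso_stalkMap_of_isOpenImmersion_comp {W Z Z' : Scheme.{0}} (ι : W ⟶ Z') (g : Z' ⟶ Z)
    [IsOpenImmersion ι] [IsOpenImmersion (ι ≫ g)] {ξ : Z'} (hξ : ξ ∈ Set.range ι) :
    IsIso (g.stalkMap ξ) := by
  obtain ⟨w, rfl⟩ := hξ
  have h1 := Scheme.Hom.stalkMap_comp ι g w
  have h2 : IsIso ((ι ≫ g).stalkMap w) := inferInstance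
  have h3 : IsIso (ι.stalkMap w) := inferInstance
  have h4 : g.stalkMap (ι w) = (ι ≫ g).stalkMap w ≫ inv (ι.stalkMap w) :=
    (IsIso.eq_comp_inv (ι.stalkMap w)).mpr h1.symm
  have h5 : IsIso ((ι ≫ g).stalkMap w ≫ inv (ι.stalkMap w)) := IsIso.comp_isIso' h2 inferInstance
  exact h4 ▸ h5

/-- An integral birational morphism onto a normal scheme is an isomorphism of local rings. -/
lemma eq_of_isIntegralHom {Z N : Scheme.{0}} (n : N ⟶ Z) [IsIntegralHom n] {ν : N}
    {ψ' : Spec (.of K) ⟶ N} {R R' : Subring K} (hR' : HasLocalRing ψ' ν R')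
    (hR : HasLocalRing (ψ' ≫ n) (n ν) R) (hint : ∀ z : K, IsIntegral R z → z ∈ R) : R' = R := by
  have hdom := HasLocalRing.map rfl hR' hR
  refine le_antisymm ?_ hdom.1
  obtain ⟨φ', hφ', hφR', hφψ'⟩ := id hR'
  obtain ⟨φ, hφ, hφR, hφψ⟩ := id hR
  obtain ⟨V, hV, hzV, -⟩ := exists_isAffineOpen_mem_and_subset (X := Z) (x := n ν) (U := ⊤) trivial
  have hW : IsAffineOpen (n ⁻¹ᵁ V) := hV.preimage n
  have hνW : ν ∈ n ⁻¹ᵁ V := hzV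
  have h1 : n.stalkMap ν ≫ φ' = φ := by
    apply Spec.map_injective
    rw [← cancel_mono (Z.fromSpecStalk (n ν)), hφψ, ← hφψ', Spec.map_comp, Category.assoc,
      Scheme.SpecMap_stalkMap_fromSpecStalk, Category.assoc]
  have hcomp : n.app V ≫ N.presheaf.germ _ ν hνW ≫ φ' = Z.presheaf.germ V (n ν) hzV ≫ φ := by
    rw [← h1, Scheme.Hom.germ_stalkMap_assoc]
  -- The sections over an affine neighbourhood are integral over `R`, hence lie in `R`; every
  -- element of the stalk is a quotient of two of them.
  have hA : ∀ s, φ'.hom ((N.presheaf.germ _ ν hνW).hom s) ∈ R := by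
    intro s
    apply hint
    obtain ⟨p, hp, hps⟩ := IsIntegralHom.isIntegral_app (f := n) V hV s
    let θ : Γ(Z, V) →+* R := (φ.hom.comp (Z.presheaf.germ V (n ν) hzV).hom).codRestrict R
      fun a ↦ hφR ▸ ⟨_, rfl⟩
    refine ⟨p.map θ, hp.map θ, ?_⟩
    rw [Polynomial.eval₂_map]
    have h2 : (algebraMap R K).comp θ =
        (φ'.hom.comp (N.presheaf.germ _ ν hνW).hom).comp (n.app V).hom :=
      (congrArg CommRingCat.Hom.hom hcomp).symm
    rw [h2]
    have h3 := Polynomial.hom_eval₂ p (n.app V).hom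
      (φ'.hom.comp (N.presheaf.germ _ ν hνW).hom) s
    rw [hps, map_zero] at h3
    exact h3.symm
  intro z hz
  rw [← hφR'] at hz
  obtain ⟨o, rfl⟩ := hz
  let _ := (N.presheaf.germ _ ν hνW).hom.toAlgebra
  let M := (hW.primeIdealOf ⟨ν, hνW⟩).asIdeal.primeCompl
  have hloc : IsLocalization M (N.presheaf.stalk ν) :=
    hW.isLocalization_stalk ⟨ν, hνW⟩
  obtain ⟨a, b, hab⟩ : ∃ a b : Γ(N, n ⁻¹ᵁ V), IsUnit ((N.presheaf.germ _ ν hνW).hom b) ∧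
      o * (N.presheaf.germ _ ν hνW).hom b = (N.presheaf.germ _ ν hνW).hom a := by
    obtain ⟨⟨a, b⟩, hab⟩ := IsLocalization.surj M o
    exact ⟨a, b, IsLocalization.map_units (N.presheaf.stalk ν) b, hab⟩
  have hb := (hab.1.map φ'.hom)
  have hb0 := hb.ne_zero
  have e := congrArg φ'.hom hab.2
  rw [map_mul] at e
  rw [(eq_mul_inv_iff_mul_eq₀ hb0).mpr e]
  refine mul_mem (hA a) (hdom.2 _ (hA b) ?_)
  obtain ⟨c, hc⟩ := hab.1.exists_right_inv
  rw [← hφR']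
  exact ⟨c, eq_inv_of_mul_eq_one_right (by rw [← map_mul, hc, map_one])⟩

/-- A form of Zariski's main theorem: a morphism that is isolated in its fibre at `ξ` and
birational onto a normal scheme is an isomorphism of local rings at `ξ`. -/
lemma eq_of_quasiFiniteAt {Z Z' : Scheme.{0}} (f : Z' ⟶ Z) [LocallyOfFiniteType f]
    [IsSeparated f] [QuasiCompact f] {ξ : Z'} (hξ : f.QuasiFiniteAt ξ) {ψ' : Spec (.of K) ⟶ Z'}
    {R R' : Subring K} (hR' : HasLocalRing ψ' ξ R')
    (hR : HasLocalRing (ψ' ≫ f) (f ξ) R) (hint : ∀ z : K, IsIntegral R z → z ∈ R) : R' = R := by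
  have h1 : IsIso (f.toNormalization.stalkMap ξ) :=
    isIso_stalkMap_of_isOpenImmersion_comp f.quasiFiniteLocus.ι f.toNormalization
      (by rw [Scheme.Opens.range_ι]; exact hξ)
  have h2 := hR'.of_isIso_stalkMap f.toNormalization h1
  refine eq_of_isIntegralHom f.fromNormalization h2 ?_ hint
  rw [Category.assoc, Scheme.Hom.toNormalization_fromNormalization, ← Scheme.Hom.comp_apply,
    Scheme.Hom.toNormalization_fromNormalization]
  exact hR

end

section

/-! ### The cuspidal cubic and its flex tangent in the plane -/

variable {a : Fin 3 → MvPolynomial (Fin 3) ℂ}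

lemma isHomogeneous_cubicForm (ha : IsCoordinateSystem a) (l : ℂ) :
    (cubicForm a l).IsHomogeneous 3 := by
  have h (i : Fin 3) (n : ℕ) : (a i ^ n).IsHomogeneous n := by
    simpa using (ha.1 i).pow n
  refine ((((ha.1 2).mul (h 1 2)).sub (h 0 3)).sub ?_)
  simpa using (MvPolynomial.isHomogeneous_C (Fin 3) l).mul (h 2 3)

lemma map_cubicForm {S : Type} [CommRing S] [Algebra ℂ S] (f : MvPolynomial (Fin 3) ℂ →ₐ[ℂ] S)
    (l : ℂ) : f (cubicForm a l) =
      f (a 2) * f (a 1) ^ 2 - f (a 0) ^ 3 - algebraMap ℂ S l * f (a 2) ^ 3 := by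
  rw [cubicForm, map_sub, map_sub, map_mul, map_mul, map_pow, map_pow, map_pow,
    ← MvPolynomial.algebraMap_eq, AlgHom.commutes]

lemma notMem_span_of_algHom {S : Type} [CommRing S] [Algebra ℂ S]
    (f : MvPolynomial (Fin 3) ℂ →ₐ[ℂ] S) {F G : MvPolynomial (Fin 3) ℂ} (hF : f F = 0)
    (hG : f G ≠ 0) : G ∉ Ideal.span {F} := by
  rw [Ideal.mem_span_singleton]
  rintro ⟨H, rfl⟩
  exact hG (by rw [map_mul, hF, zero_mul])

lemma IsCoordinateSystem.notMem_span_cubicForm (ha : IsCoordinateSystem a) (i : Fin 3) :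
    a i ∉ Ideal.span {cubicForm a 0} := by
  obtain ⟨f, hf⟩ := ha.exists_algHom (S := ℂ) fun _ ↦ 1
  exact notMem_span_of_algHom f (by rw [map_cubicForm]; simp [hf]) (by simp [hf])

lemma IsCoordinateSystem.notMem_span_two (ha : IsCoordinateSystem a) {i : Fin 3} (hi : i ≠ 2) :
    a i ∉ Ideal.span {a 2} := by
  obtain ⟨f, hf⟩ := ha.exists_algHom (S := ℂ) fun i ↦ if i = 2 then 0 else 1
  exact notMem_span_of_algHom f (by simp [hf]) (by simp [hf, hi])

/-- The coordinates in which the cuspidal cubic `F` has its standard equation and the flex `v` is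
the point `[0 : 1 : 0]`. -/
structure IsNormalForm (a : Fin 3 → MvPolynomial (Fin 3) ℂ) (F : MvPolynomial (Fin 3) ℂ)
    (v : Fin 3 → ℂ) : Prop where
  coord : IsCoordinateSystem a
  span_eq : Ideal.span {F} = Ideal.span {cubicForm a 0}
  eval_zero : MvPolynomial.eval v (a 0) = 0
  eval_one : MvPolynomial.eval v (a 1) ≠ 0
  eval_two : MvPolynomial.eval v (a 2) = 0
  tangent : Ideal.span {tangentLine F v} = Ideal.span {a 2}

variable {K : Type} [Field K] [Algebra ℂ K] {ψ : Spec (.of K) ⟶ Plane}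
  {Φ : MvPolynomial (Fin 3) ℂ →ₐ[ℂ] K} {F : MvPolynomial (Fin 3) ℂ} {v : Fin 3 → ℂ}

omit [Algebra ℂ K] in
lemma rr_zero (x y : K) : rr x y 0 = y⁻¹ - (x / y) ^ 3 := by rw [rr, pow_zero, div_one]

/-- The local ring of the plane at the flex. -/
lemma IsGenericEval.hasLocalRing_flex (h : IsGenericEval ψ Φ) (ha : IsNormalForm a F v)
    (h2 : Φ (a 2) = 1) {p₀ : Plane} (hp : IsPointWithCoords p₀ v) :
    HasLocalRing ψ p₀ (towRing (Φ (a 0)) (Φ (a 1)) 0) := by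
  obtain ⟨R, -, hR⟩ := h.exists_ring p₀
  have hy := h.ne_zero (ha.coord.1 1) (ha.coord.ne_zero 1)
  have := hR.isLocalRing
  have h1 : a 1 ∉ homIdeal p₀ := (hp 1 _ (ha.coord.1 1)).not.mpr ha.eval_one
  have h1' : a 1 ^ 3 ∉ homIdeal p₀ := fun h' ↦ h1 (Ideal.IsPrime.mem_of_pow_mem inferInstance _ h')
  have h0 : a 0 ∈ homIdeal p₀ := (hp 1 _ (ha.coord.1 0)).mpr ha.eval_zero
  have hc : cubicForm a 0 ∈ homIdeal p₀ := by
    refine (hp 3 _ (isHomogeneous_cubicForm ha.coord 0)).mpr ?_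
    simp [cubicForm, ha.eval_zero, ha.eval_two]
  have hcy : Φ (cubicForm a 0) / Φ (a 1 ^ 3) = rr (Φ (a 0)) (Φ (a 1)) 0 := by
    rw [map_cubicForm, h2, rr, map_pow]
    field_simp
    simp
  have hc3 := isHomogeneous_cubicForm ha.coord 0
  have ha3 : (a 1 ^ 3).IsHomogeneous 3 := by simpa using (ha.coord.1 1).pow 3
  have e1 := h.essGen (ha.coord.perm (Equiv.swap 1 2)) (y := p₀) (by simpa using h1) hR
  have e2 : EssGen (gens (Φ (a 0) / Φ (a 1)) (rr (Φ (a 0)) (Φ (a 1)) 0)) R := by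
    have e3 : (Equiv.swap (1 : Fin 3) 2) 0 = 0 := by decide
    simp only [Function.comp_apply, Equiv.swap_apply_left, Equiv.swap_apply_right, h2, e3] at e1
    have hg := gens_subset_iff.mp e1.1
    refine e1.mono_closure (gens_subset_iff.mpr ?_) (gens_subset_iff.mpr ⟨hg.1, hg.2.1, ?_⟩)
    · have hg' := gens_subset_iff.mp (Subring.subset_closure
        (s := gens (Φ (a 0) / Φ (a 1)) (rr (Φ (a 0)) (Φ (a 1)) 0)))
      refine ⟨hg'.1, hg'.2.1, ?_⟩
      have := add_mem hg'.2.2 (pow_mem hg'.2.1 3)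
      nth_rw 2 [rr_zero] at this
      rwa [sub_add_cancel, ← one_div] at this
    · rw [← hcy]
      exact h.div_mem hR hc3 ha3 h1'
  have e4 : R = towRing (Φ (a 0)) (Φ (a 1)) 0 :=
    eq_locAt_origin e2 ((h.nonunit_iff hR (ha.coord.1 0) (ha.coord.1 1) h1).mpr h0)
      (hcy ▸ (h.nonunit_iff hR hc3 ha3 h1').mpr hc)
  exact e4 ▸ hR

/-- The standard coordinates describe a plane setup for the tower of blow-ups. -/
lemma IsGenericEval.isPlaneSetup (h : IsGenericEval ψ Φ) (ha : IsNormalForm a F v)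
    (h2 : Φ (a 2) = 1) {c₀ p₀ : Plane} (hc : IsGenericPointOfCurve c₀ F)
    (hp : IsPointWithCoords p₀ v) : ∃ Rc, IsPlaneSetup ψ c₀ p₀ (Φ (a 0)) (Φ (a 1)) Rc := by
  obtain ⟨R, -, hR⟩ := h.exists_ring c₀
  have hy := h.ne_zero (ha.coord.1 1) (ha.coord.ne_zero 1)
  have hcy : Φ (cubicForm a 0) / Φ (a 1 ^ 3) = rr (Φ (a 0)) (Φ (a 1)) 0 := by
    rw [map_cubicForm, h2, rr, map_pow]
    field_simp
    simp
  have hI : homIdeal c₀ = Ideal.span {cubicForm a 0} := Eq.trans hc ha.span_eq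
  have h0 : a 0 ∉ homIdeal c₀ := hI ▸ ha.coord.notMem_span_cubicForm 0
  have h1 : a 1 ∉ homIdeal c₀ := hI ▸ ha.coord.notMem_span_cubicForm 1
  have h1' : a 1 ^ 3 ∉ homIdeal c₀ := fun h' ↦ h1 (Ideal.IsPrime.mem_of_pow_mem inferInstance _ h')
  have hc3 := isHomogeneous_cubicForm ha.coord 0
  have ha3 : (a 1 ^ 3).IsHomogeneous 3 := by simpa using (ha.coord.1 1).pow 3
  have hPF := h.isPlaneField ha.coord h2
  refine ⟨R, hPF, fun z ↦ ?_, hR, ?_, ?_, h.hasLocalRing_flex ha h2 hp⟩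
  · obtain ⟨R, -, hR⟩ := h.exists_ring z
    exact ⟨R, hR⟩
  · rw [inv_div]
    exact h.div_mem hR (ha.coord.1 1) (ha.coord.1 0) h0
  · have := (h.nonunit_iff hR hc3 ha3 h1').mpr (hI ▸ Ideal.mem_span_singleton_self _)
    rw [hcy] at this
    exact this.resolve_left (hPF.rr 0).ne_zero_right

/-- On the flex tangent, the coordinate `u` is invertible and `1 / y` vanishes. -/
lemma IsGenericEval.flexTangent (h : IsGenericEval ψ Φ) (ha : IsNormalForm a F v)
    (h2 : Φ (a 2) = 1) {l₀ : Plane} (hl : IsGenericPointOfCurve l₀ (tangentLine F v))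
    {R : Subring K} (hR : HasLocalRing ψ l₀ R) :
    (Φ (a 0) / Φ (a 1))⁻¹ ∈ R ∧ Φ (a 1) ∉ R := by
  have hI : homIdeal l₀ = Ideal.span {a 2} := Eq.trans hl ha.tangent
  have h0 : a 0 ∉ homIdeal l₀ := hI ▸ ha.coord.notMem_span_two (by decide)
  have h1 : a 1 ∉ homIdeal l₀ := hI ▸ ha.coord.notMem_span_two (by decide)
  refine ⟨by rw [inv_div]; exact h.div_mem hR (ha.coord.1 1) (ha.coord.1 0) h0, ?_⟩
  have := (h.nonunit_iff hR (ha.coord.1 2) (ha.coord.1 1) h1).mpr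
    (hI ▸ Ideal.mem_span_singleton_self _)
  rw [h2, one_div, inv_inv] at this
  exact this.resolve_left (inv_ne_zero (h.ne_zero (ha.coord.1 1) (ha.coord.ne_zero 1)))

lemma homIdeal_le {y : Plane} {J : Ideal (MvPolynomial (Fin 3) ℂ)}
    (h : ∀ d G, G.IsHomogeneous d → G ∈ homIdeal y → G ∈ J) : homIdeal y ≤ J := by
  have h1 := (show ProjectiveSpectrum planeGrading from y).asHomogeneousIdeal.isHomogeneous
  have h2 := h1.toIdeal_homogeneousCore_eq_self
  have h3 : (Ideal.homogeneousCore planeGrading (homIdeal y)).toIdeal ≤ J := by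
    change Ideal.homogeneousCore' planeGrading (homIdeal y) ≤ J
    rw [Ideal.homogeneousCore', Ideal.span_le]
    rintro _ ⟨⟨G, d, hG⟩, hGy, rfl⟩
    exact h d G hG hGy
  exact h2.ge.trans h3

lemma exists_homIdeal_eq_bot (ha : IsCoordinateSystem a) : ∃ η : Plane, homIdeal η = ⊥ := by
  obtain ⟨η, -, hη⟩ := exists_point ha ⊥
  refine ⟨η, eq_bot_iff.mpr (homIdeal_le fun d G hG h ↦ ?_)⟩
  exact ha.dehom_injective hG ((Submodule.mem_bot _).mp ((hη d _ hG).mp h))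

end

section

/-! ### The surfaces over the function field -/

variable {X : Scheme.{0}} {s : X ⟶ SpecC}

/-- The surfaces of a presentation of `S^c(E₈)` over a field `K` that is the function field of the
plane by means of the generic evaluation `Φ`. -/
structure IsSurfaceModel (S : Construction s) (a : Fin 3 → MvPolynomial (Fin 3) ℂ) {K : Type}
    [Field K] [Algebra ℂ K] (ψ : Spec (.of K) ⟶ Plane) (Φ : MvPolynomial (Fin 3) ℂ →ₐ[ℂ] K)
    (ψ₈ : Spec (.of K) ⟶ S.X₈) (ψ₉ : Spec (.of K) ⟶ S.X₉) : Prop where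
  normalForm : IsNormalForm a S.F S.v
  eval : IsGenericEval ψ Φ
  eval_two : Φ (a 2) = 1
  model₈ : IsTowerModel ψ S.ρ ψ₈ S.p₀
  centre : HasLocalRing ψ₈ S.p (towRing (Φ (a 0)) (Φ (a 1)) 7)
  ne_centre : ψ₈ (closedPt (.of K)) ≠ S.p
  comp : ψ₉ ≫ S.π = ψ₈
  model₉ : IsTowerModel ψ (S.π ≫ S.ρ) ψ₉ S.p₀

section

variable {K : Type} [Field K] [Algebra ℂ K]

lemma exists_isSurfaceModel (S : Construction s) {a : Fin 3 → MvPolynomial (Fin 3) ℂ}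
    (ha : IsNormalForm a S.F S.v) {ψ : Spec (.of K) ⟶ Plane} {η : Plane} (hη : homIdeal η = ⊥)
    (h : HasLocalRing ψ η ⊤)
    (hs : ψ ≫ planeStr = Spec.map (CommRingCat.ofHom (algebraMap ℂ K))) :
    ∃ Φ ψ₈ ψ₉, IsSurfaceModel S a ψ Φ ψ₈ ψ₉ := by
  obtain ⟨Φ, hΦ, h2⟩ := exists_isGenericEval hη h hs (ha.coord.1 2) (ha.coord.ne_zero 2)
  obtain ⟨Rc, hset⟩ := hΦ.isPlaneSetup ha h2 S.isGeneric_c₀ S.isPoint_p₀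
  obtain ⟨ψ₈, h8, hc, hp, hpp⟩ := S.tower.exists_model hset
  have hne := apply_closedPt_ne S.blowUp.1 hc hp (hset.ne_towRing 7)
  obtain ⟨ψ₉, h9, h9'⟩ := h8.blowUp hset.isPlaneField S.blowUp hp hpp hne
  exact ⟨Φ, ψ₈, ψ₉, ha, hΦ, h2, h8, hp, hne, h9, h9'⟩

end

lemma HasLocalRing.apply_closedPt {K : Type} [Field K] {Z : Scheme.{0}} {ψ : Spec (.of K) ⟶ Z}
    {z : Z} (h : HasLocalRing ψ z ⊤) : ψ (closedPt (.of K)) = z := by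
  obtain ⟨φ, hφ, hφr, rfl⟩ := h
  have hb : Function.Bijective φ.hom := ⟨hφ, RingHom.range_eq_top.mp hφr⟩
  have : IsLocalHom φ.hom := ⟨fun a ha ↦ by
    obtain ⟨b, hb'⟩ := ha.exists_right_inv
    obtain ⟨b, rfl⟩ := hb.2 b
    exact .of_mul_eq_one b (hφ (by rw [map_mul, hb', map_one]))⟩
  rw [Scheme.Hom.comp_apply]
  exact (congrArg _ (specMap_closedPt φ)).trans (fromSpecStalk_closedPt z)

lemma HasLocalRing.map_field {K K' : Type} [Field K] [Field K'] {Z : Scheme.{0}}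
    {ψ : Spec (.of K) ⟶ Z} {z : Z} {R : Subring K} (h : HasLocalRing ψ z R)
    (θ : CommRingCat.of K ⟶ .of K') : HasLocalRing (Spec.map θ ≫ ψ) z (R.map θ.hom) := by
  obtain ⟨φ, hφ, rfl, rfl⟩ := h
  refine ⟨φ ≫ θ, (RingHom.injective θ.hom).comp hφ, ?_, by rw [Spec.map_comp, Category.assoc]⟩
  rw [CommRingCat.hom_comp, RingHom.map_range]

lemma isField_stalk {η : Plane} (hη : homIdeal η = ⊥) : IsField (Plane.presheaf.stalk η) := by
  refine (MulEquiv.isField · (stalkEquiv η).toMulEquiv) ?_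
  refine ⟨⟨0, 1, zero_ne_one⟩, mul_comm, fun {z} hz ↦ ?_⟩
  obtain ⟨d, G, H, hG, hH, hHη, rfl⟩ := exists_frac η z
  have hG0 : G ∉ homIdeal η := by
    intro h
    rw [hη, Ideal.mem_bot] at h
    subst h
    apply hz
    apply HomogeneousLocalization.val_injective
    rw [val_frac, HomogeneousLocalization.val_zero, Localization.mk_zero]
  refine ⟨frac η hH hG hG0, HomogeneousLocalization.val_injective _ ?_⟩
  rw [HomogeneousLocalization.val_mul, val_frac, val_frac, HomogeneousLocalization.val_one,
    Localization.mk_mul, ← Localization.mk_one, Localization.mk_eq_mk_iff,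
    Localization.r_iff_exists]
  exact ⟨1, by simp; ring⟩

lemma hasLocalRing_fromSpecStalk_genericPoint [IsIntegral X] (z : X) :
    HasLocalRing (K := X.functionField) (X.fromSpecStalk (genericPoint X)) z
      (algebraMap (X.presheaf.stalk z) X.functionField).range :=
  ⟨X.presheaf.stalkSpecializes ((genericPoint_spec X).specializes trivial),
    IsFractionRing.injective (X.presheaf.stalk z) X.functionField, rfl,
    Scheme.SpecMap_stalkSpecializes_fromSpecStalk _⟩

lemma fromSpecStalk_comp_structure {z : X} :
    letI := stalkAlgebra s z
    X.fromSpecStalk z ≫ s =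
      Spec.map (CommRingCat.ofHom (algebraMap ℂ (X.presheaf.stalk z))) := by
  rw [← cancel_mono SpecC.toSpecΓ, Category.assoc, Scheme.toSpecΓ_naturality,
    Scheme.fromSpecStalk_toSpecΓ_assoc, ← SpecMap_ΓSpecIso_hom, ← Spec.map_comp,
    ← Spec.map_comp]
  congr 1
  refine (Iso.hom_inv_id_assoc (Scheme.ΓSpecIso (CommRingCat.of ℂ)) _).symm

/-- The function field of `X` is the function field of the plane. -/
lemma Construction.exists_model [IsIntegral X] (S : Construction s)
    {a : Fin 3 → MvPolynomial (Fin 3) ℂ} (ha : IsNormalForm a S.F S.v) :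
    letI := stalkAlgebra s (genericPoint X)
    ∃ (ψ : Spec (.of X.functionField) ⟶ Plane) (Φ : MvPolynomial (Fin 3) ℂ →ₐ[ℂ] X.functionField)
      (ψ₈ : _) (ψ₉ : _), IsSurfaceModel S a ψ Φ ψ₈ ψ₉ ∧
        ψ₉ ≫ S.q = X.fromSpecStalk (genericPoint X) := by
  let := stalkAlgebra s (genericPoint X)
  obtain ⟨η, hη⟩ := exists_homIdeal_eq_bot ha.coord
  -- the tower over the residue field at the generic point of the plane
  obtain ⟨K, _, _, ψ₀, hψ₀, hs₀⟩ : ∃ (K : Type) (_ : Field K) (_ : Algebra ℂ K)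
      (ψ₀ : Spec (.of K) ⟶ Plane), HasLocalRing ψ₀ η ⊤ ∧
        ψ₀ ≫ planeStr = Spec.map (CommRingCat.ofHom (algebraMap ℂ K)) := by
    let _ : Field (Plane.presheaf.stalk η) := (isField_stalk hη).toField
    obtain ⟨f, hf⟩ := Spec.map_surjective (Plane.fromSpecStalk η ≫ planeStr)
    refine ⟨Plane.presheaf.stalk η, inferInstance, f.hom.toAlgebra, Plane.fromSpecStalk η,
      ⟨𝟙 _, Function.injective_id, RingHom.range_eq_top.mpr Function.surjective_id, ?_⟩, hf.symm⟩
    rw [Spec.map_id]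
    exact Category.id_comp (Plane.fromSpecStalk η)
  obtain ⟨Φ₀, ψ₈₀, ψ₉₀, h₀⟩ := exists_isSurfaceModel S ha hη hψ₀ hs₀
  obtain ⟨z, hzη, hz, -⟩ := h₀.model₉.away η (by
    rintro rfl
    have h0 := (S.isPoint_p₀ 1 _ (ha.coord.1 0)).mpr ha.eval_zero
    exact ha.coord.ne_zero 0 ((Submodule.mem_bot _).mp (hη.le h0))) ⊤ hψ₀
  obtain ⟨U, hU, hiso⟩ := S.q_birational
  have hzg : ∀ z', z ⤳ z' := fun z' ↦ by
    obtain ⟨R', hR'⟩ := h₀.model₉.hasLocalRing z'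
    exact hz.apply_closedPt ▸ hR'.specializes
  have hgU : genericPoint X ∈ U :=
    ((genericPoint_spec X).mem_open_set_iff U.isOpen).mpr (by simpa using hU)
  have hqz : S.q z = genericPoint X := by
    obtain ⟨z', hz'⟩ := (S.q ∣_ U).surjective ⟨_, hgU⟩
    have h1 : S.q ((S.q ⁻¹ᵁ U).ι z') = genericPoint X := by
      rw [← Scheme.Hom.comp_apply, ← morphismRestrict_ι, Scheme.Hom.comp_apply, hz']
      rfl
    have h2 : S.q z ⤳ genericPoint X := h1 ▸ (hzg _).map S.q.continuous
    exact (h2.antisymm ((genericPoint_spec X).specializes trivial)).eq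
  have hq : IsIso (S.q.stalkMap z) := by
    have : IsOpenImmersion ((S.q ⁻¹ᵁ U).ι ≫ S.q) := by
      rw [← morphismRestrict_ι]
      infer_instance
    refine isIso_stalkMap_of_isOpenImmersion_comp (S.q ⁻¹ᵁ U).ι S.q ?_
    rw [Scheme.Opens.range_ι]
    exact show S.q z ∈ U from hqz ▸ hgU
  -- The contraction is birational, so this field is the function field of `X`; transport along the
  -- isomorphism.
  obtain ⟨φ, hφ, hφr, hφψ⟩ := hqz ▸ hz.of_isIso_stalkMap S.q hq
  have hiso : IsIso φ := (ConcreteCategory.isIso_iff_bijective φ).mpr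
    ⟨hφ, RingHom.range_eq_top.mp hφr⟩
  have hψX : Spec.map (inv φ) ≫ ψ₉₀ ≫ S.q = X.fromSpecStalk (genericPoint X) := by
    rw [← hφψ, ← Spec.map_comp_assoc, IsIso.hom_inv_id, Spec.map_id, Category.id_comp]
  have hψη : HasLocalRing (K := X.functionField) (Spec.map (inv φ) ≫ ψ₀) η ⊤ := by
    have := hψ₀.map_field (K' := X.functionField) (inv φ)
    have hsurj : Function.Surjective (inv φ).hom :=
      (ConcreteCategory.bijective_of_isIso (inv φ)).2
    rwa [← RingHom.range_eq_map, RingHom.range_eq_top.mpr hsurj] at this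
  obtain ⟨Φ, ψ₈, ψ₉, h⟩ := exists_isSurfaceModel S ha hη hψη (by
    rw [← h₀.model₉.comp, ← fromSpecStalk_comp_structure, ← hψX]
    simp only [Category.assoc, S.q_over])
  refine ⟨_, Φ, ψ₈, ψ₉, h, ?_⟩
  rw [← hψX, ← h.model₉.unique (Spec.map (inv φ) ≫ ψ₉₀) (by rw [Category.assoc, h₀.model₉.comp]),
    Category.assoc]

end

section

/-! ### Divisorial rings and generalizations -/

variable {K : Type} [Field K]

lemma isUnit_locAt {A : Type} [CommRing A] {α : A →+* K} {P : Ideal A} [P.IsPrime]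
    (hα : Function.Injective α) {z : K} {n d : A} (hn : n ∉ P)
    (hz : z * α d = α n) : z ≠ 0 ∧ z⁻¹ ∈ locAt α P := by
  have h0 : ∀ {a}, a ∉ P → α a ≠ 0 := fun ha h ↦ ha (hα (h.trans α.map_zero.symm) ▸ P.zero_mem)
  have hz0 : z ≠ 0 := left_ne_zero_of_mul (hz ▸ h0 hn)
  exact ⟨hz0, d, n, hn, by rw [← hz, inv_mul_cancel_left₀ hz0]⟩

lemma isLocalRing_locAt {A : Type} [CommRing A] {α : A →+* K} {P : Ideal A} [P.IsPrime]
    (hα : Function.Injective α) : IsLocalRing (locAt α P) := by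
  refine .of_isUnit_or_isUnit_one_sub_self fun ⟨z, hz⟩ ↦ ?_
  obtain ⟨n, d, hd, h⟩ := id hz
  rw [isUnit_subring_iff, isUnit_subring_iff]
  by_cases hn : n ∈ P
  · refine .inr (isUnit_locAt hα (n := d - n) (d := d) (fun h' ↦ hd ?_) ?_)
    · simpa using P.add_mem h' hn
    · change (1 - z) * α d = _
      rw [map_sub, ← h]; ring
  · exact .inl (isUnit_locAt hα hn h)

/-- The subring `R` of the field `K` is a discrete valuation ring with field of fractions `K`. -/
def IsDivisorial (R : Subring K) : Prop :=
  ∃ p ∈ R, p ≠ 0 ∧ p⁻¹ ∉ R ∧ ∀ w : K, w ≠ 0 → ∃ n : ℕ, ∃ e ∈ R, e⁻¹ ∈ R ∧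
    (w = e * p ^ n ∨ w⁻¹ = e * p ^ n)

namespace IsDivisorial

variable {R : Subring K}

lemma mem_or_inv_mem (h : IsDivisorial R) (w : K) : w ∈ R ∨ w⁻¹ ∈ R := by
  obtain ⟨p, hp, hp0, -, h⟩ := h
  by_cases hw : w = 0
  · exact .inl (hw ▸ zero_mem R)
  obtain ⟨n, e, he, -, h | h⟩ := h w hw
  · exact .inl (h ▸ mul_mem he (pow_mem hp n))
  · exact .inr (h ▸ mul_mem he (pow_mem hp n))

lemma ne_top (h : IsDivisorial R) : R ≠ ⊤ := by
  rintro rfl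
  obtain ⟨p, -, -, hp, -⟩ := h
  exact hp trivial

/-- A discrete valuation ring is a maximal proper subring. -/
lemma eq_of_le (h : IsDivisorial R) {S : Subring K} (hS : S ≠ ⊤) (hRS : R ≤ S) : R = S := by
  obtain ⟨p, hp, hp0, hpi, h⟩ := h
  refine le_antisymm hRS fun w hw ↦ ?_
  by_contra hwR
  have hw0 : w ≠ 0 := fun h ↦ hwR (h ▸ zero_mem R)
  obtain ⟨n, e, he, hei, h1 | h1⟩ := h w hw0
  · exact hwR (h1 ▸ mul_mem he (pow_mem hp n))
  · have he0 : e ≠ 0 := by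
      rintro rfl
      exact inv_ne_zero hw0 (by rw [h1, zero_mul])
    have hn : n ≠ 0 := by
      rintro rfl
      rw [pow_zero, mul_one] at h1
      exact hwR (by rw [← inv_inv w, h1]; exact hei)
    have hpS : p⁻¹ ∈ S := by
      have : p⁻¹ = w * (e * p ^ (n - 1)) := by
        rw [eq_comm, ← inv_inv w, h1, ← Nat.sub_one_add_one hn, pow_succ]
        field_simp
        rw [Nat.add_sub_cancel]
      rw [this]
      exact mul_mem hw (hRS (mul_mem he (pow_mem hp _)))
    refine hS (eq_top_iff.mpr fun z _ ↦ ?_)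
    by_cases hz : z = 0
    · exact hz ▸ zero_mem S
    obtain ⟨m, e', he', hei', h2 | h2⟩ := h z hz
    · exact h2 ▸ hRS (mul_mem he' (pow_mem hp m))
    · rw [← inv_inv z, h2, mul_inv, ← inv_pow]
      exact mul_mem (hRS hei') (pow_mem hpS m)

lemma eq_of_dom (h : IsDivisorial R) {S : Subring K} (hRS : Dom R S) : R = S := by
  refine le_antisymm hRS.1 fun w hw ↦ ?_
  rcases h.mem_or_inv_mem w with h' | h'
  · exact h'
  · rw [← inv_inv w]
    exact hRS.2 _ h' (by rwa [inv_inv])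

/-- A discrete valuation ring, as a subring of its field of fractions, is divisorial. -/
lemma of_isDiscreteValuationRing {O : Type} [CommRing O] [IsDomain O] [IsDiscreteValuationRing O]
    [Algebra O K] [IsFractionRing O K] : IsDivisorial (algebraMap O K).range := by
  obtain ⟨p, hp⟩ := IsDiscreteValuationRing.exists_irreducible O
  have hinj := IsFractionRing.injective O K
  have hinv : ∀ e : Oˣ, (algebraMap O K e)⁻¹ ∈ (algebraMap O K).range := fun e ↦
    ⟨(e⁻¹ : Oˣ), eq_inv_of_mul_eq_one_left (by rw [← map_mul, Units.inv_mul, map_one])⟩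
  have hp0 : algebraMap O K p ≠ 0 := (map_ne_zero_iff _ hinj).mpr hp.ne_zero
  refine ⟨algebraMap O K p, ⟨p, rfl⟩, hp0, ?_, fun w hw ↦ ?_⟩
  · rintro ⟨q, hq⟩
    refine hp.not_isUnit (.of_mul_eq_one q (hinj ?_))
    rw [map_mul, hq, mul_inv_cancel₀ hp0, map_one]
  · obtain ⟨a, b, hb, rfl⟩ := IsFractionRing.div_surjective (A := O) w
    have hb0 : b ≠ 0 := nonZeroDivisors.ne_zero hb
    have ha0 : a ≠ 0 := by rintro rfl; simp at hw
    obtain ⟨m, u, rfl⟩ := IsDiscreteValuationRing.eq_unit_mul_pow_irreducible ha0 hp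
    obtain ⟨n, v, rfl⟩ := IsDiscreteValuationRing.eq_unit_mul_pow_irreducible hb0 hp
    have hu0 : algebraMap O K u ≠ 0 := (map_ne_zero_iff _ hinj).mpr u.ne_zero
    have hv0 : algebraMap O K v ≠ 0 := (map_ne_zero_iff _ hinj).mpr v.ne_zero
    rcases le_total n m with hmn | hmn
    · refine ⟨m - n, algebraMap O K u * (algebraMap O K v)⁻¹, mul_mem ⟨_, rfl⟩ (hinv v), ?_,
        .inl ?_⟩
      · rw [mul_inv, inv_inv]
        exact mul_mem (hinv u) ⟨_, rfl⟩
      · rw [map_mul, map_mul, map_pow, map_pow, ← Nat.sub_add_cancel hmn, pow_add,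
          Nat.add_sub_cancel]
        field_simp
    · refine ⟨n - m, algebraMap O K v * (algebraMap O K u)⁻¹, mul_mem ⟨_, rfl⟩ (hinv u), ?_,
        .inr ?_⟩
      · rw [mul_inv, inv_inv]
        exact mul_mem (hinv v) ⟨_, rfl⟩
      · rw [map_mul, map_mul, map_pow, map_pow, ← Nat.sub_add_cancel hmn, pow_add,
          Nat.add_sub_cancel]
        field_simp

end IsDivisorial

/-- A localization of the local ring at a point is the local ring at a generalization. -/
lemma HasLocalRing.exists_generalization {Z : Scheme.{0}} {ψ : Spec (.of K) ⟶ Z} {z : Z}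
    {R S : Subring K} (h : HasLocalRing ψ z R) (hall : ∀ z, ∃ R, HasLocalRing ψ z R)
    [IsLocalRing S] (hRS : R ≤ S) {t : Set K} (hS : EssGen t S) (ht : t ⊆ R) :
    ∃ z', z' ⤳ z ∧ HasLocalRing ψ z' S := by
  have := h.isLocalRing
  obtain ⟨g, hg, rfl⟩ := h.exists_spec
  let j : Spec (.of S) ⟶ Z := Spec.map (CommRingCat.ofHom (Subring.inclusion hRS)) ≫ g
  have hj : Spec.map (CommRingCat.ofHom S.subtype) ≫ j = ψ := by
    rw [← hg, ← Spec.map_comp_assoc]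
    rfl
  have hsp : j (closedPt (.of S)) ⤳ g (closedPt (.of R)) := by
    rw [Scheme.Hom.comp_apply]
    exact Specializes.map (IsLocalRing.specializes_closedPoint (R := R) _) g.continuous
  obtain ⟨R', hR'⟩ := hall (j (closedPt (.of S)))
  have hdom := HasLocalRing.dom_of_comp j hj hR'
  have hle := hR'.le_of_specializes h hsp
  have : S = R' := le_antisymm (hS.le_of_dom (ht.trans hle) hdom le_rfl) hdom.1
  exact ⟨_, hsp, this ▸ hR'⟩

lemma EssGen.le_of_forall [Algebra ℂ K] {x y : K} {R T : Subring K} (h : EssGen (gens x y) R)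
    [IsLocalRing R] (hT : gens x y ⊆ T)
    (H : ∀ g : A2, ev x y g ≠ 0 → (ev x y g)⁻¹ ∈ R → (ev x y g)⁻¹ ∈ T) : R ≤ T := by
  have h1 := essGen_gens_iff.mp h
  rw [h1.eq_locAt (P := centre (ev x y) R h1.1) (mem_centre_iff R h1.1)]
  rintro z ⟨n, d, hd, hz⟩
  rw [mem_centre_iff] at hd
  push Not at hd
  rw [← eq_mul_inv_iff_mul_eq₀ hd.1] at hz
  exact hz ▸ mul_mem (ev_mem hT n) (H d hd.1 hd.2)

end

section

/-! ### The exceptional curve of the last blow-up -/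

lemma isClosed_singleton_iff_specializes {Z : Type} [TopologicalSpace Z] {z : Z} :
    IsClosed ({z} : Set Z) ↔ ∀ z', z ⤳ z' → z' = z := by
  rw [← closure_subset_iff_isClosed]
  exact forall_congr' fun z' ↦ by rw [← specializes_iff_mem_closure]; rfl

section

variable {K : Type} [Field K] [Algebra ℂ K] {x y : K}

lemma inv_aeval_inv_mem {T : Subring K} {r : K} (hr0 : r ≠ 0) (hr : r ∈ T)
    (H : ∀ p : Polynomial ℂ, p ≠ 0 → (Polynomial.aeval r p)⁻¹ ∈ T) {p : Polynomial ℂ}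
    (hp : p ≠ 0) : (Polynomial.aeval r⁻¹ p)⁻¹ ∈ T := by
  let _ : Invertible r⁻¹ := invertibleOfNonzero (inv_ne_zero hr0)
  have h1 := Polynomial.eval₂_reverse_mul_pow (algebraMap ℂ K) r⁻¹ p
  rw [invOf_eq_inv, inv_inv, ← Polynomial.aeval_def, ← Polynomial.aeval_def] at h1
  rw [← h1, mul_inv, ← inv_pow, inv_inv]
  exact mul_mem (H _ (Polynomial.reverse_eq_zero.not.mpr hp)) (pow_mem hr _)

omit [Algebra ℂ K] in
lemma rr_seven (hu : x / y ≠ 0) : rr x y 7 = x / y * rr x y 8 := by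
  rw [rr_succ x y 7, mul_div_cancel₀ _ hu]

/-- A local ring containing the local ring with coordinates `u`, `rₙ` dominates it as soon as both
coordinates are not invertible. -/
lemma dom_towRing (h : IsPlaneField x y) {n : ℕ} {R : Subring K} [IsLocalRing R]
    (hle : towRing x y n ≤ R) (hu : (x / y)⁻¹ ∉ R) (hr : (rr x y n)⁻¹ ∉ R) :
    Dom (towRing x y n) R := by
  refine ⟨hle, fun w hw hw' ↦ ?_⟩
  by_contra hcon
  obtain ⟨c, hc, d, hd, e⟩ := exists_eq_of_nonunit hw hcon (h.rr n).injective
  have := nonunit_add (mul_mem (hle left_mem_locAt) (hle hc))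
    (mul_mem (hle right_mem_locAt) (hle hd)) (nonunit_mul (hle hc) (.inr hu))
    (nonunit_mul (hle hd) (.inr hr))
  rw [← e] at this
  exact this.elim (fun h0 ↦ hcon (by rw [h0, inv_zero]; exact zero_mem _)) fun h' ↦ h' hw'

lemma dom_towRing_seven (h : IsPlaneField x y) : Dom (towRing x y 7) (towRing x y 8) := by
  have hu := h.infinity.ne_zero_left
  have h8 := isLocalRing_locAt (P := originIdeal) (h.rr 8).injective
  have h7 := isLocalRing_locAt (P := originIdeal) (h.rr 7).injective
  have hu' := inv_left_notMem_origin (h.rr 8)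
  have hr7 : rr x y 7 ∈ towRing x y 8 := by
    rw [rr_seven hu]
    exact mul_mem left_mem_locAt right_mem_locAt
  have hr : (rr x y 7)⁻¹ ∉ towRing x y 8 := by
    have := nonunit_mul (right_mem_locAt : rr x y 8 ∈ towRing x y 8) (.inr hu')
    rw [← rr_seven hu] at this
    exact this.resolve_left (h.rr 7).ne_zero_right
  have hg : gens (x / y) (rr x y 7) ⊆ towRing x y 8 :=
    gens_subset_iff.mpr ⟨algebraMap_mem_locAt, left_mem_locAt, hr7⟩
  refine dom_towRing h ?_ hu' hr
  refine (essGen_gens_iff.mpr (essGen_locAt (h.rr 7).injective)).le_of_forall hg fun g hg0 hg' ↦ ?_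
  rw [inv_mem_locAt_iff (h.rr 7).injective (by rintro rfl; simp at hg0),
    nonunit_ev hg (.inr hu') (.inr hr)] at hg'
  tauto

/-- The local rings over the last centre are contained in the ring of the exceptional curve. -/
lemma le_excRing (h : IsPlaneField x y) {R' : Subring K} [IsLocalRing R']
    (hdom : Dom (towRing x y 7) R') (hE : EssGen (gens (x / y) (rr x y 8)) R' ∨
        ((rr x y 8)⁻¹ ∈ R' ∧ EssGen (gens (rr x y 8)⁻¹ (rr x y 7)) R')) :
    R' ≤ excRing x y := by
  have hu : (x / y)⁻¹ ∉ R' := fun hu ↦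
    inv_left_notMem_origin (h.rr 7) (hdom.2 _ left_mem_locAt hu)
  have hu0 := h.infinity.ne_zero_left
  have hr7 : (rr x y 7)⁻¹ ∉ R' := fun hu ↦
    inv_right_notMem_origin (h.rr 7) (hdom.2 _ right_mem_locAt hu)
  have hexc := isLocalRing_locAt (P := Ideal.span {(Polynomial.C Polynomial.X : A2)}) (h.rr 8).injective
  -- A polynomial in the chart coordinates is a unit of the local ring only if its restriction to
  -- the exceptional curve is nonzero; then it is a unit of `excRing`.
  rcases hE with hE | ⟨hr, hE⟩
  · refine hE.le_of_forall (gens_subset_iff.mpr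
      ⟨algebraMap_mem_excRing, left_mem_excRing, rr_mem_excRing⟩) fun g hg0 hg ↦ ?_
    refine (inv_mem_locAt_iff (h.rr 8).injective (a := g) (by rintro rfl; simp at hg0)).mpr ?_
    rw [Ideal.mem_span_singleton]
    rintro ⟨q, rfl⟩
    rw [map_mul, ev_C, Polynomial.aeval_X] at hg hg0
    exact (nonunit_mul (ev_mem hE.1 q) (.inr hu)).elim hg0 (fun h' ↦ h' hg)
  · have hr8 : rr x y 8 ≠ 0 := (h.rr 8).ne_zero_right
    have hri : (rr x y 8)⁻¹ ∈ excRing x y := by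
      simpa using inv_aeval_rr_mem_excRing h (p := Polynomial.X) Polynomial.X_ne_zero
    have e7 : rr x y 7 = x / y * rr x y 8 := rr_seven hu0
    refine hE.le_of_forall (gens_subset_iff.mpr
      ⟨algebraMap_mem_excRing, hri, ?_⟩) fun g hg0 hg ↦ ?_
    · rw [e7]
      exact mul_mem left_mem_excRing rr_mem_excRing
    -- modulo `rr x y 7` the value of `g` is a polynomial in `1 / rr x y 8`
    have e : ev (rr x y 8)⁻¹ (rr x y 7) g = Polynomial.aeval (rr x y 8)⁻¹ (g.coeff 0) +
        rr x y 7 * ev (rr x y 8)⁻¹ (rr x y 7) g.divX := by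
      conv_lhs => rw [← Polynomial.divX_mul_X_add g, map_add, map_mul, ev_X, ev_C]
      ring
    have hc0 : g.coeff 0 ≠ 0 := by
      intro h0
      rw [h0, map_zero, zero_add] at e
      rw [e] at hg hg0
      exact (nonunit_mul (ev_mem hE.1 _) (.inr hr7)).elim hg0 (fun h' ↦ h' hg)
    have hun := inv_aeval_inv_mem hr8 rr_mem_excRing
      (fun p hp ↦ inv_aeval_rr_mem_excRing h hp) hc0
    have hmem : gens (rr x y 8)⁻¹ (rr x y 7) ⊆ excRing x y := gens_subset_iff.mpr
      ⟨algebraMap_mem_excRing, hri, e7 ▸ mul_mem left_mem_excRing rr_mem_excRing⟩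
    by_contra hcon
    have h7' : ∀ w ∈ excRing x y, rr x y 7 * w = 0 ∨ (rr x y 7 * w)⁻¹ ∉ excRing x y :=
      fun w hw ↦ by
        rw [e7, mul_assoc]
        exact nonunit_mul (mul_mem rr_mem_excRing hw) (.inr (inv_left_notMem_excRing h))
    have h7 := h7' _ (ev_mem hmem g.divX)
    have hneg : -(rr x y 7 * ev (rr x y 8)⁻¹ (rr x y 7) g.divX) = 0 ∨
        (-(rr x y 7 * ev (rr x y 8)⁻¹ (rr x y 7) g.divX))⁻¹ ∉ excRing x y := by
      rw [neg_eq_zero, inv_neg, neg_mem_iff]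
      exact h7
    have := nonunit_add (R := excRing x y) (ev_mem hmem g)
      (neg_mem (mul_mem (hmem (by simp [gens])) (ev_mem hmem g.divX))) (.inr hcon) hneg
    rw [e, add_neg_cancel_right] at this
    refine this.elim (fun h' ↦ ?_) (fun h' ↦ h' hun)
    rw [h', zero_add] at e
    rw [e] at hg hg0
    exact (nonunit_mul (ev_mem hE.1 _) (.inr hr7)).elim hg0 (fun h' ↦ h' hg)

end

variable {X : Scheme.{0}} {s : X ⟶ SpecC} {S : Construction s}
  {a : Fin 3 → MvPolynomial (Fin 3) ℂ} {K : Type} [Field K] [Algebra ℂ K]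
  {ψ : Spec (.of K) ⟶ Plane} {Φ : MvPolynomial (Fin 3) ℂ →ₐ[ℂ] K} {ψ₈ : Spec (.of K) ⟶ S.X₈}
  {ψ₉ : Spec (.of K) ⟶ S.X₉}

namespace IsSurfaceModel

lemma isPlaneField (h : IsSurfaceModel S a ψ Φ ψ₈ ψ₉) : IsPlaneField (Φ (a 0)) (Φ (a 1)) :=
  h.eval.isPlaneField h.normalForm.coord h.eval_two

lemma ne_flex (h : IsSurfaceModel S a ψ Φ ψ₈ ψ₉) : S.l₀ ≠ S.p₀ := by
  intro hlp
  have h0 : a 0 ∈ homIdeal S.p₀ :=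
    (S.isPoint_p₀ 1 _ (h.normalForm.coord.1 0)).mpr h.normalForm.eval_zero
  rw [← hlp] at h0
  exact h.normalForm.coord.notMem_span_two (i := 0) (by decide)
    ((S.isGeneric_l₀.trans h.normalForm.tangent).le h0)

lemma ring_le_excRing (h : IsSurfaceModel S a ψ Φ ψ₈ ψ₉) {z : S.X₉} (hz : S.π z = S.p)
    {R : Subring K} (hR : HasLocalRing ψ₉ z R) : R ≤ excRing (Φ (a 0)) (Φ (a 1)) := by
  obtain ⟨R', hR', hdom, hE⟩ := hasLocalRing_over_centre h.isPlaneField S.blowUp h.comp h.centre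
    h.ne_centre hz
  obtain rfl := hR.unique hR'
  have := hR.isLocalRing
  exact le_excRing h.isPlaneField hdom hE

/-- The point of the exceptional curve at which `u` and `r₈` vanish. -/
lemma exists_point_tower (h : IsSurfaceModel S a ψ Φ ψ₈ ψ₉) : ∃ z : S.X₉, S.π z = S.p ∧
    HasLocalRing ψ₉ z (towRing (Φ (a 0)) (Φ (a 1)) 8) := by
  set x := Φ (a 0)
  set y := Φ (a 1)
  have hf := h.isPlaneField
  have hu := hf.infinity.ne_zero_left
  have hloc : IsLocalRing (towRing x y 8) := isLocalRing_locAt (hf.rr 8).injective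
  have e7 : rr x y 7 = x / y * rr x y 8 := rr_seven hu
  obtain ⟨z, hz, R', hR', hd, hd', hm, hE⟩ := S.blowUp.exists_center h.comp h.ne_centre h.centre
    left_mem_locAt right_mem_locAt (inv_left_notMem_origin (hf.rr 7))
    (inv_right_notMem_origin (hf.rr 7)) (fun z hz hz' ↦ exists_eq_of_nonunit hz hz' (hf.rr 7).injective)
    (dom_towRing_seven hf) (by rw [← rr_succ]; exact right_mem_locAt)
  refine ⟨z, hz, ?_⟩
  rw [← rr_succ] at hm hE
  have : R' = towRing x y 8 := by
    refine le_antisymm hd.1 ((essGen_gens_iff.mpr (essGen_locAt (hf.rr 8).injective)).le_of_dom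
      (gens_subset_iff.mpr ⟨fun c ↦ hd'.1 (algebraMap_mem_locAt c), hd'.1 left_mem_locAt, hm⟩)
      hd le_rfl)
  exact this ▸ hR'

lemma isClosed_tower (h : IsSurfaceModel S a ψ Φ ψ₈ ψ₉) {z : S.X₉}
    (hR : HasLocalRing ψ₉ z (towRing (Φ (a 0)) (Φ (a 1)) 8)) (hz : S.π z = S.p) :
    IsClosed ({z} : Set S.X₉) := by
  have hf := h.isPlaneField
  rw [isClosed_singleton_iff_specializes]
  intro z' hzz'
  have hz' : S.π z' = S.p :=
    isClosed_singleton_iff_specializes.mp S.blowUp.1 _ (hz ▸ hzz'.map S.π.continuous)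
  obtain ⟨R', hR', -, hE⟩ := hasLocalRing_over_centre hf S.blowUp h.comp h.centre h.ne_centre hz'
  have hle := hR.le_of_specializes hR' hzz'
  have := hR'.isLocalRing
  rcases hE with hE | ⟨hr, -⟩
  · have : R' = towRing (Φ (a 0)) (Φ (a 1)) 8 := eq_locAt_origin hE
      (.inr fun h' ↦ inv_left_notMem_origin (hf.rr 8) (hle h'))
      (.inr fun h' ↦ inv_right_notMem_origin (hf.rr 8) (hle h'))
    exact (hR.eq_of_specializes_of_dom hR' hzz' (this ▸ Dom.refl _)).symm
  · exact absurd (hle hr) (inv_right_notMem_origin (hf.rr 8))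

/-- The fibre of the contraction through the point `u = r₈ = 0` is reduced to this point near it. -/
lemma eq_of_specializes_tower (h : IsSurfaceModel S a ψ Φ ψ₈ ψ₉) {z : S.X₉}
    (hR : HasLocalRing ψ₉ z (towRing (Φ (a 0)) (Φ (a 1)) 8)) (hz : S.π z = S.p) {ξ : S.X₉}
    (hξ : ξ ⤳ z) (hq : S.q ξ = S.q z) : ξ = z := by
  by_contra hne
  have hf := h.isPlaneField
  have hu := hf.infinity.ne_zero_left
  have hξc : ¬ IsClosed ({ξ} : Set S.X₉) := fun hc ↦
    hne (isClosed_singleton_iff_specializes.mp hc _ hξ).symm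
  have := S.q_proper
  have hqc : IsClosed ({S.q ξ} : Set X) := by
    rw [hq, ← Set.image_singleton]
    exact S.q.isClosedMap _ (h.isClosed_tower hR hz)
  obtain ⟨R, hRξ⟩ := h.model₉.hasLocalRing ξ
  have hle := hRξ.le_of_specializes hR hξ
  rcases (S.contracts ξ hξc).mp hqc with hl | ⟨hπ, hp⟩
  · -- near `z`, the strict transform of the flex tangent does not meet the exceptional curve
    obtain ⟨R', -, hR'⟩ := h.eval.exists_ring S.l₀
    have hlp := h.ne_flex
    obtain ⟨ξ', -, hξ', hu'⟩ := h.model₉.away _ hlp R' hR'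
    obtain rfl := hu' ξ (by rw [Scheme.Hom.comp_apply, hl])
    obtain rfl := hRξ.unique hξ'
    obtain ⟨h1, h2⟩ := h.eval.flexTangent h.normalForm h.eval_two S.isGeneric_l₀ hR'
    apply h2
    have e := inv_right_eq hf
    -- On the tangent line `1 / u` is regular, while `y = (1 / u)³ (1 + u⁵ r₈)⁻¹` is not; but
    -- `1 + u⁵ r₈` is a unit at the point.
    have e' : Φ (a 1) = ((Φ (a 0) / Φ (a 1))⁻¹) ^ 3 *
        (1 + (Φ (a 0) / Φ (a 1)) ^ 5 * rr (Φ (a 0)) (Φ (a 1)) 8)⁻¹ := by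
      rw [inv_pow, ← mul_inv, ← e, inv_inv]
    rw [e']
    refine mul_mem (pow_mem h1 3) (hle ?_)
    have hor : (1 + Polynomial.C Polynomial.X ^ 5 * Polynomial.X : A2) ∉ originIdeal := by
      intro h'
      have h' : Polynomial.evalEval 0 0 (1 + Polynomial.C Polynomial.X ^ 5 * Polynomial.X : A2) = 0 :=
        h'
      simp [Polynomial.evalEval] at h'
    have := (inv_mem_locAt_iff (hf.rr 8).injective (P := originIdeal)
      (by
        intro h'
        rw [h'] at hor
        exact hor (zero_mem _))).mpr hor
    simpa using this
  · have hπξ : S.π ξ ⤳ S.p := hz ▸ hξ.map S.π.continuous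
    obtain ⟨R₁, hR₁⟩ := h.model₈.hasLocalRing (S.π ξ)
    have hd₁ := hRξ.map h.comp hR₁
    have hle₁ := hR₁.le_of_specializes h.centre hπξ
    have hp₀ := h.eval.hasLocalRing_flex h.normalForm h.eval_two S.isPoint_p₀
    have hd₀ : Dom (towRing (Φ (a 0)) (Φ (a 1)) 0) R₁ := hR₁.map h.model₈.comp (hp ▸ hp₀)
    have hu1 : (Φ (a 0) / Φ (a 1))⁻¹ ∉ R₁ := fun h' ↦
      inv_left_notMem_origin (hf.rr 0) (hd₀.2 _ left_mem_locAt h')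
    have hu2 : (Φ (a 0) / Φ (a 1))⁻¹ ∉ R := fun h' ↦
      hu1 (hd₁.2 _ (hd₀.1 left_mem_locAt) h')
    have h7 : (rr (Φ (a 0)) (Φ (a 1)) 7)⁻¹ ∉ R₁ := by
      have e7 : rr (Φ (a 0)) (Φ (a 1)) 7 = Φ (a 0) / Φ (a 1) * rr (Φ (a 0)) (Φ (a 1)) 8 := rr_seven hu
      have := nonunit_mul (hle right_mem_locAt : rr (Φ (a 0)) (Φ (a 1)) 8 ∈ R) (.inr hu2)
      rw [← e7] at this
      exact fun h' ↦ this.elim (hf.rr 7).ne_zero_right fun h'' ↦ h'' (hd₁.1 h')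
    have := hR₁.isLocalRing
    have hdom := dom_towRing hf hle₁ hu1 h7
    have := hR₁.eq_of_specializes_of_dom h.centre hπξ hdom
    rw [this] at hπ
    exact hπ S.blowUp.1

end IsSurfaceModel

end

section

/-! ### The local rings of the contracted surface -/

/-- Every element of `ℂ[x, y]` is constant modulo a maximal ideal. -/
lemma exists_sub_C_mem (M : Ideal A2) [hM : M.IsMaximal] (g : A2) :
    ∃ c : ℂ, g - Polynomial.C (Polynomial.C c) ∈ M := by
  let _ := Ideal.Quotient.field M
  have h1 : Algebra.FiniteType ℂ (A2 ⧸ M) := inferInstance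
  have h2 : Module.Finite ℂ (A2 ⧸ M) := finite_of_finite_type_of_isJacobsonRing ℂ (A2 ⧸ M)
  obtain ⟨c, hc⟩ := (IsAlgClosed.algebraMap_bijective_of_isIntegral (k := ℂ) (K := A2 ⧸ M)).2
    (Ideal.Quotient.mk M g)
  refine ⟨c, Ideal.Quotient.eq.mp (hc.symm.trans rfl)⟩

lemma specializes_iff_homIdeal_le {y y' : Plane} : y ⤳ y' ↔ homIdeal y ≤ homIdeal y' := by
  rw [specializes_iff_mem_closure]
  exact (ProjectiveSpectrum.le_iff_mem_closure planeGrading y y').symm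

variable {a : Fin 3 → MvPolynomial (Fin 3) ℂ}

lemma isClosed_of_isMaximal (ha : IsCoordinateSystem a) {M : Ideal A2} [hM : M.IsMaximal] {y : Plane}
    (hy : ∀ d G, G.IsHomogeneous d → (G ∈ homIdeal y ↔ ha.dehom G ∈ M)) :
    IsClosed ({y} : Set Plane) := by
  rw [isClosed_singleton_iff_specializes]
  intro y' hyy'
  have hle := specializes_iff_homIdeal_le.mp hyy'
  have key : ∀ d G, G.IsHomogeneous d → ∃ c : ℂ, (ha.dehom G ∈ M ↔ c = 0) ∧
      G - MvPolynomial.C c * a 2 ^ d ∈ homIdeal y := by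
    intro d G hG
    -- `ℂ` is algebraically closed, so every function on the chart is constant modulo `M`.
    obtain ⟨c, hc⟩ := exists_sub_C_mem M (ha.dehom G)
    have h1 : (MvPolynomial.C c * a 2 ^ d).IsHomogeneous d := by
      simpa using (MvPolynomial.isHomogeneous_C (Fin 3) c).mul ((ha.1 2).pow d)
    refine ⟨c, ⟨fun h ↦ ?_, fun h ↦ by simpa [h] using hc⟩, (hy d _ (hG.sub h1)).mpr ?_⟩
    · by_contra hc0
      have h3 : (Polynomial.C (Polynomial.C c) : A2) ∈ M := by
        simpa using M.sub_mem h hc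
      refine hM.ne_top (Ideal.eq_top_of_isUnit_mem _ h3 ?_)
      exact ((isUnit_iff_ne_zero.mpr hc0).map Polynomial.C).map Polynomial.C
    · rw [map_sub, map_mul, map_pow, ha.dehom_two, one_pow, mul_one, ← MvPolynomial.algebraMap_eq,
        AlgHom.commutes]
      exact hc
  have h2' : a 2 ∉ homIdeal y' := by
    intro h2'
    -- otherwise all coordinates vanish at `y'`
    apply (show ProjectiveSpectrum planeGrading from y').not_irrelevant_le
    refine HomogeneousIdeal.toIdeal_irrelevant_le _ |>.mpr fun d hd G hG ↦ ?_
    obtain ⟨c, -, hc⟩ := key d G hG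
    have := (homIdeal y').add_mem (hle hc) ((homIdeal y').mul_mem_left (MvPolynomial.C c)
      (Ideal.pow_mem_of_mem _ h2' d hd))
    simpa using this
  have hge : homIdeal y' ≤ homIdeal y := by
    refine homIdeal_le fun d G hG hGy ↦ ?_
    obtain ⟨c, hc, hc'⟩ := key d G hG
    refine (hy d G hG).mpr (hc.mpr ?_)
    by_contra hc0
    have h3 : MvPolynomial.C c * a 2 ^ d ∈ homIdeal y' := by
      simpa using (homIdeal y').sub_mem hGy (hle hc')
    have h4 := (homIdeal y').mul_mem_left (MvPolynomial.C c⁻¹) h3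
    rw [← mul_assoc, ← MvPolynomial.C_mul, inv_mul_cancel₀ hc0, MvPolynomial.C_1, one_mul] at h4
    exact h2' (Ideal.IsPrime.mem_of_pow_mem inferInstance _ h4)
  exact ((specializes_iff_homIdeal_le.mpr hge).antisymm hyy').eq

variable {X : Scheme.{0}} {s : X ⟶ SpecC}

/-- The surfaces together with the local rings of the contracted surface, which is normal. -/
structure IsContractionModel (S : Construction s) (a : Fin 3 → MvPolynomial (Fin 3) ℂ) {K : Type}
    [Field K] [Algebra ℂ K] (ψ : Spec (.of K) ⟶ Plane) (Φ : MvPolynomial (Fin 3) ℂ →ₐ[ℂ] K)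
    (ψ₈ : Spec (.of K) ⟶ S.X₈) (ψ₉ : Spec (.of K) ⟶ S.X₉) : Prop
    extends IsSurfaceModel S a ψ Φ ψ₈ ψ₉ where
  exists_ring : ∀ z : X, ∃ R, HasLocalRing (ψ₉ ≫ S.q) z R
  integrallyClosed : ∀ (z : X) (R : Subring K), HasLocalRing (ψ₉ ≫ S.q) z R →
    ∀ w : K, _root_.IsIntegral R w → w ∈ R

variable {S : Construction s} {K : Type} [Field K] [Algebra ℂ K]
  {ψ : Spec (.of K) ⟶ Plane} {Φ : MvPolynomial (Fin 3) ℂ →ₐ[ℂ] K} {ψ₈ : Spec (.of K) ⟶ S.X₈}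
  {ψ₉ : Spec (.of K) ⟶ S.X₉}

namespace IsContractionModel

/-- The contraction is an isomorphism near a point that is isolated in its fibre. -/
lemma hasLocalRing_of_isolated (h : IsContractionModel S a ψ Φ ψ₈ ψ₉) {ξ : S.X₉}
    (hξ : IsClosed ({ξ} : Set S.X₉)) (hiso : ∀ ξ', ξ' ⤳ ξ → S.q ξ' = S.q ξ → ξ' = ξ)
    {R : Subring K} (hR : HasLocalRing ψ₉ ξ R) : HasLocalRing (ψ₉ ≫ S.q) (S.q ξ) R := by
  have := S.q_proper
  obtain ⟨R', hR'⟩ := h.exists_ring (S.q ξ)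
  have := eq_of_quasiFiniteAt S.q (quasiFiniteAt_of_isClosed S.q hξ hiso) hR hR'
    (h.integrallyClosed _ _ hR')
  exact this ▸ hR'

/-- The image of the last exceptional curve is a curve. -/
lemma exists_exceptional (h : IsContractionModel S a ψ Φ ψ₈ ψ₉) :
    ∃ z : X, HasLocalRing (ψ₉ ≫ S.q) z (excRing (Φ (a 0)) (Φ (a 1))) := by
  obtain ⟨ξ, hξ, hR⟩ := h.exists_point_tower
  have h1 := h.hasLocalRing_of_isolated (h.isClosed_tower hR hξ)
    (fun ξ' h' h'' ↦ h.eq_of_specializes_tower hR hξ h' h'') hR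
  have hf := h.isPlaneField.rr 8
  have := isLocalRing_locAt (P := Ideal.span {(Polynomial.C Polynomial.X : A2)}) hf.injective
  have hle : towRing (Φ (a 0)) (Φ (a 1)) 8 ≤ excRing (Φ (a 0)) (Φ (a 1)) := by
    rintro z ⟨n, d, hd, e⟩
    refine ⟨n, d, fun h' ↦ hd ?_, e⟩
    rw [Ideal.mem_span_singleton] at h'
    exact Ideal.mem_of_dvd _ h' C_X_mem_originIdeal
  obtain ⟨z, -, hz⟩ := h1.exists_generalization h.exists_ring hle (essGen_locAt hf.injective)
    (by rintro _ ⟨g, rfl⟩; exact apply_mem_locAt g)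
  exact ⟨z, hz⟩

lemma homIdeal_flex (h : IsContractionModel S a ψ Φ ψ₈ ψ₉) :
    a 2 ∈ homIdeal S.p₀ ∧ a 2 ∈ homIdeal S.l₀ :=
  ⟨(S.isPoint_p₀ 1 _ (h.normalForm.coord.1 2)).mpr h.normalForm.eval_two,
    (S.isGeneric_l₀.trans h.normalForm.tangent).ge (Ideal.mem_span_singleton_self _)⟩

/-- The local rings at the points of the affine plane are local rings of the surface. -/
lemma exists_maximal (h : IsContractionModel S a ψ Φ ψ₈ ψ₉) (M : Ideal A2) [hM : M.IsMaximal] :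
    ∃ ξ : S.X₉, HasLocalRing ψ₉ ξ (locAt (ev (Φ (a 0)) (Φ (a 1))) M) ∧
      HasLocalRing (ψ₉ ≫ S.q) (S.q ξ) (locAt (ev (Φ (a 0)) (Φ (a 1))) M) ∧
      IsClosed ({ξ} : Set S.X₉) := by
  have ha := h.normalForm.coord
  obtain ⟨y, h2, hy⟩ := exists_point ha M
  obtain ⟨R, -, hR⟩ := h.eval.exists_ring y
  have := h.eval.eq_locAt ha h.eval_two h2 hR M hy
  rw [this] at hR
  have hyp : y ≠ S.p₀ := by
    rintro rfl
    exact h2 h.homIdeal_flex.1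
  obtain ⟨ξ, hξy, hξ, hu⟩ := h.model₉.away y hyp _ hR
  have hclosed : IsClosed ({ξ} : Set S.X₉) := by
    have h1 : ({ξ} : Set S.X₉) = (S.π ≫ S.ρ) ⁻¹' {y} :=
      Set.ext fun ξ' ↦ ⟨fun h' ↦ (congrArg _ h').trans hξy, fun h' ↦ hu ξ' h'⟩
    rw [h1]
    exact (isClosed_of_isMaximal ha hy).preimage (S.π ≫ S.ρ).continuous
  refine ⟨ξ, hξ, h.hasLocalRing_of_isolated hclosed (fun ξ' hξ' hq ↦ ?_) hξ, hclosed⟩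
  by_contra hne
  have hξc : ¬ IsClosed ({ξ'} : Set S.X₉) := fun hc ↦
    hne (isClosed_singleton_iff_specializes.mp hc _ hξ').symm
  have := S.q_proper
  have hqc : IsClosed ({S.q ξ'} : Set X) := by
    rw [hq, ← Set.image_singleton]
    exact S.q.isClosedMap _ hclosed
  have hle := specializes_iff_homIdeal_le.mp (hξ'.map (S.π ≫ S.ρ).continuous)
  rw [hξy, Scheme.Hom.comp_apply] at hle
  rcases (S.contracts ξ' hξc).mp hqc with hl | ⟨-, hp⟩
  · exact h2 (hle (hl ▸ h.homIdeal_flex.2))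
  · exact h2 (hle (hp ▸ h.homIdeal_flex.1))

lemma exists_prime (h : IsContractionModel S a ψ Φ ψ₈ ψ₉) (P : Ideal A2) [hP : P.IsPrime] :
    ∃ z : X, HasLocalRing (ψ₉ ≫ S.q) z (locAt (ev (Φ (a 0)) (Φ (a 1))) P) := by
  obtain ⟨M, hM, hPM⟩ := P.exists_le_maximal hP.ne_top
  obtain ⟨ξ, -, hξ, -⟩ := h.exists_maximal M
  have hf := h.isPlaneField
  have := isLocalRing_locAt (P := P) hf.injective
  obtain ⟨z, -, hz⟩ := hξ.exists_generalization h.exists_ring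
    (S := locAt (ev (Φ (a 0)) (Φ (a 1))) P)
    (fun z ⟨n, d, hd, e⟩ ↦ ⟨n, d, fun h' ↦ hd (hPM h'), e⟩) (essGen_locAt hf.injective)
    (by rintro _ ⟨g, rfl⟩; exact apply_mem_locAt g)
  exact ⟨z, hz⟩

/-- A curve on the contracted surface is the strict transform of a curve in the affine plane or the
image of the last exceptional curve. -/
lemma classification (h : IsContractionModel S a ψ Φ ψ₈ ψ₉) {z : X}
    (hz : ¬ IsClosed ({z} : Set X)) {R : Subring K} (hR : HasLocalRing (ψ₉ ≫ S.q) z R)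
    (hdvr : IsDivisorial R) :
    (∃ g : A2, Prime g ∧ (∀ P : Ideal A2, ∀ [P.IsPrime], P = Ideal.span {g} →
        R = locAt (ev (Φ (a 0)) (Φ (a 1))) P) ∧
      ∃ ξ : S.X₉, S.q ξ = z ∧ HasLocalRing ψ (S.ρ (S.π ξ)) R ∧ a 2 ∉ homIdeal (S.ρ (S.π ξ))) ∨
      R = excRing (Φ (a 0)) (Φ (a 1)) := by
  have ha := h.normalForm.coord
  have hf := h.isPlaneField
  have := S.q_proper
  obtain ⟨ξ, rfl⟩ : z ∈ Set.range S.q :=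
    hR.specializes.mem_closed S.q.isClosedMap.isClosed_range
      ⟨ψ₉ (closedPt (.of K)), (Scheme.Hom.comp_apply _ _ _).symm⟩
  have hξc : ¬ IsClosed ({ξ} : Set S.X₉) := fun hc ↦ hz (by
    rw [← Set.image_singleton]
    exact S.q.isClosedMap _ hc)
  obtain ⟨R', hRξ⟩ := h.model₉.hasLocalRing ξ
  obtain rfl := hdvr.eq_of_dom (HasLocalRing.map rfl hRξ hR)
  have hcon := (S.contracts ξ hξc).not.mp hz
  push Not at hcon
  by_cases hp : S.ρ (S.π ξ) = S.p₀
  · right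
    -- The older exceptional curves are contracted, so `ξ` is the last one.
    have hπc : IsClosed ({S.π ξ} : Set S.X₈) := by
      by_contra hπc
      exact hcon.2 hπc hp
    have hπp : S.π ξ = S.p := by
      by_contra hne
      obtain ⟨R₁, hR₁⟩ := h.model₈.hasLocalRing (S.π ξ)
      obtain ⟨ξ', -, -, hu⟩ := S.blowUp.hasLocalRing_away h.comp h.ne_centre hne hR₁
      apply hξc
      have h1 : ({ξ} : Set S.X₉) = S.π ⁻¹' {S.π ξ} :=
        Set.ext fun ξ'' ↦ ⟨fun h' ↦ congrArg _ h', fun h' ↦ (hu ξ'' h').trans (hu ξ rfl).symm⟩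
      rw [h1]
      exact hπc.preimage S.π.continuous
    refine hdvr.eq_of_le ?_ (h.ring_le_excRing hπp hRξ)
    intro htop
    exact inv_left_notMem_excRing hf (htop ▸ Subring.mem_top _)
  · left
    obtain ⟨R₁, -, hR₁⟩ := h.eval.exists_ring (S.ρ (S.π ξ))
    obtain ⟨ξ', -, hξ', hu⟩ := h.model₉.away _ hp R₁ hR₁
    obtain rfl := hu ξ rfl
    obtain rfl := hRξ.unique hξ'
    -- The only curve outside of the affine chart is the flex tangent, which is contracted.
    have h2 : a 2 ∉ homIdeal (S.ρ (S.π ξ)) := by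
      intro h2
      have hsp : S.l₀ ⤳ S.ρ (S.π ξ) := specializes_iff_homIdeal_le.mpr (by
        rw [show homIdeal S.l₀ = _ from S.isGeneric_l₀.trans h.normalForm.tangent, Ideal.span_le]
        exact Set.singleton_subset_iff.mpr h2)
      obtain ⟨R₂, -, hR₂⟩ := h.eval.exists_ring S.l₀
      have hne : R₂ ≠ ⊤ := by
        rintro rfl
        exact (h.eval.flexTangent h.normalForm h.eval_two S.isGeneric_l₀ hR₂).2 trivial
      have e := hdvr.eq_of_le hne (hR₂.le_of_specializes hR₁ hsp)
      exact hcon.1 (hR₂.eq_of_specializes_of_dom hR₁ hsp (e ▸ Dom.refl _)).symm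
    have hE := h.eval.essGen ha h2 hR₁
    rw [h.eval_two, div_one, div_one, essGen_gens_iff] at hE
    have := hR₁.isLocalRing
    have hRP := hE.eq_locAt (mem_centre_iff _ hE.1)
    set P := centre (ev (Φ (a 0)) (Φ (a 1))) _ hE.1 with hP
    have hP0 : P ≠ ⊥ := by
      intro h0
      refine hdvr.ne_top (eq_top_iff.mpr fun w _ ↦ ?_)
      obtain ⟨n, d, hd, e⟩ := hf.exists_fraction w
      rw [hRP]
      exact ⟨n, d, fun h' ↦ hd ((Submodule.mem_bot _).mp (h0.le h')), e⟩
    obtain ⟨g, hgP, hg⟩ := Ideal.IsPrime.exists_mem_prime_of_ne_bot (I := P) inferInstance hP0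
    refine ⟨g, hg, fun Q _ hQ ↦ ?_, ξ, rfl, hR₁, h2⟩
    refine hdvr.eq_of_le ?_ ?_
    · intro htop
      have := (inv_mem_locAt_iff (P := Q) hf.injective hg.ne_zero).mp (htop ▸ Subring.mem_top _)
      exact this (hQ ▸ Ideal.mem_span_singleton_self g)
    · rw [hRP]
      rintro w ⟨n, d, hd, e⟩
      refine ⟨n, d, fun h' ↦ hd ?_, e⟩
      rw [hQ, Ideal.mem_span_singleton] at h'
      exact Ideal.mem_of_dvd _ h' hgP

end IsContractionModel

end

section

/-! ### Two-forms and local coordinates -/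

section Wedge

variable {K : Type} [Field K] [Algebra ℂ K]

/-- The two-form `dp ∧ dq`. -/
def wedge (p q : K) : ⋀[K]^2 (Ω[K⁄ℂ]) :=
  exteriorPower.ιMulti K 2 ![KaehlerDifferential.D ℂ K p, KaehlerDifferential.D ℂ K q]

/-- The wedge product of two one-forms. -/
def wedge₂ : Ω[K⁄ℂ] [⋀^Fin 2]→ₗ[K] ⋀[K]^2 (Ω[K⁄ℂ]) := exteriorPower.ιMulti K 2

lemma wedge_eq (p q : K) :
    wedge p q = wedge₂ ![KaehlerDifferential.D ℂ K p, KaehlerDifferential.D ℂ K q] := rfl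

lemma wedge₂_add_left (m m' n : Ω[K⁄ℂ]) : wedge₂ ![m + m', n] = wedge₂ ![m, n] + wedge₂ ![m', n] :=
  wedge₂.toMultilinearMap.cons_add ![n] m m'

lemma wedge₂_smul_left (c : K) (m n : Ω[K⁄ℂ]) : wedge₂ ![c • m, n] = c • wedge₂ ![m, n] :=
  wedge₂.toMultilinearMap.cons_smul ![n] c m

lemma wedge₂_self (m : Ω[K⁄ℂ]) : wedge₂ ![m, m] = 0 :=
  wedge₂.map_eq_zero_of_eq _ (i := 0) (j := 1) rfl (by decide)

lemma wedge₂_swap (m n : Ω[K⁄ℂ]) : wedge₂ ![m, n] = -wedge₂ ![n, m] := by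
  have := wedge₂.map_swap ![n, m] (i := 0) (j := 1) (by decide)
  rw [← this]
  congr 1
  ext i
  fin_cases i <;> rfl

lemma wedge₂_add_right (m n n' : Ω[K⁄ℂ]) :
    wedge₂ ![m, n + n'] = wedge₂ ![m, n] + wedge₂ ![m, n'] := by
  rw [wedge₂_swap, wedge₂_add_left, neg_add, ← wedge₂_swap, ← wedge₂_swap]

lemma wedge₂_smul_right (c : K) (m n : Ω[K⁄ℂ]) : wedge₂ ![m, c • n] = c • wedge₂ ![m, n] := by
  rw [wedge₂_swap, wedge₂_smul_left, wedge₂_swap n m, smul_neg, neg_neg]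

lemma wedge₂_comb (a b c d : K) (m n : Ω[K⁄ℂ]) :
    wedge₂ ![a • m + b • n, c • m + d • n] = (a * d - b * c) • wedge₂ ![m, n] := by
  rw [wedge₂_add_left, wedge₂_add_right, wedge₂_add_right]
  simp only [wedge₂_smul_left, wedge₂_smul_right, wedge₂_self, smul_zero, zero_add, add_zero]
  rw [wedge₂_swap n m, smul_neg, smul_neg, smul_smul, smul_smul, ← sub_eq_add_neg, ← sub_smul]
  congr 1
  ring

/-- The Jacobian determinant of the change of coordinates from `x`, `y` to `u`, `r₈`. -/
lemma wedge_eq_smul {x y : K} (h : IsPlaneField x y) :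
    wedge x y = (-(y ^ 3 * (x / y) ^ 8)) • wedge (x / y) (rr x y 8) := by
  have hy := h.ne_zero_right
  have hu := h.infinity.ne_zero_left
  set u := x / y with hu'
  set r := rr x y 8
  have hx : x = u * y := (div_mul_cancel₀ x hy).symm
  have hw : y * (u ^ 3 + u ^ 8 * r) = 1 := by
    have := inv_right_eq h
    rw [show u ^ 3 + u ^ 8 * r = y⁻¹ by rw [this]; ring, mul_inv_cancel₀ hy]
  clear_value u r
  let D := KaehlerDifferential.D ℂ K
  have hDx : D x = u • D y + y • D u := by
    conv_lhs => rw [hx]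
    exact D.leibniz u y
  have hDy : D y = (-(y ^ 2 * (3 * u ^ 2 + 8 * u ^ 7 * r))) • D u + (-(y ^ 2 * u ^ 8)) • D r := by
    have h1 := congrArg D hw
    rw [D.map_one_eq_zero, D.leibniz, map_add, D.leibniz, D.leibniz_pow, D.leibniz_pow] at h1
    have h2 : u ^ 3 + u ^ 8 * r = y⁻¹ := eq_inv_of_mul_eq_one_right hw
    rw [h2] at h1
    have h3 := congrArg (y • ·) h1
    simp only [smul_add, smul_smul, smul_zero, mul_inv_cancel₀ hy, one_smul] at h3
    rw [← sub_eq_zero, ← h3]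
    module
  rw [wedge_eq, wedge_eq]
  change wedge₂ ![D x, D y] = _ • wedge₂ ![D u, D r]
  have hDx' : D x = (u * (-(y ^ 2 * (3 * u ^ 2 + 8 * u ^ 7 * r))) + y) • D u +
      (u * (-(y ^ 2 * u ^ 8))) • D r := by
    rw [hDx, hDy]
    module
  rw [hDx', hDy, wedge₂_comb]
  congr 1
  ring

variable {O : Type} [CommRing O] [Algebra ℂ O] [Algebra O K] [IsScalarTower ℂ O K]

/-- The two-form of any two functions is a regular multiple of that of local coordinates. -/
lemma exists_wedge_eq_smul {a b : O}
    (h : Submodule.span O {KaehlerDifferential.D ℂ O a, KaehlerDifferential.D ℂ O b} = ⊤)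
    (a' b' : O) : ∃ c : O, wedge (algebraMap O K a') (algebraMap O K b') =
      algebraMap O K c • wedge (algebraMap O K a) (algebraMap O K b) := by
  have key : ∀ t : O, ∃ p q : O, KaehlerDifferential.D ℂ K (algebraMap O K t) =
      algebraMap O K p • KaehlerDifferential.D ℂ K (algebraMap O K a) +
        algebraMap O K q • KaehlerDifferential.D ℂ K (algebraMap O K b) := by
    intro t
    have ht : KaehlerDifferential.D ℂ O t ∈
      Submodule.span O {KaehlerDifferential.D ℂ O a, KaehlerDifferential.D ℂ O b} := h ▸ trivial
    obtain ⟨p, q, e⟩ := Submodule.mem_span_pair.mp ht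
    have := congrArg (KaehlerDifferential.map ℂ ℂ O K) e
    rw [map_add, map_smul, map_smul, KaehlerDifferential.map_D, KaehlerDifferential.map_D,
      KaehlerDifferential.map_D] at this
    exact ⟨p, q, by rw [← this, algebraMap_smul, algebraMap_smul]⟩
  obtain ⟨p, q, e⟩ := key a'
  obtain ⟨p', q', e'⟩ := key b'
  refine ⟨p * q' - q * p', ?_⟩
  rw [wedge_eq, e, e', wedge₂_comb, wedge_eq, map_sub, map_mul, map_mul]

/-- Any two expressions of a form in local coordinates differ by a unit. -/
lemma IsLocalExpression.exists_unit {ω : ⋀[K]^2 (Ω[K⁄ℂ])} {f f' : K}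
    (h : IsLocalExpression ℂ O K ω f) (h' : IsLocalExpression ℂ O K ω f') (hω : ω ≠ 0) :
    f ≠ 0 ∧ ∃ c ∈ (algebraMap O K).range, c⁻¹ ∈ (algebraMap O K).range ∧ f' = c * f := by
  obtain ⟨a, b, hab, e⟩ := h
  obtain ⟨a', b', hab', e'⟩ := h'
  change ω = f • wedge (algebraMap O K a) (algebraMap O K b) at e
  change ω = f' • wedge (algebraMap O K a') (algebraMap O K b') at e'
  have hf : f ≠ 0 := by rintro rfl; exact hω (by rw [e, zero_smul])
  have hf' : f' ≠ 0 := by rintro rfl; exact hω (by rw [e', zero_smul])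
  have hw : wedge (algebraMap O K a) (algebraMap O K b) ≠ 0 := by
    intro h0; exact hω (by rw [e, h0, smul_zero])
  have hw' : wedge (algebraMap O K a') (algebraMap O K b') ≠ 0 := by
    intro h0; exact hω (by rw [e', h0, smul_zero])
  obtain ⟨c, hc⟩ := exists_wedge_eq_smul (K := K) hab a' b'
  obtain ⟨c', hc'⟩ := exists_wedge_eq_smul (K := K) hab' a b
  have h1 : f = f' * algebraMap O K c := by
    rw [e, hc, smul_smul] at e'
    exact smul_left_injective K hw e'
  have h2 : f' = f * algebraMap O K c' := by
    have := e'.symm.trans e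
    rw [hc', smul_smul] at this
    exact smul_left_injective K hw' this
  refine ⟨hf, algebraMap O K c', ⟨c', rfl⟩, ⟨c, ?_⟩, by rw [h2, mul_comm]⟩
  apply eq_inv_of_mul_eq_one_left
  apply mul_left_cancel₀ hf'
  rw [mul_one, ← mul_assoc, ← h1, ← h2]

/-- Elements that generate a local ring essentially are local coordinates. -/
lemma span_D_eq_top {R : Subring K} {s t : O} (hinj : Function.Injective (algebraMap O K))
    (hR : (algebraMap O K).range = R)
    (hE : EssGen (gens (algebraMap O K s) (algebraMap O K t)) R) :
    Submodule.span O {KaehlerDifferential.D ℂ O s, KaehlerDifferential.D ℂ O t} = ⊤ := by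
  set N := Submodule.span O {KaehlerDifferential.D ℂ O s, KaehlerDifferential.D ℂ O t} with hN
  let T : Subring O :=
    { carrier := {o | KaehlerDifferential.D ℂ O o ∈ N}
      mul_mem' := fun {p q} hp hq ↦ by
        rw [Set.mem_ofPred_eq, Derivation.leibniz]
        exact N.add_mem (N.smul_mem _ hq) (N.smul_mem _ hp)
      one_mem' := by rw [Set.mem_ofPred_eq, Derivation.map_one_eq_zero]; exact N.zero_mem
      add_mem' := fun {p q} hp hq ↦ by rw [Set.mem_ofPred_eq, map_add]; exact N.add_mem hp hq
      zero_mem' := by rw [Set.mem_ofPred_eq, map_zero]; exact N.zero_mem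
      neg_mem' := fun {p} hp ↦ by rw [Set.mem_ofPred_eq, map_neg]; exact N.neg_mem hp }
  have hT : R ≤ T.map (algebraMap O K) := by
    refine hE.2 _ (gens_subset_iff.mpr ⟨fun c ↦ ⟨algebraMap ℂ O c, ?_, ?_⟩, ⟨s, ?_, rfl⟩,
      ⟨t, ?_, rfl⟩⟩) ?_
    · change KaehlerDifferential.D ℂ O (algebraMap ℂ O c) ∈ N
      rw [Derivation.map_algebraMap]
      exact N.zero_mem
    · exact (IsScalarTower.algebraMap_apply ℂ O K c).symm
    · exact Submodule.subset_span (by simp)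
    · exact Submodule.subset_span (by simp)
    · rintro _ ⟨o, ho, rfl⟩ hinv
      rw [← hR] at hinv
      obtain ⟨o', ho'⟩ := hinv
      by_cases h0 : algebraMap O K o = 0
      · rw [h0, inv_zero]; exact zero_mem _
      refine ⟨o', ?_, ho'⟩
      change KaehlerDifferential.D ℂ O o' ∈ N
      have hoo : o * o' = 1 := hinj (by rw [map_mul, ho', mul_inv_cancel₀ h0, map_one])
      have h1 := congrArg (fun z ↦ o' • KaehlerDifferential.D ℂ O z) hoo
      simp only [Derivation.leibniz, Derivation.map_one_eq_zero, smul_zero, smul_add, smul_smul]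
        at h1
      rw [mul_comm o' o, hoo, one_smul, add_eq_zero_iff_eq_neg] at h1
      rw [h1]
      exact N.neg_mem (N.smul_mem _ ho)
  rw [eq_top_iff, ← KaehlerDifferential.span_range_derivation, Submodule.span_le]
  rintro _ ⟨o, rfl⟩
  obtain ⟨o', ho', e⟩ := hT (hR ▸ ⟨o, rfl⟩ : algebraMap O K o ∈ R)
  exact hinj e ▸ ho'

end Wedge

end

section

/-! ### Points of codimension one -/

section

variable {X : Scheme.{0}} [IsIntegral X] [IsLocallyNoetherian X] {s : X ⟶ SpecC}

omit [IsLocallyNoetherian X] in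
lemma isScalarTower_stalk (z : X) :
    letI := stalkAlgebra s z
    letI := stalkAlgebra s (genericPoint X)
    IsScalarTower ℂ (X.presheaf.stalk z) X.functionField := by
  let := stalkAlgebra s z
  let := stalkAlgebra s (genericPoint X)
  refine IsScalarTower.of_algebraMap_eq fun c ↦ ?_
  exact (TopCat.Presheaf.germ_stalkSpecializes_apply (F := X.presheaf) (U := ⊤) _ _ _).symm

lemma isDiscreteValuationRing_stalk {z : X} (hz : Order.coheight z = 1)
    (hn : IsIntegrallyClosed (X.presheaf.stalk z)) :
    IsDiscreteValuationRing (X.presheaf.stalk z) := by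
  have h1 : Ring.KrullDimLE 1 (X.presheaf.stalk z) := krullDimLE_of_coheight_le hz.le
  have hf : ¬ IsField (X.presheaf.stalk z) := by
    intro hf
    have h2 := ringKrullDim_stalk_eq_coheight z
    rw [hz, ringKrullDim_eq_zero_of_isField hf] at h2
    exact absurd h2 (by decide)
  refine ((IsDiscreteValuationRing.TFAE _ hf).out 0 2).mpr ?_
  have : Ring.DimensionLEOne (X.presheaf.stalk z) := ⟨fun {p} hp hpr ↦
    (Ring.krullDimLE_one_iff_of_isPrime_bot.mp h1) p hp hpr⟩
  exact { }

/-- A point whose local ring is a valuation ring, and not a field, has codimension one. -/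
lemma coheight_eq_one {z : X} {R : Subring X.functionField}
    (hR : (algebraMap (X.presheaf.stalk z) X.functionField).range = R)
    (hval : ∀ w, w ∈ R ∨ w⁻¹ ∈ R) (hne : R ≠ ⊤) :
    Order.coheight z = 1 ∧ IsDiscreteValuationRing (X.presheaf.stalk z) := by
  subst hR
  have hinj := IsFractionRing.injective (X.presheaf.stalk z) X.functionField
  have hf : ¬ IsField (X.presheaf.stalk z) := by
    intro hf
    apply hne
    rw [RingHom.range_eq_top]
    let _ := hf.toField
    intro w
    obtain ⟨a, b, hb, rfl⟩ := IsFractionRing.div_surjective (A := X.presheaf.stalk z) w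
    have hb0 : b ≠ 0 := nonZeroDivisors.ne_zero hb
    obtain ⟨c, hc⟩ := hf.mul_inv_cancel hb0
    refine ⟨a * c, ?_⟩
    rw [eq_div_iff ((map_ne_zero_iff _ hinj).mpr hb0), ← map_mul, mul_assoc, mul_comm c, hc, mul_one]
  have hpre : PreValuationRing (X.presheaf.stalk z) := ⟨fun a b ↦ by
    by_cases hb : b = 0
    · exact ⟨0, .inl (by rw [hb, mul_zero])⟩
    by_cases ha : a = 0
    · exact ⟨0, .inr (by rw [ha, mul_zero])⟩
    have ha' := (map_ne_zero_iff _ hinj).mpr ha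
    have hb' := (map_ne_zero_iff _ hinj).mpr hb
    rcases hval (algebraMap _ X.functionField b / algebraMap _ X.functionField a) with ⟨c, hc⟩ | ⟨c, hc⟩
    · exact ⟨c, .inl (hinj (by rw [map_mul, hc, mul_div_cancel₀ _ ha']))⟩
    · exact ⟨c, .inr (hinj (by rw [map_mul, hc, inv_div, mul_div_cancel₀ _ hb']))⟩⟩
  have hv : ValuationRing (X.presheaf.stalk z) := { }
  have hd : IsDiscreteValuationRing (X.presheaf.stalk z) :=
    ((IsDiscreteValuationRing.TFAE _ hf).out 0 1).mpr hv
  refine ⟨?_, hd⟩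
  have h2 := ringKrullDim_stalk_eq_coheight z
  rw [IsDiscreteValuationRing.ringKrullDim_eq_one] at h2
  exact_mod_cast h2.symm

lemma exists_eq_mul_zpow_ord {z : X} (hz : Order.coheight z = 1)
    [IsDiscreteValuationRing (X.presheaf.stalk z)] {p : X.presheaf.stalk z} (hp : Irreducible p)
    {f : X.functionField} (hf : f ≠ 0) : ∃ e : (X.presheaf.stalk z)ˣ,
      f = algebraMap (X.presheaf.stalk z) X.functionField e *
        algebraMap (X.presheaf.stalk z) X.functionField p ^ Scheme.ord f z := by
  have hinj := IsFractionRing.injective (X.presheaf.stalk z) X.functionField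
  have hp0 : algebraMap (X.presheaf.stalk z) X.functionField p ≠ 0 :=
    (map_ne_zero_iff _ hinj).mpr hp.ne_zero
  obtain ⟨a, b, hb, e⟩ := IsFractionRing.div_surjective (A := X.presheaf.stalk z) f
  have hb0 : b ≠ 0 := nonZeroDivisors.ne_zero hb
  have ha0 : a ≠ 0 := by rintro rfl; simp at e; exact hf e.symm
  obtain ⟨m, u, rfl⟩ := IsDiscreteValuationRing.eq_unit_mul_pow_irreducible ha0 hp
  obtain ⟨n, v, rfl⟩ := IsDiscreteValuationRing.eq_unit_mul_pow_irreducible hb0 hp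
  have hv0 : algebraMap (X.presheaf.stalk z) X.functionField v ≠ 0 :=
    (map_ne_zero_iff _ hinj).mpr v.ne_zero
  have hvi : algebraMap (X.presheaf.stalk z) X.functionField (v⁻¹ : (X.presheaf.stalk z)ˣ) =
      (algebraMap (X.presheaf.stalk z) X.functionField v)⁻¹ :=
    eq_inv_of_mul_eq_one_left (by rw [← map_mul, Units.inv_mul, map_one])
  have key : f = algebraMap (X.presheaf.stalk z) X.functionField (u * v⁻¹ : (X.presheaf.stalk z)ˣ) *
        algebraMap (X.presheaf.stalk z) X.functionField p ^ ((m : ℤ) - n) := by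
    rw [← e, map_mul, map_mul, map_pow, map_pow, Units.val_mul, map_mul, hvi, zpow_sub₀ hp0,
      zpow_natCast, zpow_natCast]
    field_simp
  have hord : Scheme.ord f z = (m : ℤ) - n := by
    rw [Scheme.ord_eq_iff hz hf, key, map_mul, map_zpow₀]
    have : Ring.KrullDimLE 1 (X.presheaf.stalk z) := krullDimLE_of_coheight_le hz.le
    have h1 : Scheme.ordHom z hz (algebraMap (X.presheaf.stalk z) X.functionField
      (u * v⁻¹ : (X.presheaf.stalk z)ˣ)) = 1 := Ring.ordFrac_of_isUnit (Units.isUnit _)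
    have h2 : Scheme.ordHom z hz (algebraMap (X.presheaf.stalk z) X.functionField p) =
      WithZero.exp 1 := Ring.ordFrac_irreducible hp
    rw [h1, h2, one_mul, ← WithZero.exp_zsmul]
    simp [WithZero.exp]
  exact ⟨u * v⁻¹, hord ▸ key⟩

omit [IsLocallyNoetherian X] [IsIntegral X] in
/-- The residue field at a closed point is the field of complex numbers. -/
lemma exists_sub_mem_maximalIdeal [LocallyOfFiniteType s] {z : X} (hz : IsClosed ({z} : Set X)) :
    letI := stalkAlgebra s z
    ∀ o : X.presheaf.stalk z, ∃ c : ℂ, o - algebraMap ℂ (X.presheaf.stalk z) c ∈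
      IsLocalRing.maximalIdeal (X.presheaf.stalk z) := by
  let := stalkAlgebra s z
  intro o
  have h1 : (residueFieldIsoBase s z hz).inv =
      CommRingCat.ofHom (algebraMap ℂ (X.presheaf.stalk z)) ≫ X.residue z := by
    apply Spec.map_injective
    rw [SpecMap_residueFieldIsoBase_inv, Spec.map_comp, ← fromSpecStalk_comp_structure (s := s)]
    rfl
  have hb : Function.Surjective (residueFieldIsoBase s z hz).inv.hom :=
    (ConcreteCategory.bijective_of_isIso (residueFieldIsoBase s z hz).inv).2
  obtain ⟨c, hc⟩ := hb ((X.residue z).hom o)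
  refine ⟨c, (IsLocalRing.residue_eq_zero_iff _).mp ?_⟩
  change (X.residue z).hom (o - algebraMap ℂ (X.presheaf.stalk z) c) = 0
  rw [map_sub, sub_eq_zero, ← hc, h1]
  rfl

omit [IsLocallyNoetherian X] in
/-- At a closed point of codimension one there is only one local coordinate, so that there are no
nonzero two-forms. -/
lemma not_isLocalExpression_of_isClosed [LocallyOfFiniteType s] {z : X}
    (hz : IsClosed ({z} : Set X)) [IsDiscreteValuationRing (X.presheaf.stalk z)] :
    letI := stalkAlgebra s z
    letI := stalkAlgebra s (genericPoint X)
    ∀ (ω : ⋀[X.functionField]^2 (Ω[X.functionField⁄ℂ])) (f : X.functionField),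
      IsLocalExpression ℂ (X.presheaf.stalk z) X.functionField ω f → ω = 0 := by
  let := stalkAlgebra s z
  let := stalkAlgebra s (genericPoint X)
  have := isScalarTower_stalk (s := s) z
  rintro ω f ⟨a, b, hab, e⟩
  obtain ⟨p, hp⟩ := IsDiscreteValuationRing.exists_irreducible (X.presheaf.stalk z)
  have hres : ∀ o : X.presheaf.stalk z, ∃ (c : ℂ) (o' : X.presheaf.stalk z),
      o = algebraMap ℂ (X.presheaf.stalk z) c + p * o' := by
    intro o
    obtain ⟨c, h3⟩ := exists_sub_mem_maximalIdeal (s := s) hz o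
    rw [hp.maximalIdeal_eq, Ideal.mem_span_singleton] at h3
    obtain ⟨o', ho'⟩ := h3
    exact ⟨c, o', by rw [← ho', add_sub_cancel]⟩
  set N := Submodule.span (X.presheaf.stalk z) {KaehlerDifferential.D ℂ (X.presheaf.stalk z) p,
    KaehlerDifferential.D ℂ (X.presheaf.stalk z) p} with hN
  have hNtop : N = ⊤ := by
    rw [eq_top_iff]
    refine Submodule.le_of_le_smul_of_le_jacobson_bot (I := IsLocalRing.maximalIdeal (X.presheaf.stalk z))
      (Submodule.fg_def.mpr ⟨_, Set.toFinite _, hab⟩) (IsLocalRing.maximalIdeal_le_jacobson _) ?_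
    rw [← KaehlerDifferential.span_range_derivation, Submodule.span_le]
    rintro _ ⟨o, rfl⟩
    obtain ⟨c, o', rfl⟩ := hres o
    rw [map_add, Derivation.map_algebraMap, zero_add, Derivation.leibniz, add_comm]
    refine Submodule.add_mem_sup (N.smul_mem _ (Submodule.subset_span (by simp)))
      (Submodule.smul_mem_smul ?_ (Submodule.subset_span ⟨_, rfl⟩))
    rw [hp.maximalIdeal_eq]
    exact Ideal.mem_span_singleton_self p
  obtain ⟨c, hc⟩ := exists_wedge_eq_smul (K := X.functionField) hNtop a b
  change ω = f • wedge _ _ at e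
  rw [e, hc, wedge_eq, wedge₂_self, smul_zero, smul_zero]

end

end

section

/-! ### Anticanonical curves -/

variable {X : Scheme.{0}} [IsIntegral X] {s : X ⟶ SpecC}

/-- The function field of the surface as the function field of the plane, with all local rings. -/
lemma Construction.exists_contractionModel (S : Construction s)
    {a : Fin 3 → MvPolynomial (Fin 3) ℂ} (ha : IsNormalForm a S.F S.v) :
    letI := stalkAlgebra s (genericPoint X)
    ∃ (ψ : Spec (.of X.functionField) ⟶ Plane) (Φ : MvPolynomial (Fin 3) ℂ →ₐ[ℂ] X.functionField)
      (ψ₈ : _) (ψ₉ : _), IsContractionModel S a ψ Φ ψ₈ ψ₉ ∧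
        ψ₉ ≫ S.q = X.fromSpecStalk (genericPoint X) := by
  let := stalkAlgebra s (genericPoint X)
  obtain ⟨ψ, Φ, ψ₈, ψ₉, h, hX⟩ := S.exists_model ha
  refine ⟨ψ, Φ, ψ₈, ψ₉, ⟨h, fun z ↦ ⟨_, hX ▸ hasLocalRing_fromSpecStalk_genericPoint z⟩,
    fun z R hR w hw ↦ ?_⟩, hX⟩
  rw [hX] at hR
  obtain rfl := hR.unique (hasLocalRing_fromSpecStalk_genericPoint z)
  have hn := S.normal z
  have h1 : _root_.IsIntegral (X.presheaf.stalk z) w := by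
    obtain ⟨p, hp, hpw⟩ := hw
    have hinj := IsFractionRing.injective (X.presheaf.stalk z) X.functionField
    let e := RingEquiv.ofBijective (algebraMap (X.presheaf.stalk z) X.functionField).rangeRestrict
      ⟨fun p q hpq ↦ hinj (congrArg Subtype.val hpq), RingHom.rangeRestrict_surjective _⟩
    refine ⟨p.map e.symm.toRingHom, hp.map _, ?_⟩
    rw [Polynomial.eval₂_map, ← hpw]
    congr 1
    ext z
    obtain ⟨z, rfl⟩ := e.surjective z
    simp
    rfl
  exact (IsIntegrallyClosed.isIntegral_iff (K := X.functionField)).mp h1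

variable [IsLocallyNoetherian X] {S : Construction s} {a : Fin 3 → MvPolynomial (Fin 3) ℂ}

lemma mem_or_inv_mem_of_prime {K : Type} [Field K] [Algebra ℂ K] {x y : K} (h : IsPlaneField x y)
    {g : A2} (hg : Prime g) {P : Ideal A2} [P.IsPrime] (hP : P = Ideal.span {g}) :
    (∀ w, w ∈ locAt (ev x y) P ∨ w⁻¹ ∈ locAt (ev x y) P) ∧ locAt (ev x y) P ≠ ⊤ := by
  refine ⟨mem_or_inv_mem_locAt h.injective h.exists_fraction hP hg.ne_zero, fun h' ↦ ?_⟩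
  exact (inv_mem_locAt_iff h.injective hg.ne_zero).mp (h' ▸ Subring.mem_top (ev x y g)⁻¹)
    (hP ▸ Ideal.mem_span_singleton_self g)

lemma isPrime_span {g : A2} (hg : Prime g) : (Ideal.span {g}).IsPrime :=
  (Ideal.span_singleton_prime hg.ne_zero).mpr hg

omit [IsLocallyNoetherian X] in
/-- In local coordinates of the affine plane, or near the last exceptional curve, a two-form
`h • dx ∧ dy` is given by the following functions. -/
lemma isLocalExpression_of_essGen {z : X} :
    letI := stalkAlgebra s (genericPoint X)
    ∀ {R : Subring X.functionField} {p q : X.functionField},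
      (algebraMap (X.presheaf.stalk z) X.functionField).range = R → EssGen (gens p q) R →
      letI := stalkAlgebra s z
      ∀ f, IsLocalExpression ℂ (X.presheaf.stalk z) X.functionField (f • wedge p q) f := by
  let := stalkAlgebra s (genericPoint X)
  intro R p q hR hE
  let := stalkAlgebra s z
  have := isScalarTower_stalk (s := s) z
  intro f
  obtain ⟨-, hp, hq⟩ := gens_subset_iff.mp hE.1
  rw [← hR] at hp hq
  obtain ⟨p, rfl⟩ := hp
  obtain ⟨q, rfl⟩ := hq
  exact ⟨p, q, span_D_eq_top (IsFractionRing.injective _ _) hR hE, rfl⟩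

lemma prime_C_X : Prime (Polynomial.C Polynomial.X : A2) :=
  Polynomial.prime_C_iff.mpr Polynomial.prime_X

/-- A prime divisor in the anticanonical system is the image of the last exceptional curve or the
strict transform of a curve `α(y² - x³) + β = 0`: the equation of the curve has at most a simple
pole along the last exceptional curve, because `dx ∧ dy` has one. -/
lemma exists_of_anticanonical :
    letI := stalkAlgebra s (genericPoint X)
    ∀ {ψ : Spec (.of X.functionField) ⟶ Plane} {Φ : MvPolynomial (Fin 3) ℂ →ₐ[ℂ] X.functionField}
      {ψ₈ : _} {ψ₉ : _} (_ : IsContractionModel S a ψ Φ ψ₈ ψ₉)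
      (_ : ψ₉ ≫ S.q = X.fromSpecStalk (genericPoint X)) {D : AlgebraicCycle X ℤ}
      (_ : D ∈ anticanonicalSystem s) {z₀ : X}
      (_ : ∀ z, (z = z₀ → D z = 1) ∧ (z ≠ z₀ → D z = 0)),
    ∃ R, HasLocalRing (ψ₉ ≫ S.q) z₀ R ∧ IsDivisorial R ∧ ¬ IsClosed ({z₀} : Set X) ∧
      (R = excRing (Φ (a 0)) (Φ (a 1)) ∨ ∃ (α β : ℂ) (g : A2), α ≠ 0 ∧
        g = Polynomial.C (Polynomial.C α) * cuspPoly + Polynomial.C (Polynomial.C β) ∧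
        Prime g ∧ (∀ P : Ideal A2, ∀ [P.IsPrime], P = Ideal.span {g} →
          R = locAt (ev (Φ (a 0)) (Φ (a 1))) P) ∧
        ∃ ξ : S.X₉, S.q ξ = z₀ ∧ HasLocalRing ψ (S.ρ (S.π ξ)) R ∧
          a 2 ∉ homIdeal (S.ρ (S.π ξ))) := by
  let := stalkAlgebra s (genericPoint X)
  intro ψ Φ ψ₈ ψ₉ h hX D hDs z₀ hD
  obtain ⟨-, hDne, ω, hω, hexp⟩ := hDs
  have hf := h.isPlaneField
  set x := Φ (a 0)
  set y := Φ (a 1)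
  have := S.proper
  have hr : ∀ {z R}, HasLocalRing (ψ₉ ≫ S.q) z R →
      (algebraMap (X.presheaf.stalk z) X.functionField).range = R := fun {z R} hR ↦ by
    rw [hX] at hR
    exact (hasLocalRing_fromSpecStalk_genericPoint z).unique hR
  -- the form is `H • dx ∧ dy`
  obtain ⟨H, hH⟩ : ∃ H : X.functionField, ω = H • wedge x y := by
    have := isPrime_span prime_C_X
    obtain ⟨z, hz⟩ := h.exists_prime (Ideal.span {(Polynomial.C Polynomial.X : A2)})
    obtain ⟨hval, hne⟩ := mem_or_inv_mem_of_prime hf prime_C_X rfl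
    obtain ⟨hc, -⟩ := coheight_eq_one (hr hz) hval hne
    let := stalkAlgebra s z
    have := isScalarTower_stalk (s := s) z
    obtain ⟨f, ⟨b, b', hb, e⟩, -⟩ := hexp z hc
    have hE : EssGen (gens x y) (locAt (ev x y) (Ideal.span {(Polynomial.C Polynomial.X : A2)})) :=
      essGen_gens_iff.mpr (essGen_locAt hf.injective)
    obtain ⟨-, hx, hy⟩ := gens_subset_iff.mp hE.1
    rw [← hr hz] at hx hy
    obtain ⟨x', hx'⟩ := hx
    obtain ⟨y', hy'⟩ := hy
    generalize locAt (ev x y) (Ideal.span {(Polynomial.C Polynomial.X : A2)}) = R₀ at hE hz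
    rw [← hx', ← hy'] at hE
    obtain ⟨c, hc⟩ := exists_wedge_eq_smul (K := X.functionField)
      (span_D_eq_top (IsFractionRing.injective _ _) (hr hz) hE) b b'
    refine ⟨f * algebraMap _ X.functionField c, ?_⟩
    rw [e, mul_smul, ← hx', ← hy', ← hc]
    rfl
  have hH0 : H ≠ 0 := by rintro rfl; exact hω (by rw [hH, zero_smul])
  -- Up to a unit, the coefficient of `ω` in local coordinates is `ϖ ^ (-D z)`.
  have hloc : ∀ {z R f p q}, HasLocalRing (ψ₉ ≫ S.q) z R → (∀ w, w ∈ R ∨ w⁻¹ ∈ R) → R ≠ ⊤ →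
      EssGen (gens p q) R → ω = f • wedge p q → IsDiscreteValuationRing (X.presheaf.stalk z) ∧
      f ≠ 0 ∧ ∀ ϖ : X.presheaf.stalk z, Irreducible ϖ → ∃ e ∈ R, e⁻¹ ∈ R ∧
        f = e * algebraMap (X.presheaf.stalk z) X.functionField ϖ ^ (-D z) := by
    intro z R f p q hz hval hne hE hω'
    obtain ⟨hc, hd⟩ := coheight_eq_one (hr hz) hval hne
    let := stalkAlgebra s z
    have := isScalarTower_stalk (s := s) z
    obtain ⟨f', hf', hDf'⟩ := hexp z hc
    have h1 := isLocalExpression_of_essGen (s := s) (hr hz) hE f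
    rw [← hω'] at h1
    obtain ⟨hf0, c, hcR, hciR, e⟩ := h1.exists_unit hf' hω
    have hf'0 := (hf'.exists_unit h1 hω).1
    refine ⟨hd, hf0, fun ϖ hϖ ↦ ?_⟩
    obtain ⟨v, hv⟩ := exists_eq_mul_zpow_ord hc hϖ hf'0
    have hvi : algebraMap (X.presheaf.stalk z) X.functionField (v⁻¹ : (X.presheaf.stalk z)ˣ) =
        (algebraMap (X.presheaf.stalk z) X.functionField v)⁻¹ :=
      eq_inv_of_mul_eq_one_left (by rw [← map_mul, Units.inv_mul, map_one])
    rw [hr hz] at hcR hciR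
    have hvR : ∀ o, algebraMap (X.presheaf.stalk z) X.functionField o ∈ R := fun o ↦ hr hz ▸ ⟨o, rfl⟩
    have hc0 : c ≠ 0 := by rintro rfl; exact hf'0 (by rw [e, zero_mul])
    refine ⟨c⁻¹ * algebraMap (X.presheaf.stalk z) X.functionField v, mul_mem hciR (hvR _), ?_, ?_⟩
    · rw [mul_inv, inv_inv, ← hvi]
      exact mul_mem hcR (hvR _)
    · rw [hDf', neg_neg, mul_assoc, ← hv, e, inv_mul_cancel_left₀ hc0]
  -- the divisor is a curve
  have hc₀ : Order.coheight z₀ = 1 := by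
    by_contra hc
    exact one_ne_zero (((hD z₀).1 rfl).symm.trans (hDne z₀ hc))
  have hdvr := isDiscreteValuationRing_stalk hc₀ (S.normal z₀)
  have hz₀ : ¬ IsClosed ({z₀} : Set X) := by
    intro hcl
    obtain ⟨f, hf', -⟩ := hexp z₀ hc₀
    exact hω (not_isLocalExpression_of_isClosed hcl ω f hf')
  obtain ⟨R, hR⟩ := h.exists_ring z₀
  have hdiv : IsDivisorial R := hr hR ▸ IsDivisorial.of_isDiscreteValuationRing
  refine ⟨R, hR, hdiv, hz₀, ?_⟩
  by_cases hRe : R = excRing x y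
  · exact .inl hRe
  right
  obtain ⟨g₀, hg₀, hRg, ξ, hξ, hξR, hξ2⟩ := (h.classification hz₀ hR hdiv).resolve_right hRe
  have hu0 : ev x y g₀ ≠ 0 := fun h' ↦ hg₀.ne_zero (hf.injective (by rw [h', map_zero]))
  -- the function `H * g₀` is a unit along all curves of the affine plane
  have hunit : ∀ g : A2, Prime g → ∀ P : Ideal A2, [P.IsPrime] → P = Ideal.span {g} →
      H * ev x y g₀ ∈ locAt (ev x y) P ∧ (H * ev x y g₀)⁻¹ ∈ locAt (ev x y) P := by
    intro g hg P _ hP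
    obtain ⟨hval, hne⟩ := mem_or_inv_mem_of_prime hf hg hP
    have hEss := essGen_gens_iff.mpr (essGen_locAt hf.injective (P := P))
    by_cases hgP : g₀ ∈ P
    · have hPg : P = Ideal.span {g₀} := by
        rw [hP, Ideal.mem_span_singleton] at hgP
        rw [hP, Ideal.span_singleton_eq_span_singleton]
        exact hg.associated_of_dvd hg₀ hgP
      obtain rfl := hRg P hPg
      obtain ⟨hd, -, h1⟩ := hloc hR hval hne hEss hH
      obtain ⟨ϖ, hϖ⟩ := IsDiscreteValuationRing.exists_irreducible (X.presheaf.stalk z₀)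
      obtain ⟨e, he, hei, h2⟩ := h1 ϖ hϖ
      have hinj := IsFractionRing.injective (X.presheaf.stalk z₀) X.functionField
      have hϖ0 : algebraMap (X.presheaf.stalk z₀) X.functionField ϖ ≠ 0 := fun h' ↦
        hϖ.ne_zero (hinj (h'.trans (map_zero _).symm))
      rw [(hD z₀).1 rfl, zpow_neg_one] at h2
      have hmem : ∀ o, algebraMap (X.presheaf.stalk z₀) X.functionField o ∈
          locAt (ev x y) P := fun o ↦ hr hR ▸ ⟨o, rfl⟩
      obtain ⟨c, hc, hϖc⟩ := exists_eq_mul_of_nonunit (α := ev x y) rfl hPg (hmem ϖ) (.inr (by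
        intro h'
        rw [← hr hR] at h'
        obtain ⟨o, ho⟩ := h'
        refine hϖ.not_isUnit (IsUnit.of_mul_eq_one o (hinj ?_))
        rw [map_mul, ho, mul_inv_cancel₀ hϖ0, map_one]))
      have hc0 : c ≠ 0 := by
        rintro rfl
        exact hϖ0 (by rw [hϖc, mul_zero])
      -- `g₀` is a uniformizer at the curve
      have hci : c⁻¹ ∈ locAt (ev x y) P := by
        have hg : ev x y g₀ ∈ locAt (ev x y) P := apply_mem_locAt g₀
        have hc' := hc
        rw [← hr hR] at hg hc'
        obtain ⟨g', hg'⟩ := hg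
        obtain ⟨c', hc'⟩ := hc'
        rcases hϖ.isUnit_or_isUnit (a := g') (b := c')
          (hinj (by rw [map_mul, hg', hc', hϖc])) with hu | hu
        · obtain ⟨v, hv⟩ := hu.exists_right_inv
          refine absurd ?_ ((inv_mem_locAt_iff (a := g₀) hf.injective hg₀.ne_zero).mp.mt (fun h' ↦ h' hgP))
          rw [← hg', show (algebraMap (X.presheaf.stalk z₀) X.functionField g')⁻¹ =
            algebraMap (X.presheaf.stalk z₀) X.functionField v from
              inv_eq_of_mul_eq_one_right (by rw [← map_mul, hv, map_one])]
          exact hmem v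
        · obtain ⟨v, hv⟩ := hu.exists_right_inv
          rw [← hc', show (algebraMap (X.presheaf.stalk z₀) X.functionField c')⁻¹ =
            algebraMap (X.presheaf.stalk z₀) X.functionField v from
              inv_eq_of_mul_eq_one_right (by rw [← map_mul, hv, map_one])]
          exact hmem v
      have h3 : H * ev x y g₀ = e * c⁻¹ := by
        rw [h2, hϖc]
        field_simp
      rw [h3, mul_inv, inv_inv]
      exact ⟨mul_mem he hci, mul_mem hei hc⟩
    · obtain ⟨z, hz⟩ := h.exists_prime P
      have hzz : z ≠ z₀ := by
        rintro rfl
        have := isPrime_span hg₀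
        have hinv : (ev x y g₀)⁻¹ ∈ locAt (ev x y) P :=
          (inv_mem_locAt_iff hf.injective hg₀.ne_zero).mpr hgP
        rw [hz.unique hR, hRg (Ideal.span {g₀}) rfl] at hinv
        exact (inv_mem_locAt_iff hf.injective hg₀.ne_zero).mp hinv
          (Ideal.mem_span_singleton_self g₀)
      obtain ⟨hd, -, h1⟩ := hloc hz hval hne hEss hH
      obtain ⟨ϖ, hϖ⟩ := IsDiscreteValuationRing.exists_irreducible (X.presheaf.stalk z)
      obtain ⟨e, he, hei, h2⟩ := h1 ϖ hϖ
      rw [(hD z).2 hzz, neg_zero, zpow_zero, mul_one] at h2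
      subst h2
      refine ⟨mul_mem he (apply_mem_locAt g₀), ?_⟩
      rw [mul_inv]
      exact mul_mem hei ((inv_mem_locAt_iff hf.injective hg₀.ne_zero).mpr hgP)
  obtain ⟨c, hc0, hc⟩ := eq_const_of_forall_unit hf (mul_ne_zero hH0 hu0) hunit
  -- regularity along the last exceptional curve bounds the pole of `g₀`
  have hexc : x / y * ev x y g₀ ∈ excRing x y := by
    obtain ⟨z, hz⟩ := h.exists_exceptional
    have hzz : z ≠ z₀ := by
      rintro rfl
      exact hRe (hR.unique hz)
    obtain ⟨hval, hne⟩ := mem_or_inv_mem_of_prime (hf.rr 8) prime_C_X rfl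
    obtain ⟨hd, hf0, h1⟩ := hloc hz hval hne (essGen_gens_iff.mpr (essGen_locAt (hf.rr 8).injective))
      (by rw [hH, wedge_eq_smul hf, smul_smul])
    obtain ⟨ϖ, hϖ⟩ := IsDiscreteValuationRing.exists_irreducible (X.presheaf.stalk z)
    obtain ⟨e, he, hei, h2⟩ := h1 ϖ hϖ
    rw [(hD z).2 hzz, neg_zero, zpow_zero, mul_one] at h2
    obtain ⟨e', he', hei', he0, -, hy, -, -⟩ := exists_unit_excRing hf
    have hu := hf.infinity.ne_zero_left
    have he1 : e ≠ 0 := h2 ▸ hf0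
    have : x / y * ev x y g₀ = algebraMap ℂ X.functionField (-c) * e'^3 * e⁻¹ := by
      rw [eq_mul_inv_iff_mul_eq₀ he1, ← h2, map_neg, ← hc, ← hy]
      ring
    rw [this]
    exact mul_mem (mul_mem (algebraMap_mem_excRing _) (pow_mem he' 3)) hei
  rcases eq_pencil hf hg₀.ne_zero hexc with ⟨c', rfl⟩ | ⟨α, β, hα, hg⟩
  · exfalso
    have hc' : c' ≠ 0 := by
      rintro rfl
      exact hg₀.ne_zero (by simp)
    exact hg₀.not_isUnit (((isUnit_iff_ne_zero.mpr hc').map Polynomial.C).map Polynomial.C)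
  · exact ⟨α, β, g₀, hα, hg, hg₀, hRg, ξ, hξ, hξR, hξ2⟩

end

section

/-! ### Normal proper curves and their function fields -/

/-- A proper integral scheme over `ℂ` all of whose local rings are valuation rings: a normal proper
curve (or a point). -/
structure IsNormalCurve {E : Scheme.{0}} [IsIntegral E] (t : E ⟶ SpecC) : Prop where
  proper : IsProper t
  valuationRing : ∀ e : E, ValuationRing (E.presheaf.stalk e)

section

lemma isDominant_fromSpecStalk_genericPoint (E : Scheme.{0}) [IsIntegral E] :
    IsDominant (E.fromSpecStalk (genericPoint E)) := by
  refine ⟨Dense.mono ?_ (dense_iff_closure_eq.mpr (genericPoint_spec E))⟩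
  rw [Set.singleton_subset_iff, Scheme.range_fromSpecStalk]
  exact specializes_rfl

lemma exists_lift_of_isProper {Z Y : Scheme.{0}} (r : Z ⟶ Y) [hr : IsProper r] {R K : Type}
    [CommRing R] [IsDomain R] [ValuationRing R] [Field K] [Algebra R K] [IsFractionRing R K]
    (i₁ : Spec (.of K) ⟶ Z) (i₂ : Spec (.of R) ⟶ Y)
    (h : i₁ ≫ r = Spec.map (CommRingCat.ofHom (algebraMap R K)) ≫ i₂) :
    ∃ l : Spec (.of R) ⟶ Z,
      Spec.map (CommRingCat.ofHom (algebraMap R K)) ≫ l = i₁ ∧ l ≫ r = i₂ := by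
  have hv : ValuativeCriterion r := by
    rw [IsProper.eq_valuativeCriterion] at hr
    exact hr.1.1.1
  rw [ValuativeCriterion.eq] at hv
  obtain ⟨⟨l⟩⟩ := hv.1 { R := R, K := K, i₁ := i₁, i₂ := i₂, commSq := ⟨h⟩ }
  exact ⟨l.l, l.fac_left, l.fac_right⟩

variable {E E' : Scheme.{0}} [IsIntegral E] [IsIntegral E'] {t : E ⟶ SpecC} {t' : E' ⟶ SpecC}

/-- A rational map from a normal curve to a proper scheme is a morphism, by the valuative
criterion. -/
lemma IsNormalCurve.exists_extension (h : IsNormalCurve t) {Z : Scheme.{0}} {r : Z ⟶ SpecC}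
    [IsProper r] (g : Spec E.functionField ⟶ Z) (hg : g ≫ r = E.fromSpecStalk _ ≫ t) :
    ∃ f : E ⟶ Z, f ≫ r = t ∧ E.fromSpecStalk (genericPoint E) ≫ f = g := by
  have : IsSeparated (Limits.terminal.from Z) := by
    rw [← Limits.terminal.comp_from r]
    infer_instance
  have : Z.IsSeparated := ⟨this⟩
  let F := Scheme.RationalMap.ofFunctionField t r g hg
  -- The valuative criterion extends the rational map to the spectrum of each local ring.
  have hdom : F.domain = ⊤ := by
    rw [eq_top_iff]
    intro e _
    have := h.valuationRing e
    have hgen : genericPoint E ⤳ e := (genericPoint_spec E).specializes trivial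
    have hcomp : Spec.map (CommRingCat.ofHom (algebraMap (E.presheaf.stalk e) E.functionField)) ≫
        E.fromSpecStalk e = E.fromSpecStalk _ := Scheme.SpecMap_stalkSpecializes_fromSpecStalk hgen
    obtain ⟨l, hl, hl'⟩ : ∃ l : Spec (E.presheaf.stalk e) ⟶ Z, Spec.map (CommRingCat.ofHom
        (algebraMap (E.presheaf.stalk e) E.functionField)) ≫ l = g ∧
          l ≫ r = E.fromSpecStalk e ≫ t := by
      have hd : IsDomain (E.presheaf.stalk e) := inferInstance
      have hf : IsFractionRing (E.presheaf.stalk e) E.functionField := inferInstance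
      exact @exists_lift_of_isProper Z SpecC r _ (E.presheaf.stalk e) E.functionField
        _ hd (h.valuationRing e) _ _ hf g (E.fromSpecStalk e ≫ t)
        (hg.trans (by rw [← hcomp, Category.assoc]))
    let p := Scheme.PartialMap.ofFromSpecStalk t r l hl'
    have he : e ∈ p.domain := Scheme.PartialMap.mem_domain_ofFromSpecStalk t r _ _
    refine Scheme.RationalMap.mem_domain.mpr ⟨p, he, ?_⟩
    apply Scheme.RationalMap.eq_of_fromFunctionField_eq
    rw [Scheme.RationalMap.fromFunctionField_ofFunctionField,
      Scheme.RationalMap.fromFunctionField_toRationalMap]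
    have h1 : p.fromSpecStalkOfMem he = l :=
      Scheme.PartialMap.fromSpecStalkOfMem_ofFromSpecStalk t r _ _
    have hgp : genericPoint E ∈ p.domain := hgen.mem_open p.domain.2 he
    have h2 : p.fromFunctionField = Spec.map (CommRingCat.ofHom
        (algebraMap (E.presheaf.stalk e) E.functionField)) ≫ p.fromSpecStalkOfMem he := by
      change p.domain.fromSpecStalkOfMem _ hgp ≫ p.hom = _ ≫ p.domain.fromSpecStalkOfMem e he ≫ p.hom
      rw [← Category.assoc]
      congr 1
      rw [← cancel_mono p.domain.ι, Category.assoc, Scheme.Opens.fromSpecStalkOfMem_ι,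
        Scheme.Opens.fromSpecStalkOfMem_ι, hcomp]
    rw [h2, h1]
    exact hl
  let p := F.toPartialMap
  have hp : p.domain = ⊤ := hdom
  have hiso : IsIso p.domain.ι := by
    rw [hp]
    exact inferInstanceAs (IsIso E.topIso.hom)
  have hF : p.fromFunctionField = g := by
    rw [← Scheme.RationalMap.fromFunctionField_toRationalMap,
      Scheme.RationalMap.toRationalMap_toPartialMap]
    exact Scheme.RationalMap.fromFunctionField_ofFunctionField t r g hg
  have hfg : E.fromSpecStalk (genericPoint E) ≫ inv p.domain.ι ≫ p.hom = g := by
    rw [← hF, ← Scheme.Opens.fromSpecStalkOfMem_ι p.domain (genericPoint E) (by rw [hp]; trivial),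
      Category.assoc, IsIso.hom_inv_id_assoc]
    rfl
  refine ⟨inv p.domain.ι ≫ p.hom, ?_, hfg⟩
  have hd : IsDominant (E.fromSpecStalk (genericPoint E)) :=
    isDominant_fromSpecStalk_genericPoint _
  refine ext_of_isDominant (E.fromSpecStalk (genericPoint E)) ?_
  rw [← hg, ← hfg]
  simp only [Category.assoc]

/-- Normal proper curves with isomorphic function fields are isomorphic. -/
lemma IsNormalCurve.nonempty_iso (h : IsNormalCurve t) (h' : IsNormalCurve t')
    (θ : Spec E.functionField ≅ Spec E'.functionField)
    (hθ : θ.hom ≫ E'.fromSpecStalk (genericPoint E') ≫ t' = E.fromSpecStalk (genericPoint E) ≫ t) :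
    ∃ f : E ≅ E', f.hom ≫ t' = t := by
  have := h.proper
  have := h'.proper
  obtain ⟨f, hf, hfθ⟩ := h.exists_extension (r := t') (θ.hom ≫ E'.fromSpecStalk _) (by
    rw [Category.assoc, hθ])
  obtain ⟨g, hg, hgθ⟩ := h'.exists_extension (r := t) (θ.inv ≫ E.fromSpecStalk _) (by
    rw [Category.assoc, ← hθ, Iso.inv_hom_id_assoc])
  have key : ∀ {A : Scheme.{0}} [IsIntegral A] {r : A ⟶ SpecC} [IsProper r] {m : A ⟶ A},
      m ≫ r = r → A.fromSpecStalk (genericPoint A) ≫ m = A.fromSpecStalk (genericPoint A) →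
      m = 𝟙 A := fun {A} _ {r} _ {m} hm hA ↦ by
    have hd : IsDominant (A.fromSpecStalk (genericPoint A)) :=
    isDominant_fromSpecStalk_genericPoint _
    exact ext_of_isDominant_of_isSeparated r (by rw [hm, Category.id_comp])
      (A.fromSpecStalk (genericPoint A)) (by rw [hA, Category.comp_id])
  refine ⟨⟨f, g, key (r := t) (by rw [Category.assoc, hg, hf]) ?_,
    key (r := t') (by rw [Category.assoc, hf, hg]) ?_⟩, hf⟩
  · rw [reassoc_of% hfθ, hgθ, Iso.hom_inv_id_assoc]
  · rw [reassoc_of% hgθ, hfθ, Iso.inv_hom_id_assoc]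

end

end

section

/-! ### Smooth curves are normal -/

section

variable {O K : Type} [CommRing O] [IsDomain O] [IsLocalRing O] [IsNoetherianRing O] [Algebra ℂ O]
  [Field K] [Algebra ℂ K] [Algebra O K] [IsScalarTower ℂ O K] [IsFractionRing O K]

omit [IsDomain O] [IsNoetherianRing O] in
/-- The class of `o - o(m)` in the cotangent space, as a function of `o`. -/
def cotangentDerivation
    (h : ∀ o : O, ∃ c : ℂ, o - algebraMap ℂ O c ∈ IsLocalRing.maximalIdeal O) :
    Derivation ℂ O (IsLocalRing.CotangentSpace O) :=
  let ε : O → ℂ := fun o ↦ (h o).choose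
  have hε : ∀ o, o - algebraMap ℂ O (ε o) ∈ IsLocalRing.maximalIdeal O := fun o ↦ (h o).choose_spec
  have huniq : ∀ o c, o - algebraMap ℂ O c ∈ IsLocalRing.maximalIdeal O → ε o = c := fun o c hc ↦ by
    by_contra hne
    have h1 := Ideal.sub_mem _ hc (hε o)
    rw [sub_sub_sub_cancel_left, ← map_sub] at h1
    exact (IsLocalRing.mem_maximalIdeal _).mp h1
      ((isUnit_iff_ne_zero.mpr (sub_ne_zero.mpr hne)).map (algebraMap ℂ O))
  have hadd : ∀ a b, ε (a + b) = ε a + ε b := fun a b ↦ huniq _ _ (by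
    have := Ideal.add_mem _ (hε a) (hε b)
    rw [map_add]
    convert this using 1
    ring)
  have hmul : ∀ a b, ε (a * b) = ε a * ε b := fun a b ↦ huniq _ _ (by
    have := Ideal.add_mem _ (Ideal.mul_mem_left _ a (hε b))
      (Ideal.mul_mem_left _ (algebraMap ℂ O (ε b)) (hε a))
    rw [map_mul]
    convert this using 1
    ring)
  have halg : ∀ c, ε (algebraMap ℂ O c) = c := fun c ↦ huniq _ _ (by simp)
  Derivation.mk'
    { toFun := fun o ↦ (IsLocalRing.maximalIdeal O).toCotangent ⟨_, hε o⟩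
      map_add' := fun a b ↦ by
        rw [← map_add]
        congr 1
        ext
        simp only [hadd, map_add, Submodule.coe_add]
        ring
      map_smul' := fun c a ↦ by
        refine Eq.trans ?_ (algebraMap_smul O c _)
        rw [← map_smul]
        congr 1
        ext
        change c • a - algebraMap ℂ O (ε (c • a)) = algebraMap ℂ O c * (a - algebraMap ℂ O (ε a))
        rw [Algebra.smul_def, hmul, halg, map_mul]
        ring }
    (fun a b ↦ by
      change (IsLocalRing.maximalIdeal O).toCotangent ⟨_, hε (a * b)⟩ =
        a • (IsLocalRing.maximalIdeal O).toCotangent ⟨_, hε b⟩ +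
        b • (IsLocalRing.maximalIdeal O).toCotangent ⟨_, hε a⟩
      rw [← map_smul, ← map_smul, ← map_add, ← sub_eq_zero, ← map_sub,
        Ideal.toCotangent_eq_zero]
      have h1 : a * b - algebraMap ℂ O (ε (a * b)) - (a * (b - algebraMap ℂ O (ε b)) +
        b * (a - algebraMap ℂ O (ε a))) =
          -((a - algebraMap ℂ O (ε a)) * (b - algebraMap ℂ O (ε b))) := by
        rw [hmul, map_mul]
        ring
      change a * b - algebraMap ℂ O (ε (a * b)) - (a * (b - algebraMap ℂ O (ε b)) +
        b * (a - algebraMap ℂ O (ε a))) ∈ _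
      rw [h1, pow_two]
      exact neg_mem (Ideal.mul_mem_mul (hε a) (hε b)))

omit [IsDomain O] [IsNoetherianRing O] in
lemma cotangentDerivation_of_mem
    (h : ∀ o : O, ∃ c : ℂ, o - algebraMap ℂ O c ∈ IsLocalRing.maximalIdeal O)
    (o : IsLocalRing.maximalIdeal O) :
    cotangentDerivation h o = (IsLocalRing.maximalIdeal O).toCotangent o := by
  have h0 : (h o).choose = 0 := by
    by_contra hne
    have h1 := Ideal.sub_mem _ o.2 (h o).choose_spec
    rw [sub_sub_cancel] at h1
    exact (IsLocalRing.mem_maximalIdeal _).mp h1 ((isUnit_iff_ne_zero.mpr hne).map (algebraMap ℂ O))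
  change (IsLocalRing.maximalIdeal O).toCotangent ⟨_, _⟩ = _
  congr 1
  ext
  change (o : O) - algebraMap ℂ O (h o).choose = o
  rw [h0, map_zero, sub_zero]

/-- A smooth local `ℂ`-algebra with residue field `ℂ` is a valuation ring if the differentials of
its fraction field are generated by one element. -/
lemma valuationRing_of_formallySmooth [Algebra.FormallySmooth ℂ O] [Algebra.EssFiniteType ℂ O]
    (h : ∀ o : O, ∃ c : ℂ, o - algebraMap ℂ O c ∈ IsLocalRing.maximalIdeal O)
    (hK : ∃ ω : Ω[K⁄ℂ], Submodule.span K {ω} = ⊤) : ValuationRing O := by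
  have hfree : Module.Free O Ω[O⁄ℂ] := Module.free_of_flat_of_isLocalRing
  have hΩ : ∃ ω : Ω[O⁄ℂ], Submodule.span O {ω} = ⊤ := by
    let b := Module.Free.chooseBasis O Ω[O⁄ℂ]
    have h1 : LinearIndependent K (KaehlerDifferential.map ℂ ℂ O K ∘ b) :=
      LinearIndependent.of_isLocalizedModule K (nonZeroDivisors O)
        (KaehlerDifferential.map ℂ ℂ O K) b.linearIndependent
    obtain ⟨ω, hω⟩ := hK
    have h2 : Module.finrank K Ω[K⁄ℂ] ≤ 1 :=
      finrank_le_one ω fun w ↦ Submodule.mem_span_singleton.mp (hω ▸ trivial)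
    have hfin : Module.Finite K Ω[K⁄ℂ] := ⟨⟨{ω}, by simpa using hω⟩⟩
    have h3 := h1.fintype_card_le_finrank
    have hs : Subsingleton (Module.Free.ChooseBasisIndex O Ω[O⁄ℂ]) :=
      Fintype.card_le_one_iff_subsingleton.mp (h3.trans h2)
    rcases isEmpty_or_nonempty (Module.Free.ChooseBasisIndex O Ω[O⁄ℂ]) with h0 | ⟨⟨i⟩⟩
    · refine ⟨0, ?_⟩
      rw [← b.span_eq, Set.range_eq_empty, Submodule.span_empty, Submodule.span_zero_singleton]
    · refine ⟨b i, ?_⟩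
      rw [← b.span_eq]
      congr 1
      ext w
      simp only [Set.mem_singleton_iff, Set.mem_range]
      exact ⟨fun h ↦ ⟨i, h.symm⟩, fun ⟨j, h⟩ ↦ Subsingleton.elim i j ▸ h.symm⟩
  obtain ⟨ω, hω⟩ := hΩ
  let l := (cotangentDerivation h).liftKaehlerDifferential
  have hl : ∀ o, l (KaehlerDifferential.D ℂ O o) = cotangentDerivation h o :=
    (cotangentDerivation h).liftKaehlerDifferential_comp_D
  have hp : (IsLocalRing.maximalIdeal O).IsPrincipal := by
    rw [← IsLocalRing.finrank_cotangentSpace_le_one_iff]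
    refine finrank_le_one (l ω) fun w ↦ ?_
    obtain ⟨o, rfl⟩ := Ideal.toCotangent_surjective _ w
    have h1 : KaehlerDifferential.D ℂ O o ∈ Submodule.span O {ω} := hω ▸ trivial
    obtain ⟨c, hc⟩ := Submodule.mem_span_singleton.mp h1
    refine ⟨IsLocalRing.residue O c, ?_⟩
    have h2 : l (c • ω) = (IsLocalRing.maximalIdeal O).toCotangent o := by
      rw [hc, hl, cotangentDerivation_of_mem]
    rw [map_smul] at h2
    rw [← h2]
    exact algebraMap_smul _ _ _
  exact ((tfae_of_isNoetherianRing_of_isLocalRing_of_isDomain O).out 4 1).mp hp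

end

section

variable {E : Scheme.{0}} [IsIntegral E] {t : E ⟶ SpecC}

omit [IsIntegral E] in
lemma formallySmooth_stalk [Smooth t] {V : E.Opens} (hV : IsAffineOpen V) (e : V) :
    letI := stalkAlgebra t e.1
    Algebra.FormallySmooth ℂ (E.presheaf.stalk e.1) ∧
      Algebra.EssFiniteType ℂ (E.presheaf.stalk e.1) ∧
      IsNoetherianRing (E.presheaf.stalk e.1) := by
  let := stalkAlgebra t e.1
  have h1 : (t.appLE ⊤ V le_top).hom.Smooth :=
    HasRingHomProperty.appLE @Smooth t inferInstance ⟨⊤, isAffineOpen_top _⟩ ⟨V, hV⟩ le_top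
  let φ : ℂ →+* Γ(E, V) :=
    (t.appLE ⊤ V le_top).hom.comp (Scheme.ΓSpecIso (CommRingCat.of ℂ)).inv.hom
  have hφ : φ.Smooth := RingHom.Smooth.respectsIso.2 _
    (Scheme.ΓSpecIso (CommRingCat.of ℂ)).symm.commRingCatIsoToRingEquiv h1
  let : Algebra ℂ Γ(E, V) := φ.toAlgebra
  have hφ' : Algebra.Smooth ℂ Γ(E, V) := hφ
  have := hV.isLocalization_stalk e
  have htow : IsScalarTower ℂ Γ(E, V) (E.presheaf.stalk e.1) := by
    refine IsScalarTower.of_algebraMap_eq fun c ↦ ?_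
    change E.presheaf.germ ⊤ e.1 trivial (t.appTop _) =
      E.presheaf.germ V e.1 e.2 (E.presheaf.map _ (t.appTop _))
    exact (TopCat.Presheaf.germ_res_apply _ _ _ _ _).symm
  have := Algebra.FormallySmooth.of_isLocalization (R := Γ(E, V)) (Rₘ := E.presheaf.stalk e.1)
    (hV.primeIdealOf e).asIdeal.primeCompl
  have := Algebra.EssFiniteType.of_isLocalization (E.presheaf.stalk e.1)
    (hV.primeIdealOf e).asIdeal.primeCompl
  have hn : IsNoetherianRing Γ(E, V) := Algebra.FiniteType.isNoetherianRing ℂ _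
  exact ⟨.comp ℂ Γ(E, V) _, .comp ℂ Γ(E, V) _,
    IsLocalization.isNoetherianRing (hV.primeIdealOf e).asIdeal.primeCompl _ hn⟩

/-- A smooth proper integral scheme is a normal curve if the differentials of its function field
are generated by one element. -/
lemma isNormalCurve_of_smooth [Smooth t] [IsProper t]
    (h : letI := stalkAlgebra t (genericPoint E)
      ∃ ω : Ω[E.functionField⁄ℂ], Submodule.span E.functionField {ω} = ⊤) : IsNormalCurve t := by
  refine ⟨inferInstance, fun e ↦ ?_⟩
  have : CompactSpace E := QuasiCompact.compactSpace_of_compactSpace t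
  obtain ⟨e₀, he₀, hc⟩ := (isClosed_closure (s := ({e} : Set E))).exists_closed_singleton
    (closure_nonempty_iff.mpr ⟨e, rfl⟩)
  replace he₀ : e ⤳ e₀ := specializes_iff_mem_closure.mpr he₀
  let := stalkAlgebra t (genericPoint E)
  let := stalkAlgebra t e₀
  have := isScalarTower_stalk (s := t) e₀
  obtain ⟨_, ⟨V, hV, rfl⟩, hxV, -⟩ :=
    E.isBasis_affineOpens.exists_subset_of_mem_open (Set.mem_univ e₀) isOpen_univ
  obtain ⟨h1, h2, h3⟩ := formallySmooth_stalk (t := t) hV ⟨e₀, hxV⟩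
  have hv : ValuationRing (E.presheaf.stalk e₀) :=
    valuationRing_of_formallySmooth (K := E.functionField) (exists_sub_mem_maximalIdeal (s := t) hc) h
  replace hv := (ValuationRing.iff_isInteger_or_isInteger (E.presheaf.stalk e₀)
    E.functionField).mp hv
  refine (ValuationRing.iff_isInteger_or_isInteger (E.presheaf.stalk e) E.functionField).mpr ?_
  have hle : ∀ w : E.functionField, IsLocalization.IsInteger (E.presheaf.stalk e₀) w →
      IsLocalization.IsInteger (E.presheaf.stalk e) w := by
    rintro _ ⟨o, rfl⟩
    exact ⟨E.presheaf.stalkSpecializes he₀ o, TopCat.Presheaf.stalkSpecializes_comp_apply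
      E.presheaf ((genericPoint_spec E).specializes trivial) he₀ o⟩
  exact fun w ↦ (hv w).imp (hle _) (hle _)

end

end

section

/-! ### Local rings of closed curves -/

/-- `θ : R ⟶ K(E)` is the residue map of the local ring `R` of the ambient scheme at the generic
point of the closed integral subscheme `E`, and restricts to the surjections of local rings. -/
structure IsResidueMap {K : Type} [Field K] {Z E : Scheme.{0}} [IsIntegral E]
    (ψ : Spec (.of K) ⟶ Z) (i : E ⟶ Z) (t : Z ⟶ SpecC) {R : Subring K} (θ : R →+* E.functionField) :
    Prop where
  surjective : Function.Surjective θ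
  isLocalHom : IsLocalHom θ
  stalk : ∀ e S, HasLocalRing ψ (i e) S → ∃ (hS : S ≤ R) (σ : S →+* E.presheaf.stalk e),
    Function.Surjective σ ∧ IsLocalHom σ ∧
      ∀ r, algebraMap _ E.functionField (σ r) = θ (Subring.inclusion hS r)
  map_const : letI := stalkAlgebra (i ≫ t) (genericPoint E)
    ∀ (f : ℂ →+* R), ψ ≫ t = Spec.map (CommRingCat.ofHom (R.subtype.comp f)) →
      ∀ c, θ (f c) = algebraMap ℂ E.functionField c

section

variable {K : Type} [Field K] {Z E : Scheme.{0}} [IsIntegral E] {ψ : Spec (.of K) ⟶ Z}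
  {R : Subring K}

/-- The isomorphism between the stalk and the subring representing it, with its inclusion in `K`. -/
lemma HasLocalRing.exists_equiv_hom {z : Z} (h : HasLocalRing ψ z R) :
    ∃ (φ : Z.presheaf.stalk z ⟶ .of K) (e : Z.presheaf.stalk z ≃+* R),
      Spec.map φ ≫ Z.fromSpecStalk z = ψ ∧ ∀ o, φ.hom o = (e o : K) := by
  obtain ⟨φ, hφ, rfl, h⟩ := h
  exact ⟨φ, RingEquiv.ofBijective φ.hom.rangeRestrict
    ⟨fun x y hxy ↦ hφ (congrArg Subtype.val hxy), φ.hom.rangeRestrict_surjective⟩, h, fun _ ↦ rfl⟩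

lemma exists_isResidueMap (i : E ⟶ Z) [IsClosedImmersion i] (t : Z ⟶ SpecC)
    (h : HasLocalRing ψ (i (genericPoint E)) R) :
    ∃ θ : R →+* E.functionField, IsResidueMap ψ i t θ := by
  obtain ⟨φ, ε, hφ, hε⟩ := h.exists_equiv_hom
  let θ : R →+* E.functionField := (i.stalkMap (genericPoint E)).hom.comp ε.symm.toRingHom
  refine ⟨θ, ?_, ?_, ?_, ?_⟩
  · exact (i.stalkMap_surjective (genericPoint E)).comp ε.symm.surjective
  · have : IsLocalHom ε.symm.toRingHom := ⟨fun a ha ↦ (MulEquiv.isUnit_map ε.symm).mp ha⟩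
    exact RingHom.isLocalHom_comp _ _
  · intro e S hS
    obtain ⟨φ', δ, hφ', hδ⟩ := hS.exists_equiv_hom
    have hsp : genericPoint E ⤳ e := (genericPoint_spec E).specializes trivial
    have hsp' : i (genericPoint E) ⤳ i e := hsp.map i.continuous
    have hle := h.le_of_specializes hS hsp'
    have key : φ' = Z.presheaf.stalkSpecializes hsp' ≫ φ := by
      apply Spec.map_injective
      rw [← cancel_mono (Z.fromSpecStalk _), hφ', Spec.map_comp, Category.assoc,
        Scheme.SpecMap_stalkSpecializes_fromSpecStalk, hφ]
    refine ⟨hle, (i.stalkMap e).hom.comp δ.symm.toRingHom,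
      (i.stalkMap_surjective e).comp δ.symm.surjective, ?_, fun r ↦ ?_⟩
    · have : IsLocalHom δ.symm.toRingHom := ⟨fun a ha ↦ (MulEquiv.isUnit_map δ.symm).mp ha⟩
      exact RingHom.isLocalHom_comp _ _
    · obtain ⟨o, rfl⟩ := δ.surjective r
      have h1 : Subring.inclusion hle (δ o) = ε (Z.presheaf.stalkSpecializes hsp' o) :=
        Subtype.ext ((hδ o).symm.trans ((congrArg (fun f ↦ f.hom o) key).trans (hε _)))
      rw [h1]
      change E.presheaf.stalkSpecializes hsp (i.stalkMap e (δ.symm (δ o))) =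
        i.stalkMap (genericPoint E) (ε.symm (ε (Z.presheaf.stalkSpecializes hsp' o)))
      rw [RingEquiv.symm_apply_apply, RingEquiv.symm_apply_apply]
      exact (i.stalkSpecializes_stalkMap_apply _ _ hsp o).symm
  · let := stalkAlgebra (i ≫ t) (genericPoint E)
    intro f hf c
    let := stalkAlgebra t (i (genericPoint E))
    have h1 : CommRingCat.ofHom (R.subtype.comp f) =
        CommRingCat.ofHom (algebraMap ℂ (Z.presheaf.stalk (i (genericPoint E)))) ≫ φ := by
      apply Spec.map_injective
      rw [← hf, Spec.map_comp, ← fromSpecStalk_comp_structure (s := t), reassoc_of% hφ]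
    have h2 : f c = ε (algebraMap ℂ (Z.presheaf.stalk (i (genericPoint E))) c) :=
      Subtype.ext ((congrArg (fun f ↦ f.hom c) h1).trans (hε _))
    rw [h2]
    change i.stalkMap (genericPoint E) (ε.symm (ε _)) = _
    rw [RingEquiv.symm_apply_apply]
    exact (Scheme.Hom.germ_stalkMap_apply i ⊤ _ trivial _)

namespace IsResidueMap

variable {i : E ⟶ Z} {t : Z ⟶ SpecC} {θ : R →+* E.functionField}

lemma eq_zero_iff (h : IsResidueMap ψ i t θ) (w : R) : θ w = 0 ↔ (w : K) = 0 ∨ (w : K)⁻¹ ∉ R := by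
  have := h.isLocalHom
  have h1 : IsUnit w ↔ θ w ≠ 0 := by
    rw [← isUnit_iff_ne_zero]
    exact ⟨fun h ↦ h.map θ, fun h ↦ IsUnit.of_map θ w h⟩
  rw [← not_iff_not, ← ne_eq, ← h1]
  push Not
  constructor
  · intro hu
    obtain ⟨v, hv⟩ := hu.exists_right_inv
    have hv' : (w : K) * v = 1 := congrArg Subtype.val hv
    exact ⟨left_ne_zero_of_mul_eq_one hv', inv_eq_of_mul_eq_one_right hv' ▸ v.2⟩
  · rintro ⟨h0, hi⟩
    exact .of_mul_eq_one ⟨_, hi⟩ (Subtype.ext (mul_inv_cancel₀ h0))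

/-- The local ring of the curve at `e` is the image of the local ring of the ambient scheme. -/
lemma range_eq (h : IsResidueMap ψ i t θ) {e : E} {S : Subring K} (hS : HasLocalRing ψ (i e) S) :
    ∃ hle : S ≤ R, (algebraMap (E.presheaf.stalk e) E.functionField).range =
      (θ.comp (Subring.inclusion hle)).range := by
  obtain ⟨hle, σ, hσ, -, h1⟩ := h.stalk e S hS
  refine ⟨hle, ?_⟩
  ext w
  constructor
  · rintro ⟨o, rfl⟩
    obtain ⟨r, rfl⟩ := hσ o
    exact ⟨r, (h1 r).symm⟩
  · rintro ⟨r, rfl⟩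
    exact ⟨σ r, h1 r⟩

end IsResidueMap

end

end

section

/-! ### Function fields of plane curves -/

/-- The affine equation `y² = x³ + l`. -/
def cubicPoly (l : ℂ) : A2 := cuspPoly - Polynomial.C (Polynomial.C l)

lemma cubicPoly_eq (l : ℂ) :
    cubicPoly l = Polynomial.X ^ 2 - Polynomial.C (Polynomial.X ^ 3 + Polynomial.C l) := by
  rw [cubicPoly, cuspPoly, map_add, sub_sub]

lemma monic_cubicPoly (l : ℂ) : (cubicPoly l).Monic :=
  cubicPoly_eq l ▸ Polynomial.monic_X_pow_sub_C _ (by norm_num)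

lemma natDegree_cubicPoly (l : ℂ) : (cubicPoly l).natDegree = 2 :=
  cubicPoly_eq l ▸ Polynomial.natDegree_X_pow_sub_C

lemma prime_cubicPoly (l : ℂ) : Prime (cubicPoly l) := by
  have h := (WeierstrassCurve.Affine.irreducible_polynomial
    (W := (⟨0, 0, 0, 0, l⟩ : WeierstrassCurve ℂ).toAffine)).prime
  have h1 : WeierstrassCurve.Affine.polynomial
      (⟨0, 0, 0, 0, l⟩ : WeierstrassCurve ℂ).toAffine = cubicPoly l := by
    rw [cubicPoly_eq, WeierstrassCurve.Affine.polynomial]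
    simp
  rwa [h1] at h

section

variable {L : Type} [Field L] [Algebra ℂ L]

lemma ev_cubicPoly (x y : L) (l : ℂ) :
    ev x y (cubicPoly l) = y ^ 2 - x ^ 3 - algebraMap ℂ L l := by
  rw [cubicPoly, map_sub, ev_cuspPoly, ev_C, Polynomial.aeval_C]

/-- `L` is the function field of the affine plane curve `g = 0`, with the coordinate functions
`x` and `y`. -/
structure IsCurveField (g : A2) (x y : L) : Prop where
  eq_zero_iff : ∀ p, ev x y p = 0 ↔ g ∣ p
  exists_fraction : ∀ w, ∃ n d, ev x y d ≠ 0 ∧ w * ev x y d = ev x y n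

namespace IsCurveField

variable {g : A2} {x y : L}

lemma essGen_top (h : IsCurveField g x y) : EssGen (gens x y) (⊤ : Subring L) := by
  refine ⟨fun _ _ ↦ trivial, fun T hT hinv w _ ↦ ?_⟩
  obtain ⟨n, d, hd, hw⟩ := h.exists_fraction w
  rw [(eq_mul_inv_iff_mul_eq₀ hd).mpr hw]
  exact mul_mem (ev_mem hT n) (hinv _ (ev_mem hT d) trivial)

lemma span_D_eq_top (h : IsCurveField g x y) :
    Submodule.span L {KaehlerDifferential.D ℂ L x, KaehlerDifferential.D ℂ L y} = ⊤ :=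
  ScE8.span_D_eq_top (O := L) (K := L) (R := ⊤) Function.injective_id
    (RingHom.range_eq_top.mpr Function.surjective_id) h.essGen_top

lemma relation {l : ℂ} (h : IsCurveField (cubicPoly l) x y) : y ^ 2 = x ^ 3 + algebraMap ℂ L l := by
  have := (h.eq_zero_iff (cubicPoly l)).mpr dvd_rfl
  rw [ev_cubicPoly] at this
  linear_combination this

lemma aeval_ne_zero {l : ℂ} (h : IsCurveField (cubicPoly l) x y) {p : Polynomial ℂ} (hp : p ≠ 0) :
    Polynomial.aeval x p ≠ 0 := by
  rw [← ev_C (y := y), Ne, h.eq_zero_iff]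
  intro hd
  have := Polynomial.natDegree_le_of_dvd hd (Polynomial.C_ne_zero.mpr hp)
  rw [natDegree_cubicPoly, Polynomial.natDegree_C] at this
  omega

lemma right_ne_zero {l : ℂ} (h : IsCurveField (cubicPoly l) x y) : y ≠ 0 := by
  have h1 := (h.eq_zero_iff Polynomial.X).not.mpr fun hd ↦ by
    have := Polynomial.natDegree_le_of_dvd hd Polynomial.X_ne_zero
    rw [natDegree_cubicPoly, Polynomial.natDegree_X] at this
    omega
  simpa using h1

/-- The differential of `x` generates the differentials of the field of the curve
`y² = x³ + l`. -/
lemma span_D_left {l : ℂ} (h : IsCurveField (cubicPoly l) x y) :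
    Submodule.span L {KaehlerDifferential.D ℂ L x} = ⊤ := by
  rw [eq_top_iff, ← h.span_D_eq_top, Submodule.span_le]
  have h0 : KaehlerDifferential.D ℂ L x ∈ Submodule.span L {KaehlerDifferential.D ℂ L x} :=
    Submodule.mem_span_singleton_self _
  rintro _ (rfl | rfl)
  · exact h0
  have h1 := congrArg (KaehlerDifferential.D ℂ L) h.relation
  rw [map_add, Derivation.map_algebraMap, add_zero, Derivation.leibniz_pow,
    Derivation.leibniz_pow] at h1
  have h2 : (2 * y) • KaehlerDifferential.D ℂ L y =
      (3 * x ^ 2) • KaehlerDifferential.D ℂ L x := by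
    simpa [← smul_assoc, two_mul, nsmul_eq_mul] using h1
  have h3 : (2 * y : L) ≠ 0 := by
    have := charZero_of_injective_algebraMap (algebraMap ℂ L).injective
    exact mul_ne_zero two_ne_zero h.right_ne_zero
  have h4 : KaehlerDifferential.D ℂ L y = (2 * y)⁻¹ • (3 * x ^ 2) • KaehlerDifferential.D ℂ L x := by
    rw [← h2, inv_smul_smul₀ h3]
  exact h4 ▸ Submodule.smul_mem _ _ (Submodule.smul_mem _ _ h0)

lemma isFractionRing (h : IsCurveField g x y) {B : Type} [CommRing B] [Algebra B L] {π : A2 →+* B}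
    (hπ : Function.Surjective π) (hg : ∀ p, g ∣ p → π p = 0)
    (hev : ∀ p, algebraMap B L (π p) = ev x y p) : IsFractionRing B L := by
  have hinj : Function.Injective (algebraMap B L) := by
    rw [injective_iff_map_eq_zero]
    intro q hq
    obtain ⟨p, rfl⟩ := hπ q
    rw [hev, h.eq_zero_iff] at hq
    exact hg p hq
  have : FaithfulSMul B L := (faithfulSMul_iff_algebraMap_injective _ _).mpr hinj
  refine IsFractionRing.of_field _ _ fun w ↦ ?_
  obtain ⟨n, d, hd, hw⟩ := h.exists_fraction w
  exact ⟨π n, π d, by rw [hev, hev, (eq_mul_inv_iff_mul_eq₀ hd).mpr hw, div_eq_mul_inv]⟩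

/-- The field of a plane curve is determined by its equation. -/
lemma exists_ringEquiv {L' : Type} [Field L'] [Algebra ℂ L'] {x' y' : L'}
    (h : IsCurveField g x y) (h' : IsCurveField g x' y') :
    ∃ e : L ≃+* L', ∀ c, e (algebraMap ℂ L c) = algebraMap ℂ L' c := by
  -- both fields are fraction fields of the image `B` of `ℂ[X, Y]` in `L`
  let B := (ev x y).range
  let π : A2 →+* B := (ev x y).rangeRestrict
  have hπ : Function.Surjective π := (ev x y).rangeRestrict_surjective
  have hg : ∀ p, g ∣ p → π p = 0 := fun p hp ↦ Subtype.ext ((h.eq_zero_iff p).mpr hp)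
  have hg' : ∀ p, π p = 0 → ev x' y' p = 0 := fun p hp ↦
    (h'.eq_zero_iff p).mpr ((h.eq_zero_iff p).mp (congrArg Subtype.val hp))
  let f : B →+* L' := π.liftOfSurjective hπ ⟨ev x' y', hg'⟩
  have hf : ∀ p, f (π p) = ev x' y' p := fun p ↦
    π.liftOfRightInverse_comp_apply _ _ ⟨ev x' y', hg'⟩ p
  let := f.toAlgebra
  have := h.isFractionRing (B := B) hπ hg fun _ ↦ rfl
  have := h'.isFractionRing (B := B) hπ hg hf
  let e := IsLocalization.algEquiv (nonZeroDivisors B) L L'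
  refine ⟨e.toRingEquiv, fun c ↦ ?_⟩
  have h1 : e (ev x y (Polynomial.C (Polynomial.C c))) = f (π (Polynomial.C (Polynomial.C c))) :=
    e.commutes (π (Polynomial.C (Polynomial.C c)))
  rw [hf, ev_C, ev_C, Polynomial.aeval_C, Polynomial.aeval_C] at h1
  exact h1

/-- The substitution `(x, y) ↦ (c² x, c³ y)`. -/
def weightedScale (c : ℂ) : A2 →+* A2 :=
  (Polynomial.aevalAeval (Polynomial.C (Polynomial.C (c ^ 2) * Polynomial.X))
    (Polynomial.C (Polynomial.C (c ^ 3)) * Polynomial.X) : A2 →ₐ[ℂ] A2).toRingHom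

omit [Field L] [Algebra ℂ L] in
lemma weightedScale_X (c : ℂ) : weightedScale c Polynomial.X =
    Polynomial.C (Polynomial.C (c ^ 3)) * Polynomial.X := by simp [weightedScale]

omit [Field L] [Algebra ℂ L] in
lemma weightedScale_C_X (c : ℂ) : weightedScale c (Polynomial.C Polynomial.X) =
    Polynomial.C (Polynomial.C (c ^ 2)) * Polynomial.C Polynomial.X := by simp [weightedScale]

omit [Field L] [Algebra ℂ L] in
lemma weightedScale_C_C (c a : ℂ) : weightedScale c (Polynomial.C (Polynomial.C a)) =
    Polynomial.C (Polynomial.C a) := by simp [weightedScale]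

omit [Field L] [Algebra ℂ L] in
lemma weightedScale_weightedScale {c c' : ℂ} (h : c * c' = 1) (p : A2) :
    weightedScale c (weightedScale c' p) = p := by
  have h2 : c' ^ 2 * c ^ 2 = 1 := by rw [← mul_pow, mul_comm, h, one_pow]
  have h3 : c' ^ 3 * c ^ 3 = 1 := by rw [← mul_pow, mul_comm, h, one_pow]
  have : (weightedScale c).comp (weightedScale c') = RingHom.id A2 := by
    refine Polynomial.ringHom_ext' (Polynomial.ringHom_ext (fun a ↦ ?_) ?_) ?_
    · rw [RingHom.comp_apply, RingHom.comp_apply, weightedScale_C_C, weightedScale_C_C]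
      rfl
    · rw [RingHom.comp_apply, RingHom.comp_apply, weightedScale_C_X, map_mul, weightedScale_C_C,
        weightedScale_C_X, ← mul_assoc, ← map_mul, ← map_mul, ← map_mul, h2]
      simp
    · rw [RingHom.comp_apply, weightedScale_X, map_mul, weightedScale_C_C, weightedScale_X,
        ← mul_assoc, ← map_mul, ← map_mul, h3]
      simp
  exact congrArg (fun f ↦ f p) this

lemma ev_weightedScale (c : ℂ) (p : A2) : ev x y (weightedScale c p) =
    ev (algebraMap ℂ L c ^ 2 * x) (algebraMap ℂ L c ^ 3 * y) p := by
  have : (ev x y).comp (weightedScale c) =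
      ev (algebraMap ℂ L c ^ 2 * x) (algebraMap ℂ L c ^ 3 * y) := by
    refine Polynomial.ringHom_ext' (Polynomial.ringHom_ext (fun a ↦ ?_) ?_) ?_ <;>
      simp [weightedScale]
  exact congrArg (· p) this

lemma scale {l : ℂ} (h : IsCurveField (cubicPoly l) x y) {c : ℂ} (hc : c ≠ 0) :
    IsCurveField (cubicPoly (c ^ 6 * l)) (algebraMap ℂ L c ^ 2 * x) (algebraMap ℂ L c ^ 3 * y) := by
  have hinv : ∀ p, weightedScale c (weightedScale c⁻¹ p) = p :=
    weightedScale_weightedScale (mul_inv_cancel₀ hc)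
  have hinv' : ∀ p, weightedScale c⁻¹ (weightedScale c p) = p :=
    weightedScale_weightedScale (inv_mul_cancel₀ hc)
  have hg : ∀ (c l : ℂ), weightedScale c (cubicPoly (c ^ 6 * l)) =
      Polynomial.C (Polynomial.C (c ^ 6)) * cubicPoly l := by
    intro c l
    simp [cubicPoly, cuspPoly, weightedScale, mul_pow, mul_sub]
    ring
  refine ⟨fun p ↦ ?_, fun w ↦ ?_⟩
  · rw [← ev_weightedScale, h.eq_zero_iff]
    constructor
    · rintro ⟨q, hq⟩
      have h1 := congrArg (weightedScale c⁻¹) hq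
      have h2 := hg c⁻¹ (c ^ 6 * l)
      rw [← mul_assoc, ← mul_pow, inv_mul_cancel₀ hc, one_pow, one_mul] at h2
      rw [hinv', map_mul, h2] at h1
      exact ⟨Polynomial.C (Polynomial.C (c⁻¹ ^ 6)) * weightedScale c⁻¹ q, h1.trans (by ring)⟩
    · rintro ⟨q, rfl⟩
      rw [map_mul, hg]
      exact ⟨Polynomial.C (Polynomial.C (c ^ 6)) * weightedScale c q, by ring⟩
  · obtain ⟨n, d, hd, hw⟩ := h.exists_fraction w
    refine ⟨weightedScale c⁻¹ n, weightedScale c⁻¹ d, ?_, ?_⟩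
    · rwa [← ev_weightedScale, hinv]
    · rwa [← ev_weightedScale, ← ev_weightedScale, hinv, hinv]

end IsCurveField

variable {K : Type} [Field K] [Algebra ℂ K] {Z E : Scheme.{0}} [IsIntegral E]
  {ψ : Spec (.of K) ⟶ Z} {R : Subring K} {i : E ⟶ Z} {t : Z ⟶ SpecC} {θ : R →+* E.functionField}

namespace IsResidueMap

lemma map_ev (h : IsResidueMap ψ i t θ)
    (hψ : ψ ≫ t = Spec.map (CommRingCat.ofHom (algebraMap ℂ K))) {x y : K} (hx : x ∈ R)
    (hy : y ∈ R) (hR : gens x y ⊆ R) (p : A2) :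
    letI := stalkAlgebra (i ≫ t) (genericPoint E)
    θ ⟨ev x y p, ev_mem hR p⟩ = ev (θ ⟨x, hx⟩) (θ ⟨y, hy⟩) p := by
  let := stalkAlgebra (i ≫ t) (genericPoint E)
  have hc := (gens_subset_iff.mp hR).1
  let f : ℂ →+* R := (algebraMap ℂ K).codRestrict R hc
  have h1 : ∀ c, θ (f c) = algebraMap ℂ E.functionField c := h.map_const f hψ
  have : θ.comp ((ev x y).codRestrict R (ev_mem hR)) = ev (θ ⟨x, hx⟩) (θ ⟨y, hy⟩) := by
    refine Polynomial.ringHom_ext' (Polynomial.ringHom_ext (fun a ↦ ?_) ?_) ?_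
    · refine Eq.trans (congrArg θ (Subtype.ext ?_)) ((h1 a).trans ?_)
      · simp [f]
      · simp
    · refine Eq.trans (congrArg θ (Subtype.ext (a2 := ⟨x, hx⟩) ?_)) ?_
      · simp
      · simp
    · refine Eq.trans (congrArg θ (Subtype.ext ?_)) (ev_X).symm
      simp
  exact congrArg (· p) this

/-- The function field of a curve on a surface whose local ring is that of the plane curve
`g = 0`. -/
lemma isCurveField (h : IsResidueMap ψ i t θ)
    (hψ : ψ ≫ t = Spec.map (CommRingCat.ofHom (algebraMap ℂ K))) {x y : K} (hxy : IsPlaneField x y)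
    {g : A2} {P : Ideal A2} [P.IsPrime] (hP : P = Ideal.span {g}) (hR : R = locAt (ev x y) P) :
    letI := stalkAlgebra (i ≫ t) (genericPoint E)
    ∃ (hx : x ∈ R) (hy : y ∈ R), IsCurveField g (θ ⟨x, hx⟩) (θ ⟨y, hy⟩) := by
  let := stalkAlgebra (i ≫ t) (genericPoint E)
  have hm : ∀ p, ev x y p ∈ R := fun p ↦ hR ▸ apply_mem_locAt p
  have hx : x ∈ R := by simpa using hm (Polynomial.C Polynomial.X)
  have hy : y ∈ R := by simpa using hm Polynomial.X
  have hgens : gens x y ⊆ R := gens_subset_iff.mpr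
    ⟨fun c ↦ by simpa using hm (Polynomial.C (Polynomial.C c)), hx, hy⟩
  have key : ∀ p, ev (θ ⟨x, hx⟩) (θ ⟨y, hy⟩) p = 0 ↔ p ∈ P := by
    intro p
    rw [← h.map_ev hψ hx hy hgens, h.eq_zero_iff]
    by_cases hp0 : p = 0
    · simp [hp0]
    have h0 : ev x y p ≠ 0 := fun h0 ↦ hp0 (hxy.injective (h0.trans (map_zero _).symm))
    change (ev x y p = 0 ∨ (ev x y p)⁻¹ ∉ R) ↔ _
    rw [hR, inv_mem_locAt_iff hxy.injective hp0]
    simp [h0]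
  refine ⟨hx, hy, fun p ↦ by rw [key, hP, Ideal.mem_span_singleton], fun w ↦ ?_⟩
  obtain ⟨⟨z, hz⟩, rfl⟩ := h.surjective w
  obtain ⟨n, d, hd, e⟩ := mem_locAt.mp (hR ▸ hz)
  refine ⟨n, d, (key d).not.mpr hd, ?_⟩
  rw [← h.map_ev hψ hx hy hgens, ← h.map_ev hψ hx hy hgens, ← map_mul]
  exact congrArg θ (Subtype.ext e)

end IsResidueMap

end

end

section

/-! ### Plane cubic curves -/

section

variable {a : Fin 3 → MvPolynomial (Fin 3) ℂ}

lemma IsCoordinateSystem.prime (ha : IsCoordinateSystem a) (i : Fin 3) : Prime (a i) := by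
  refine (MvPolynomial.irreducible_of_totalDegree_eq_one
    ((ha.1 i).totalDegree (ha.ne_zero i)) fun c hc ↦ isUnit_iff_ne_zero.mpr ?_).prime
  rintro rfl
  exact ha.ne_zero i (MvPolynomial.ext _ _ fun m ↦ by simpa using hc m)

lemma IsCoordinateSystem.dehom_cubicForm (ha : IsCoordinateSystem a) (l : ℂ) :
    ha.dehom (cubicForm a l) = cubicPoly l := by
  rw [map_cubicForm, ha.dehom_zero, ha.dehom_one, ha.dehom_two, cubicPoly, cuspPoly, one_pow,
    one_mul, mul_one, map_pow]
  rfl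

/-- A form is divisible by a cubic form as soon as this holds in the affine coordinates. -/
lemma IsCoordinateSystem.mem_span_cubicForm (ha : IsCoordinateSystem a) {l : ℂ} {d : ℕ}
    {G : MvPolynomial (Fin 3) ℂ} (hG : G.IsHomogeneous d) (h : cubicPoly l ∣ ha.dehom G) :
    G ∈ Ideal.span {cubicForm a l} := by
  obtain ⟨q, hq⟩ := h
  obtain ⟨N, hN⟩ := ha.exists_hom q
  obtain ⟨Q, hQ, rfl⟩ := hN (N + d) (by omega)
  have h2 : (a 2 ^ (N + 3)).IsHomogeneous (N + 3) := by simpa using (ha.1 2).pow (N + 3)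
  have h3 : (cubicForm a l * Q).IsHomogeneous (N + 3 + d) := by
    have := (isHomogeneous_cubicForm ha l).mul hQ
    rwa [show 3 + (N + d) = N + 3 + d by ring] at this
  have h4 : a 2 ^ (N + 3) * G - cubicForm a l * Q = 0 := by
    refine ha.dehom_injective ((h2.mul hG).sub h3) ?_
    rw [map_sub, map_mul, map_mul, map_pow, ha.dehom_two, hq, ha.dehom_cubicForm]
    ring
  rw [sub_eq_zero] at h4
  have h5 : ¬ a 2 ∣ cubicForm a l := by
    obtain ⟨f, hf⟩ := ha.exists_algHom (S := ℂ) ![1, 0, 0]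
    have := notMem_span_of_algHom f (F := a 2) (G := cubicForm a l) (by simp [hf])
      (by rw [map_cubicForm]; simp [hf])
    rwa [Ideal.mem_span_singleton] at this
  obtain ⟨Q', rfl⟩ := (ha.prime 2).pow_dvd_of_dvd_mul_left (N + 3) h5 (Dvd.intro _ h4)
  rw [Ideal.mem_span_singleton]
  refine ⟨Q', mul_left_cancel₀ (pow_ne_zero (N + 3) (ha.ne_zero 2)) (h4.trans (by ring))⟩

lemma IsCoordinateSystem.homIdeal_eq_span (ha : IsCoordinateSystem a) {l : ℂ} {c : Plane}
    (hc : ∀ d G, G.IsHomogeneous d → (G ∈ homIdeal c ↔ cubicPoly l ∣ ha.dehom G)) :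
    homIdeal c = Ideal.span {cubicForm a l} := by
  refine le_antisymm (homIdeal_le fun d G hG hGc ↦ ha.mem_span_cubicForm hG ((hc d G hG).mp hGc)) ?_
  rw [Ideal.span_singleton_le_iff_mem]
  exact (hc 3 _ (isHomogeneous_cubicForm ha l)).mpr (ha.dehom_cubicForm l ▸ dvd_rfl)

lemma mem_zeroLocus_iff {y : Plane} {F : MvPolynomial (Fin 3) ℂ} :
    y ∈ ProjectiveSpectrum.zeroLocus planeGrading {F} ↔ F ∈ homIdeal y :=
  (ProjectiveSpectrum.mem_zeroLocus planeGrading y {F}).trans Set.singleton_subset_iff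

lemma closure_eq_zeroLocus {c : Plane} {F : MvPolynomial (Fin 3) ℂ}
    (hc : homIdeal c = Ideal.span {F}) :
    closure ({c} : Set Plane) = ProjectiveSpectrum.zeroLocus planeGrading {F} := by
  ext y
  rw [← specializes_iff_mem_closure, specializes_iff_homIdeal_le, hc,
    Ideal.span_singleton_le_iff_mem]
  exact mem_zeroLocus_iff.symm

lemma exists_coord_notMem (ha : IsCoordinateSystem a) (y : Plane) : ∃ i, a i ∉ homIdeal y := by
  by_contra! h
  have h1 : ∀ i, (MvPolynomial.X i : MvPolynomial (Fin 3) ℂ) ∈ homIdeal y := by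
    intro i
    have : (MvPolynomial.X i : MvPolynomial (Fin 3) ℂ) ∈ Submodule.span ℂ (Set.range a) :=
      ha.span_eq ▸ MvPolynomial.isHomogeneous_X ℂ i
    have hle : Submodule.span ℂ (Set.range a) ≤ (homIdeal y).restrictScalars ℂ := by
      rw [Submodule.span_le]
      rintro _ ⟨j, rfl⟩
      exact h j
    exact hle this
  apply (show ProjectiveSpectrum planeGrading from y).not_irrelevant_le
  refine HomogeneousIdeal.toIdeal_irrelevant_le _ |>.mpr fun d hd G hG ↦ ?_
  have hG' : G.IsHomogeneous d := hG
  rw [G.as_sum]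
  refine Ideal.sum_mem _ fun m hm ↦ ?_
  have hm0 : m ≠ 0 := by
    rintro rfl
    have := hG' (MvPolynomial.mem_support_iff.mp hm)
    simp at this
    omega
  obtain ⟨i, hi⟩ := Finsupp.ne_iff.mp hm0
  rw [Finsupp.coe_zero, Pi.zero_apply] at hi
  exact Ideal.mem_of_dvd _ ((MvPolynomial.X_dvd_monomial).mpr (.inr hi)) (h1 i)

end

instance : IsProper planeStr := by
  have h0 : IsScalarTower ℂ (planeGrading 0) (MvPolynomial (Fin 3) ℂ) :=
    ⟨fun c x y ↦ smul_mul_assoc c (x : MvPolynomial (Fin 3) ℂ) y⟩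
  have h1 : Algebra.FiniteType (planeGrading 0) (MvPolynomial (Fin 3) ℂ) :=
    Algebra.FiniteType.of_restrictScalars_finiteType ℂ _ _
  have h2 : Function.Bijective (algebraMap ℂ (planeGrading 0)) := by
    refine ⟨fun c c' h ↦ MvPolynomial.C_injective _ _ (congrArg Subtype.val h), fun ⟨G, hG⟩ ↦ ?_⟩
    have hG' : G.IsHomogeneous 0 := hG
    refine ⟨G.coeff 0, Subtype.ext ?_⟩
    exact ((MvPolynomial.totalDegree_eq_zero_iff_eq_C).mp
      (Nat.le_zero.mp hG'.totalDegree_le)).symm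
  have h3 : IsIso (CommRingCat.ofHom (algebraMap ℂ (planeGrading 0))) :=
    (RingEquiv.ofBijective _ h2).toCommRingCatIso.isIso_hom
  unfold planeStr
  infer_instance

lemma isReduced_stalk_of_isAffineOpen {Z : Scheme.{0}} {V : Z.Opens} (hV : IsAffineOpen V)
    (h : _root_.IsReduced Γ(Z, V)) (e : V) : _root_.IsReduced (Z.presheaf.stalk e.1) :=
  have := hV.isLocalization_stalk e
  isReduced_localizationPreserves (hV.primeIdealOf e).asIdeal.primeCompl _ h

/-- Every point of a scheme is the generic point of an integral closed subscheme. -/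
lemma exists_isClosedImmersion {Z : Scheme.{0}} (c : Z) :
    ∃ (E : Scheme.{0}) (_ : IsIntegral E) (j : E ⟶ Z), IsClosedImmersion j ∧
      j (genericPoint E) = c ∧ Set.range j = closure {c} := by
  let f : Spec (Z.residueField c) ⟶ Z := Z.fromSpecResidueField c
  have hf : Set.range f = {c} := Scheme.range_fromSpecResidueField c
  have : QuasiCompact f := ⟨fun U _ _ ↦ (Set.toFinite _).isCompact⟩
  have h1 : IrreducibleSpace f.image := by
    have : PreirreducibleSpace f.image := by
      refine ⟨?_⟩
      rw [← (Scheme.Hom.denseRange f.toImage).closure_range, ← Set.image_univ]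
      exact ((PreirreducibleSpace.isPreirreducible_univ).image _
        f.toImage.continuous.continuousOn).closure
    exact ⟨⟨f.toImage (genericPoint _)⟩⟩
  have h2 : IsReduced f.image := by
    have (x : f.image) : _root_.IsReduced (f.image.presheaf.stalk x) := by
      obtain ⟨U, hU, hxU, -⟩ := exists_isAffineOpen_mem_and_subset (x := f.imageι x) (U := ⊤) trivial
      have h3 : _root_.IsReduced Γ(f.image, f.imageι ⁻¹ᵁ U) :=
        isReduced_of_injective _ (f.toImage_app_injective ⟨U, hU⟩)
      exact isReduced_stalk_of_isAffineOpen (hU.preimage f.imageι) h3 ⟨x, hxU⟩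
    exact isReduced_of_isReduced_stalk _
  have h3 : IsIntegral f.image := isIntegral_of_irreducibleSpace_of_isReduced _
  have h4 : Set.range f.imageι = closure {c} := by
    rw [← hf, ← Scheme.Hom.support_ker]
    exact Scheme.IdealSheafData.range_subschemeι _
  refine ⟨f.image, h3, f.imageι, inferInstance, ?_, h4⟩
  have h5 : closure ({f.imageι (genericPoint f.image)} : Set Z) = closure {c} := by
    rw [← h4, ← Set.image_univ, ← genericPoint_spec f.image |>.def, ← Set.image_singleton]
    exact (f.imageι.isClosedEmbedding.closure_image_eq _)
  exact ((specializes_iff_closure_subset.mpr h5.ge).antisymm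
    (specializes_iff_closure_subset.mpr h5.le)).eq

end

section

/-! ### Nonsingularity of the plane cubics -/

section

variable {K : Type} [Field K] {R : Subring K}

lemma inv_mem_of_nonunit_sub [IsLocalRing R] {a b : K} (ha : a ∈ R) (hb : b ∈ R) (hb0 : b ≠ 0)
    (hbi : b⁻¹ ∈ R) (h : a - b = 0 ∨ (a - b)⁻¹ ∉ R) : a ≠ 0 ∧ a⁻¹ ∈ R := by
  by_contra hc
  have ha' : a = 0 ∨ a⁻¹ ∉ R := by
    by_contra! h'
    exact hc h'
  have h1 : (b - a = 0 ∨ (b - a)⁻¹ ∉ R) := by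
    rw [← neg_sub, neg_eq_zero, inv_neg, neg_mem_iff]
    exact h
  have h2 := nonunit_add ha (sub_mem hb ha) ha' h1
  rw [add_sub_cancel] at h2
  exact h2.elim hb0 (· hbi)

lemma inv_aeval_mem [Algebra ℂ K] {x : K} (hc : ∀ c : ℂ, algebraMap ℂ K c ∈ R)
    (h : ∀ c : ℂ, (x - algebraMap ℂ K c)⁻¹ ∈ R) (p : Polynomial ℂ) :
    (Polynomial.aeval x p)⁻¹ ∈ R := by
  have h1 := (IsAlgClosed.splits p).eq_prod_roots
  let M : Submonoid (Polynomial ℂ) :=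
    { carrier := {p | (Polynomial.aeval x p)⁻¹ ∈ R}
      one_mem' := by simp [Set.mem_ofPred_eq]
      mul_mem' := fun hp hq ↦ by
        rw [Set.mem_ofPred_eq] at hp hq ⊢
        rw [map_mul, mul_inv]
        exact mul_mem hp hq }
  have h2 : p ∈ M := by
    rw [h1]
    refine mul_mem ?_ (M.multiset_prod_mem _ ?_)
    · change (Polynomial.aeval x (Polynomial.C _))⁻¹ ∈ R
      rw [Polynomial.aeval_C, ← map_inv₀]
      exact hc _
    · intro q hq
      obtain ⟨c, -, rfl⟩ := Multiset.mem_map.mp hq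
      change (Polynomial.aeval x (Polynomial.X - Polynomial.C c))⁻¹ ∈ R
      rw [map_sub, Polynomial.aeval_X, Polynomial.aeval_C]
      exact h c
  exact h2

end

section

variable {K : Type} [Field K] [Algebra ℂ K] {Z E : Scheme.{0}} [IsIntegral E]
  {ψ : Spec (.of K) ⟶ Z} {R S : Subring K} {i : E ⟶ Z} {t : Z ⟶ SpecC} {θ : R →+* E.functionField}
  {e : E}

namespace IsResidueMap

/-- A curve on a smooth surface is normal at a point where one of two local coordinates of the
surface is a multiple of the other one on the curve. -/
lemma valuationRing_of_eq (h : IsResidueMap ψ i t θ) [IsNoetherianRing (E.presheaf.stalk e)]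
    (hS : HasLocalRing ψ (i e) S) {u v : K} (huv : IsPlaneField u v) (hgen : EssGen (gens u v) S)
    (hu : u⁻¹ ∉ S) (hv : v⁻¹ ∉ S) {s r z : K} (hs : s ∈ S) (hr : r ∈ S) (hz : z ∈ S)
    (hz0 : z = 0 ∨ z⁻¹ ∉ R) (huvs : v = u * s + z * r) : ValuationRing (E.presheaf.stalk e) := by
  have := hS.isLocalRing
  have hO : S = locAt (ev u v) originIdeal := eq_locAt_origin hgen (.inr hu) (.inr hv)
  obtain ⟨hle, σ, hσ, hloc, hσθ⟩ := h.stalk e S hS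
  obtain ⟨-, huS, hvS⟩ := gens_subset_iff.mp hgen.1
  have hσz : σ ⟨z, hz⟩ = 0 := by
    apply IsFractionRing.injective (E.presheaf.stalk e) E.functionField
    rw [hσθ, map_zero, h.eq_zero_iff]
    exact hz0
  have hp : (IsLocalRing.maximalIdeal (E.presheaf.stalk e)).IsPrincipal := by
    refine ⟨σ ⟨u, huS⟩, le_antisymm (fun o ho ↦ ?_) ?_⟩
    · obtain ⟨w, rfl⟩ := hσ o
      have hw : ¬ IsUnit w := fun hw ↦ (IsLocalRing.mem_maximalIdeal _).mp ho (hw.map σ)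
      rw [isUnit_subring_iff] at hw
      refine Submodule.mem_span_singleton.mpr ?_
      by_cases hw0 : (w : K) = 0
      · exact ⟨0, by rw [show w = 0 from Subtype.ext hw0, map_zero, zero_smul]⟩
      have hw' : (w : K)⁻¹ ∉ S := fun h' ↦ hw ⟨hw0, h'⟩
      obtain ⟨c, hc, d, hd, hcd⟩ : ∃ c ∈ S, ∃ d ∈ S, (w : K) = u * c + v * d := by
        have : ∀ w' ∈ S, w'⁻¹ ∉ S → ∃ c ∈ S, ∃ d ∈ S, w' = u * c + v * d := by
          rw [hO]
          exact fun w' h1 h2 ↦ exists_eq_of_nonunit h1 h2 huv.injective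
        exact this w w.2 hw'
      have h1 : w = ⟨u, huS⟩ * (⟨c, hc⟩ + ⟨s, hs⟩ * ⟨d, hd⟩) + ⟨z, hz⟩ * (⟨r, hr⟩ * ⟨d, hd⟩) := by
        apply Subtype.ext
        change (w : K) = u * (c + s * d) + z * (r * d)
        rw [hcd, huvs]
        ring
      refine ⟨σ (⟨c, hc⟩ + ⟨s, hs⟩ * ⟨d, hd⟩), ?_⟩
      conv_rhs => rw [h1, map_add, map_mul, map_mul, hσz, zero_mul, add_zero]
      rw [smul_eq_mul, mul_comm]
    · rw [Submodule.span_singleton_le_iff_mem]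
      refine (IsLocalRing.mem_maximalIdeal _).mpr fun hun ↦ hu ?_
      exact ((isUnit_subring_iff _).mp (hun.of_map σ _)).2
  exact ((tfae_of_isNoetherianRing_of_isLocalRing_of_isDomain _).out 4 1).mp hp

/-- The cubic `y² = x³ + l` is nonsingular at infinity, with the coordinates `u = x / y` and
`w = 1 / y`. -/
lemma valuationRing_at_infinity (h : IsResidueMap ψ i t θ)
    [IsNoetherianRing (E.presheaf.stalk e)] (hS : HasLocalRing ψ (i e) S) {u w : K} {l : ℂ}
    (huv : IsPlaneField u w) (hgen : EssGen (gens u w) S) (hu : u⁻¹ ∉ S) (hw : w⁻¹ ∉ S)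
    (hz : w - u ^ 3 - algebraMap ℂ K l * w ^ 3 = 0 ∨
      (w - u ^ 3 - algebraMap ℂ K l * w ^ 3)⁻¹ ∉ R) :
    ValuationRing (E.presheaf.stalk e) := by
  have := hS.isLocalRing
  obtain ⟨hc, huS, hwS⟩ := gens_subset_iff.mp hgen.1
  have hq : 1 - algebraMap ℂ K l * w ^ 2 ∈ S :=
    sub_mem (one_mem S) (mul_mem (hc l) (pow_mem hwS 2))
  obtain ⟨hq0, hqi⟩ := inv_mem_of_nonunit_sub hq (one_mem S) one_ne_zero
    (by rw [inv_one]; exact one_mem S) (by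
      have := nonunit_mul (a := w) (b := -(algebraMap ℂ K l * w))
        (neg_mem (mul_mem (hc l) hwS)) (.inr hw)
      rwa [show w * -(algebraMap ℂ K l * w) = 1 - algebraMap ℂ K l * w ^ 2 - 1 by ring] at this)
  refine h.valuationRing_of_eq hS huv hgen hu hw
    (s := u ^ 2 * (1 - algebraMap ℂ K l * w ^ 2)⁻¹) (r := (1 - algebraMap ℂ K l * w ^ 2)⁻¹)
    (mul_mem (pow_mem huS 2) hqi) hqi
    (sub_mem (sub_mem hwS (pow_mem huS 3)) (mul_mem (hc l) (pow_mem hwS 3))) hz ?_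
  rw [← mul_left_inj' hq0]
  simp only [add_mul, mul_assoc, inv_mul_cancel₀ hq0]
  ring

/-- The cubic `y² = x³ + l` with `l ≠ 0` is nonsingular in the affine plane. -/
lemma valuationRing_affine (h : IsResidueMap ψ i t θ)
    [IsNoetherianRing (E.presheaf.stalk e)] (hS : HasLocalRing ψ (i e) S) {x y : K} {l : ℂ}
    (hl : l ≠ 0) (hxy : IsPlaneField x y) (hgen : EssGen (gens x y) S)
    (hψ : ψ ≫ t = Spec.map (CommRingCat.ofHom (algebraMap ℂ K))) :
    letI := stalkAlgebra (i ≫ t) (genericPoint E)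
    ∀ (hx : x ∈ R) (hy : y ∈ R), IsCurveField (cubicPoly l) (θ ⟨x, hx⟩) (θ ⟨y, hy⟩) →
      ValuationRing (E.presheaf.stalk e) := by
  let := stalkAlgebra (i ≫ t) (genericPoint E)
  intro hx hy hE
  have := hS.isLocalRing
  obtain ⟨hle, σ, hσ, hloc, hσθ⟩ := h.stalk e S hS
  obtain ⟨hc, hxS, hyS⟩ := gens_subset_iff.mp hgen.1
  have hevθ := h.map_ev hψ hx hy (hgen.1.trans hle)
  by_cases hx0 : ∃ x₀ : ℂ, (x - algebraMap ℂ K x₀)⁻¹ ∉ S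
  · obtain ⟨x₀, hx₀⟩ := hx0
    -- the equation of the curve vanishes on it
    have hz : y ^ 2 - x ^ 3 - algebraMap ℂ K l = 0 ∨ (y ^ 2 - x ^ 3 - algebraMap ℂ K l)⁻¹ ∉ R := by
      rw [← ev_cubicPoly]
      refine (h.eq_zero_iff ⟨ev x y (cubicPoly l), ev_mem (hgen.1.trans hle) _⟩).mp ?_
      rw [hevθ, hE.eq_zero_iff]
    have hzS : y ^ 2 - x ^ 3 - algebraMap ℂ K l ∈ S :=
      sub_mem (sub_mem (pow_mem hyS 2) (pow_mem hxS 3)) (hc l)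
    have hzS' : y ^ 2 - x ^ 3 - algebraMap ℂ K l = 0 ∨ (y ^ 2 - x ^ 3 - algebraMap ℂ K l)⁻¹ ∉ S :=
      hz.imp_right fun h' h'' ↦ h' (hle h'')
    have hqS : x ^ 2 + x * algebraMap ℂ K x₀ + algebraMap ℂ K x₀ ^ 2 ∈ S :=
      add_mem (add_mem (pow_mem hxS 2) (mul_mem hxS (hc _))) (pow_mem (hc _) 2)
    -- One of the two square roots of `x₀³ + l` is the value of `y` at the point.
    obtain ⟨y₀, hy₀, hy0⟩ : ∃ y₀ : ℂ, (y - algebraMap ℂ K y₀)⁻¹ ∉ S ∧ y₀ ^ 2 = x₀ ^ 3 + l := by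
      obtain ⟨y₀, hy₀⟩ := IsAlgClosed.exists_pow_nat_eq (x₀ ^ 3 + l) (n := 2) (by norm_num)
      by_cases h1 : (y - algebraMap ℂ K y₀)⁻¹ ∈ S
      · by_cases h2 : (y - algebraMap ℂ K (-y₀))⁻¹ ∈ S
        · exfalso
          have h3 := nonunit_add hzS (mul_mem (sub_mem hxS (hc x₀)) hqS) hzS'
            (nonunit_mul hqS (.inr hx₀))
          have h4 : y ^ 2 - x ^ 3 - algebraMap ℂ K l + (x - algebraMap ℂ K x₀) *
              (x ^ 2 + x * algebraMap ℂ K x₀ + algebraMap ℂ K x₀ ^ 2) =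
              (y - algebraMap ℂ K y₀) * (y - algebraMap ℂ K (-y₀)) := by
            have := congrArg (algebraMap ℂ K) hy₀
            simp only [map_add, map_pow] at this
            rw [map_neg]
            linear_combination this
          have hne (c : ℂ) : y - algebraMap ℂ K c ≠ 0 := by
            have := (hxy.sub (Polynomial.C c)).ne_zero_right
            rwa [Polynomial.aeval_C] at this
          rw [h4] at h3
          exact h3.elim (mul_ne_zero (hne _) (hne _))
            fun h3 ↦ h3 (by rw [mul_inv]; exact mul_mem h1 h2)
        · exact ⟨-y₀, h2, by rw [neg_sq, hy₀]⟩
      · exact ⟨y₀, h1, hy₀⟩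
    have hy0' : algebraMap ℂ K y₀ ^ 2 = algebraMap ℂ K x₀ ^ 3 + algebraMap ℂ K l := by
      rw [← map_pow, hy0, map_add, map_pow]
    have huv : IsPlaneField (x - algebraMap ℂ K x₀) (y - algebraMap ℂ K y₀) := by
      have := (((hxy.sub (Polynomial.C y₀)).swap).sub (Polynomial.C x₀)).swap
      rwa [Polynomial.aeval_C, Polynomial.aeval_C] at this
    have hgen' : EssGen (gens (x - algebraMap ℂ K x₀) (y - algebraMap ℂ K y₀)) S := by
      have hg := gens_subset_iff.mp (Subring.subset_closure
        (s := gens (x - algebraMap ℂ K x₀) (y - algebraMap ℂ K y₀)))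
      refine hgen.mono_closure (gens_subset_iff.mpr ⟨hg.1, ?_, ?_⟩)
        (gens_subset_iff.mpr ⟨hc, sub_mem hxS (hc _), sub_mem hyS (hc _)⟩)
      · simpa using add_mem hg.2.1 (hg.1 x₀)
      · simpa using add_mem hg.2.2 (hg.1 y₀)
    by_cases hy00 : y₀ = 0
    · -- at a point of order two, `y` is a local parameter
      have hx00 : x₀ ≠ 0 := by
        rintro rfl
        rw [hy00] at hy0
        exact hl (by simpa using hy0.symm)
      rw [hy00, map_zero, sub_zero] at huv hgen' hy₀
      rw [hy00, map_zero] at hy0'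
      obtain ⟨hq0, hqi⟩ := inv_mem_of_nonunit_sub hqS (b := algebraMap ℂ K (3 * x₀ ^ 2)) (hc _)
        ((map_ne_zero _).mpr (mul_ne_zero three_ne_zero (pow_ne_zero 2 hx00))) (by rw [← map_inv₀]; exact hc _) (by
          have := nonunit_mul (b := x + 2 * algebraMap ℂ K x₀)
            (add_mem hxS (mul_mem (ofNat_mem S 2) (hc x₀))) (.inr hx₀)
          rw [map_mul, map_pow, map_ofNat]
          convert this using 3 <;> ring)
      refine h.valuationRing_of_eq hS huv.swap (by rwa [gens, Set.pair_comm, ← gens]) hy₀ hx₀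
        (s := y * (x ^ 2 + x * algebraMap ℂ K x₀ + algebraMap ℂ K x₀ ^ 2)⁻¹)
        (r := -(x ^ 2 + x * algebraMap ℂ K x₀ + algebraMap ℂ K x₀ ^ 2)⁻¹)
        (mul_mem hyS hqi) (neg_mem hqi) hzS hz ?_
      rw [← mul_left_inj' hq0]
      simp only [add_mul, mul_assoc, neg_mul, mul_neg, inv_mul_cancel₀ hq0]
      linear_combination hy0'
    · -- otherwise `x` is a local parameter
      have hq : y + algebraMap ℂ K y₀ ∈ S := add_mem hyS (hc _)
      obtain ⟨hq0, hqi⟩ := inv_mem_of_nonunit_sub hq (b := algebraMap ℂ K (2 * y₀)) (hc _)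
        ((map_ne_zero _).mpr (mul_ne_zero two_ne_zero hy00)) (by rw [← map_inv₀]; exact hc _) (by
          rw [map_mul, map_ofNat, show y + algebraMap ℂ K y₀ - 2 * algebraMap ℂ K y₀ =
            y - algebraMap ℂ K y₀ by ring]
          exact .inr hy₀)
      refine h.valuationRing_of_eq hS huv hgen' hx₀ hy₀
        (s := (x ^ 2 + x * algebraMap ℂ K x₀ + algebraMap ℂ K x₀ ^ 2) * (y + algebraMap ℂ K y₀)⁻¹)
        (r := (y + algebraMap ℂ K y₀)⁻¹) (mul_mem hqS hqi) hqi hzS hz ?_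
      rw [← mul_left_inj' hq0]
      simp only [add_mul, mul_assoc, inv_mul_cancel₀ hq0]
      linear_combination -hy0'
  · -- the local ring contains `ℂ(x)` and hence the function field
    push Not at hx0
    have hsurj : ∀ w, ∃ o, algebraMap (E.presheaf.stalk e) E.functionField o = w := by
      intro w
      obtain ⟨n, d, hd, hw⟩ := hE.exists_fraction w
      obtain ⟨q, hq⟩ : ∃ q, d = d %ₘ cubicPoly l + cubicPoly l * q :=
        ⟨_, (Polynomial.modByMonic_add_div d (cubicPoly l)).symm⟩
      have hdeg : (d %ₘ cubicPoly l).natDegree ≤ 1 := by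
        have := Polynomial.natDegree_modByMonic_lt d (monic_cubicPoly l) fun h1 ↦ by
          have := natDegree_cubicPoly l
          rw [h1, Polynomial.natDegree_one] at this
          omega
        rw [natDegree_cubicPoly] at this
        omega
      obtain ⟨β, α, hαβ⟩ := Polynomial.exists_eq_X_add_C_of_natDegree_le_one hdeg
      have hf := (hE.eq_zero_iff (cubicPoly l)).mpr dvd_rfl
      have hd1 : ev (θ ⟨x, hx⟩) (θ ⟨y, hy⟩) d = Polynomial.aeval (θ ⟨x, hx⟩) β * θ ⟨y, hy⟩ +
          Polynomial.aeval (θ ⟨x, hx⟩) α := by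
        rw [hq, map_add, map_mul, hf, zero_mul, add_zero, hαβ]
        simp
      let d' : A2 := Polynomial.C α - Polynomial.C β * Polynomial.X
      -- `N` is the norm over `ℂ(x)` of the denominator `β y + α`, and `d'` its conjugate.
      let N : Polynomial ℂ := α ^ 2 - β ^ 2 * (Polynomial.X ^ 3 + Polynomial.C l)
      have hN : Polynomial.aeval (θ ⟨x, hx⟩) N = ev (θ ⟨x, hx⟩) (θ ⟨y, hy⟩) d *
          ev (θ ⟨x, hx⟩) (θ ⟨y, hy⟩) d' := by
        have := hE.relation
        rw [hd1]
        simp only [N, d', map_sub, map_mul, map_add, map_pow, ev_C, ev_X, Polynomial.aeval_X,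
          Polynomial.aeval_C]
        linear_combination (Polynomial.aeval (θ ⟨x, hx⟩) β) ^ 2 * this
      have hN0 : N ≠ 0 := by
        intro hN0
        rw [hN0, map_zero, eq_comm, mul_eq_zero, or_iff_right hd, hE.eq_zero_iff] at hN
        have hd' : d' = 0 := by
          refine Polynomial.eq_zero_of_dvd_of_natDegree_lt hN ?_
          rw [natDegree_cubicPoly]
          refine lt_of_le_of_lt (b := 1) ?_ one_lt_two
          simp only [d']
          compute_degree
        have hα : α = 0 := by simpa [d'] using congrArg (Polynomial.coeff · 0) hd'
        have hβ : β = 0 := by simpa [d'] using congrArg (Polynomial.coeff · 1) hd'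
        exact hd (by rw [hd1, hα, hβ]; simp)
      have hNi := inv_aeval_mem hc hx0 N
      have hNx : Polynomial.aeval x N ≠ 0 := by
        intro h0
        exact hN0 (Polynomial.C_injective ((hxy.injective (by simpa using h0)).trans
          (map_zero _).symm))
      have h0 : Polynomial.aeval (θ ⟨x, hx⟩) N ≠ 0 := by
        rw [← ev_C (y := θ ⟨y, hy⟩), ← hevθ, Ne, h.eq_zero_iff, not_or, not_not]
        change ev x y (Polynomial.C N) ≠ 0 ∧ (ev x y (Polynomial.C N))⁻¹ ∈ R
        rw [ev_C]
        exact ⟨hNx, hle hNi⟩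
      let r : S := ⟨ev x y n, ev_mem hgen.1 n⟩ * ⟨ev x y d', ev_mem hgen.1 d'⟩ * ⟨_, hNi⟩
      refine ⟨σ r, (hσθ r).trans (mul_right_cancel₀ h0 ?_)⟩
      have h1 : θ (Subring.inclusion hle r) * Polynomial.aeval (θ ⟨x, hx⟩) N =
          ev (θ ⟨x, hx⟩) (θ ⟨y, hy⟩) (n * d') := by
        rw [← ev_C (y := θ ⟨y, hy⟩), ← hevθ, ← hevθ, ← map_mul]
        refine congrArg θ (Subtype.ext ?_)
        change ev x y n * ev x y d' * (Polynomial.aeval x N)⁻¹ * ev x y (Polynomial.C N) =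
          ev x y (n * d')
        rw [ev_C, mul_assoc, inv_mul_cancel₀ hNx, mul_one, map_mul]
      rw [h1, hN, map_mul, ← hw, mul_assoc]
    rw [ValuationRing.iff_isInteger_or_isInteger (E.presheaf.stalk e) E.functionField]
    exact fun w ↦ .inl (hsurj w)

end IsResidueMap

end

end

section

/-! ### Curves with the function field of a plane cubic -/

section

variable {E E' : Scheme.{0}} [IsIntegral E] [IsIntegral E'] {t : E ⟶ SpecC} {t' : E' ⟶ SpecC}

lemma IsNormalCurve.exists_iso_of_ringEquiv (h : IsNormalCurve t) (h' : IsNormalCurve t') :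
    letI := stalkAlgebra t (genericPoint E)
    letI := stalkAlgebra t' (genericPoint E')
    (∃ e : E.functionField ≃+* E'.functionField,
      ∀ c, e (algebraMap ℂ E.functionField c) = algebraMap ℂ E'.functionField c) →
    ∃ f : E ≅ E', f.hom ≫ t' = t := by
  let := stalkAlgebra t (genericPoint E)
  let := stalkAlgebra t' (genericPoint E')
  rintro ⟨e, he⟩
  let i : E.functionField ≅ E'.functionField := e.toCommRingCatIso
  let θ : Spec E.functionField ≅ Spec E'.functionField :=
    ⟨Spec.map i.inv, Spec.map i.hom, by rw [← Spec.map_comp, i.hom_inv_id, Spec.map_id],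
      by rw [← Spec.map_comp, i.inv_hom_id, Spec.map_id]⟩
  refine h.nonempty_iso h' θ ?_
  have h1 : CommRingCat.ofHom (algebraMap ℂ E'.functionField) ≫ i.inv =
      CommRingCat.ofHom (algebraMap ℂ E.functionField) := by
    ext c
    exact (e.symm_apply_eq).mpr (he c).symm
  rw [fromSpecStalk_comp_structure (s := t), fromSpecStalk_comp_structure (s := t')]
  exact (Spec.map_comp _ _).symm.trans (congrArg Spec.map h1)

/-- Normal proper curves with the same affine equation are isomorphic. -/
lemma IsNormalCurve.exists_iso_of_isCurveField (h : IsNormalCurve t) (h' : IsNormalCurve t')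
    {g : A2} :
    letI := stalkAlgebra t (genericPoint E)
    letI := stalkAlgebra t' (genericPoint E')
    ∀ {x y : E.functionField} {x' y' : E'.functionField}, IsCurveField g x y →
      IsCurveField g x' y' → ∃ f : E ≅ E', f.hom ≫ t' = t := by
  let := stalkAlgebra t (genericPoint E)
  let := stalkAlgebra t' (genericPoint E')
  intro x y x' y' hE hE'
  exact h.exists_iso_of_ringEquiv h' (hE.exists_ringEquiv hE')

end

section

variable {K : Type} [Field K] [Algebra ℂ K] {ψ : Spec (.of K) ⟶ Plane}
  {Φ : MvPolynomial (Fin 3) ℂ →ₐ[ℂ] K} {a : Fin 3 → MvPolynomial (Fin 3) ℂ}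

lemma IsGenericEval.hasLocalRing_top (h : IsGenericEval ψ Φ) {η : Plane} (hη : homIdeal η = ⊥) :
    HasLocalRing ψ η ⊤ := by
  obtain ⟨R, hR, hRη⟩ := h.exists_ring η
  have : R = ⊤ := by
    rw [eq_top_iff]
    intro z _
    obtain ⟨d, G, H, hG, hH, hH0, hz⟩ := h.exists_fraction z
    refine hR.ge ⟨d, G, H, hG, hH, ?_, hz⟩
    rw [hη, Ideal.mem_bot]
    rintro rfl
    exact hH0 (map_zero _)
  exact this ▸ hRη

/-- The plane cubic `a₂a₁² = a₀³ + l a₂³` with `l ≠ 0`, as a reduced subscheme of the plane, is a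
normal curve, with the expected function field. -/
lemma IsGenericEval.exists_planeCubic (h : IsGenericEval ψ Φ) (ha : IsCoordinateSystem a)
    (h2 : Φ (a 2) = 1) (hψ : ψ ≫ planeStr = Spec.map (CommRingCat.ofHom (algebraMap ℂ K))) {l : ℂ}
    (hl : l ≠ 0) :
    ∃ (E : Scheme.{0}) (_ : IsIntegral E) (j : E ⟶ Plane), IsClosedImmersion j ∧
      Set.range j = ProjectiveSpectrum.zeroLocus planeGrading {cubicForm a l} ∧
      IsNormalCurve (j ≫ planeStr) ∧
      (letI := stalkAlgebra (j ≫ planeStr) (genericPoint E)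
      ∃ x y : E.functionField, IsCurveField (cubicPoly l) x y) := by
  have hP := isPrime_span (prime_cubicPoly l)
  obtain ⟨c, hc2, hc⟩ := exists_point ha (Ideal.span {cubicPoly l})
  have hcI := ha.homIdeal_eq_span fun d G hG ↦ (hc d G hG).trans Ideal.mem_span_singleton
  obtain ⟨E, hE, j, hj, hjc, hrange⟩ := exists_isClosedImmersion c
  have hF3 := isHomogeneous_cubicForm ha l
  have hxy := h.isPlaneField ha h2
  have hy0 := hxy.ne_zero_right
  obtain ⟨R, -, hR⟩ := h.exists_ring c
  have hR' := h.eq_locAt ha h2 hc2 hR _ hc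
  obtain ⟨θ, hθ⟩ := exists_isResidueMap j planeStr (hjc.symm ▸ hR)
  obtain ⟨hx, hy, hcf⟩ := hθ.isCurveField hψ hxy rfl hR'
  rw [closure_eq_zeroLocus hcI] at hrange
  refine ⟨E, hE, j, hj, hrange, ⟨inferInstance, fun e ↦ ?_⟩, _, _, hcf⟩
  have : IsLocallyNoetherian E := LocallyOfFiniteType.isLocallyNoetherian (j ≫ planeStr)
  obtain ⟨S, -, hS⟩ := h.exists_ring (j e)
  have hFe : cubicForm a l ∈ homIdeal (j e) :=
    mem_zeroLocus_iff.mp (hrange ▸ Set.mem_range_self e)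
  by_cases h2e : a 2 ∈ homIdeal (j e)
  · have h0e : a 0 ∈ homIdeal (j e) := by
      refine Ideal.IsPrime.mem_of_pow_mem inferInstance 3 ?_
      have h1 : a 0 ^ 3 = a 2 * (a 1 ^ 2 - MvPolynomial.C l * a 2 ^ 2) - cubicForm a l := by
        rw [cubicForm]
        ring
      exact h1 ▸ sub_mem (Ideal.mul_mem_right _ _ h2e) hFe
    have h1e : a 1 ∉ homIdeal (j e) := by
      obtain ⟨i, hi⟩ := exists_coord_notMem ha (j e)
      fin_cases i
      · exact absurd h0e hi
      · exact hi
      · exact absurd h2e hi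
    have h1c : a 1 ^ 3 ∉ homIdeal c := fun h' ↦ h1e <| by
      have hsp : c ⤳ j e := by
        rw [specializes_iff_mem_closure, closure_eq_zeroLocus hcI]
        exact mem_zeroLocus_iff.mpr hFe
      exact specializes_iff_homIdeal_le.mp hsp (Ideal.IsPrime.mem_of_pow_mem inferInstance 3 h')
    have e1 := h.essGen (ha.perm (Equiv.swap 1 2)) (y := j e) (by simpa using h1e) hS
    have e3 : (Equiv.swap (1 : Fin 3) 2) 0 = 0 := by decide
    simp only [Function.comp_apply, Equiv.swap_apply_left, Equiv.swap_apply_right, e3] at e1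
    have hu := (h.nonunit_iff hS (ha.1 0) (ha.1 1) h1e).mpr h0e
    have hw := (h.nonunit_iff hS (ha.1 2) (ha.1 1) h1e).mpr h2e
    have hz := (h.nonunit_iff hR hF3 (by simpa using (ha.1 1).pow 3) h1c).mpr
      (hcI ▸ Ideal.mem_span_singleton_self _)
    have hzw : Φ (cubicForm a l) / Φ (a 1 ^ 3) = (Φ (a 1))⁻¹ - (Φ (a 0) / Φ (a 1)) ^ 3 -
        algebraMap ℂ K l * (Φ (a 1))⁻¹ ^ 3 := by
      rw [map_cubicForm, h2, map_pow]
      field_simp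
    rw [hzw] at hz
    rw [h2, one_div] at e1 hw
    exact hθ.valuationRing_at_infinity hS hxy.infinity e1
      (hu.resolve_left hxy.infinity.ne_zero_left) (hw.resolve_left hxy.infinity.ne_zero_right) hz
  · have e1 := h.essGen ha h2e hS
    rw [h2, div_one, div_one] at e1
    exact hθ.valuationRing_affine hS hl hxy e1 hψ hx hy hcf

/-- A normal curve with the function field of `y² = x³ + l` is the plane cubic with this
equation. -/
lemma IsNormalCurve.isPlaneCurve {E : Scheme.{0}} [IsIntegral E] {t : E ⟶ SpecC}
    (ht : IsNormalCurve t) (h : IsGenericEval ψ Φ)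
    (hψ : ψ ≫ planeStr = Spec.map (CommRingCat.ofHom (algebraMap ℂ K)))
    (ha : IsCoordinateSystem a) {l : ℂ} (hl : l ≠ 0) :
    letI := stalkAlgebra t (genericPoint E)
    ∀ {x y : E.functionField}, IsCurveField (cubicPoly l) x y → IsPlaneCurve t (cubicForm a l) := by
  let := stalkAlgebra t (genericPoint E)
  intro x y hxy
  obtain ⟨η, hη⟩ := exists_homIdeal_eq_bot ha
  obtain ⟨Φ', h', h2⟩ := exists_isGenericEval hη (h.hasLocalRing_top hη) hψ (ha.1 2) (ha.ne_zero 2)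
  obtain ⟨E', hE', j, hj, hrange, ht', x', y', hxy'⟩ := h'.exists_planeCubic ha h2 hψ hl
  obtain ⟨f, hf⟩ := ht.exists_iso_of_isCurveField ht' hxy hxy'
  refine ⟨inferInstance, f.hom ≫ j, inferInstance, by rw [Category.assoc, hf], ?_⟩
  rw [← hrange, Scheme.Hom.comp_base, TopCat.coe_comp, Set.range_comp, f.hom.surjective.range_eq,
    Set.image_univ]

lemma isCoordinateSystem_X : IsCoordinateSystem (MvPolynomial.X : Fin 3 → MvPolynomial (Fin 3) ℂ) :=
  ⟨fun i ↦ MvPolynomial.isHomogeneous_X ℂ i, MvPolynomial.linearIndependent_X _ _⟩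

lemma IsNormalCurve.hasJInvariant {E : Scheme.{0}} [IsIntegral E] {t : E ⟶ SpecC}
    (ht : IsNormalCurve t) (h : IsGenericEval ψ Φ)
    (hψ : ψ ≫ planeStr = Spec.map (CommRingCat.ofHom (algebraMap ℂ K))) {l : ℂ} (hl : l ≠ 0) :
    letI := stalkAlgebra t (genericPoint E)
    ∀ {x y : E.functionField}, IsCurveField (cubicPoly l) x y → HasJInvariant t 0 := by
  let := stalkAlgebra t (genericPoint E)
  intro x y hxy
  let W : WeierstrassCurve ℂ := ⟨0, 0, 0, 0, l⟩
  have hΔ : W.Δ = -432 * l ^ 2 := by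
    simp [W, WeierstrassCurve.Δ, WeierstrassCurve.b₂, WeierstrassCurve.b₄, WeierstrassCurve.b₆,
      WeierstrassCurve.b₈]
    ring
  have hW : W.IsElliptic := ⟨by rw [hΔ, isUnit_iff_ne_zero]; simpa using hl⟩
  have hF : cubicForm MvPolynomial.X l = WeierstrassCurve.Projective.polynomial W := by
    simp [cubicForm, WeierstrassCurve.Projective.polynomial, W]
    ring
  refine ⟨W, hW, ?_, hF ▸ ht.isPlaneCurve h hψ isCoordinateSystem_X hl hxy⟩
  rw [WeierstrassCurve.j_eq_zero_iff]
  simp [W, WeierstrassCurve.c₄, WeierstrassCurve.b₂, WeierstrassCurve.b₄]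

end

end

section

/-! ### The members of the pencil -/

instance : originIdeal.IsMaximal :=
  RingHom.ker_isMaximal_of_surjective _ fun c ↦ ⟨Polynomial.C (Polynomial.C c), by simp⟩

/-- The point where the cubic `y² = x³` is singular: `y / x` is not regular there. -/
lemma not_cubicPoly_zero_dvd {n d : A2} (hd : d ∉ originIdeal) :
    ¬ cubicPoly 0 ∣ Polynomial.X * d - Polynomial.C Polynomial.X * n := by
  rintro ⟨q, hq⟩
  have h1 := congrArg (Polynomial.mapRingHom (Polynomial.evalRingHom (0 : ℂ))) hq
  simp only [cubicPoly, cuspPoly, map_sub, map_mul, map_pow, map_zero, sub_zero,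
    Polynomial.coe_mapRingHom, Polynomial.map_X, Polynomial.map_C, Polynomial.coe_evalRingHom,
    Polynomial.eval_X, zero_mul, ne_eq, OfNat.ofNat_ne_zero, not_false_eq_true, zero_pow] at h1
  rw [pow_two, mul_assoc] at h1
  have h2 := congrArg (Polynomial.eval 0) (mul_left_cancel₀ Polynomial.X_ne_zero h1)
  rw [Polynomial.eval_mul, Polynomial.eval_X, zero_mul] at h2
  refine hd ?_
  change Polynomial.evalEval 0 0 d = 0
  have h3 : Polynomial.evalEvalRingHom (0 : ℂ) 0 = (Polynomial.evalRingHom 0).comp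
      (Polynomial.mapRingHom (Polynomial.evalRingHom (0 : ℂ))) := by
    refine Polynomial.ringHom_ext' (Polynomial.ringHom_ext (fun a ↦ ?_) ?_) ?_ <;> simp
  exact (congrArg (· d) h3).trans h2

section

variable {X : Scheme.{0}} {s : X ⟶ SpecC}

lemma isSeparated_of_isProper [IsProper s] : X.IsSeparated := by
  have : IsSeparated (Limits.terminal.from X) := by
    rw [← Limits.terminal.comp_from s]
    infer_instance
  exact ⟨this⟩

variable {K : Type} [Field K] {ψ : Spec (.of K) ⟶ X}

/-- A curve on a surface contains every point whose local ring is contained in that of the curve. -/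
lemma mem_range_of_le [X.IsSeparated] (hall : ∀ z, ∃ R, HasLocalRing ψ z R) {E : Scheme.{0}}
    [IsIntegral E] (i : E ⟶ X) [IsClosedImmersion i] {R S : Subring K}
    (hR : HasLocalRing ψ (i (genericPoint E)) R) {z : X} (hz : HasLocalRing ψ z S) (hSR : S ≤ R)
    {t : Set K} (ht : EssGen t R) (htS : t ⊆ S) : ∃ e, i e = z := by
  have := hR.isLocalRing
  obtain ⟨z', hz', hR'⟩ := hz.exists_generalization hall hSR ht htS
  obtain rfl := hR'.eq_of_dom hR (Dom.refl R) (Dom.refl R)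
  exact hz'.mem_closed i.isClosedEmbedding.isClosed_range ⟨_, rfl⟩

end

section

variable {X : Scheme.{0}} [IsIntegral X] {s : X ⟶ SpecC} [IsLocallyNoetherian X]
  {S : Construction s} {a : Fin 3 → MvPolynomial (Fin 3) ℂ}

omit [IsLocallyNoetherian X] in
/-- The strict transform of the cuspidal cubic is not a normal curve: neither `y / x` nor `x / y` is
regular at the cusp. -/
lemma IsContractionModel.not_isCurveField_zero :
    letI := stalkAlgebra s (genericPoint X)
    ∀ {ψ : Spec (.of X.functionField) ⟶ Plane} {Φ : MvPolynomial (Fin 3) ℂ →ₐ[ℂ] X.functionField}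
      {ψ₈ : _} {ψ₉ : _} (_ : IsContractionModel S a ψ Φ ψ₈ ψ₉) {E : Scheme.{0}} [IsIntegral E]
      (i : E ⟶ X) [IsClosedImmersion i] (_ : IsNormalCurve (i ≫ s)) {R : Subring X.functionField}
      {θ : R →+* E.functionField} (_ : HasLocalRing (ψ₉ ≫ S.q) (i (genericPoint E)) R)
      (_ : IsResidueMap (ψ₉ ≫ S.q) i s θ)
      (_ : (ψ₉ ≫ S.q) ≫ s = Spec.map (CommRingCat.ofHom (algebraMap ℂ X.functionField)))
      {P : Ideal A2} [P.IsPrime] (_ : P = Ideal.span {cubicPoly 0})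
      (_ : R = locAt (ev (Φ (a 0)) (Φ (a 1))) P), False := by
  let := stalkAlgebra s (genericPoint X)
  intro ψ Φ ψ₈ ψ₉ h E _ i _ hE R θ hR hθ hψ P _ hP hRP
  let := stalkAlgebra (i ≫ s) (genericPoint E)
  have hxy := h.isPlaneField
  obtain ⟨hx, hy, hcf⟩ := hθ.isCurveField hψ hxy hP hRP
  -- The local ring of the surface at the cusp is that of the plane, and the curve has a point `e`
  -- there.
  obtain ⟨ξ, -, hξ, -⟩ := h.exists_maximal originIdeal
  have := S.proper
  have := isSeparated_of_isProper (s := s)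
  have hPo : P ≤ originIdeal := by
    rw [hP, Ideal.span_singleton_le_iff_mem, mem_originIdeal_iff]
    exact ⟨Polynomial.C (-Polynomial.X ^ 2), Polynomial.X, by simp [cubicPoly, cuspPoly]; ring⟩
  obtain ⟨e, he⟩ := mem_range_of_le h.exists_ring i hR hξ
    (hRP ▸ fun w ⟨n, d, hd, e⟩ ↦ ⟨n, d, fun h' ↦ hd (hPo h'), e⟩)
    (hRP ▸ essGen_locAt hxy.injective) (by rintro _ ⟨g, rfl⟩; exact apply_mem_locAt g)
  have hval := hE.valuationRing e
  obtain ⟨hle, σ, hσ, hloc, hσθ⟩ := hθ.stalk e _ (he.symm ▸ hξ)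
  have hgens : gens (Φ (a 0)) (Φ (a 1)) ⊆ R := by
    rw [hRP, gens_subset_iff]
    exact ⟨algebraMap_mem_locAt, left_mem_locAt, right_mem_locAt⟩
  have hev := hθ.map_ev hψ hx hy hgens
  have hx0 : θ ⟨_, hx⟩ ≠ 0 := by
    have := hcf.aeval_ne_zero Polynomial.X_ne_zero
    rwa [Polynomial.aeval_X] at this
  have hrel := hcf.relation
  rw [map_zero, add_zero] at hrel
  rw [ValuationRing.iff_isInteger_or_isInteger (E.presheaf.stalk e) E.functionField] at hval
  rcases hval (θ ⟨_, hy⟩ / θ ⟨_, hx⟩) with ⟨o, ho⟩ | ⟨o, ho⟩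
  · obtain ⟨⟨r, n, d, hd, hr⟩, rfl⟩ := hσ o
    rw [hσθ, eq_div_iff hx0] at ho
    refine not_cubicPoly_zero_dvd (n := n) hd ((hcf.eq_zero_iff _).mp ?_)
    have h1 : θ (Subring.inclusion hle ⟨r, n, d, hd, hr⟩) * ev (θ ⟨_, hx⟩) (θ ⟨_, hy⟩) d =
        ev (θ ⟨_, hx⟩) (θ ⟨_, hy⟩) n := by
      rw [← hev, ← hev, ← map_mul]
      exact congrArg θ (Subtype.ext hr)
    rw [map_sub, map_mul, map_mul, ev_X, ev_C, Polynomial.aeval_X, ← h1, ← ho]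
    ring
  · have hxo : (Φ (a 0))⁻¹ ∈ locAt (ev (Φ (a 0)) (Φ (a 1))) originIdeal := by
      have hxS : Φ (a 0) ∈ locAt (ev (Φ (a 0)) (Φ (a 1))) originIdeal := left_mem_locAt
      have hu : IsUnit (σ ⟨_, hxS⟩) := by
        refine .of_mul_eq_one (o ^ 2) (IsFractionRing.injective (E.presheaf.stalk e)
          E.functionField ?_)
        have h1 : algebraMap (E.presheaf.stalk e) E.functionField (σ ⟨_, hxS⟩) = θ ⟨_, hx⟩ := hσθ _
        have hy0 := hcf.right_ne_zero
        rw [map_mul, map_pow, ho, h1, map_one, inv_div, div_pow, hrel]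
        field_simp
      exact ((isUnit_subring_iff _).mp (hu.of_map σ _)).2
    exact inv_left_notMem_origin hxy hxo

end

end

section

/-! ### Regular functions on normal surfaces -/

lemma IsDivisorial.of_div_pow_mem {K : Type} [Field K] {R : Subring K} {t : K} (ht : t ∈ R)
    (ht0 : t ≠ 0) (hti : t⁻¹ ∉ R) (hfrac : ∀ w : K, ∃ a ∈ R, ∃ b ∈ R, b ≠ 0 ∧ w * b = a)
    (hR : ∀ c ∈ R, c ≠ 0 → ∃ n : ℕ, c / t ^ n ∈ R ∧ (c / t ^ n)⁻¹ ∈ R) : IsDivisorial R := by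
  refine ⟨t, ht, ht0, hti, fun w hw ↦ ?_⟩
  obtain ⟨a, ha, b, hb, hb0, e⟩ := hfrac w
  have ha0 : a ≠ 0 := e ▸ mul_ne_zero hw hb0
  obtain ⟨m, hm, hm'⟩ := hR a ha ha0
  obtain ⟨n, hn, hn'⟩ := hR b hb hb0
  rw [← eq_div_iff hb0] at e
  rcases le_total n m with h | h
  · refine ⟨m - n, a / t ^ m * (b / t ^ n)⁻¹, mul_mem hm hn', ?_, .inl ?_⟩
    · rw [mul_inv, inv_inv]
      exact mul_mem hm' hn
    · obtain ⟨k, rfl⟩ := Nat.exists_eq_add_of_le h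
      rw [e, Nat.add_sub_cancel_left, pow_add]
      field_simp
  · refine ⟨n - m, b / t ^ n * (a / t ^ m)⁻¹, mul_mem hn hm', ?_, .inr ?_⟩
    · rw [mul_inv, inv_inv]
      exact mul_mem hn' hm
    · obtain ⟨k, rfl⟩ := Nat.exists_eq_add_of_le h
      rw [e, Nat.add_sub_cancel_left, pow_add]
      field_simp

/-- A Noetherian integrally closed local ring is the intersection of the discrete valuation rings
among its localizations: an element `w` outside of it is excluded by the localization at an
associated prime of `w`. -/
lemma exists_isDivisorial_locAt {K : Type} [Field K] {S : Subring K} [IsNoetherianRing S]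
    (hfrac : ∀ w : K, ∃ n d : S, d ≠ 0 ∧ w * d = n)
    (hint : ∀ w : K, _root_.IsIntegral S w → w ∈ S) {w : K} (hw : w ∉ S) :
    ∃ (P : Ideal S) (_ : P.IsPrime), IsDivisorial (locAt S.subtype P) ∧ w ∉ locAt S.subtype P := by
  -- `J z` is the ideal of denominators of `z`; a maximal one among the `J (s * w)` with `s * w ∉ S`
  -- is prime.
  let J (z : K) : Ideal S :=
    { carrier := {t | (t : K) * z ∈ S}
      add_mem' := fun {a b} ha hb ↦ by
        change ((a + b : S) : K) * z ∈ S
        rw [Subring.coe_add, add_mul]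
        exact add_mem ha hb
      zero_mem' := by
        change ((0 : S) : K) * z ∈ S
        simp
      smul_mem' := fun c {a} ha ↦ by
        change ((c * a : S) : K) * z ∈ S
        rw [Subring.coe_mul, mul_assoc]
        exact mul_mem c.2 ha }
  have hJ : ∀ {z : K} {t : S}, t ∈ J z ↔ (t : K) * z ∈ S := Iff.rfl
  obtain ⟨P, ⟨s, hsw, rfl⟩, hmax⟩ := set_has_maximal_iff_noetherian.mpr
    (inferInstance : IsNoetherian S S) {P | ∃ s : S, (s : K) * w ∉ S ∧ P = J (s * w)}
    ⟨_, 1, by simpa using hw, rfl⟩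
  set z : K := s * w with hz
  have hP : (J z).IsPrime := by
    refine ⟨fun h ↦ hsw ?_, fun {c d} hcd ↦ or_iff_not_imp_left.mpr fun hc ↦ ?_⟩
    · have : (1 : S) ∈ J z := h ▸ Submodule.mem_top
      simpa [hJ] using this
    · have h1 : J z ≤ J ((c * s : S) * w) := fun t ht ↦ by
        rw [hJ] at ht ⊢
        rw [Subring.coe_mul, mul_assoc, ← hz, mul_left_comm]
        exact mul_mem c.2 ht
      have h2 : J ((c * s : S) * w) = J z := by
        by_contra hne
        refine hmax _ ⟨c * s, ?_, rfl⟩ (lt_of_le_of_ne h1 (Ne.symm hne))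
        rwa [Subring.coe_mul, mul_assoc]
      rw [← h2, hJ, Subring.coe_mul, mul_assoc, ← hz, ← mul_assoc, mul_comm (d : K)]
      exact hcd
  have hinj : Function.Injective S.subtype := Subtype.val_injective
  have hwP : w ∉ locAt S.subtype (J z) := by
    rintro ⟨n, d, hd, e⟩
    refine hd (hJ.mpr ?_)
    rw [hz, mul_left_comm, mul_comm (d : K)]
    exact mul_mem s.2 (by rw [show w * (d : K) = n from e]; exact n.2)
  refine ⟨J z, hP, ?_, hwP⟩
  obtain ⟨d, hd0, hdz⟩ : ∃ d : S, d ≠ 0 ∧ d ∈ J z := by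
    obtain ⟨n, d, hd, e⟩ := hfrac z
    exact ⟨d, hd, by rw [hJ, mul_comm, e]; exact n.2⟩
  -- multiplication by `z` does not preserve the prime, as `z` is not integral
  obtain ⟨t, ht, htz⟩ : ∃ t, ∃ ht : t ∈ J z, (⟨_, ht⟩ : S) ∉ J z := by
    by_contra hcon
    push Not at hcon
    refine hsw (hint z (isIntegral_of_smul_mem_submodule
      (Submodule.map (Algebra.linearMap S K) (J z)) ?_
      (Submodule.FG.map _ (IsNoetherian.noetherian (J z))) z ?_))
    · rw [Submodule.ne_bot_iff]
      exact ⟨d, ⟨d, hdz, rfl⟩, fun h ↦ hd0 (Subtype.ext h)⟩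
    · rintro _ ⟨t, ht, rfl⟩
      exact ⟨_, hcon t ht, mul_comm (t : K) z⟩
  have ht0 : (t : K) ≠ 0 := fun h0 ↦ htz (by
    have : (⟨_, ht⟩ : S) = 0 := Subtype.ext (mul_eq_zero_of_left h0 z)
    rw [this]
    exact zero_mem _)
  -- As `t z` is a unit of the localization, `t` generates its maximal ideal.
  have hdiv : ∀ c ∈ locAt S.subtype (J z), c⁻¹ ∉ locAt S.subtype (J z) → c / t ∈
      locAt S.subtype (J z) := by
    rintro c ⟨n, m, hm, e⟩ hc
    have hn : n ∈ J z := by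
      by_contra hn
      refine hc ⟨m, n, hn, ?_⟩
      have hc0 : c ≠ 0 := by
        rintro rfl
        rw [zero_mul] at e
        exact hn ((map_eq_zero_iff _ hinj).mp e.symm ▸ zero_mem _)
      rw [← e, inv_mul_cancel_left₀ hc0]
    refine ⟨⟨_, hn⟩, m * ⟨_, ht⟩, fun h' ↦ (hP.mem_or_mem h').elim hm htz, ?_⟩
    change c / t * (m * (t * z)) = n * z
    rw [← show c * (m : K) = n from e]
    field_simp
  have hmem : ∀ n : S, (n : K) ∈ locAt S.subtype (J z) := fun n ↦ apply_mem_locAt n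
  have hti : (t : K)⁻¹ ∉ locAt S.subtype (J z) :=
    fun h' ↦ (inv_mem_locAt_iff hinj fun h ↦ ht0 (congrArg Subtype.val h)).mp h' ht
  refine .of_div_pow_mem (hmem t) ht0 hti (fun w ↦ ?_) fun c hc hc0 ↦ ?_
  · obtain ⟨n, m, hm, e⟩ := hfrac w
    exact ⟨n, hmem n, m, hmem m, fun h ↦ hm (Subtype.ext h), e⟩
  · by_contra hcon
    push Not at hcon
    have hall : ∀ n : ℕ, c / t ^ n ∈ locAt S.subtype (J z) := by
      intro n
      induction n with
      | zero => simpa using hc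
      | succ n ih =>
        rw [pow_succ, ← div_div]
        exact hdiv _ ih (hcon n ih)
    -- An element divisible by all powers of `t` would give a strictly increasing chain of ideals.
    let I : ℕ →o Ideal S :=
      { toFun := fun n ↦
          { carrier := {s | s * t ^ n / c ∈ locAt S.subtype (J z)}
            add_mem' := fun {a b} ha hb ↦ by
              change ((a + b : S) : K) * t ^ n / c ∈ locAt S.subtype (J z)
              rw [Subring.coe_add, add_mul, add_div]
              exact add_mem ha hb
            zero_mem' := by
              change ((0 : S) : K) * t ^ n / c ∈ locAt S.subtype (J z)
              simp
            smul_mem' := fun b {a} ha ↦ by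
              change ((b * a : S) : K) * t ^ n / c ∈ locAt S.subtype (J z)
              rw [Subring.coe_mul, mul_assoc, mul_div_assoc]
              exact mul_mem (hmem b) ha }
        monotone' := monotone_nat_of_le_succ fun n s hs ↦ by
          change (s : K) * t ^ (n + 1) / c ∈ locAt S.subtype (J z)
          rw [pow_succ, ← mul_assoc, mul_div_right_comm]
          exact mul_mem hs (hmem t) }
    obtain ⟨n, hn⟩ := monotone_stabilizes_iff_noetherian.mpr (inferInstance : IsNoetherian S S) I
    obtain ⟨a, d, hd, e⟩ := hall (n + 1)
    replace e : c / t ^ (n + 1) * d = a := e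
    have h1 : a ∈ I (n + 1) := by
      change (a : K) * t ^ (n + 1) / c ∈ locAt S.subtype (J z)
      rw [← e]
      convert hmem d using 1
      field_simp
    rw [← hn (n + 1) n.le_succ] at h1
    change (a : K) * t ^ n / c ∈ locAt S.subtype (J z) at h1
    refine hti ?_
    have h2 : (t : K)⁻¹ = a * t ^ n / c * (d : K)⁻¹ := by
      have hd0 : (d : K) ≠ 0 := fun h ↦ hd ((Subtype.ext h : d = 0) ▸ zero_mem _)
      rw [← e, pow_succ]
      field_simp
    rw [h2]
    exact mul_mem h1 ((inv_mem_locAt_iff hinj (by rintro rfl; exact hd (zero_mem _))).mpr hd)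

/-! ### The singularity `r² = q³ + p⁵` -/

section

variable {A : Type} [CommRing A] [IsDomain A] {p q r h : A} {I : Ideal A} [I.IsPrime]

/-- If `q = b²` modulo `p ^ k` for `k < 3`, then this can be improved to `p ^ (k + 1)` by a change
of the lift `b`. -/
lemma exists_lift_of_cuspidal_relation (hp : Prime p) (h2 : 2 * h = 1) (h3 : (3 : A) ∉ I) {b Q N : A}
    {k : ℕ} (hk : 1 ≤ k) (hbp : ¬ p ∣ b) (hI : I = Ideal.span {b, p}) (he : r ^ 2 = q ^ 3 + p ^ 5)
    (hq : q = b ^ 2 + p ^ k * Q) (hr : p ∣ r - b ^ 3)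
    (hN : p ^ (3 * k) * Q ^ 3 + p ^ 5 = p ^ (2 * k) * (p * N)) :
    ∃ b' Q', ¬ p ∣ b' ∧ I = Ideal.span {b', p} ∧ q = b' ^ 2 + p ^ (k + 1) * Q' ∧
      p ∣ r - b' ^ 3 := by
  have hp2 : ¬ p ∣ 2 := fun h' ↦ hp.not_isUnit (isUnit_of_dvd_one (h2 ▸ h'.mul_right h))
  have hpk : p ∣ p ^ k := dvd_pow_self p (by omega)
  obtain ⟨δ, hδ⟩ : ∃ δ, δ = r - b ^ 3 - 3 * h * b * (p ^ k * Q) := ⟨_, rfl⟩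
  have hpδ : p ∣ δ := hδ ▸ dvd_sub hr (((hpk.mul_right Q).mul_left (3 * h * b)))
  -- `δ` is the error of `r` after linearizing `q³` at `b²`; comparing `r²` with `q³ + p⁵` shows
  -- that it is divisible by `p ^ (2 * k)`.
  have key : δ * (2 * b ^ 3 + 3 * b * (p ^ k * Q) + δ) =
      p ^ (2 * k) * (3 * h ^ 2 * b ^ 2 * Q ^ 2 + p * N) := by
    have e1 : p ^ (2 * k) = (p ^ k) ^ 2 := by rw [← pow_mul, mul_comm]
    have e2 : p ^ (3 * k) = (p ^ k) ^ 3 := by rw [← pow_mul, mul_comm]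
    rw [e1, e2] at hN
    rw [e1]
    rw [hq] at he
    rw [hδ]
    linear_combination he + hN - (3 * b ^ 4 * (p ^ k * Q) + 3 * b ^ 2 * (p ^ k * Q) ^ 2 * (1 + 2 * h)
      + 3 * b * (p ^ k * Q) * (r - b ^ 3 - 3 * h * b * (p ^ k * Q))) * h2
  have hM : ¬ p ∣ 2 * b ^ 3 + 3 * b * (p ^ k * Q) + δ := fun h' ↦ by
    have h4 : p ∣ 2 * b ^ 3 := by
      have := dvd_sub (dvd_sub h' hpδ) ((hpk.mul_right Q).mul_left (3 * b))
      ring_nf at this ⊢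
      exact this
    exact (hp.dvd_or_dvd h4).elim hp2 fun h5 ↦ hbp (hp.dvd_of_dvd_pow h5)
  obtain ⟨d, rfl⟩ := hp.pow_dvd_of_dvd_mul_right (2 * k) hM (Dvd.intro _ key.symm)
  rw [mul_assoc] at key
  replace key := mul_left_cancel₀ (pow_ne_zero _ hp.ne_zero) key
  have hp2k : p ∣ p ^ (2 * k) := dvd_pow_self p (by omega)
  have h4 : p ∣ b ^ 2 * (2 * b * d - 3 * h ^ 2 * Q ^ 2) := by
    have h5 : b ^ 2 * (2 * b * d - 3 * h ^ 2 * Q ^ 2) =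
        p * N - d * (3 * b * (p ^ k * Q)) - d * (p ^ (2 * k) * d) := by
      linear_combination key
    rw [h5]
    exact dvd_sub (dvd_sub (dvd_mul_right p N) (((hpk.mul_right Q).mul_left _).mul_left d))
      ((hp2k.mul_right d).mul_left d)
  obtain ⟨m, hm⟩ := (hp.dvd_or_dvd h4).resolve_left fun h' ↦ hbp (hp.dvd_of_dvd_pow h')
  have hbI : b ∈ I := hI ▸ Ideal.subset_span (by simp)
  have hpI : p ∈ I := hI ▸ Ideal.subset_span (by simp)
  -- Modulo `p` this gives `3 h² Q² = 2 b d`, so `Q` vanishes at the point.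
  have hQ : Q ∈ I := by
    have h5 : (3 : A) * (h ^ 2 * Q ^ 2) ∈ I := by
      have h6 : (3 : A) * (h ^ 2 * Q ^ 2) = b * (2 * d) - p * m := by linear_combination -hm
      rw [h6]
      exact sub_mem (I.mul_mem_right _ hbI) (I.mul_mem_right _ hpI)
    have hhI : h ∉ I := fun h' ↦ Ideal.IsPrime.one_notMem ‹_› (h2 ▸ I.mul_mem_left 2 h')
    have h6 := ((‹I.IsPrime›.mem_or_mem h5).resolve_left h3)
    exact Ideal.IsPrime.mem_of_pow_mem ‹_› 2 (((‹I.IsPrime›).mem_or_mem h6).resolve_left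
      fun h' ↦ hhI (Ideal.IsPrime.mem_of_pow_mem ‹_› 2 h'))
  rw [hI, Ideal.mem_span_pair] at hQ
  obtain ⟨c, e, hce⟩ := hQ
  obtain ⟨j, rfl⟩ : ∃ j, k = j + 1 := ⟨k - 1, by omega⟩
  -- completing the square: the term `p ^ k * c * b` is absorbed into `b²`
  refine ⟨b + h * c * p ^ (j + 1), e - h ^ 2 * c ^ 2 * p ^ j, fun h' ↦ hbp ?_, ?_, ?_, ?_⟩
  · exact (dvd_add_left (hpk.mul_left (h * c))).mp h'
  · rw [hI, pow_succ, ← mul_assoc]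
    have := Ideal.span_pair_add_mul_left (x := p) b (h * c * p ^ j)
    rw [Ideal.span_pair_comm, ← this, Ideal.span_pair_comm]
  · rw [hq, ← hce]
    linear_combination (-p ^ (j + 1) * b * c) * h2
  · have h5 : r - (b + h * c * p ^ (j + 1)) ^ 3 = (r - b ^ 3) - p ^ (j + 1) *
      (3 * b ^ 2 * h * c + 3 * b * h ^ 2 * c ^ 2 * p ^ (j + 1) + (h * c) ^ 3 * (p ^ (j + 1)) ^ 2) := by
      ring
    rw [h5]
    exact dvd_sub hr (hpk.mul_right _)

/-- On a surface with local equation `r² = q³ + p⁵`, the curve `p = 0`, where `q = b²` and `r = b³`,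
does not have a regular parameter `b` that extends to the surface. -/
lemma not_cuspidal_relation (hp : Prime p) (h2 : 2 * h = 1) (h3 : (3 : A) ∉ I) {b : A}
    (hbp : ¬ p ∣ b) (hI : I = Ideal.span {b, p}) (he : r ^ 2 = q ^ 3 + p ^ 5)
    (hq : p ∣ q - b ^ 2) (hr : p ∣ r - b ^ 3) : False := by
  obtain ⟨Q, hQ⟩ := hq
  obtain ⟨b, Q, hbp, hI, hq, hr⟩ := exists_lift_of_cuspidal_relation hp h2 h3 le_rfl hbp hI he
    (Q := Q) (N := Q ^ 3 + p ^ 2) (by linear_combination hQ) hr (by ring)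
  obtain ⟨b, Q, hbp, hI, hq, hr⟩ := exists_lift_of_cuspidal_relation hp h2 h3 one_le_two hbp hI he
    (N := p * Q ^ 3 + 1) hq hr (by ring)
  have hp2 : ¬ p ∣ 2 := fun h' ↦ hp.not_isUnit (isUnit_of_dvd_one (h2 ▸ h'.mul_right h))
  obtain ⟨δ, hδ⟩ : ∃ δ, δ = r - b ^ 3 - 3 * h * b * (p ^ 3 * Q) := ⟨_, rfl⟩
  have hpδ : p ∣ δ :=
    hδ ▸ dvd_sub hr (((dvd_pow_self p three_ne_zero).mul_right Q).mul_left (3 * h * b))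
  have key : (2 * b ^ 3 + 3 * b * (p ^ 3 * Q) + δ) * δ =
      p ^ 5 * (1 + p * (3 * h ^ 2 * b ^ 2 * Q ^ 2 + p ^ 3 * Q ^ 3)) := by
    rw [hq] at he
    rw [hδ]
    linear_combination he - (3 * b ^ 4 * (p ^ 3 * Q) + 3 * b ^ 2 * (p ^ 3 * Q) ^ 2 * (1 + 2 * h)
      + 3 * b * (p ^ 3 * Q) * (r - b ^ 3 - 3 * h * b * (p ^ 3 * Q))) * h2
  have hM : ¬ p ∣ 2 * b ^ 3 + 3 * b * (p ^ 3 * Q) + δ := fun h' ↦ by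
    have h4 : p ∣ 2 * b ^ 3 := by
      have := dvd_sub (dvd_sub h' hpδ)
        (((dvd_pow_self p three_ne_zero).mul_right Q).mul_left (3 * b))
      ring_nf at this ⊢
      exact this
    exact (hp.dvd_or_dvd h4).elim hp2 fun h5 ↦ hbp (hp.dvd_of_dvd_pow h5)
  obtain ⟨d, rfl⟩ := hp.pow_dvd_of_dvd_mul_left 5 hM (Dvd.intro _ key.symm)
  have hbI : b ∈ I := hI ▸ Ideal.subset_span (by simp)
  have hpI : p ∈ I := hI ▸ Ideal.subset_span (by simp)
  have h1 : (2 * b ^ 3 + 3 * b * (p ^ 3 * Q) + p ^ 5 * d) * d =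
      1 + p * (3 * h ^ 2 * b ^ 2 * Q ^ 2 + p ^ 3 * Q ^ 3) :=
    mul_left_cancel₀ (pow_ne_zero 5 hp.ne_zero) (by linear_combination key)
  have h1' : (1 : A) = b * ((2 * b ^ 2 + 3 * (p ^ 3 * Q)) * d) +
      p * (p ^ 4 * d * d - (3 * h ^ 2 * b ^ 2 * Q ^ 2 + p ^ 3 * Q ^ 3)) := by
    linear_combination -h1
  refine Ideal.IsPrime.one_notMem ‹I.IsPrime› ?_
  rw [h1']
  exact add_mem (I.mul_mem_right _ hbI) (I.mul_mem_right _ hpI)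

end

end

section

/-! ### Points on the cuspidal cubic -/

lemma HasLocalRing.algebraMap_mem {K : Type} [Field K] [Algebra ℂ K] {Z : Scheme.{0}}
    {ψ : Spec (.of K) ⟶ Z} {z : Z} {R : Subring K} (h : HasLocalRing ψ z R) {t : Z ⟶ SpecC}
    (hψ : ψ ≫ t = Spec.map (CommRingCat.ofHom (algebraMap ℂ K))) (c : ℂ) :
    algebraMap ℂ K c ∈ R := by
  have := h.isLocalRing
  obtain ⟨g, rfl, -⟩ := h.exists_spec
  have h1 : CommRingCat.ofHom (algebraMap ℂ K) =
      Spec.preimage (g ≫ t) ≫ CommRingCat.ofHom R.subtype := by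
    apply Spec.map_injective
    rw [← hψ, Spec.map_comp, Spec.map_preimage, Category.assoc]
  have h2 : algebraMap ℂ K c = R.subtype ((Spec.preimage (g ≫ t)).hom c) :=
    congrArg (fun f ↦ f.hom c) h1
  exact h2 ▸ Subtype.property _

lemma dom_locAt {K : Type} [Field K] {A : Type} [CommRing A] {α : A →+* K} {P : Ideal A} [P.IsPrime]
    {T : Subring K} (hT : Set.range α ⊆ T) (hP : ∀ a, a ∈ P ↔ α a = 0 ∨ (α a)⁻¹ ∉ T) :
    Dom (locAt α P) T := by
  have key : ∀ d ∉ P, α d ≠ 0 ∧ (α d)⁻¹ ∈ T := fun d hd ↦ by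
    rw [hP] at hd
    tauto
  refine ⟨fun z ⟨n, d, hd, e⟩ ↦ ?_, fun z ⟨n, d, hd, e⟩ hz ↦ ?_⟩
  · obtain ⟨h0, hi⟩ := key d hd
    rw [← eq_mul_inv_iff_mul_eq₀ h0] at e
    exact e ▸ mul_mem (hT ⟨n, rfl⟩) hi
  · by_cases hz0 : z = 0
    · rw [hz0, inv_zero]
      exact zero_mem _
    obtain ⟨h0, hi⟩ := key d hd
    refine ⟨d, n, fun hn ↦ ?_, by rw [← e, inv_mul_cancel_left₀ hz0]⟩
    refine ((hP n).mp hn).elim (e ▸ mul_ne_zero hz0 h0) fun h' ↦ h' ?_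
    rw [← e, mul_inv]
    exact mul_mem hz hi

/-- A local ring contained in `R` is dominated by the preimage in `R` of a valuation ring of the
residue field of `R`. -/
lemma exists_composite_valuation {K L : Type} [Field K] [Field L] {R S : Subring K} [IsLocalRing S]
    (hSR : S ≤ R) (θ : R →+* L) [IsLocalHom θ] : ∃ (V : ValuationSubring L) (T : Subring K),
      IsLocalRing T ∧ Dom S T ∧ (∀ w, w ∈ T ↔ ∃ hw : w ∈ R, θ ⟨w, hw⟩ ∈ V) ∧
        ∀ w, ∀ hw : w ∈ R, θ ⟨w, hw⟩ ∈ V → (θ ⟨w, hw⟩ = 0 ∨ (θ ⟨w, hw⟩)⁻¹ ∉ V) →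
          w = 0 ∨ w⁻¹ ∉ T := by
  obtain ⟨V, hV, hloc⟩ :=
    (LocalSubring.range (θ.comp (Subring.inclusion hSR))).exists_le_valuationSubring
  let T : Subring K := (V.toSubring.comap θ).map R.subtype
  have hT : ∀ w, w ∈ T ↔ ∃ hw : w ∈ R, θ ⟨w, hw⟩ ∈ V :=
    fun w ↦ ⟨fun ⟨⟨w, hw⟩, h, e⟩ ↦ e ▸ ⟨hw, h⟩, fun ⟨hw, h⟩ ↦ ⟨⟨w, hw⟩, h, rfl⟩⟩
  have hinv : ∀ w, ∀ hw : w ∈ R, w ≠ 0 → ∀ hw' : w⁻¹ ∈ R, θ ⟨w⁻¹, hw'⟩ = (θ ⟨w, hw⟩)⁻¹ := by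
    intro w hw h0 hw'
    refine eq_inv_of_mul_eq_one_left ?_
    rw [← map_mul, ← map_one θ]
    exact congrArg θ (Subtype.ext (inv_mul_cancel₀ h0))
  have hne : ∀ w, ∀ hw : w ∈ R, w ≠ 0 → w⁻¹ ∈ R → θ ⟨w, hw⟩ ≠ 0 := fun w hw h0 hw' ↦ by
    have : IsUnit (⟨w, hw⟩ : R) := (isUnit_subring_iff _).mpr ⟨h0, hw'⟩
    exact (this.map θ).ne_zero
  refine ⟨V, T, ?_, ⟨fun w hw ↦ (hT w).mpr ⟨hSR hw, hV ⟨⟨w, hw⟩, rfl⟩⟩, fun w hw hwT ↦ ?_⟩, hT,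
    fun w hw hwV hw' ↦ ?_⟩
  · let σ : T →+* V := (θ.comp (Subring.inclusion fun w hw ↦ ((hT w).mp hw).1)).codRestrict
      V.toSubring fun w ↦ ((hT w).mp w.2).2
    have : IsLocalHom σ := ⟨fun w hw ↦ by
      obtain ⟨hwR, hwV⟩ := (hT w).mp w.2
      have h1 : θ ⟨w, hwR⟩ ≠ 0 ∧ (θ ⟨w, hwR⟩)⁻¹ ∈ V.toSubring :=
        (isUnit_subring_iff (R := V.toSubring) (σ w)).mp hw
      have h2 := (isUnit_subring_iff _).mp (IsUnit.of_map θ (⟨w, hwR⟩ : R) h1.1.isUnit)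
      refine (isUnit_subring_iff w).mpr ⟨h2.1, (hT _).mpr ⟨h2.2, ?_⟩⟩
      rw [hinv _ hwR h2.1]
      exact h1.2⟩
    exact RingHom.domain_isLocalRing σ
  · by_cases h0 : w = 0
    · rw [h0, inv_zero]
      exact zero_mem _
    obtain ⟨hwR, hwV⟩ := (hT _).mp hwT
    rw [hinv w (hSR hw) h0] at hwV
    have h1 := hne w (hSR hw) h0 hwR
    let v : (LocalSubring.range (θ.comp (Subring.inclusion hSR))).toSubring := ⟨_, ⟨w, hw⟩, rfl⟩
    have hu : IsUnit v := by
      refine hloc.map_nonunit v ?_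
      exact (isUnit_subring_iff (R := V.toSubring) _).mpr ⟨h1, hwV⟩
    obtain ⟨⟨_, s, rfl⟩, hs⟩ := hu.exists_right_inv
    have hs' : θ ⟨w, hSR hw⟩ * θ (Subring.inclusion hSR s) = 1 := congrArg Subtype.val hs
    by_contra hwS
    have h3 : ¬ IsUnit (⟨w, hw⟩ * s : S) := fun h' ↦
      hwS ((isUnit_subring_iff _).mp (isUnit_of_mul_isUnit_left h')).2
    have h4 := ((IsLocalRing.isUnit_or_isUnit_one_sub_self (⟨w, hw⟩ * s : S)).resolve_left h3).map
      (θ.comp (Subring.inclusion hSR))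
    refine h4.ne_zero ?_
    rw [map_sub, map_one, map_mul, sub_eq_zero]
    exact hs'.symm
  · by_contra! h
    obtain ⟨h0, hi⟩ := h
    obtain ⟨hwR, hwV'⟩ := (hT _).mp hi
    rw [hinv w hw h0] at hwV'
    exact hw'.elim (hne w hw h0 hwR) (· hwV')

variable {X : Scheme.{0}} [IsIntegral X] {s : X ⟶ SpecC} [IsLocallyNoetherian X]
  {S : Construction s} {a : Fin 3 → MvPolynomial (Fin 3) ℂ} {K : Type} [Field K] [Algebra ℂ K]
  {ψ : Spec (.of K) ⟶ Plane} {Φ : MvPolynomial (Fin 3) ℂ →ₐ[ℂ] K} {ψ₈ : Spec (.of K) ⟶ S.X₈}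
  {ψ₉ : Spec (.of K) ⟶ S.X₉}

omit [IsIntegral X] [IsLocallyNoetherian X] in
lemma IsContractionModel.exists_tower (h : IsContractionModel S a ψ Φ ψ₈ ψ₉) :
    ∃ z : X, HasLocalRing (ψ₉ ≫ S.q) z (towRing (Φ (a 0)) (Φ (a 1)) 8) := by
  obtain ⟨ξ, hξ, hR⟩ := h.exists_point_tower
  exact ⟨_, h.hasLocalRing_of_isolated (h.isClosed_tower hR hξ)
    (fun ξ' h' h'' ↦ h.eq_of_specializes_tower hR hξ h' h'') hR⟩

omit [IsIntegral X] [IsLocallyNoetherian X] in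
/-- The points of the strict transform of the cuspidal cubic are in the affine plane, or equal to
the point `u = r₈ = 0` of the last exceptional curve. -/
lemma IsContractionModel.left_mem_or_eq_towRing [X.IsSeparated]
    (h : IsContractionModel S a ψ Φ ψ₈ ψ₉)
    (hψ : (ψ₉ ≫ S.q) ≫ s = Spec.map (CommRingCat.ofHom (algebraMap ℂ K))) {z : X} {R : Subring K}
    (hR : HasLocalRing (ψ₉ ≫ S.q) z R) {P : Ideal A2} [P.IsPrime] (hP : P = Ideal.span {cuspPoly})
    (hle : R ≤ locAt (ev (Φ (a 0)) (Φ (a 1))) P) :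
    Φ (a 0) ∈ R ∨ R = towRing (Φ (a 0)) (Φ (a 1)) 8 := by
  have hxy := h.isPlaneField
  have hf := hxy.rr 8
  set x := Φ (a 0)
  set y := Φ (a 1)
  have hx0 : x ≠ 0 := hxy.ne_zero_left
  have hy0 : y ≠ 0 := hxy.ne_zero_right
  set Q := locAt (ev x y) P with hQ
  have hQloc : IsLocalRing Q := isLocalRing_locAt hxy.injective
  have hRloc := hR.isLocalRing
  have hxQ : x ∈ Q := left_mem_locAt
  have hyQ : y ∈ Q := right_mem_locAt
  have hX : (Polynomial.C Polynomial.X : A2) ∉ P := by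
    rw [hP, Ideal.mem_span_singleton]
    rintro ⟨g, hg⟩
    have := congrArg (Polynomial.evalEval 1 1) hg
    simp [cuspPoly, Polynomial.evalEval] at this
  have hY : (Polynomial.X : A2) ∉ P := by
    rw [hP, Ideal.mem_span_singleton]
    rintro ⟨g, hg⟩
    have := congrArg (Polynomial.evalEval 1 1) hg
    simp [cuspPoly, Polynomial.evalEval] at this
  have hxi : x⁻¹ ∈ Q := by
    have := (inv_mem_locAt_iff (P := P) hxy.injective (a := Polynomial.C Polynomial.X)
      (by simp)).mpr hX
    simpa using this
  have hyi : y⁻¹ ∈ Q := by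
    have := (inv_mem_locAt_iff (P := P) hxy.injective (a := Polynomial.X) (by simp)).mpr hY
    simpa using this
  let θ := IsLocalRing.residue Q
  -- A composite valuation `T` along the cubic dominates `R`, so `z` is its centre on the surface,
  -- which is determined by the coordinates contained in `T`.
  obtain ⟨V, T, hTloc, hdom, hT, hTu⟩ := exists_composite_valuation hle θ
  have hconst : ∀ c : ℂ, algebraMap ℂ K c ∈ T := fun c ↦ hdom.1 (hR.algebraMap_mem hψ c)
  have hyx : y / x ∈ Q := by
    rw [div_eq_mul_inv]
    exact mul_mem hyQ hxi
  have hxy' : x / y ∈ Q := by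
    rw [div_eq_mul_inv]
    exact mul_mem hxQ hyi
  have hfQ : y ^ 2 - x ^ 3 ∈ Q := sub_mem (pow_mem hyQ 2) (pow_mem hxQ 3)
  have hf0 : θ ⟨_, hfQ⟩ = 0 := by
    rw [IsLocalRing.residue_eq_zero_iff, IsLocalRing.mem_maximalIdeal, mem_nonunits_iff,
      isUnit_subring_iff]
    rintro ⟨-, h'⟩
    have h0 : cuspPoly ≠ 0 := monic_cuspPoly.ne_zero
    have := (inv_mem_locAt_iff (P := P) hxy.injective h0).mp (by rwa [ev_cuspPoly])
    exact this (hP ▸ Ideal.mem_span_singleton_self _)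
  by_cases ht : θ ⟨_, hyx⟩ ∈ V
  · left
    -- `x = t²` and `y = t³` on the cubic, where `t = y / x`
    have hxT : x ∈ T := by
      refine (hT x).mpr ⟨hxQ, ?_⟩
      have h1 : (⟨x, hxQ⟩ : Q) = ⟨_, hyx⟩ ^ 2 - ⟨_, hfQ⟩ * ⟨_, hxi⟩ ^ 2 := by
        refine Subtype.ext ?_
        change x = (y / x) ^ 2 - (y ^ 2 - x ^ 3) * x⁻¹ ^ 2
        field_simp
        ring
      rw [h1, map_sub, map_mul, hf0, zero_mul, sub_zero, map_pow]
      exact pow_mem ht 2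
    have hyT : y ∈ T := by
      have h1 := mul_mem ((hT _).mpr ⟨hyx, ht⟩) hxT
      rwa [div_mul_cancel₀ _ hx0] at h1
    have hrange : Set.range (ev x y) ⊆ T := by
      rintro _ ⟨g, rfl⟩
      exact ev_mem (gens_subset_iff.mpr ⟨hconst, hxT, hyT⟩) g
    have hd := dom_locAt hrange (mem_centre_iff T hrange)
    obtain ⟨z', hz'⟩ := h.exists_prime (centre (ev x y) T hrange)
    obtain rfl := hR.eq_of_dom hz' hdom hd
    rw [hR.unique hz']
    exact left_mem_locAt
  · right
    have hu0 := hxy.infinity.ne_zero_left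
    have huQ : θ ⟨_, hxy'⟩ = (θ ⟨_, hyx⟩)⁻¹ := by
      refine eq_inv_of_mul_eq_one_left ?_
      rw [← map_mul, ← map_one θ]
      refine congrArg θ (Subtype.ext ?_)
      change x / y * (y / x) = 1
      field_simp
    have hr : rr x y 8 = (y ^ 2 - x ^ 3) * (y ^ 5 * x⁻¹ ^ 8) := by
      rw [rr]
      field_simp
    have hrQ : rr x y 8 ∈ Q := hr ▸ mul_mem hfQ (mul_mem (pow_mem hyQ 5) (pow_mem hxi 8))
    have hr0 : θ ⟨_, hrQ⟩ = 0 := by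
      have h1 : (⟨_, hrQ⟩ : Q) = ⟨_, hfQ⟩ * (⟨_, hyQ⟩ ^ 5 * ⟨_, hxi⟩ ^ 8) := Subtype.ext hr
      rw [h1, map_mul, hf0, zero_mul]
    have huT : x / y ∈ T := (hT _).mpr ⟨hxy', huQ ▸ (V.mem_or_inv_mem _).resolve_left ht⟩
    have hrT : rr x y 8 ∈ T := (hT _).mpr ⟨hrQ, hr0 ▸ zero_mem V⟩
    have hu' := hTu _ hxy' (huQ ▸ (V.mem_or_inv_mem _).resolve_left ht)
      (.inr (by rwa [huQ, inv_inv]))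
    have hr' := hTu _ hrQ (hr0 ▸ zero_mem V) (.inl hr0)
    have hgens : gens (x / y) (rr x y 8) ⊆ T := gens_subset_iff.mpr ⟨hconst, huT, hrT⟩
    have hd : Dom (towRing x y 8) T := dom_locAt (by rintro _ ⟨g, rfl⟩; exact ev_mem hgens g)
      (nonunit_ev hgens hu' hr')
    obtain ⟨z', hz'⟩ := h.exists_tower
    obtain rfl := hR.eq_of_dom hz' hdom hd
    exact hR.unique hz'

end

section

/-! ### The image of the last exceptional curve is singular -/

/-- Every valuation ring of the function field of a normal proper curve is one of its local
rings. -/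
lemma IsNormalCurve.exists_stalk_eq {E : Scheme.{0}} [IsIntegral E] {t : E ⟶ SpecC}
    (h : IsNormalCurve t) :
    letI := stalkAlgebra t (genericPoint E)
    ∀ (V : ValuationSubring E.functionField) (_ : ∀ c : ℂ, algebraMap ℂ E.functionField c ∈ V),
      ∃ e : E, (algebraMap (E.presheaf.stalk e) E.functionField).range = V.toSubring := by
  let := stalkAlgebra t (genericPoint E)
  intro V hV
  have := h.proper
  let f : ℂ →+* V := (algebraMap ℂ E.functionField).codRestrict V.toSubring hV
  obtain ⟨l, hl, -⟩ := exists_lift_of_isProper t (R := V) (K := E.functionField)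
    (E.fromSpecStalk (genericPoint E)) (Spec.map (CommRingCat.ofHom f)) (by
      rw [← Spec.map_comp]
      exact fromSpecStalk_comp_structure (s := t))
  have hE := hasLocalRing_fromSpecStalk_genericPoint (X := E) (l (closedPt (.of V)))
  have : IsLocalRing V.toSubring := inferInstanceAs (IsLocalRing V)
  have hdom := HasLocalRing.dom_of_comp (S := V.toSubring) l hl hE
  have hval := h.valuationRing (l (closedPt (.of V)))
  refine ⟨_, le_antisymm hdom.1 fun w hw ↦ ?_⟩
  rw [ValuationRing.iff_isInteger_or_isInteger (E.presheaf.stalk (l (closedPt (.of V))))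
    E.functionField] at hval
  rcases hval w with h' | h'
  · exact h'
  · have := hdom.2 _ h' (by rwa [inv_inv])
    rwa [inv_inv] at this

namespace IsCurveField

variable {L : Type} [Field L] [Algebra ℂ L] {x y : L}

lemma left_eq_zero (h : IsCurveField (Polynomial.C Polynomial.X) x y) : x = 0 := by
  have := (h.eq_zero_iff (Polynomial.C Polynomial.X)).mpr dvd_rfl
  simpa using this

lemma aeval_injective (h : IsCurveField (Polynomial.C Polynomial.X) x y) :
    Function.Injective (Polynomial.aeval y : Polynomial ℂ →ₐ[ℂ] L) := by
  rw [injective_iff_map_eq_zero]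
  intro p hp
  have h1 : ev x y (p.map Polynomial.C) = 0 := by
    rw [ev_apply, Polynomial.eval₂_map, ← hp, Polynomial.aeval_def]
    congr 1
    ext c
    simp
  rw [h.eq_zero_iff] at h1
  obtain ⟨q, hq⟩ := h1
  have h2 := congrArg (Polynomial.map (Polynomial.evalRingHom (0 : ℂ))) hq
  rw [Polynomial.map_map, Polynomial.map_mul, Polynomial.map_C] at h2
  have h3 : (Polynomial.evalRingHom (0 : ℂ)).comp Polynomial.C = RingHom.id ℂ := by
    ext c; simp
  rw [h3, Polynomial.map_id] at h2
  simpa using h2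

/-- The function field of a line. -/
lemma exists_fraction_aeval (h : IsCurveField (Polynomial.C Polynomial.X) x y) (w : L) :
    ∃ n d : Polynomial ℂ, d ≠ 0 ∧ w * Polynomial.aeval y d = Polynomial.aeval y n := by
  have h1 : ∀ p : A2, ev x y p =
      Polynomial.aeval y (p.map (Polynomial.evalRingHom (0 : ℂ))) := fun p ↦ by
    rw [ev_apply, Polynomial.aeval_def, Polynomial.eval₂_map]
    congr 1
    refine Polynomial.ringHom_ext (fun c ↦ ?_) ?_
    · simp
    · simp [h.left_eq_zero]
  obtain ⟨n, d, hd, e⟩ := h.exists_fraction w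
  rw [h1] at hd
  rw [h1, h1] at e
  exact ⟨_, _, fun h0 ↦ hd (by rw [h0, map_zero]), e⟩

lemma span_D_right (h : IsCurveField (Polynomial.C Polynomial.X) x y) :
    Submodule.span L {KaehlerDifferential.D ℂ L y} = ⊤ := by
  rw [← h.span_D_eq_top, h.left_eq_zero, map_zero, Submodule.span_insert_zero]

/-- The valuation at infinity of the function field of a line. -/
lemma exists_infinity (h : IsCurveField (Polynomial.C Polynomial.X) x y) :
    ∃ V : ValuationSubring L, (∀ c : ℂ, algebraMap ℂ L c ∈ V) ∧ y⁻¹ ∈ V ∧ y ∉ V ∧ y ≠ 0 ∧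
      ∀ w ∈ V, w = 0 ∨ w⁻¹ ∉ V → ∃ c ∈ V, w = y⁻¹ * c := by
  have hy0 : y ≠ 0 := by
    rintro rfl
    have := h.aeval_injective (a₁ := Polynomial.X) (a₂ := 0) (by simp)
    exact Polynomial.X_ne_zero this
  let α : Polynomial ℂ →+* L := (Polynomial.aeval y⁻¹ : Polynomial ℂ →ₐ[ℂ] L).toRingHom
  have hrev : ∀ p : Polynomial ℂ, α p.reverse * y ^ p.natDegree = Polynomial.aeval y p := by
    intro p
    let := invertibleOfNonzero hy0
    have := Polynomial.eval₂_reverse_mul_pow (algebraMap ℂ L) y p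
    rwa [invOf_eq_inv] at this
  have hrev' : ∀ p : Polynomial ℂ, Polynomial.aeval y p.reverse * y⁻¹ ^ p.natDegree = α p := by
    intro p
    let := invertibleOfNonzero (inv_ne_zero hy0)
    have := Polynomial.eval₂_reverse_mul_pow (algebraMap ℂ L) y⁻¹ p
    rwa [invOf_eq_inv, inv_inv] at this
  -- `V` is the localization of `ℂ[1 / y]` at the origin.
  have hX : α Polynomial.X = y⁻¹ := Polynomial.aeval_X _
  have hα : Function.Injective α := by
    rw [injective_iff_map_eq_zero]
    intro p hp
    rw [← hrev', mul_eq_zero] at hp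
    have := h.aeval_injective
      ((hp.resolve_right (pow_ne_zero _ (inv_ne_zero hy0))).trans (map_zero _).symm)
    simpa using this
  have hfrac : ∀ w : L, ∃ n d, d ≠ 0 ∧ w * α d = α n := by
    intro w
    obtain ⟨n, d, hd, e⟩ := h.exists_fraction_aeval w
    refine ⟨n.reverse * Polynomial.X ^ d.natDegree, d.reverse * Polynomial.X ^ n.natDegree,
      mul_ne_zero (by simpa using hd) (pow_ne_zero _ Polynomial.X_ne_zero), ?_⟩
    rw [← hrev, ← hrev] at e
    rw [map_mul, map_mul, map_pow, map_pow, hX, inv_pow, inv_pow]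
    field_simp
    linear_combination e
  have hP : (Ideal.span {(Polynomial.X : Polynomial ℂ)}).IsPrime :=
    (Ideal.span_singleton_prime Polynomial.X_ne_zero).mpr Polynomial.prime_X
  let V : ValuationSubring L := { locAt α (Ideal.span {(Polynomial.X : Polynomial ℂ)}) with
    mem_or_inv_mem' := mem_or_inv_mem_locAt hα hfrac rfl Polynomial.X_ne_zero }
  refine ⟨V, fun c ↦ ?_, ?_, ?_, hy0, fun w hw hw' ↦ ?_⟩
  · have := apply_mem_locAt (α := α) (P := Ideal.span {(Polynomial.X : Polynomial ℂ)})
      (Polynomial.C c)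
    rwa [show α (Polynomial.C c) = algebraMap ℂ L c from Polynomial.aeval_C _ _] at this
  · have := apply_mem_locAt (α := α) (P := Ideal.span {(Polynomial.X : Polynomial ℂ)})
      Polynomial.X
    rwa [hX] at this
  · intro hyV
    have := inv_mem_locAt_iff (P := Ideal.span {(Polynomial.X : Polynomial ℂ)}) hα
      Polynomial.X_ne_zero
    rw [hX, inv_inv] at this
    exact this.mp hyV (Ideal.mem_span_singleton_self _)
  · exact exists_eq_mul_of_nonunit hX rfl hw hw'

end IsCurveField

variable {X : Scheme.{0}} [IsIntegral X] {s : X ⟶ SpecC} [IsLocallyNoetherian X]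
  {S : Construction s} {a : Fin 3 → MvPolynomial (Fin 3) ℂ}

/-- A rational function is regular at a point of the contracted surface if it has no pole along the
curves through this point. -/
lemma IsContractionModel.mem_of_forall_prime :
    letI := stalkAlgebra s (genericPoint X)
    ∀ {ψ : Spec (.of X.functionField) ⟶ Plane} {Φ : MvPolynomial (Fin 3) ℂ →ₐ[ℂ] X.functionField}
      {ψ₈ : _} {ψ₉ : _} (_ : IsContractionModel S a ψ Φ ψ₈ ψ₉)
      (_ : ψ₉ ≫ S.q = X.fromSpecStalk (genericPoint X)) {z : X} {R : Subring X.functionField}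
      (_ : HasLocalRing (ψ₉ ≫ S.q) z R) (_ : ¬ IsDivisorial R) {w : X.functionField}
      (_ : w ∈ excRing (Φ (a 0)) (Φ (a 1)))
      (_ : ∀ (g : A2) (P : Ideal A2) (_ : P.IsPrime), Prime g → P = Ideal.span {g} →
        R ≤ locAt (ev (Φ (a 0)) (Φ (a 1))) P → w ∈ locAt (ev (Φ (a 0)) (Φ (a 1))) P), w ∈ R := by
  let := stalkAlgebra s (genericPoint X)
  intro ψ Φ ψ₈ ψ₉ h hX z R hR hdiv w hw hwg
  obtain ⟨ε, -⟩ := hR.exists_equiv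
  have hnoeth : IsNoetherianRing R := isNoetherianRing_of_ringEquiv _ ε
  have hr : (algebraMap (X.presheaf.stalk z) X.functionField).range = R := by
    rw [hX] at hR
    exact (hasLocalRing_fromSpecStalk_genericPoint z).unique hR
  by_contra hwR
  obtain ⟨P, hP, hdvr, hwP⟩ := exists_isDivisorial_locAt (S := R) (fun w ↦ by
    obtain ⟨n, d, hd, rfl⟩ := IsFractionRing.div_surjective (A := X.presheaf.stalk z) w
    have hd0 : algebraMap (X.presheaf.stalk z) X.functionField d ≠ 0 :=
      IsFractionRing.to_map_ne_zero_of_mem_nonZeroDivisors hd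
    exact ⟨⟨_, hr ▸ ⟨n, rfl⟩⟩, ⟨_, hr ▸ ⟨d, rfl⟩⟩, fun h0 ↦ hd0 (congrArg Subtype.val h0),
      div_mul_cancel₀ _ hd0⟩) (h.integrallyClosed z R hR) hwR
  have hinj : Function.Injective R.subtype := Subtype.val_injective
  have := isLocalRing_locAt (P := P) hinj
  have hle : R ≤ locAt R.subtype P := fun w hw ↦ apply_mem_locAt (α := R.subtype) ⟨w, hw⟩
  obtain ⟨z', hz', hRz'⟩ := hR.exists_generalization h.exists_ring hle (essGen_locAt hinj)
    (by rintro _ ⟨g, rfl⟩; exact g.2)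
  have hzc : ¬ IsClosed ({z'} : Set X) := fun hc ↦ by
    obtain rfl := isClosed_singleton_iff_specializes.mp hc _ hz'
    exact hdiv (hR.unique hRz' ▸ hdvr)
  rcases h.classification hzc hRz' hdvr with ⟨g, hg, hgP, -⟩ | hexc
  · have hgp := isPrime_span hg
    rw [hgP _ rfl] at hwP hle
    exact hwP (hwg g _ hgp hg rfl hle)
  · exact hwP (hexc ▸ hw)

end

section

/-! ### Exclusion of the last exceptional curve -/

section

variable {K L : Type} [Field K] [Algebra ℂ K] [Field L]

/-- A local ring `A` on the contracted surface with the functions `p = 1 / f`, `q = x / f²` and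
`r = y / f³`, where `f = y² - x³`, is not regular along the curve `p = 0`. -/
lemma false_of_regular_parameter {R A : Subring K} [IsLocalRing A] (hA : A ≤ R) (θ : R →+* L)
    (hcA : ∀ c : ℂ, algebraMap ℂ K c ∈ A) {V : ValuationSubring L}
    (hV : ∀ w, w ∈ V ↔ ∃ c : A, θ (Subring.inclusion hA c) = w) {τ : L} (hτ : τ ∈ V) (hτ0 : τ ≠ 0)
    (hτi : τ⁻¹ ∉ V) (hτV : ∀ w ∈ V, w = 0 ∨ w⁻¹ ∉ V → ∃ c ∈ V, w = τ * c) {p q r : A}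
    (hrel : r ^ 2 = q ^ 3 + p ^ 5) (hp0 : p ≠ 0)
    (hker : ∀ c, θ (Subring.inclusion hA c) = 0 ↔ p ∣ c)
    (hq : θ (Subring.inclusion hA q) = τ ^ 2) (hr : θ (Subring.inclusion hA r) = τ ^ 3) : False := by
  let σ : A →+* L := θ.comp (Subring.inclusion hA)
  -- A lift `b` of the parameter `τ` generates the maximal ideal together with `p`, which
  -- contradicts `not_cuspidal_relation`.
  obtain ⟨b, hb⟩ : ∃ b, σ b = τ := (hV τ).mp hτ
  have hkerσ : RingHom.ker σ = Ideal.span {p} := by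
    ext c
    rw [RingHom.mem_ker, Ideal.mem_span_singleton]
    exact hker c
  have hp : Prime p := by
    rw [← Ideal.span_singleton_prime hp0, ← hkerσ]
    exact RingHom.ker_isPrime σ
  let half : A := ⟨_, hcA (1 / 2)⟩
  let third : A := ⟨_, hcA (1 / 3)⟩
  have h2 : 2 * half = 1 := Subtype.ext (by
    change (2 : K) * algebraMap ℂ K (1 / 2) = 1
    rw [← map_ofNat (algebraMap ℂ K) 2, ← map_mul, ← map_one (algebraMap ℂ K)]
    norm_num)
  have h3 : 3 * third = 1 := Subtype.ext (by
    change (3 : K) * algebraMap ℂ K (1 / 3) = 1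
    rw [← map_ofNat (algebraMap ℂ K) 3, ← map_mul, ← map_one (algebraMap ℂ K)]
    norm_num)
  have hbI : b ∈ IsLocalRing.maximalIdeal A := by
    rw [IsLocalRing.mem_maximalIdeal, mem_nonunits_iff]
    intro hu
    obtain ⟨c, hc⟩ := hu.exists_right_inv
    refine hτi ((hV _).mpr ⟨c, ?_⟩)
    refine eq_inv_of_mul_eq_one_right ?_
    rw [← hb, ← map_one σ, ← hc, map_mul]
    rfl
  have hpI : p ∈ IsLocalRing.maximalIdeal A := by
    rw [IsLocalRing.mem_maximalIdeal, mem_nonunits_iff]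
    exact hp.not_isUnit
  have hI : IsLocalRing.maximalIdeal A = Ideal.span {b, p} := by
    apply le_antisymm
    · intro c hc
      have hcV : σ c ∈ V := (hV _).mpr ⟨c, rfl⟩
      obtain ⟨d, hd, e⟩ := hτV (σ c) hcV (by
        by_contra! hcon
        obtain ⟨h0, hi⟩ := hcon
        obtain ⟨c', hc'⟩ := (hV _).mp hi
        have h4 : p ∣ c * c' - 1 := by
          rw [← hker]
          change σ (c * c' - 1) = 0
          rw [map_sub, map_mul, map_one, show σ c' = (σ c)⁻¹ from hc', mul_inv_cancel₀ h0, sub_self]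
        have h5 : (1 : A) ∈ IsLocalRing.maximalIdeal A := by
          have := sub_mem (Ideal.mul_mem_right c' _ hc) (Ideal.mem_of_dvd _ h4 hpI)
          rwa [sub_sub_cancel] at this
        exact (Ideal.ne_top_iff_one _).mp (IsLocalRing.maximalIdeal.isMaximal A).ne_top h5)
      obtain ⟨d, rfl⟩ := (hV _).mp hd
      have h4 : p ∣ c - b * d := by
        rw [← hker]
        change σ (c - b * d) = 0
        rw [map_sub, map_mul, hb, sub_eq_zero]
        exact e
      obtain ⟨m, hm⟩ := h4
      rw [Ideal.mem_span_pair]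
      exact ⟨d, m, by linear_combination -hm⟩
    · rw [Ideal.span_le]
      rintro _ (rfl | rfl)
      · exact hbI
      · exact hpI
  refine not_cuspidal_relation (I := IsLocalRing.maximalIdeal A) hp h2 (fun h' ↦ ?_) (b := b) ?_ hI
    hrel ?_ ?_
  · refine (Ideal.ne_top_iff_one _).mp (IsLocalRing.maximalIdeal.isMaximal A).ne_top ?_
    exact h3 ▸ Ideal.mul_mem_right third _ h'
  · rw [← hker]
    exact fun h0 ↦ hτ0 (hb.symm.trans h0)
  · rw [← hker]
    change σ (q - b ^ 2) = 0
    rw [map_sub, map_pow, hb, sub_eq_zero]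
    exact hq
  · rw [← hker]
    change σ (r - b ^ 3) = 0
    rw [map_sub, map_pow, hb, sub_eq_zero]
    exact hr

end

variable {X : Scheme.{0}} [IsIntegral X] {s : X ⟶ SpecC} [IsLocallyNoetherian X]
  {S : Construction s} {a : Fin 3 → MvPolynomial (Fin 3) ℂ}

/-- The image of the last exceptional curve is not a smooth curve: it has a cusp at the singular
point of the surface. -/
lemma IsContractionModel.false_of_smooth_excRing :
    letI := stalkAlgebra s (genericPoint X)
    ∀ {ψ : Spec (.of X.functionField) ⟶ Plane} {Φ : MvPolynomial (Fin 3) ℂ →ₐ[ℂ] X.functionField}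
      {ψ₈ : _} {ψ₉ : _} (_ : IsContractionModel S a ψ Φ ψ₈ ψ₉)
      (_ : ψ₉ ≫ S.q = X.fromSpecStalk (genericPoint X)) {E : Scheme.{0}} [IsIntegral E]
      (i : E ⟶ X) [IsClosedImmersion i] (_ : Smooth (i ≫ s))
      {θ : excRing (Φ (a 0)) (Φ (a 1)) →+* E.functionField}
      (_ : HasLocalRing (ψ₉ ≫ S.q) (i (genericPoint E)) (excRing (Φ (a 0)) (Φ (a 1))))
      (_ : IsResidueMap (ψ₉ ≫ S.q) i s θ)
      (_ : (ψ₉ ≫ S.q) ≫ s = Spec.map (CommRingCat.ofHom (algebraMap ℂ X.functionField))),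
      False := by
  let := stalkAlgebra s (genericPoint X)
  intro ψ Φ ψ₈ ψ₉ h hX E _ i _ hsm
  set x := Φ (a 0)
  set y := Φ (a 1)
  intro θ hR hθ hψ
  let := stalkAlgebra (i ≫ s) (genericPoint E)
  have hxy : IsPlaneField x y := h.isPlaneField
  have := S.proper
  have := isSeparated_of_isProper (s := s)
  have : IsProper (i ≫ s) := inferInstance
  have hCX := isPrime_span prime_C_X
  obtain ⟨hu, hr8, hcf⟩ := hθ.isCurveField hψ (hxy.rr 8) rfl rfl
  have hE : IsNormalCurve (i ≫ s) := isNormalCurve_of_smooth ⟨_, hcf.span_D_right⟩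
  obtain ⟨V, hcV, hτV, hyV, hρ0, hmV⟩ := hcf.exists_infinity
  -- `A` is the local ring of the surface at the point at infinity of the exceptional curve, its
  -- intersection with the contracted curves.
  obtain ⟨e, he⟩ := hE.exists_stalk_eq V hcV
  obtain ⟨A, hA⟩ := h.exists_ring (i e)
  have := hA.isLocalRing
  obtain ⟨hAR, hAV⟩ := hθ.range_eq hA
  rw [he] at hAV
  have hV : ∀ w, w ∈ V ↔ ∃ c : A, θ (Subring.inclusion hAR c) = w := fun w ↦ by
    change w ∈ V.toSubring ↔ _
    rw [hAV]
    rfl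
  have hcA : ∀ c : ℂ, algebraMap ℂ X.functionField c ∈ A := hA.algebraMap_mem hψ
  have hr8A : rr x y 8 ∉ A := fun h' ↦ hyV ((hV _).mpr ⟨⟨_, h'⟩, rfl⟩)
  obtain ⟨ε, hε, hεi, hε0, ⟨c, hc, hεc⟩, hyε, hxε, hfε⟩ := exists_unit_excRing hxy
  have hu0 : x / y ≠ 0 := hxy.infinity.ne_zero_left
  have hexc : excRing x y ≠ ⊤ := fun h' ↦ inv_left_notMem_excRing hxy (h' ▸ trivial)
  have hdiv : ¬ IsDivisorial A := fun hd ↦ by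
    have := hd.eq_of_le hexc hAR
    exact hr8A (this ▸ rr_mem_excRing)
  have hxR : x ∉ excRing x y := fun h' ↦ by
    refine inv_left_notMem_excRing hxy ?_
    have : (x / y)⁻¹ = x * (x / y) * ε⁻¹ := by
      rw [← hxε]
      have := hxy.ne_zero_left
      field_simp
    rw [this]
    exact mul_mem (mul_mem h' hu) hεi
  -- The strict transform of the cuspidal cubic does not pass through this point, so `1 / f` has no
  -- pole along the curves through it.
  have hcusp : ∀ (P : Ideal A2) [P.IsPrime], P = Ideal.span {cuspPoly} →
      ¬ A ≤ locAt (ev x y) P := fun P _ hP hle ↦ by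
    rcases h.left_mem_or_eq_towRing hψ hA hP hle with h' | h'
    · exact hxR (hAR h')
    · exact hr8A (h' ▸ right_mem_locAt)
  have hmem : ∀ w ∈ excRing x y, (∀ (P : Ideal A2) (_ : P.IsPrime), cuspPoly ∉ P →
      A ≤ locAt (ev x y) P → w ∈ locAt (ev x y) P) → w ∈ A := by
    intro w hw hwP
    refine h.mem_of_forall_prime hX hA hdiv hw fun g P hP hg hgP hle ↦ hwP P hP (fun hcP ↦ ?_) hle
    rw [hgP, Ideal.mem_span_singleton] at hcP
    have h0 : Prime (cubicPoly 0) := prime_cubicPoly 0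
    have h1 : cubicPoly 0 = cuspPoly := by simp [cubicPoly]
    rw [h1] at h0
    refine hcusp P ?_ hle
    rw [hgP, Ideal.span_singleton_eq_span_singleton]
    exact hg.irreducible.associated_of_dvd h0.irreducible hcP
  set f := y ^ 2 - x ^ 3 with hf
  have hfev : ev x y cuspPoly = f := ev_cuspPoly
  have hr80 : rr x y 8 ≠ 0 := (hxy.rr 8).ne_zero_right
  have hf0 : f ≠ 0 := by
    intro h0
    rw [h0, zero_mul] at hfε
    exact mul_ne_zero hr80 (pow_ne_zero 3 hε0) hfε.symm
  have hr8i : (rr x y 8)⁻¹ ∈ excRing x y := by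
    have := inv_aeval_rr_mem_excRing hxy Polynomial.X_ne_zero
    rwa [Polynomial.aeval_X] at this
  -- `v = 1 / (f * u)` is a unit on the exceptional curve, with value the parameter at infinity
  obtain ⟨v, hv⟩ : ∃ v, v = (rr x y 8)⁻¹ * ε⁻¹ ^ 3 := ⟨_, rfl⟩
  have hvR : v ∈ excRing x y := hv ▸ mul_mem hr8i (pow_mem hεi 3)
  have hp : f⁻¹ = x / y * v := by
    rw [hv, inv_eq_iff_eq_inv, mul_inv, ← div_eq_inv_mul, eq_div_iff hu0, hfε]
    simp [mul_comm]
  have hq : x * f⁻¹ ^ 2 = ε * v ^ 2 := by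
    rw [hp, ← hxε]
    ring
  have hr : y * f⁻¹ ^ 3 = ε * v ^ 3 := by
    rw [hp, ← hyε]
    ring
  have hpR : f⁻¹ ∈ excRing x y := hp ▸ mul_mem hu hvR
  have hfP : ∀ (P : Ideal A2) [P.IsPrime], cuspPoly ∉ P → f⁻¹ ∈ locAt (ev x y) P :=
    fun P _ hP ↦ hfev ▸ (inv_mem_locAt_iff hxy.injective monic_cuspPoly.ne_zero).mpr hP
  have hpA : f⁻¹ ∈ A := hmem _ hpR fun P _ hP _ ↦ hfP P hP
  have hqR : x * f⁻¹ ^ 2 ∈ excRing x y := hq ▸ mul_mem hε (pow_mem hvR 2)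
  have hrR : y * f⁻¹ ^ 3 ∈ excRing x y := hr ▸ mul_mem hε (pow_mem hvR 3)
  have hqA : x * f⁻¹ ^ 2 ∈ A := hmem _ hqR fun P _ hP _ ↦
    mul_mem left_mem_locAt (pow_mem (hfP P hP) 2)
  have hrA : y * f⁻¹ ^ 3 ∈ A := hmem _ hrR fun P _ hP _ ↦
    mul_mem right_mem_locAt (pow_mem (hfP P hP) 3)
  have hθu : θ ⟨_, hu⟩ = 0 := hcf.left_eq_zero
  have hθε : θ ⟨ε, hε⟩ = 1 := by
    have h1 : (⟨ε, hε⟩ : excRing x y) = 1 + ⟨_, hu⟩ * ⟨c, hc⟩ := Subtype.ext hεc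
    rw [h1, map_add, map_mul, hθu, zero_mul, add_zero, map_one]
  have hθv : θ ⟨v, hvR⟩ = (θ ⟨_, hr8⟩)⁻¹ := by
    refine eq_inv_of_mul_eq_one_left ?_
    have h1 : (⟨v, hvR⟩ : excRing x y) * ⟨_, hr8⟩ * ⟨ε, hε⟩ ^ 3 = 1 := Subtype.ext (by
      change v * rr x y 8 * ε ^ 3 = 1
      rw [hv]
      field_simp)
    have h2 := congrArg θ h1
    rwa [map_mul, map_pow, hθε, one_pow, mul_one, map_mul, map_one] at h2
  have hker : ∀ c : A, θ (Subring.inclusion hAR c) = 0 ↔ (⟨_, hpA⟩ : A) ∣ c := by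
    intro c
    constructor
    · intro h0
      have h1 := (hθ.eq_zero_iff _).mp h0
      obtain ⟨d, hd, hcd⟩ := exists_eq_mul_of_nonunit
        (α := ev (x / y) (rr x y 8)) (p := x / y) (a := Polynomial.C Polynomial.X) (by simp) rfl
        (hAR c.2) h1
      -- `c` has a zero and `f` a simple pole along the exceptional curve, so `c f` is regular.
      have hcf : (c : X.functionField) * f ∈ A := by
        refine hmem _ ?_ fun P _ _ hle ↦ mul_mem (hle c.2)
          (sub_mem (pow_mem right_mem_locAt 2) (pow_mem left_mem_locAt 3))
        have h2 : (c : X.functionField) * f = rr x y 8 * ε ^ 3 * d := by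
          rw [hcd, ← hfε]
          ring
        rw [h2]
        exact mul_mem (mul_mem hr8 (pow_mem hε 3)) hd
      refine ⟨⟨_, hcf⟩, Subtype.ext ?_⟩
      change (c : X.functionField) = f⁻¹ * (c * f)
      field_simp
    · rintro ⟨d, rfl⟩
      have h1 : Subring.inclusion hAR ⟨_, hpA⟩ = ⟨_, hu⟩ * ⟨v, hvR⟩ := Subtype.ext hp
      rw [map_mul, map_mul, h1, map_mul, hθu, zero_mul, zero_mul]
  refine false_of_regular_parameter hAR θ hcA hV hτV (inv_ne_zero hρ0) (by rwa [inv_inv]) hmV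
    (p := ⟨_, hpA⟩) (q := ⟨_, hqA⟩) (r := ⟨_, hrA⟩) (Subtype.ext ?_) (fun h0 ↦ ?_) hker ?_ ?_
  · change (y * f⁻¹ ^ 3) ^ 2 = (x * f⁻¹ ^ 2) ^ 3 + f⁻¹ ^ 5
    have : f⁻¹ ^ 5 = f * f⁻¹ ^ 6 := by field_simp
    rw [this]
    nth_rw 3 [hf]
    ring
  · exact inv_ne_zero hf0 (congrArg Subtype.val h0)
  · have h1 : Subring.inclusion hAR ⟨_, hqA⟩ = ⟨ε, hε⟩ * ⟨v, hvR⟩ ^ 2 := Subtype.ext hq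
    rw [h1, map_mul, map_pow, hθε, hθv, one_mul]
  · have h1 : Subring.inclusion hAR ⟨_, hrA⟩ = ⟨ε, hε⟩ * ⟨v, hvR⟩ ^ 3 := Subtype.ext hr
    rw [h1, map_mul, map_pow, hθε, hθv, one_mul]

end

section

/-! ### The normal form of a cuspidal cubic -/

open MvPolynomial

lemma pderiv_pderiv_comm (i j : Fin 3) (F : MvPolynomial (Fin 3) ℂ) :
    pderiv i (pderiv j F) = pderiv j (pderiv i F) := by
  have h : ⁅(pderiv i : Derivation ℂ (MvPolynomial (Fin 3) ℂ) (MvPolynomial (Fin 3) ℂ)),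
      (pderiv j : Derivation ℂ (MvPolynomial (Fin 3) ℂ) (MvPolynomial (Fin 3) ℂ))⁆ = 0 := by
    refine MvPolynomial.derivation_ext fun k ↦ ?_
    rw [Derivation.commutator_apply, pderiv_X, pderiv_X]
    by_cases h1 : i = k <;> by_cases h2 : j = k <;> simp [h1, h2, eq_comm]
  have := congrArg (fun D ↦ D F) h
  rwa [Derivation.commutator_apply, Derivation.zero_apply, sub_eq_zero] at this

/-- The expansion of a ternary cubic form, given by a symmetric trilinear form `t`, at a linear
combination of two vectors. -/
lemma cubic_expansion {t : Fin 3 → Fin 3 → Fin 3 → ℂ} (h1 : ∀ i j k, t i j k = t j i k)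
    (h2 : ∀ i j k, t i j k = t i k j) (u w : Fin 3 → ℂ) (c d : ℂ) :
    ∑ i, ∑ j, ∑ k, t i j k * ((c * u i + d * w i) * (c * u j + d * w j) * (c * u k + d * w k)) =
      c ^ 3 * (∑ i, ∑ j, ∑ k, t i j k * (u i * u j * u k)) +
      3 * c ^ 2 * d * (∑ i, ∑ j, ∑ k, t i j k * (u i * u j * w k)) +
      3 * c * d ^ 2 * (∑ i, ∑ j, ∑ k, t i j k * (u i * w j * w k)) +
      d ^ 3 * (∑ i, ∑ j, ∑ k, t i j k * (w i * w j * w k)) := by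
  have e1 : t 0 1 0 = t 0 0 1 := h2 _ _ _
  have e2 : t 1 0 0 = t 0 0 1 := (h1 _ _ _).trans e1
  have e3 : t 0 2 0 = t 0 0 2 := h2 _ _ _
  have e4 : t 2 0 0 = t 0 0 2 := (h1 _ _ _).trans e3
  have e5 : t 1 0 1 = t 0 1 1 := h1 _ _ _
  have e6 : t 1 1 0 = t 0 1 1 := (h2 _ _ _).trans e5
  have e7 : t 2 0 2 = t 0 2 2 := h1 _ _ _
  have e8 : t 2 2 0 = t 0 2 2 := (h2 _ _ _).trans e7
  have e9 : t 1 2 1 = t 1 1 2 := h2 _ _ _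
  have e10 : t 2 1 1 = t 1 1 2 := (h1 _ _ _).trans e9
  have e11 : t 2 1 2 = t 1 2 2 := h1 _ _ _
  have e12 : t 2 2 1 = t 1 2 2 := (h2 _ _ _).trans e11
  have e13 : t 0 2 1 = t 0 1 2 := h2 _ _ _
  have e14 : t 1 0 2 = t 0 1 2 := h1 _ _ _
  have e15 : t 1 2 0 = t 0 1 2 := (h2 _ _ _).trans e14
  have e16 : t 2 0 1 = t 0 1 2 := (h1 _ _ _).trans e13
  have e17 : t 2 1 0 = t 0 1 2 := (h2 _ _ _).trans e16
  simp only [Fin.sum_univ_three, e1, e2, e3, e4, e5, e6, e7, e8, e9, e10, e11, e12, e13, e14, e15,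
    e16, e17]
  ring

/-- A cubic form is given by a symmetric trilinear form. -/
lemma exists_trilinear {F : MvPolynomial (Fin 3) ℂ} (hF : F.IsHomogeneous 3) :
    ∃ t : Fin 3 → Fin 3 → Fin 3 → ℂ, (∀ i j k, t i j k = t j i k) ∧ (∀ i j k, t i j k = t i k j) ∧
      (∀ w, 6 * eval w F = ∑ i, ∑ j, ∑ k, t i j k * (w i * w j * w k)) ∧
      (∀ w i, 2 * eval w (pderiv i F) = ∑ j, ∑ k, t i j k * (w j * w k)) ∧
      ∀ w i j, eval w (pderiv i (pderiv j F)) = ∑ k, t i j k * w k := by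
  have h3 : ∀ w i j k, eval w (pderiv k (pderiv i (pderiv j F))) =
      eval 0 (pderiv k (pderiv i (pderiv j F))) := fun w i j k ↦ by
    have h : (pderiv k (pderiv i (pderiv j F))).IsHomogeneous 0 := hF.pderiv.pderiv.pderiv
    rw [← totalDegree_zero_iff_isHomogeneous, totalDegree_eq_zero_iff_eq_C] at h
    rw [h, eval_C, eval_C]
  let t : Fin 3 → Fin 3 → Fin 3 → ℂ := fun i j k ↦ eval 0 (pderiv k (pderiv i (pderiv j F)))
  have hH : ∀ w i j, eval w (pderiv i (pderiv j F)) = ∑ k, t i j k * w k := fun w i j ↦ by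
    have := congrArg (eval w) (hF.pderiv (i := j) |>.pderiv (i := i)).sum_X_mul_pderiv
    simp only [map_sum, map_mul, eval_X, h3, nsmul_eq_mul] at this
    simp only [Nat.reduceSub, Nat.cast_one, map_one, one_mul] at this
    rw [← this]
    exact Finset.sum_congr rfl fun k _ ↦ mul_comm _ _
  have hG : ∀ w i, 2 * eval w (pderiv i F) = ∑ j, ∑ k, t i j k * (w j * w k) := fun w i ↦ by
    have := congrArg (eval w) (hF.pderiv (i := i)).sum_X_mul_pderiv
    simp only [map_sum, map_mul, eval_X, nsmul_eq_mul] at this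
    simp only [Nat.reduceSub, Nat.cast_ofNat, map_ofNat] at this
    rw [← this]
    refine Finset.sum_congr rfl fun j _ ↦ ?_
    rw [pderiv_pderiv_comm, hH, Finset.mul_sum]
    exact Finset.sum_congr rfl fun k _ ↦ by ring
  refine ⟨t, fun i j k ↦ ?_, fun i j k ↦ ?_, fun w ↦ ?_, hG, hH⟩
  · simp only [t]
    rw [pderiv_pderiv_comm i j]
  · simp only [t]
    rw [pderiv_pderiv_comm i j, pderiv_pderiv_comm k j, pderiv_pderiv_comm k i]
  · have := congrArg (eval w) hF.sum_X_mul_pderiv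
    simp only [map_sum, map_mul, eval_X, nsmul_eq_mul] at this
    simp only [Nat.cast_ofNat, map_ofNat] at this
    have h6 : (6 : ℂ) * eval w F = 2 * (3 * eval w F) := by ring
    rw [h6, ← this, Finset.mul_sum]
    refine Finset.sum_congr rfl fun i _ ↦ ?_
    rw [mul_left_comm, hG, Finset.mul_sum]
    refine Finset.sum_congr rfl fun j _ ↦ ?_
    rw [Finset.mul_sum]
    exact Finset.sum_congr rfl fun k _ ↦ by ring

/-- The linear form with given values. -/
def linForm (f : (Fin 3 → ℂ) →ₗ[ℂ] ℂ) : MvPolynomial (Fin 3) ℂ :=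
  ∑ i, C (f fun j ↦ if i = j then 1 else 0) * X i

lemma eval_linForm (f : (Fin 3 → ℂ) →ₗ[ℂ] ℂ) (w : Fin 3 → ℂ) : eval w (linForm f) = f w := by
  rw [linForm, map_sum, f.pi_apply_eq_sum_univ w]
  exact Finset.sum_congr rfl fun i _ ↦ by rw [map_mul, eval_C, eval_X, smul_eq_mul, mul_comm]

lemma isHomogeneous_linForm (f : (Fin 3 → ℂ) →ₗ[ℂ] ℂ) : (linForm f).IsHomogeneous 1 := by
  refine IsHomogeneous.sum _ _ _ fun i _ ↦ ?_
  simpa using (isHomogeneous_C (Fin 3) _).mul (isHomogeneous_X ℂ i)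

/-- A symmetric matrix of rank one. -/
lemma exists_eq_mul_of_rank_eq_one {H : Matrix (Fin 3) (Fin 3) ℂ} (hr : H.rank = 1)
    (hs : ∀ i j, H i j = H j i) : ∃ (m : Fin 3 → ℂ) (l : ℂ), m ≠ 0 ∧ l ≠ 0 ∧
      ∀ i j, H i j = l * (m i * m j) := by
  have hr' := hr
  rw [Matrix.rank] at hr'
  obtain ⟨v, hv0, hv⟩ := finrank_eq_one_iff'.mp hr'
  obtain ⟨m, hm⟩ : ∃ m : Fin 3 → ℂ, m = v := ⟨_, rfl⟩
  have h1 : ∀ j, ∃ c : ℂ, ∀ i, H i j = c * m i := fun j ↦ by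
    obtain ⟨c, hc⟩ := hv ⟨_, ⟨Pi.single j 1, rfl⟩⟩
    refine ⟨c, fun i ↦ ?_⟩
    have := congrArg (fun f ↦ f.1 i) hc
    rw [hm]
    simpa using this.symm
  choose n hn using h1
  have hm0 : m ≠ 0 := fun h ↦ hv0 (Subtype.ext (hm.symm.trans h))
  obtain ⟨k, hk⟩ := Function.ne_iff.mp hm0
  replace hk : m k ≠ 0 := hk
  have h2 : ∀ j, n j * m k = n k * m j := fun j ↦ by rw [← hn, hs, hn]
  refine ⟨m, n k / m k, hm0, div_ne_zero (fun h0 ↦ ?_) hk, fun i j ↦ ?_⟩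
  · have h3 : H = 0 := by
      ext i j
      have := h2 j
      rw [h0, zero_mul, mul_eq_zero] at this
      rw [hn, this.resolve_right hk, zero_mul, Matrix.zero_apply]
    rw [h3, Matrix.rank_zero] at hr
    exact zero_ne_one hr
  · rw [hn]
    field_simp
    linear_combination m i * h2 j

/-- A basis adapted to a linear form `m` and a vector `z` in its kernel. -/
lemma exists_adapted_basis {z m : Fin 3 → ℂ} (hz : z ≠ 0) (hm : m ≠ 0) (hzm : ∑ i, m i * z i = 0) :
    ∃ b : Module.Basis (Fin 3) ℂ (Fin 3 → ℂ), b 2 = z ∧ ∑ i, m i * b 0 i = 0 ∧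
      ∑ i, m i * b 1 i = 1 := by
  let f : (Fin 3 → ℂ) →ₗ[ℂ] ℂ := ∑ i, m i • LinearMap.proj i
  have hf : ∀ w, f w = ∑ i, m i * w i := fun w ↦ by simp [f]
  obtain ⟨k, hk⟩ := Function.ne_iff.mp hm
  replace hk : m k ≠ 0 := hk
  obtain ⟨e', he'⟩ : ∃ e', f e' = 1 := ⟨Pi.single k (m k)⁻¹, by
    rw [hf, Finset.sum_eq_single k (fun j _ hj ↦ by simp [hj]) (by simp)]
    simp [hk]⟩
  obtain ⟨e, he, hez⟩ : ∃ e, f e = 0 ∧ e ∉ Submodule.span ℂ {z} := by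
    by_contra! h
    have h1 : LinearMap.ker f ≤ Submodule.span ℂ {z} := fun e he ↦ h e he
    have h2 := Submodule.finrank_mono h1
    rw [finrank_span_singleton hz] at h2
    have h3 := f.finrank_range_add_finrank_ker
    have h4 := Submodule.finrank_le (LinearMap.range f)
    rw [Module.finrank_self] at h4
    rw [Module.finrank_fin_fun] at h3
    omega
  have hli : LinearIndependent ℂ ![e, e', z] := by
    rw [Fintype.linearIndependent_iff]
    intro c hc
    rw [Fin.sum_univ_three] at hc
    change c 0 • e + c 1 • e' + c 2 • z = 0 at hc
    have h1 : c 1 = 0 := by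
      have := congrArg f hc
      rw [map_add, map_add, map_smul, map_smul, map_smul, he, he', hf z, hzm] at this
      simpa using this
    have h0 : c 0 = 0 := by
      by_contra h0
      refine hez (Submodule.mem_span_singleton.mpr ⟨-(c 0)⁻¹ * c 2, ?_⟩)
      rw [h1, zero_smul, add_zero] at hc
      rw [mul_smul, eq_comm, ← inv_smul_smul₀ h0 e, eq_neg_of_add_eq_zero_left hc, smul_neg, neg_smul]
    have h2 : c 2 = 0 := by
      rw [h0, h1, zero_smul, zero_smul, zero_add, zero_add, smul_eq_zero] at hc
      exact hc.resolve_right hz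
    intro i
    fin_cases i <;> assumption
  refine ⟨basisOfLinearIndependentOfCardEqFinrank hli (by simp), ?_, ?_, ?_⟩
  · simp
  · simpa [hf] using he
  · simpa [hf] using he'

/-- A cuspidal cubic has the equation `a₂a₁² = a₀³` in suitable coordinates. -/
lemma exists_eq_cubicForm {F : MvPolynomial (Fin 3) ℂ} (hF : IsCuspidalCubic F) :
    ∃ a, IsCoordinateSystem a ∧ F = cubicForm a 0 := by
  obtain ⟨hF3, hirr, z, hz0, hz, hrank⟩ := hF
  obtain ⟨t, ht1, ht2, htF, htG, htH⟩ := exists_trilinear hF3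
  obtain ⟨m, l, hm0, hl0, hml⟩ := exists_eq_mul_of_rank_eq_one hrank fun i j ↦ by
    simp only [Matrix.of_apply]
    rw [pderiv_pderiv_comm]
  replace hml : ∀ i j, ∑ k, t i j k * z k = l * (m i * m j) := fun i j ↦ by
    rw [← htH]
    exact hml i j
  have htz : ∀ i, ∑ j, ∑ k, t i j k * (z j * z k) = 0 := fun i ↦ by rw [← htG, hz, mul_zero]
  -- The tangent cone `m² = 0` passes through the singular point `z`.
  have hmz : ∑ i, m i * z i = 0 := by
    obtain ⟨i, hi⟩ := Function.ne_iff.mp hm0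
    have h1 : l * m i * ∑ j, m j * z j = 0 := by
      rw [← htz i, Finset.mul_sum]
      refine Finset.sum_congr rfl fun j _ ↦ ?_
      rw [show l * m i * (m j * z j) = l * (m i * m j) * z j by ring, ← hml, Finset.sum_mul]
      exact Finset.sum_congr rfl fun k _ ↦ by ring
    exact (mul_eq_zero.mp h1).resolve_left (mul_ne_zero hl0 hi)
  obtain ⟨b, hb2, hb0, hb1⟩ := exists_adapted_basis hz0 hm0 hmz
  -- the cubic is `(l / 2) a₂ a₁²` plus a binary cubic form in `a₀`, `a₁`
  obtain ⟨α, β, γ, δ, hexp⟩ : ∃ α β γ δ : ℂ, ∀ w, eval w F =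
      l / 2 * (b.coord 2 w * b.coord 1 w ^ 2) + α * b.coord 0 w ^ 3 +
        β * (b.coord 0 w ^ 2 * b.coord 1 w) + γ * (b.coord 0 w * b.coord 1 w ^ 2) +
          δ * b.coord 1 w ^ 3 := by
    refine ⟨(∑ i, ∑ j, ∑ k, t i j k * (b 0 i * b 0 j * b 0 k)) / 6,
      (∑ i, ∑ j, ∑ k, t i j k * (b 0 i * b 0 j * b 1 k)) / 2,
      (∑ i, ∑ j, ∑ k, t i j k * (b 0 i * b 1 j * b 1 k)) / 2,
      (∑ i, ∑ j, ∑ k, t i j k * (b 1 i * b 1 j * b 1 k)) / 6, fun w ↦ ?_⟩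
    have hw : w = (1 : ℂ) • (b.coord 0 w • b 0 + b.coord 1 w • b 1) + b.coord 2 w • z := by
      rw [← hb2, one_smul]
      have := b.sum_repr w
      rw [Fin.sum_univ_three] at this
      exact this.symm
    generalize b.coord 0 w = c₀ at *
    generalize b.coord 1 w = c₁ at *
    generalize b.coord 2 w = c₂ at *
    set u := c₀ • b 0 + c₁ • b 1 with hu
    have h1 := cubic_expansion ht1 ht2 u z 1 c₂
    have h2 := cubic_expansion ht1 ht2 (b 0) (b 1) c₀ c₁
    have h3 : ∀ v : Fin 3 → ℂ, ∑ i, ∑ j, ∑ k, t i j k * (v i * z j * z k) = 0 := fun v ↦ by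
      refine Finset.sum_eq_zero fun i _ ↦ ?_
      rw [← mul_zero (v i), ← htz i, Finset.mul_sum]
      refine Finset.sum_congr rfl fun j _ ↦ ?_
      rw [Finset.mul_sum]
      exact Finset.sum_congr rfl fun k _ ↦ by ring
    have h4 : ∑ i, m i * u i = c₁ := by
      simp only [Fin.sum_univ_three, hu, Pi.add_apply, Pi.smul_apply, smul_eq_mul] at hb0 hb1 ⊢
      linear_combination c₀ * hb0 + c₁ * hb1
    have h5 : ∑ i, ∑ j, ∑ k, t i j k * (u i * u j * z k) = l * c₁ ^ 2 := by
      have h6 : ∀ i j, ∑ k, t i j k * (u i * u j * z k) = u i * u j * (l * (m i * m j)) :=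
        fun i j ↦ by
          rw [← hml, Finset.mul_sum]
          exact Finset.sum_congr rfl fun k _ ↦ by ring
      simp only [h6]
      rw [← h4]
      simp only [Fin.sum_univ_three]
      ring
    have hwi : ∀ i, w i = 1 * u i + c₂ * z i := fun i ↦ by
      simpa using congrFun hw i
    have hui : ∀ i, u i = c₀ * b 0 i + c₁ * b 1 i := fun i ↦ by simp [hu]
    have h7 := htF w
    simp only [hwi] at h7
    rw [h1, h3, h3, h5] at h7
    simp only [hui] at h7
    rw [h2] at h7
    linear_combination h7 / 6
  have hX : ∀ i w, eval w (linForm (b.coord i)) = b.coord i w := fun i w ↦ eval_linForm _ w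
  have h0 : ∀ i, eval 0 (linForm (b.coord i)) = 0 := fun i ↦ (hX i 0).trans (map_zero _)
  -- Otherwise the cubic contains the line `a₁ = 0`.
  have hα : α ≠ 0 := by
    rintro rfl
    have h1 : F = linForm (b.coord 1) * (C (l / 2) * (linForm (b.coord 2) * linForm (b.coord 1)) +
        C β * linForm (b.coord 0) ^ 2 + C γ * (linForm (b.coord 0) * linForm (b.coord 1)) +
          C δ * linForm (b.coord 1) ^ 2) := by
      refine MvPolynomial.funext fun w ↦ ?_
      rw [hexp]
      simp only [map_mul, map_add, map_pow, eval_C, hX]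
      ring
    rcases hirr.isUnit_or_isUnit h1 with h2 | h2
    · exact (h2.map (eval 0)).ne_zero (h0 1)
    · exact (h2.map (eval 0)).ne_zero (by simp only [map_add, map_mul, map_pow, h0]; ring)
  obtain ⟨κ, hκ⟩ := IsAlgClosed.exists_pow_nat_eq (-α) three_pos
  have hκ0 : κ ≠ 0 := by
    rintro rfl
    exact hα (by simpa using hκ.symm)
  -- completing the cube
  obtain ⟨μ, hμ⟩ : ∃ μ, 3 * κ ^ 2 * μ = -β := ⟨-β / (3 * κ ^ 2), by field_simp⟩
  let a : Fin 3 → (Fin 3 → ℂ) →ₗ[ℂ] ℂ := ![κ • b.coord 0 + μ • b.coord 1, b.coord 1,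
    (l / 2) • b.coord 2 + (γ + 3 * κ * μ ^ 2) • b.coord 0 + (δ + μ ^ 3) • b.coord 1]
  have ha0 : ∀ w, a 0 w = κ * b.coord 0 w + μ * b.coord 1 w := fun w ↦ rfl
  have ha1 : ∀ w, a 1 w = b.coord 1 w := fun w ↦ rfl
  have ha2 : ∀ w, a 2 w = l / 2 * b.coord 2 w + (γ + 3 * κ * μ ^ 2) * b.coord 0 w +
    (δ + μ ^ 3) * b.coord 1 w := fun w ↦ rfl
  have hb : ∀ i j, b.coord i (b j) = if j = i then 1 else 0 := fun i j ↦ by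
    rw [Module.Basis.coord_apply, Module.Basis.repr_self, Finsupp.single_apply]
  refine ⟨fun i ↦ linForm (a i), ⟨fun i ↦ isHomogeneous_linForm _, ?_⟩, ?_⟩
  · rw [Fintype.linearIndependent_iff]
    intro c hc
    rw [Fin.sum_univ_three] at hc
    have h1 : ∀ w, c 0 * a 0 w + c 1 * a 1 w + c 2 * a 2 w = 0 := fun w ↦ by
      have := congrArg (eval w) hc
      simpa [eval_linForm, smul_eval] using this
    have e2 : c 2 = 0 := by
      have := h1 (b 2)
      rw [ha0, ha1, ha2, hb, hb, hb] at this
      simpa [hl0] using this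
    have e0 : c 0 = 0 := by
      have := h1 (b 0)
      rw [ha0, ha1, ha2, hb, hb, hb] at this
      simpa [hκ0, e2] using this
    have e1 : c 1 = 0 := by
      have := h1 (b 1)
      rw [ha0, ha1, ha2, hb, hb, hb] at this
      simpa [e0, e2] using this
    intro i
    fin_cases i <;> assumption
  · refine MvPolynomial.funext fun w ↦ ?_
    rw [hexp]
    simp only [cubicForm, map_sub, map_mul, map_pow, eval_linForm, eval_C, zero_mul, sub_zero]
    rw [ha0, ha1, ha2]
    linear_combination (b.coord 0 w ^ 3) * hκ + (b.coord 0 w ^ 2 * b.coord 1 w) * hμ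

lemma eq_sum_of_isHomogeneous_one {G : MvPolynomial (Fin 3) ℂ} (hG : G.IsHomogeneous 1)
    (v : Fin 3 → ℂ) : G = ∑ j, C (eval v (pderiv j G)) * X j := by
  have h2 := hG.sum_X_mul_pderiv
  rw [one_smul] at h2
  nth_rw 1 [← h2]
  refine Finset.sum_congr rfl fun j _ ↦ ?_
  have h3 : (pderiv j G).IsHomogeneous 0 := hG.pderiv
  rw [← totalDegree_zero_iff_isHomogeneous, totalDegree_eq_zero_iff_eq_C] at h3
  rw [h3, eval_C, mul_comm]

lemma tangentLine_cubicForm {a : Fin 3 → MvPolynomial (Fin 3) ℂ} (ha : IsCoordinateSystem a)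
    (v : Fin 3 → ℂ) : tangentLine (cubicForm a 0) v = C (eval v (a 1) ^ 2) * a 2 +
      C (2 * eval v (a 2) * eval v (a 1)) * a 1 - C (3 * eval v (a 0) ^ 2) * a 0 := by
  have h1 := fun i ↦ eq_sum_of_isHomogeneous_one (ha.1 i) v
  rw [h1 0, h1 1, h1 2, Finset.mul_sum, Finset.mul_sum, Finset.mul_sum, ← Finset.sum_add_distrib,
    ← Finset.sum_sub_distrib, ← h1 0, ← h1 1, ← h1 2, tangentLine]
  refine Finset.sum_congr rfl fun j _ ↦ ?_
  simp only [cubicForm, map_sub, Derivation.leibniz, Derivation.leibniz_pow, map_mul, map_add,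
    smul_eq_mul, nsmul_eq_mul, map_pow, map_zero, zero_mul, sub_zero, map_ofNat, Nat.cast_ofNat]
  simp
  ring

/-- In coordinates with `F = a₂a₁² - a₀³`, a smooth inflection point is `[0 : 1 : 0]`. -/
lemma exists_isNormalForm {F : MvPolynomial (Fin 3) ℂ} (hF : IsCuspidalCubic F) {v : Fin 3 → ℂ}
    (hv : IsSmoothInflectionPoint F v) : ∃ a, IsNormalForm a F v := by
  obtain ⟨a, ha, rfl⟩ := exists_eq_cubicForm hF
  obtain ⟨hv, ⟨i, hi⟩, hfl⟩ := hv
  have ht := tangentLine_cubicForm ha v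
  have hv' : eval v (a 2) * eval v (a 1) ^ 2 - eval v (a 0) ^ 3 = 0 := by
    simpa [cubicForm] using hv
  have h1 : eval v (a 1) ≠ 0 := by
    intro h1
    have h0 : eval v (a 0) = 0 := by
      simpa [h1] using hv'
    rw [h0, h1] at ht
    have := congrArg (eval (Pi.single i 1)) ht
    rw [tangentLine, map_sum, Finset.sum_eq_single i (fun j _ hj ↦ by simp [hj]) (by simp)] at this
    exact hi (by simpa using this)
  -- the second order term along the tangent direction with `a₀ = 1` and `a₁ = 0`
  have h0 : eval v (a 0) = 0 := by
    obtain ⟨f, hf⟩ := ha.exists_algHom (S := ℂ) ![1, 0, 3 * eval v (a 0) ^ 2 / eval v (a 1) ^ 2]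
    have hfe : ∀ G, eval (fun i ↦ f (X i)) G = f G := fun G ↦ by
      rw [← MvPolynomial.aeval_eq_eval]
      exact (AlgHom.congr_fun (MvPolynomial.aeval_unique f) G).symm
    have hl : ∀ i, MvPolynomial.aeval (fun j ↦ Polynomial.C (v j) + Polynomial.X *
        Polynomial.C (f (X j))) (a i) = Polynomial.C (eval v (a i)) +
          Polynomial.X * Polynomial.C (f (a i)) := fun i ↦ by
      obtain ⟨c, hc⟩ : ∃ c : Fin 3 → ℂ, a i = ∑ j, C (c j) * X j :=
        ⟨_, eq_sum_of_isHomogeneous_one (ha.1 i) v⟩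
      have hfc : ∀ c, f (C c) = c := fun c ↦ f.commutes c
      rw [hc]
      simp only [map_sum, map_mul, MvPolynomial.aeval_X, MvPolynomial.aeval_C, eval_C, eval_X, hfc,
        Polynomial.algebraMap_eq, Finset.mul_sum, ← Finset.sum_add_distrib]
      exact Finset.sum_congr rfl fun j _ ↦ by ring
    have h2 := hfl (fun i ↦ f (X i)) (by
      have hfc : ∀ c, f (C c) = c := fun c ↦ f.commutes c
      rw [ht, hfe]
      simp only [map_sub, map_add, map_mul, hfc, hf]
      simp
      field_simp
      ring)
    obtain ⟨A, B, h3⟩ : ∃ A B, MvPolynomial.aeval (fun j ↦ Polynomial.C (v j) + Polynomial.X *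
        Polynomial.C (f (X j))) (cubicForm a 0) = Polynomial.C A + Polynomial.C B * Polynomial.X +
          Polynomial.C (-3 * eval v (a 0)) * Polynomial.X ^ 2 - Polynomial.X ^ 3 := by
      refine ⟨eval v (a 2) * eval v (a 1) ^ 2 - eval v (a 0) ^ 3,
        3 * eval v (a 0) ^ 2 / eval v (a 1) ^ 2 * eval v (a 1) ^ 2 - 3 * eval v (a 0) ^ 2, ?_⟩
      have h5 : Polynomial.C (3 : ℂ) = 3 := map_ofNat Polynomial.C 3
      rw [cubicForm]
      simp only [map_sub, map_mul, map_pow, hl, hf]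
      simp [h5]
      ring
    rw [h3] at h2
    have h4 := Polynomial.X_pow_dvd_iff.mp h2 2 (by norm_num)
    rw [Polynomial.coeff_sub, Polynomial.coeff_add, Polynomial.coeff_add, Polynomial.coeff_C_mul_X_pow,
      Polynomial.coeff_C_mul_X, Polynomial.coeff_C, Polynomial.coeff_X_pow] at h4
    simpa using h4
  have h2 : eval v (a 2) = 0 := by
    simpa [h0, h1] using hv'
  refine ⟨a, ha, rfl, h0, h1, h2, ?_⟩
  rw [ht, h0, h2, Ideal.span_singleton_eq_span_singleton]
  simp only [mul_zero, zero_mul, ne_eq, OfNat.ofNat_ne_zero, not_false_eq_true, zero_pow, map_zero,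
    add_zero, sub_zero]
  exact associated_unit_mul_left _ _ ((isUnit_iff_ne_zero.mpr (pow_ne_zero 2 h1)).map C)

end

section

/-! ### The smooth anticanonical curves -/

variable {X : Scheme.{0}} [IsIntegral X] {s : X ⟶ SpecC} [IsLocallyNoetherian X]
  {S : Construction s} {a : Fin 3 → MvPolynomial (Fin 3) ℂ}

omit [IsIntegral X] [IsLocallyNoetherian X] in
lemma IsSurfaceModel.comp_planeStr {K : Type} [Field K] [Algebra ℂ K] {ψ : Spec (.of K) ⟶ Plane}
    {Φ : MvPolynomial (Fin 3) ℂ →ₐ[ℂ] K} {ψ₈ : _} {ψ₉ : _} (h : IsSurfaceModel S a ψ Φ ψ₈ ψ₉) :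
    ψ ≫ planeStr = (ψ₉ ≫ S.q) ≫ s := by
  rw [Category.assoc, S.q_over, ← h.model₉.comp]
  simp only [Category.assoc]

/-- A smooth member of `|-K_X|` is the strict transform of a plane cubic `y² = x³ + l` with
`l ≠ 0`, and has the function field of this cubic. -/
lemma IsContractionModel.exists_isCurveField :
    letI := stalkAlgebra s (genericPoint X)
    ∀ {ψ : Spec (.of X.functionField) ⟶ Plane} {Φ : MvPolynomial (Fin 3) ℂ →ₐ[ℂ] X.functionField}
      {ψ₈ : _} {ψ₉ : _} (_ : IsContractionModel S a ψ Φ ψ₈ ψ₉)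
      (_ : ψ₉ ≫ S.q = X.fromSpecStalk (genericPoint X)) {E : Scheme.{0}} [IsIntegral E]
      (i : E ⟶ X) (_ : IsSmoothAnticanonicalCurve s i),
      ∃ l : ℂ, l ≠ 0 ∧
        (∃ ξ : S.X₉, S.q ξ = i (genericPoint E) ∧
          IsGenericPointOfCurve (S.ρ (S.π ξ)) (cubicForm a l)) ∧
        IsNormalCurve (i ≫ s) ∧
        (letI := stalkAlgebra (i ≫ s) (genericPoint E)
        ∃ x y : E.functionField, IsCurveField (cubicPoly l) x y) := by
  let := stalkAlgebra s (genericPoint X)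
  intro ψ Φ ψ₈ ψ₉ h hX E _ i ⟨hi, hsm, D, hD, hDz⟩
  let := stalkAlgebra (i ≫ s) (genericPoint E)
  have hψ : (ψ₉ ≫ S.q) ≫ s = Spec.map (CommRingCat.ofHom (algebraMap ℂ X.functionField)) := by
    rw [hX]
    exact fromSpecStalk_comp_structure
  obtain ⟨R, hR, -, -, rfl | ⟨α, β, g, hα, hg, -, hRg, ξ, hξ, hRξ, h2⟩⟩ :=
    exists_of_anticanonical h hX hD (z₀ := i (genericPoint E)) fun z ↦
      ⟨fun hz ↦ (hDz z).trans (if_pos hz), fun hz ↦ (hDz z).trans (if_neg hz)⟩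
  · obtain ⟨θ, hθ⟩ := exists_isResidueMap i s hR
    exact (h.false_of_smooth_excRing hX i hsm hR hθ hψ).elim
  -- The curve `α(y² - x³) + β = 0` is `y² = x³ + l` with `l = -β / α`.
  have hgl : g = Polynomial.C (Polynomial.C α) * cubicPoly (-β / α) := by
    rw [hg, cubicPoly, mul_sub, ← map_mul, ← map_mul, mul_div_cancel₀ _ hα]
    simp
  have hu : IsUnit (Polynomial.C (Polynomial.C α) : A2) :=
    (hα.isUnit.map Polynomial.C).map Polynomial.C
  generalize -β / α = l at hgl
  have hP := isPrime_span (prime_cubicPoly l)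
  have hRP := hRg (Ideal.span {cubicPoly l}) (by
    rw [hgl, Ideal.span_singleton_mul_left_unit hu])
  have hxy := h.isPlaneField
  obtain ⟨θ, hθ⟩ := exists_isResidueMap i s hR
  obtain ⟨hx, hy, hcf⟩ := hθ.isCurveField hψ hxy rfl hRP
  have := S.proper
  have hn : IsNormalCurve (i ≫ s) := isNormalCurve_of_smooth ⟨_, hcf.span_D_left⟩
  refine ⟨l, ?_, ⟨ξ, hξ, h.normalForm.coord.homIdeal_eq_span fun d G hG ↦ ?_⟩, hn, _, _, hcf⟩
  · rintro rfl
    exact h.not_isCurveField_zero i hn hR hθ hψ rfl hRP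
  · have h3 := h.eval.nonunit_iff hRξ hG (H := a 2 ^ d)
      (by simpa using (h.normalForm.coord.1 2).pow d)
      fun h' ↦ h2 (Ideal.IsPrime.mem_of_pow_mem inferInstance _ h')
    rw [map_pow, h.eval_two, one_pow, div_one, ← h.normalForm.coord.ev_dehom rfl rfl h.eval_two,
      hRP] at h3
    refine h3.symm.trans ?_
    by_cases h0 : h.normalForm.coord.dehom G = 0
    · simp [h0]
    · rw [inv_mem_locAt_iff hxy.injective h0, not_not, Ideal.mem_span_singleton,
        map_eq_zero_iff _ hxy.injective]
      simp [h0]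

end

end

end ScE8

theorem mainTheorem12 {X : Scheme.{0}} [IsIntegral X] [IsLocallyNoetherian X]
    (s : X ⟶ ScE8.SpecC) (K : ScE8.Construction s) :
    -- all smooth members of the anticanonical system are isomorphic over `ℂ`
    (∀ (E E' : Scheme.{0}) [IsIntegral E] [IsIntegral E'] (i : E ⟶ X) (i' : E' ⟶ X),
      ScE8.IsSmoothAnticanonicalCurve s i → ScE8.IsSmoothAnticanonicalCurve s i' →
        Nonempty (Over.mk (i ≫ s) ≅ Over.mk (i' ≫ s))) ∧
    -- there are coordinates in which `C` is `a₃a₂² = a₁³` and `x = [0 : 1 : 0]`, such that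
    (∃ a : Fin 3 → MvPolynomial (Fin 3) ℂ, ScE8.IsCoordinateSystem a ∧
      Ideal.span {K.F} = Ideal.span {ScE8.cubicForm a 0} ∧
      MvPolynomial.eval K.v (a 0) = 0 ∧ MvPolynomial.eval K.v (a 2) = 0 ∧
      ∀ (E : Scheme.{0}) [IsIntegral E] (i : E ⟶ X), ScE8.IsSmoothAnticanonicalCurve s i →
        ∃ l : ℂ, l ≠ 0 ∧
          -- the strict transform of `E` in the plane is `a₃a₂² = a₁³ + λa₃³`,
          (∃ ξ : K.X₉, K.q ξ = i (genericPoint E) ∧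
            ScE8.IsGenericPointOfCurve (K.ρ (K.π ξ)) (ScE8.cubicForm a l)) ∧
          -- `E` itself is isomorphic to this plane cubic,
          ScE8.IsPlaneCurve (i ≫ s) (ScE8.cubicForm a l)) ∧
    -- and the `j`-invariant of every smooth member is zero
    (∀ (E : Scheme.{0}) [IsIntegral E] (i : E ⟶ X), ScE8.IsSmoothAnticanonicalCurve s i →
      ScE8.HasJInvariant (i ≫ s) 0) := by
  obtain ⟨a, ha⟩ := ScE8.exists_isNormalForm K.cuspidal K.inflection
  obtain ⟨ψ, Φ, ψ₈, ψ₉, h, hX⟩ := K.exists_contractionModel ha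
  let := ScE8.stalkAlgebra s (genericPoint X)
  have hψ : ψ ≫ ScE8.planeStr = Spec.map (CommRingCat.ofHom (algebraMap ℂ X.functionField)) := by
    rw [h.comp_planeStr, hX]
    exact ScE8.fromSpecStalk_comp_structure
  refine ⟨fun E E' _ _ i i' hi hi' ↦ ?_, ⟨a, ha.coord, ha.span_eq, ha.eval_zero, ha.eval_two,
    fun E _ i hi ↦ ?_⟩, fun E _ i hi ↦ ?_⟩
  · let := ScE8.stalkAlgebra (i ≫ s) (genericPoint E)
    obtain ⟨l, hl, -, hE, x, y, hxy⟩ := h.exists_isCurveField hX i hi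
    obtain ⟨l', hl', -, hE', x', y', hxy'⟩ := h.exists_isCurveField hX i' hi'
    -- Over `ℂ`, the curves `y² = x³ + l` and `y² = x³ + c⁶l` are isomorphic.
    obtain ⟨c, hc⟩ := IsAlgClosed.exists_pow_nat_eq (l' / l) (n := 6) (by norm_num)
    have hc0 : c ≠ 0 := by
      rintro rfl
      exact div_ne_zero hl' hl (hc.symm.trans (zero_pow (by norm_num)))
    have hs := hxy.scale hc0
    rw [hc, div_mul_cancel₀ _ hl] at hs
    obtain ⟨f, hf⟩ := hE.exists_iso_of_isCurveField hE' hs hxy'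
    exact ⟨Over.isoMk f hf⟩
  · obtain ⟨l, hl, hξ, hE, x, y, hxy⟩ := h.exists_isCurveField hX i hi
    exact ⟨l, hl, hξ, hE.isPlaneCurve h.eval hψ ha.coord hl hxy⟩
  · obtain ⟨l, hl, -, hE, x, y, hxy⟩ := h.exists_isCurveField hX i hi
    exact hE.hasJInvariant h.eval hψ hl hxy
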